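/- Let $(\mathcal X,\omega)$ be a compact symplectic orbifold, that is, a differentiable Deligne–Mumford stack over the category of smooth manifolds (a stack with an atlas whose atlas groupoid is étale and proper) with compact coarse moduli space, together with a closed $2$-form $\omega$ that is nondegenerate on étale charts. A \emph{Hamiltonian path} is a partition $0=t_0<t_1<\dots<t_L=1$ together with stack maps $\gamma_l:[t_{l-1},t_l]\times\mathcal X\to\mathcal X$, $l=1,\dots,L$, such that each $\gamma_l$ integrates a time dependent Hamiltonian vector field (a time dependent vector field $X$ with $dH_t=\omega(X_t,\cdot)$ for all $t$, for some smooth function $H$ on $[t_{l-1},t_l]\times\mathcal X$) and for $1\le l<L$ there is a 2-morphism $\gamma_l|_{\{t_l\}\times\mathcal X}\Rightarrow\gamma_{l+1}|_{\{t_l\}\times\mathcal X}$. It is a \emph{based Hamiltonian loop} if moreover $\gamma_1|_{\{0\}\times\mathcal X}=\mathrm{Id}_{\mathcal X}$ and there is a 2-morphism $\gamma_L|_{\{1\}\times\mathcal X}\Rightarrow\gamma_1|_{\{0\}\times\mathcal X}$. Two Hamiltonian paths are \emph{naturally related} if they are connected by a finite sequence of Hamiltonian paths in which any two neighbours either differ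 by splitting one interval of the partition in two (restricting the piece over it), or have the same partition and 2-morphisms between their corresponding pieces. Two based Hamiltonian loops $\gamma,\gamma'$ are \emph{homotopic} if there are a brick partition of $[0,1]\times[0,1]$ into rectangles $[s_k,s_{k+1}]\times[t_{k,l},t_{k,l+1}]$ and stack maps $\Gamma_{k,l}:[s_k,s_{k+1}]\times[t_{k,l},t_{k,l+1}]\times\mathcal X\to\mathcal X$ such that: for all $k$ and $s\in[s_k,s_{k+1}]$ the restrictions $\{\Gamma_{k,l}|_{\{s\}\times[t_{k,l},t_{k,l+1}]\times\mathcal X}\}_l$ form a Hamiltonian path, whose restrictions to times $0$ and $1$ agree up to 2-morphism with those of $\gamma$ and of $\gamma'$; at each interior $s_k$ the two paths coming from the layers below and above are naturally related; and the path at $s=0$ is naturally related to $\gamma$, the path at $s=1$ to $\gamma'$. Then homotopy is an equivalence relation on based Hamiltonian loops. Let $\pi_1(Ham(\mathcal X,\omega))$ be the set of its classes. For based Hamiltonian loops $\gamma,\gamma'$ let $\gamma\cdot_{cn}\gamma'$ be their concatenation ($t\mapsto\gamma(2t)$ on $[0,\tfrac12]$, then $t\mapsto\gamma'(2t-1)$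 on $[\tfrac12,1]$) and let $\gamma\cdot_{cp}\gamma'$ be their pointwise composition, with pieces $\gamma_l\circ(pr_{I_l}\times\gamma'_l)$ over the intervals $I_l$ of the common refinement of the two partitions. Both are again based Hamiltonian loops, both operations descend to $\pi_1(Ham(\mathcal X,\omega))$ and induce the same product there, and with this product $\pi_1(Ham(\mathcal X,\omega))$ is a group. -/

import Mathlib

open CategoryTheory Manifold ContDiff Set TopologicalSpace

universe v u v' u'

noncomputable section

namespace HamOrb

/-! ## The category of smooth manifolds -/

/-- A smooth manifold without boundary: Hausdorff, second countable, finite-dimensional. The model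
space is part of the data, so that products and open subsets carry Mathlib's own structures. -/
structure Man : Type 1 where
  carrier : Type
  E : Type
  H : Type
  [normedE : NormedAddCommGroup E]
  [spaceE : NormedSpace ℝ E]
  [finDim : FiniteDimensional ℝ E]
  [topH : TopologicalSpace H]
  I : ModelWithCorners ℝ E H
  [boundaryless : I.Boundaryless]
  [top : TopologicalSpace carrier]
  [charted : ChartedSpace H carrier]
  [smooth : IsManifold I ∞ carrier]
  [t2 : T2Space carrier]
  [secondCountable : SecondCountableTopology carrier]

instance : CoeSort Man Type := ⟨Man.carrier⟩

attribute [instance] Man.normedE Man.spaceE Man.finDim Man.topH Man.boundaryless Man.top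
  Man.charted Man.smooth Man.t2 Man.secondCountable

/-- Morphisms of manifolds are smooth maps. -/
instance : Category Man where
  Hom M N := C^∞⟮M.I, M; N.I, N⟯
  id _ := ContMDiffMap.id
  comp f g := ContMDiffMap.comp g f

/-- The smooth map underlying a morphism of manifolds. -/
def Man.fn {M N : Man} (f : M ⟶ N) : C^∞⟮M.I, M; N.I, N⟯ := f

/-- An open subset of a manifold, as a manifold. -/
def Man.opens (M : Man) (U : Opens M) : Man where
  carrier := U
  E := M.E
  H := M.H
  I := M.I

/-- The inclusion of an open subset. -/
def Man.incl {M : Man} (U : Opens M) : M.opens U ⟶ M :=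
  (⟨fun x => x.1, contMDiff_subtype_val⟩ : C^∞⟮M.I, U; M.I, M⟯)

/-- The inclusion of an open subset into a larger one. -/
def Man.inclOfLE {M : Man} {U V : Opens M} (h : U ≤ V) : M.opens U ⟶ M.opens V :=
  (⟨Set.inclusion h, contMDiff_inclusion h⟩ : C^∞⟮M.I, U; M.I, V⟯)

/-! ## Stacks over manifolds -/

/-- The manifold over which an object lies. -/
abbrev base {𝒳 : BasedCategory.{v, u} Man} (ξ : 𝒳.obj) : Man := 𝒳.p.obj ξ

/-- The smooth map over which an arrow lies. -/
abbrev baseMap {𝒳 : BasedCategory.{v, u} Man} {ξ η : 𝒳.obj} (g : ξ ⟶ η) :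
    C^∞⟮(base ξ).I, base ξ; (base η).I, base η⟯ :=
  Man.fn (𝒳.p.map g)

/-- Categories fibred in groupoids over manifolds. -/
structure IsCFG (𝒳 : BasedCategory.{v, u} Man) : Prop where
  exists_lift : ∀ (ξ : 𝒳.obj) (M : Man) (r : M ⟶ 𝒳.p.obj ξ),
    ∃ (ξ' : 𝒳.obj) (g : ξ' ⟶ ξ), 𝒳.p.IsHomLift r g
  unique_lift : ∀ (ξ ξ' ξ'' : 𝒳.obj) (g₁ : ξ' ⟶ ξ) (g₂ : ξ'' ⟶ ξ)
    (r : 𝒳.p.obj ξ'' ⟶ 𝒳.p.obj ξ'), r ≫ 𝒳.p.map g₁ = 𝒳.p.map g₂ →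
      ∃! g : ξ'' ⟶ ξ', 𝒳.p.map g = r ∧ g ≫ g₁ = g₂

/-- Stacks over manifolds. `glue_hom` says that the functor from the fibre over a manifold to the
descent category of an open cover is fully faithful, `glue_obj` that it is essentially surjective.
Pullbacks are not chosen: the isomorphism `pr₂^* ξ j ≅ pr₁^* ξ i` of a descent datum is given by
an object `ξ₂ i j` over `U i ∩ U j` with an arrow to `ξ i` and an arrow to `ξ j` over the two
inclusions, and the cocycle condition is tested on arbitrary objects over the triple overlap. -/
structure IsStack (𝒳 : BasedCategory.{v, u} Man) : Prop extends IsCFG 𝒳 where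
  glue_hom : ∀ (ξ η : 𝒳.obj) (f : 𝒳.p.obj ξ ⟶ 𝒳.p.obj η) (ι : Type) (U : ι → Opens (base ξ))
    (_ : ⨆ i, U i = ⊤) (ξ₁ : ι → 𝒳.obj) (r : ∀ i, ξ₁ i ⟶ ξ) (g : ∀ i, ξ₁ i ⟶ η)
    (_ : ∀ i, 𝒳.p.IsHomLift (Man.incl (U i)) (r i))
    (_ : ∀ i, 𝒳.p.IsHomLift (Man.incl (U i) ≫ f) (g i))
    (_ : ∀ (i j : ι) (ζ : 𝒳.obj) (a : ζ ⟶ ξ₁ i) (b : ζ ⟶ ξ₁ j),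
      a ≫ r i = b ≫ r j → a ≫ g i = b ≫ g j),
    ∃! h : ξ ⟶ η, 𝒳.p.map h = f ∧ ∀ i, r i ≫ h = g i
  glue_obj : ∀ (M : Man) (ι : Type) (U : ι → Opens M) (_ : ⨆ i, U i = ⊤)
    (ξ₁ : ι → 𝒳.obj) (ξ₂ : ι → ι → 𝒳.obj)
    (a : ∀ i j, ξ₂ i j ⟶ ξ₁ i) (b : ∀ i j, ξ₂ i j ⟶ ξ₁ j)
    (_ : ∀ i, 𝒳.p.obj (ξ₁ i) = M.opens (U i))
    (_ : ∀ i j, 𝒳.p.IsHomLift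
      (Man.inclOfLE (inf_le_left : U i ⊓ U j ≤ U i)) (a i j))
    (_ : ∀ i j, 𝒳.p.IsHomLift
      (Man.inclOfLE (inf_le_right : U i ⊓ U j ≤ U j)) (b i j))
    (_ : ∀ (i j k : ι) (ζ : 𝒳.obj) (c : ζ ⟶ ξ₂ i j) (d : ζ ⟶ ξ₂ j k) (e : ζ ⟶ ξ₂ i k),
      c ≫ a i j = e ≫ a i k → c ≫ b i j = d ≫ a j k → d ≫ b j k = e ≫ b i k),
    ∃ (ξ : 𝒳.obj) (r : ∀ i, ξ₁ i ⟶ ξ), 𝒳.p.obj ξ = M ∧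
      (∀ i, 𝒳.p.IsHomLift (Man.incl (U i)) (r i)) ∧ ∀ i j, a i j ≫ r i = b i j ≫ r j

/-! ## Orbifolds

By the Yoneda lemma an object `ξ` over a manifold `X` is the same as a map of stacks `X → 𝒳`. -/

/-- For objects `ξ` over `X` and `η` over `Y`, an object of `X ×_𝒳 Y` over a manifold amounts to
an object `ζ` of `𝒳` over it with arrows `ζ ⟶ ξ` and `ζ ⟶ η`. Hence `X ×_𝒳 Y` is (equivalent to
the stack of) a manifold, namely `base ζ`, with projections `baseMap α` and `baseMap β`, if and
only if `(ζ, α, β)` is universal among such data. -/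
def IsFiberProduct {𝒳 : BasedCategory.{v, u} Man} {ξ η ζ : 𝒳.obj} (α : ζ ⟶ ξ) (β : ζ ⟶ η) :
    Prop :=
  ∀ (ζ' : 𝒳.obj) (α' : ζ' ⟶ ξ) (β' : ζ' ⟶ η), ∃! h : ζ' ⟶ ζ, h ≫ α = α' ∧ h ≫ β = β'

/-- An atlas `X → 𝒳`: a representable surjective submersion. -/
def IsAtlas {𝒳 : BasedCategory.{v, u} Man} (ξ : 𝒳.obj) : Prop :=
  ∀ η : 𝒳.obj, ∃ (ζ : 𝒳.obj) (α : ζ ⟶ ξ) (β : ζ ⟶ η), IsFiberProduct α β ∧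
    Function.Surjective (baseMap β) ∧
    Manifold.IsSubmersion (base ζ).I (base η).I ∞ (baseMap β)

/-- Representable étale maps `X → 𝒳` from a manifold (étale charts of `𝒳`). -/
def IsEtale {𝒳 : BasedCategory.{v, u} Man} (ξ : 𝒳.obj) : Prop :=
  ∀ η : 𝒳.obj, ∃ (ζ : 𝒳.obj) (α : ζ ⟶ ξ) (β : ζ ⟶ η), IsFiberProduct α β ∧
    IsLocalDiffeomorph (base ζ).I (base η).I ∞ (baseMap β)

/-- The atlas groupoid `X ×_𝒳 X ⇉ X` is étale and proper. -/
def IsEtaleProper {𝒳 : BasedCategory.{v, u} Man} (ξ : 𝒳.obj) : Prop :=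
  ∀ (ζ : 𝒳.obj) (s t : ζ ⟶ ξ), IsFiberProduct s t →
    IsLocalDiffeomorph (base ζ).I (base ξ).I ∞ (baseMap s) ∧
    IsLocalDiffeomorph (base ζ).I (base ξ).I ∞ (baseMap t) ∧
    IsProperMap (fun z : base ζ => (baseMap s z, baseMap t z))

/-- An orbifold is a differentiable Deligne-Mumford stack: a stack over manifolds with an atlas
whose atlas groupoid is étale and proper. -/
structure IsOrbifold (𝒳 : BasedCategory.{v, u} Man) : Prop extends IsStack 𝒳 where
  exists_atlas : ∃ ξ : 𝒳.obj, IsAtlas ξ ∧ IsEtaleProper ξ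

/-- Two points of an atlas are identified in the coarse moduli space if some point of the atlas
groupoid has them as source and target. -/
def CoarseRel {𝒳 : BasedCategory.{v, u} Man} (ξ : 𝒳.obj) (x y : base ξ) : Prop :=
  ∃ (ζ : 𝒳.obj) (s t : ζ ⟶ ξ) (z : base ζ), baseMap s z = x ∧ baseMap t z = y

/-- The coarse moduli space `|𝒳|`, computed in any atlas, is compact. -/
def IsCompactOrbifold (𝒳 : BasedCategory.{v, u} Man) : Prop :=
  ∀ ξ : 𝒳.obj, IsAtlas ξ → CompactSpace (Quot (CoarseRel ξ))

/-! ## Functions and symplectic forms on stacks -/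

/-- Smooth functions (differential `0`-forms) on a stack. -/
structure StackFunction (𝒳 : BasedCategory.{v, u} Man) where
  val : ∀ ξ : 𝒳.obj, C^∞⟮(base ξ).I, base ξ; ℝ⟯
  compat : ∀ (ξ η : 𝒳.obj) (g : ξ ⟶ η) (x : base ξ), val ξ x = val η (baseMap g x)

/-- A (not necessarily continuous) field of alternating bilinear forms on a manifold. -/
abbrev FormField (M : Man) : Type := ∀ x : M, TangentSpace M.I x [⋀^Fin 2]→L[ℝ] ℝ

/-- The coordinate expression of a field of forms in the preferred chart at `c`. -/
def FormField.inChart {M : Man} (Ω : FormField M) (c : M) (y : M.E) :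
    M.E [⋀^Fin 2]→L[ℝ] ℝ :=
  (Ω ((extChartAt M.I c).symm y)).compContinuousLinearMap
    (mfderiv 𝓘(ℝ, M.E) M.I (extChartAt M.I c).symm y)

/-- Smooth differential `2`-forms. -/
def FormField.IsSmooth {M : Man} (Ω : FormField M) : Prop :=
  ∀ c : M, ContDiffOn ℝ ∞ (Ω.inChart c) (extChartAt M.I c).target

/-- Closed differential `2`-forms. -/
def FormField.IsClosed {M : Man} (Ω : FormField M) : Prop :=
  ∀ c : M, ∀ y ∈ (extChartAt M.I c).target, extDeriv (Ω.inChart c) y = 0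

/-- Symplectic forms on an orbifold: closed `2`-forms on the stack that are nondegenerate on
étale charts. -/
structure SymplecticForm (𝒳 : BasedCategory.{v, u} Man) where
  form : ∀ ξ : 𝒳.obj, FormField (base ξ)
  smooth : ∀ ξ : 𝒳.obj, FormField.IsSmooth (form ξ)
  compat : ∀ (ξ η : 𝒳.obj) (g : ξ ⟶ η) (x : base ξ),
    form ξ x = (form η (baseMap g x)).compContinuousLinearMap
      (mfderiv (base ξ).I (base η).I (baseMap g) x)
  closed : ∀ ξ : 𝒳.obj, FormField.IsClosed (form ξ)
  nondegenerate : ∀ ξ : 𝒳.obj, IsEtale ξ → ∀ (x : base ξ) (e : TangentSpace (base ξ).I x),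
    (∀ e' : TangentSpace (base ξ).I x, form ξ x ![e, e'] = 0) → e = 0

/-! ## The stack `S × 𝒳` for a parameter set `S` -/

section Times

variable {E : Type} [NormedAddCommGroup E] [NormedSpace ℝ E]

/-- Objects of `S × 𝒳`: an object of `𝒳` and a smooth map from its base to `S`. -/
structure TimesObj (S : Set E) (𝒳 : BasedCategory.{v, u} Man) where
  pt : 𝒳.obj
  par : C^∞⟮(base pt).I, base pt; 𝓘(ℝ, E), E⟯
  mem : ∀ x, par x ∈ S

/-- Arrows of `S × 𝒳`: arrows of `𝒳` compatible with the maps to `S`. -/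
@[ext]
structure TimesHom {S : Set E} {𝒳 : BasedCategory.{v, u} Man} (η η' : TimesObj S 𝒳) where
  hom : η.pt ⟶ η'.pt
  par : ∀ x, η'.par (baseMap hom x) = η.par x

lemma baseMap_id {𝒳 : BasedCategory.{v, u} Man} (ξ : 𝒳.obj) (x : base ξ) :
    baseMap (𝟙 ξ) x = x := by
  have h : 𝒳.p.map (𝟙 ξ) = 𝟙 _ := 𝒳.p.map_id ξ
  unfold baseMap
  rw [h]
  rfl

lemma baseMap_comp {𝒳 : BasedCategory.{v, u} Man} {ξ η ζ : 𝒳.obj} (g : ξ ⟶ η) (h : η ⟶ ζ)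
    (x : base ξ) : baseMap (g ≫ h) x = baseMap h (baseMap g x) := by
  have e : 𝒳.p.map (g ≫ h) = 𝒳.p.map g ≫ 𝒳.p.map h := 𝒳.p.map_comp g h
  unfold baseMap
  rw [e]
  rfl

instance (S : Set E) (𝒳 : BasedCategory.{v, u} Man) : Category (TimesObj S 𝒳) where
  Hom := TimesHom
  id η := ⟨𝟙 η.pt, fun x => by rw [baseMap_id]⟩
  comp g h := ⟨g.hom ≫ h.hom, fun x => by rw [baseMap_comp, h.par, g.par]⟩
  id_comp g := TimesHom.ext (Category.id_comp g.hom)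
  comp_id g := TimesHom.ext (Category.comp_id g.hom)
  assoc f g h := TimesHom.ext (Category.assoc f.hom g.hom h.hom)

/-- The product `S × 𝒳`, for a subset `S` of a normed space. For `S = [a, b]` the objects over
`M` are pairs of a smooth map `M → [a, b]` and an object of `𝒳` over `M`, that is, this is the
product of `𝒳` with the stack of the manifold with boundary `[a, b]`. -/
def times (S : Set E) (𝒳 : BasedCategory.{v, u} Man) : BasedCategory.{v, u} Man where
  obj := TimesObj S 𝒳
  category := inferInstance
  p := { obj := fun η => 𝒳.p.obj η.pt
         map := fun g => 𝒳.p.map g.hom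
         map_id := fun η => 𝒳.p.map_id η.pt
         map_comp := fun g h => 𝒳.p.map_comp g.hom h.hom }

/-- The inclusion `𝒳 = {e} × 𝒳 → S × 𝒳`. -/
def sliceAt {S : Set E} (𝒳 : BasedCategory.{v, u} Man) (e : E) (he : e ∈ S) :
    BasedFunctor 𝒳 (times S 𝒳) where
  obj ξ := (⟨ξ, ContMDiffMap.const e, fun _ => he⟩ : TimesObj S 𝒳)
  map g := (⟨g, fun _ => rfl⟩ : TimesHom _ _)
  map_id _ := rfl
  map_comp _ _ := rfl
  w := rfl

/-- The map `φ × id : S × 𝒳 → S' × 𝒳` induced by a smooth map `φ` of parameters. -/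
def reparam {E' : Type} [NormedAddCommGroup E'] [NormedSpace ℝ E'] {S : Set E} {S' : Set E'}
    (𝒳 : BasedCategory.{v, u} Man) (φ : E → E') (hφ : ContDiff ℝ ∞ φ) (hS : MapsTo φ S S') :
    BasedFunctor (times S 𝒳) (times S' 𝒳) :=
  let obj (η : TimesObj S 𝒳) : TimesObj S' 𝒳 :=
    ⟨η.pt, ⟨fun x => φ (η.par x), hφ.contMDiff.comp η.par.contMDiff⟩, fun x => hS (η.mem x)⟩
  let map {η η' : TimesObj S 𝒳} (g : TimesHom η η') : TimesHom (obj η) (obj η') :=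
    ⟨g.hom, fun x => congrArg φ (g.par x)⟩
  { obj := obj
    map := map
    map_id := fun _ => rfl
    map_comp := fun _ _ => rfl
    w := rfl }

lemma lift_par {S : Set E} {𝒳 : BasedCategory.{v, u} Man} (F : BasedFunctor (times S 𝒳) 𝒳)
    {η η' : TimesObj S 𝒳} (g : η ⟶ η') (x : base (𝒳 := 𝒳) (F.obj η)) :
    η'.par (Man.fn (eqToHom (F.w_obj η')) (baseMap (𝒳 := 𝒳) (F.map g) x)) =
      η.par (Man.fn (eqToHom (F.w_obj η)) x) := by
  have h2 : 𝒳.p.map (F.map g) ≫ eqToHom (F.w_obj η') =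
      eqToHom (F.w_obj η) ≫ (times S 𝒳).p.map g := by
    have h : 𝒳.p.map (F.map g) = eqToHom (F.w_obj η) ≫ (times S 𝒳).p.map g ≫
        eqToHom (F.w_obj η').symm := Functor.congr_hom F.w g
    rw [h]
    simp
  have h3 := congrArg (fun k => Man.fn k x) h2
  have h4 : Man.fn (eqToHom (F.w_obj η')) (baseMap (𝒳 := 𝒳) (F.map g) x) =
      baseMap (TimesHom.hom g) (Man.fn (eqToHom (F.w_obj η)) x) := h3
  rw [h4]
  exact TimesHom.par g _

/-- The map `pr_S × F : S × 𝒳 → S × 𝒳` determined by `F : S × 𝒳 → 𝒳`. -/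
def prodLift {S : Set E} {𝒳 : BasedCategory.{v, u} Man} (F : BasedFunctor (times S 𝒳) 𝒳) :
    BasedFunctor (times S 𝒳) (times S 𝒳) :=
  let obj (η : TimesObj S 𝒳) : TimesObj S 𝒳 :=
    ⟨F.obj η, η.par.comp (Man.fn (eqToHom (F.w_obj η))), fun _ => η.mem _⟩
  let map {η η' : TimesObj S 𝒳} (g : TimesHom η η') : TimesHom (obj η) (obj η') :=
    ⟨F.map (X := η) (Y := η') g, fun x => lift_par F (η := η) (η' := η') g x⟩
  { obj := obj
    map := map
    map_id := fun η => TimesHom.ext (F.map_id η)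
    map_comp := fun g h => TimesHom.ext (F.map_comp g h)
    w := F.w }

end Times

/-! ## Time dependent Hamiltonian vector fields and their integrals -/

/-- Time dependent vector fields on an orbifold, with time in `J`: a compatible family of vector
fields on all étale charts. The family is smooth in time and space jointly, which is tested by
composing with smooth maps from manifolds to `J × base ζ`. -/
structure TimeVectorField (𝒳 : BasedCategory.{v, u} Man) (J : Set ℝ) where
  val : ∀ ζ : 𝒳.obj, IsEtale ζ → J → ∀ x : base ζ, TangentSpace (base ζ).I x
  smooth : ∀ (ζ : 𝒳.obj) (hζ : IsEtale ζ) (N : Man) (f : C^∞⟮N.I, N; ℝ⟯) (hf : ∀ y, f y ∈ J)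
    (φ : N ⟶ 𝒳.p.obj ζ),
    ContMDiff N.I (base ζ).I.tangent ∞ (fun y : N =>
      (⟨Man.fn φ y, val ζ hζ ⟨f y, hf y⟩ (Man.fn φ y)⟩ : TangentBundle (base ζ).I (base ζ)))
  compat : ∀ (ζ ζ' : 𝒳.obj) (hζ : IsEtale ζ) (hζ' : IsEtale ζ') (g : ζ ⟶ ζ') (t : J)
    (x : base ζ), mfderiv (base ζ).I (base ζ').I (baseMap g) x (val ζ hζ t x) =
      val ζ' hζ' t (baseMap g x)

/-- `X` is Hamiltonian: there is a function `H` on `J × 𝒳` with `dH_t = Ω(X_t, ·)` for all `t`. -/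
def TimeVectorField.IsHamiltonian {𝒳 : BasedCategory.{v, u} Man} (Ω : SymplecticForm 𝒳)
    {J : Set ℝ} (X : TimeVectorField 𝒳 J) : Prop :=
  ∃ H : StackFunction (times J 𝒳), ∀ (ζ : 𝒳.obj) (hζ : IsEtale ζ) (t : J) (x : base ζ)
    (e : TangentSpace (base ζ).I x),
    (mfderiv (base ζ).I 𝓘(ℝ, ℝ)
      (fun y : base ζ => H.val ((sliceAt 𝒳 (t : ℝ) t.2).obj ζ) y) x e : ℝ) =
      Ω.form ζ x ![X.val ζ hζ t x, e]

/-- `F : J × 𝒳 → 𝒳` integrates the time dependent vector field `X`, that is `∂F/∂t = X_t ∘ F`.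

To differentiate `F` in the time direction, take a manifold `N` mapping to `J × 𝒳` (an object `η`,
with time coordinate `η.par : N → J`), and a tangent vector `e` of `N` along which the `𝒳`-component
`N → 𝒳` of this map is stationary: it factors through a smooth map `baseMap k : N → base ξ` with
`d (baseMap k) e = 0`. If the composite `N → J × 𝒳 → 𝒳` lifts to a smooth map `φ` from `N` to an
étale chart `base ζ`, then `dφ e` must be `d(η.par) e` times the value of `X` at `φ`.
In the basic case `N` is an open subset of `J × base ξ` and `e = ∂/∂t`. -/
def Integrates {𝒳 : BasedCategory.{v, u} Man} {J : Set ℝ} (F : BasedFunctor (times J 𝒳) 𝒳)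
    (X : TimeVectorField 𝒳 J) : Prop :=
  ∀ (η : TimesObj J 𝒳) (ξ : 𝒳.obj) (k : η.pt ⟶ ξ) (ζ : 𝒳.obj) (hζ : IsEtale ζ)
    (g : F.obj η ⟶ ζ) (n : base η.pt) (e : TangentSpace (base η.pt).I n),
    mfderiv (base η.pt).I (base ξ).I (baseMap k) n e = 0 →
    let φ : C^∞⟮(base η.pt).I, base η.pt; (base ζ).I, base ζ⟯ :=
      (baseMap g).comp (Man.fn (eqToHom (F.w_obj η).symm))
    let dt : ℝ := mfderiv (base η.pt).I 𝓘(ℝ, ℝ) η.par n e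
    mfderiv (base η.pt).I (base ζ).I φ n e =
      dt • X.val ζ hζ ⟨η.par n, η.mem n⟩ (φ n)

/-- `F` integrates some time dependent Hamiltonian vector field. -/
def IntegratesHamiltonian {𝒳 : BasedCategory.{v, u} Man} (Ω : SymplecticForm 𝒳) {J : Set ℝ}
    (F : BasedFunctor (times J 𝒳) 𝒳) : Prop :=
  ∃ X : TimeVectorField 𝒳 J, X.IsHamiltonian Ω ∧ Integrates F X

/-- There is a 2-morphism from `F` to `G`. -/
def TwoIso {𝒳 : BasedCategory.{v, u} Man} {𝒴 : BasedCategory.{v', u'} Man}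
    (F G : BasedFunctor 𝒳 𝒴) : Prop :=
  Nonempty (BasedNatTrans F G)

/-! ## Partitions of the unit interval -/

/-- A partition `0 = t₀ < t₁ < ⋯ < 1` of the unit interval, given by its set of points. -/
@[ext]
structure Partition where
  pts : Finset ℝ
  zero_mem : (0 : ℝ) ∈ pts
  one_mem : (1 : ℝ) ∈ pts
  mem_Icc : ∀ x ∈ pts, x ∈ Icc (0 : ℝ) 1

/-- `[a, b]` is one of the intervals of the partition. -/
structure Partition.Consec (P : Partition) (a b : ℝ) : Prop where
  left : a ∈ P.pts
  right : b ∈ P.pts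
  lt : a < b
  between : ∀ c ∈ P.pts, c ≤ a ∨ b ≤ c

/-- The partition obtained by adding a point. -/
def Partition.addPoint (P : Partition) (c : ℝ) (hc : c ∈ Icc (0 : ℝ) 1) :
    Partition where
  pts := insert c P.pts
  zero_mem := Finset.mem_insert_of_mem P.zero_mem
  one_mem := Finset.mem_insert_of_mem P.one_mem
  mem_Icc x hx := by
    rcases Finset.mem_insert.1 hx with rfl | hx
    · exact hc
    · exact P.mem_Icc x hx

/-- The common refinement of two partitions. -/
def Partition.union (P Q : Partition) : Partition where
  pts := P.pts ∪ Q.pts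
  zero_mem := Finset.mem_union_left _ P.zero_mem
  one_mem := Finset.mem_union_left _ P.one_mem
  mem_Icc x hx := by
    rcases Finset.mem_union.1 hx with hx | hx
    · exact P.mem_Icc x hx
    · exact Q.mem_Icc x hx

/-- The partition of `[0, 1]` into a halved copy of `P` and a halved copy of `Q`. -/
def Partition.concat (P Q : Partition) : Partition where
  pts := P.pts.image (fun x => x / 2) ∪ Q.pts.image (fun x => (x + 1) / 2)
  zero_mem := Finset.mem_union_left _ (Finset.mem_image.2 ⟨0, P.zero_mem, by norm_num⟩)
  one_mem := Finset.mem_union_right _ (Finset.mem_image.2 ⟨1, Q.one_mem, by norm_num⟩)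
  mem_Icc x hx := by
    rcases Finset.mem_union.1 hx with hx | hx
    · obtain ⟨y, hy, rfl⟩ := Finset.mem_image.1 hx
      obtain ⟨h0, h1⟩ := P.mem_Icc y hy
      constructor <;> linarith
    · obtain ⟨y, hy, rfl⟩ := Finset.mem_image.1 hx
      obtain ⟨h0, h1⟩ := Q.mem_Icc y hy
      constructor <;> linarith

lemma Partition.exists_parent {P Q : Partition} (hPQ : P.pts ⊆ Q.pts) {a b : ℝ}
    (h : Q.Consec a b) : ∃ q : ℝ × ℝ, P.Consec q.1 q.2 ∧ q.1 ≤ a ∧ b ≤ q.2 := by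
  classical
  have ha := Q.mem_Icc a h.left
  have hb := Q.mem_Icc b h.right
  have hlo : (P.pts.filter (fun x => x ≤ a)).Nonempty :=
    ⟨0, Finset.mem_filter.2 ⟨P.zero_mem, ha.1⟩⟩
  have hhi : (P.pts.filter (fun x => b ≤ x)).Nonempty :=
    ⟨1, Finset.mem_filter.2 ⟨P.one_mem, hb.2⟩⟩
  have h1 := Finset.mem_filter.1 (Finset.max'_mem _ hlo)
  have h2 := Finset.mem_filter.1 (Finset.min'_mem _ hhi)
  refine ⟨(Finset.max' _ hlo, Finset.min' _ hhi), ⟨h1.1, h2.1, ?_, ?_⟩, h1.2, h2.2⟩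
  · exact lt_of_le_of_lt h1.2 (lt_of_lt_of_le h.lt h2.2)
  · intro c hc
    rcases h.between c (hPQ hc) with hca | hbc
    · exact Or.inl (Finset.le_max' _ c (Finset.mem_filter.2 ⟨hc, hca⟩))
    · exact Or.inr (Finset.min'_le _ c (Finset.mem_filter.2 ⟨hc, hbc⟩))

lemma Partition.half_mem (P Q : Partition) : (1 / 2 : ℝ) ∈ (P.concat Q).pts :=
  Finset.mem_union_left _ (Finset.mem_image.2 ⟨1, P.one_mem, rfl⟩)

lemma Partition.concat_left {P Q : Partition} {a b : ℝ} (h : (P.concat Q).Consec a b)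
    (hb : b ≤ 1 / 2) : P.Consec (2 * a) (2 * b) := by
  have key : ∀ x ∈ (P.concat Q).pts, x ≤ 1 / 2 → 2 * x ∈ P.pts := by
    intro x hx hx2
    rcases Finset.mem_union.1 hx with hx | hx
    · obtain ⟨y, hy, rfl⟩ := Finset.mem_image.1 hx
      have : 2 * (y / 2) = y := by ring
      rwa [this]
    · obtain ⟨y, hy, rfl⟩ := Finset.mem_image.1 hx
      have h0 := (Q.mem_Icc y hy).1
      have : y = 0 := by linarith
      subst this
      norm_num [P.one_mem]
  have hlt := h.lt
  refine ⟨key a h.left (by linarith), key b h.right hb, by linarith, fun c hc => ?_⟩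
  rcases h.between (c / 2) (Finset.mem_union_left _ (Finset.mem_image.2 ⟨c, hc, rfl⟩)) with h' | h'
  · left; linarith
  · right; linarith

lemma Partition.concat_right {P Q : Partition} {a b : ℝ} (h : (P.concat Q).Consec a b)
    (hb : ¬ b ≤ 1 / 2) : Q.Consec (2 * a - 1) (2 * b - 1) := by
  have ha : 1 / 2 ≤ a := by
    rcases h.between _ (P.half_mem Q) with h' | h'
    · exact h'
    · exact absurd h' hb
  have key : ∀ x ∈ (P.concat Q).pts, 1 / 2 ≤ x → 2 * x - 1 ∈ Q.pts := by
    intro x hx hx2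
    rcases Finset.mem_union.1 hx with hx | hx
    · obtain ⟨y, hy, rfl⟩ := Finset.mem_image.1 hx
      have h0 := (P.mem_Icc y hy).2
      have : y = 1 := by linarith
      subst this
      norm_num [Q.zero_mem]
    · obtain ⟨y, hy, rfl⟩ := Finset.mem_image.1 hx
      have : 2 * ((y + 1) / 2) - 1 = y := by ring
      rwa [this]
  have hlt := h.lt
  refine ⟨key a h.left ha, key b h.right (by linarith), by linarith, fun c hc => ?_⟩
  rcases h.between ((c + 1) / 2)
    (Finset.mem_union_right _ (Finset.mem_image.2 ⟨c, hc, rfl⟩)) with h' | h'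
  · left; linarith
  · right; linarith

/-! ## Hamiltonian paths -/

/-- A tuple of stack maps `γ_l : [t_l, t_{l+1}] × 𝒳 → 𝒳`, one for each interval of a partition. -/
structure PiecewisePath (𝒳 : BasedCategory.{v, u} Man) where
  P : Partition
  map : ∀ a b, P.Consec a b → BasedFunctor (times (Icc a b) 𝒳) 𝒳

namespace PiecewisePath

variable {𝒳 : BasedCategory.{v, u} Man}

/-- The restriction of the piece over `[a, b]` to its left end `{a} × 𝒳`. -/
def left (γ : PiecewisePath 𝒳) {a b : ℝ} (h : γ.P.Consec a b) : BasedFunctor 𝒳 𝒳 :=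
  (sliceAt 𝒳 a (left_mem_Icc.2 h.lt.le)).comp (γ.map a b h)

/-- The restriction of the piece over `[a, b]` to its right end `{b} × 𝒳`. -/
def right (γ : PiecewisePath 𝒳) {a b : ℝ} (h : γ.P.Consec a b) : BasedFunctor 𝒳 𝒳 :=
  (sliceAt 𝒳 b (right_mem_Icc.2 h.lt.le)).comp (γ.map a b h)

/-- Hamiltonian paths: each piece integrates a time dependent Hamiltonian vector field, and
consecutive pieces are joined by 2-morphisms. -/
structure IsHamiltonian (Ω : SymplecticForm 𝒳) (γ : PiecewisePath 𝒳) : Prop where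
  integrates : ∀ a b (h : γ.P.Consec a b), IntegratesHamiltonian Ω (γ.map a b h)
  joins : ∀ a b c (h : γ.P.Consec a b) (h' : γ.P.Consec b c), TwoIso (γ.right h) (γ.left h')

/-- Hamiltonian loops based at the identity. -/
structure IsBasedLoop (Ω : SymplecticForm 𝒳) (γ : PiecewisePath 𝒳) : Prop extends
    IsHamiltonian Ω γ where
  closes : ∀ a b (h : γ.P.Consec a 1) (h' : γ.P.Consec 0 b), TwoIso (γ.right h) (γ.left h')
  based : ∀ b (h : γ.P.Consec 0 b), γ.left h = BasedFunctor.id 𝒳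

/-- The path obtained by subdividing the pieces according to a finer partition. -/
def subdivide (γ : PiecewisePath 𝒳) (Q : Partition) (hQ : γ.P.pts ⊆ Q.pts) :
    PiecewisePath 𝒳 where
  P := Q
  map _ _ h :=
    have hq := (Partition.exists_parent hQ h).choose_spec
    (reparam 𝒳 (fun t : ℝ => t) contDiff_id (Icc_subset_Icc hq.2.1 hq.2.2)).comp (γ.map _ _ hq.1)

/-- `γ'` arises from `γ` by splitting one interval of the partition in two. -/
def IsSplitting (γ γ' : PiecewisePath 𝒳) : Prop :=
  ∃ (c : ℝ) (hc : c ∈ Icc (0 : ℝ) 1), c ∉ γ.P.pts ∧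
    γ' = γ.subdivide (γ.P.addPoint c hc) (Finset.subset_insert _ _)

/-- `γ` and `γ'` have the same partition, and there are 2-morphisms between their pieces. -/
def TwoRelated (γ γ' : PiecewisePath 𝒳) : Prop :=
  γ.P = γ'.P ∧ ∀ a b (h : γ.P.Consec a b) (h' : γ'.P.Consec a b), TwoIso (γ.map a b h) (γ'.map a b h')

/-- Naturally related paths: connected by a finite sequence of Hamiltonian paths in which
neighbours are splitting related or 2-related. -/
def NaturallyRelated (Ω : SymplecticForm 𝒳) (γ γ' : PiecewisePath 𝒳) : Prop :=
  Relation.ReflTransGen (fun δ δ' : PiecewisePath 𝒳 => δ.IsHamiltonian Ω ∧ δ'.IsHamiltonian Ω ∧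
    (δ.IsSplitting δ' ∨ δ'.IsSplitting δ ∨ δ.TwoRelated δ')) γ γ'

/-- The paths agree at time `0` up to 2-morphism. -/
def SameStart (γ γ' : PiecewisePath 𝒳) : Prop :=
  ∀ b b' (h : γ.P.Consec 0 b) (h' : γ'.P.Consec 0 b'), TwoIso (γ.left h) (γ'.left h')

/-- The paths agree at time `1` up to 2-morphism. -/
def SameEnd (γ γ' : PiecewisePath 𝒳) : Prop :=
  ∀ a a' (h : γ.P.Consec a 1) (h' : γ'.P.Consec a' 1), TwoIso (γ.right h) (γ'.right h')

/-- The concatenation product: first `γ` at double speed, then `γ'` at double speed. -/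
def concat (γ γ' : PiecewisePath 𝒳) : PiecewisePath 𝒳 where
  P := γ.P.concat γ'.P
  map a b h :=
    if hb : b ≤ 1 / 2 then
      (reparam 𝒳 (S := Icc a b) (S' := Icc (2 * a) (2 * b)) (fun t : ℝ => 2 * t) (by fun_prop)
        (fun t ht => ⟨by linarith [ht.1], by linarith [ht.2]⟩)).comp
        (γ.map _ _ (Partition.concat_left h hb))
    else
      (reparam 𝒳 (S := Icc a b) (S' := Icc (2 * a - 1) (2 * b - 1)) (fun t : ℝ => 2 * t - 1)
        (by fun_prop) (fun t ht => ⟨by linarith [ht.1], by linarith [ht.2]⟩)).comp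
        (γ'.map _ _ (Partition.concat_right h hb))

/-- The pointwise composition product: over the common refinement of the two partitions, the
pieces are `γ_l ∘ (pr × γ'_l)`. -/
def compose (γ γ' : PiecewisePath 𝒳) : PiecewisePath 𝒳 where
  P := γ.P.union γ'.P
  map a b h :=
    (prodLift ((γ'.subdivide (γ.P.union γ'.P) Finset.subset_union_right).map a b h)).comp
      ((γ.subdivide (γ.P.union γ'.P) Finset.subset_union_left).map a b h)

end PiecewisePath

/-! ## Homotopies -/

/-- A collection of stack maps `[s_k, s_{k+1}] × [t_{k,l}, t_{k,l+1}] × 𝒳 → 𝒳`, one for each brick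
of a brick partition of the unit square. -/
structure PiecewiseHomotopy (𝒳 : BasedCategory.{v, u} Man) where
  S : Partition
  T : ∀ s s', S.Consec s s' → Partition
  map : ∀ s s' (h : S.Consec s s') a b, (T s s' h).Consec a b →
    BasedFunctor (times (Icc s s' ×ˢ Icc a b) 𝒳) 𝒳

namespace PiecewiseHomotopy

variable {𝒳 : BasedCategory.{v, u} Man}

/-- The path obtained by restricting the layer over `[s, s']` to `{σ} × [0, 1] × 𝒳`. -/
def slice (Γ : PiecewiseHomotopy 𝒳) {s s' : ℝ} (h : Γ.S.Consec s s') (σ : ℝ)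
    (hσ : σ ∈ Icc s s') : PiecewisePath 𝒳 where
  P := Γ.T s s' h
  map a b h' :=
    (reparam 𝒳 (S := Icc a b) (S' := Icc s s' ×ˢ Icc a b) (fun t : ℝ => (σ, t)) (by fun_prop)
      (fun _ ht => ⟨hσ, ht⟩)).comp
      (Γ.map s s' h a b h')

/-- `Γ` is a homotopy of Hamiltonian paths from `γ` to `γ'`, relative to the ends. -/
structure IsRelHomotopy (Ω : SymplecticForm 𝒳) (Γ : PiecewiseHomotopy 𝒳)
    (γ γ' : PiecewisePath 𝒳) : Prop where
  hamiltonian : ∀ s s' (h : Γ.S.Consec s s') σ (hσ : σ ∈ Icc s s'),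
    (Γ.slice h σ hσ).IsHamiltonian Ω
  layers : ∀ s s' s'' (h : Γ.S.Consec s s') (h' : Γ.S.Consec s' s''),
    PiecewisePath.NaturallyRelated Ω (Γ.slice h s' (right_mem_Icc.2 h.lt.le))
      (Γ.slice h' s' (left_mem_Icc.2 h'.lt.le))
  bottom : ∀ s (h : Γ.S.Consec 0 s),
    PiecewisePath.NaturallyRelated Ω (Γ.slice h 0 (left_mem_Icc.2 h.lt.le)) γ
  top : ∀ s (h : Γ.S.Consec s 1),
    PiecewisePath.NaturallyRelated Ω (Γ.slice h 1 (right_mem_Icc.2 h.lt.le)) γ'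
  starts : ∀ s s' (h : Γ.S.Consec s s') σ (hσ : σ ∈ Icc s s'),
    (Γ.slice h σ hσ).SameStart γ ∧ (Γ.slice h σ hσ).SameStart γ'
  ends : ∀ s s' (h : Γ.S.Consec s s') σ (hσ : σ ∈ Icc s s'),
    (Γ.slice h σ hσ).SameEnd γ ∧ (Γ.slice h σ hσ).SameEnd γ'

end PiecewiseHomotopy

/-! ## The fundamental group -/

/-- Hamiltonian loops of `(𝒳, Ω)` based at the identity. -/
def BasedLoop {𝒳 : BasedCategory.{v, u} Man} (Ω : SymplecticForm 𝒳) :=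
  {γ : PiecewisePath 𝒳 // γ.IsBasedLoop Ω}

/-- Homotopy of based Hamiltonian loops relative to the ends. -/
def RelHomotopic {𝒳 : BasedCategory.{v, u} Man} (Ω : SymplecticForm 𝒳) (γ γ' : BasedLoop Ω) :
    Prop :=
  ∃ Γ : PiecewiseHomotopy 𝒳, Γ.IsRelHomotopy Ω γ.1 γ'.1

/-- The set `π₁(Ham(𝒳, Ω))` of homotopy classes of based Hamiltonian loops. -/
def Pi1Ham {𝒳 : BasedCategory.{v, u} Man} (Ω : SymplecticForm 𝒳) :=
  Quot (RelHomotopic Ω)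

/-- The homotopy class of a based Hamiltonian loop. -/
def homotopyClass {𝒳 : BasedCategory.{v, u} Man} {Ω : SymplecticForm 𝒳} (γ : BasedLoop Ω) :
    Pi1Ham Ω :=
  Quot.mk _ γ

end HamOrb

end

/-!
The proof has an analytic part, which describes the pieces of Hamiltonian loops by differential
forms, and a formal part, in which everything follows from one family of maps on a square.

*Analysis.* Let `F : [a, b] × 𝒳 → 𝒳` integrate the Hamiltonian vector field of `H`. If some `F_t` is
symplectic, then `F^* Ω = Ω + dt ∧ d(H ∘ (t, F))` (`Star`, `star_of_integrates`). The contraction of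
both sides with the time direction agrees by the definition of the field, and since `Ω` is closed
the restrictions to the slices do not depend on time. Conversely, a map satisfying this identity
integrates the Hamiltonian vector field of `H`, because `Ω` is nondegenerate (`Star.integrates`).
The identity is what makes isotopies easy to transform: reparametrizing by `φ` multiplies the
Hamiltonian by `φ'` (`HamIsotopy.reparam`), and the pointwise composition `F ∘ G` has the Hamiltonian
`H_F + F_* H_G` (`HamIsotopy.comp`). The pushforward `F_* H_G` exists because the maps `F_t` are
étale, being symplectic, and are bijections on the points of the coarse moduli space
(`exists_pushforward`). For the pieces of a loop this bijectivity propagates from the identity at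
time `0`. Injectivity does because integral curves are unique. Surjectivity does because the image
of a symplectic map in the coarse space is open, and closed by compactness, so that it contains a
path as soon as it contains one of its points (`Integrates.isGood`).

Smoothness of functions on `[a, b] × 𝒳` is only a statement about plots, and plots have vanishing
time derivative where they touch the ends of the interval. The plot `osc`, essentially `t = sin τ`,
covers the ends: it replaces the interval by the line, and it shows that functions on `[a, b] × 𝒳`
are Lipschitz in time.

*Combinatorics of partitions.* Two Hamiltonian paths are naturally related if and only if their
pieces agree up to 2-morphism over some common refinement of the partitions
(`NaturallyRelated.exists_agree`, `Agree.naturallyRelated`). With this, layers of homotopies can be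
reparametrized, reversed, stacked and put next to each other after refining their partitions, so
that homotopy (`LoopHomotopic`) is an equivalence relation compatible with concatenation.

*Loops in a square.* Let `γ` and `γ'` be loops. The maps `γ(s) ∘ γ'(t)` form a piecewise smooth family
on the unit square, a Hamiltonian isotopy in either variable. A path in the square that is smooth
in each cell and joins vertices at which both loops are the identity traces a Hamiltonian loop
(`IsTrace.isLoop`). Two traces that pass through the same cells are homotopic by linear
interpolation (`exists_linear_homotopy`), and sliding across one cell after another shows that a
trace is homotopic to every trace with the same ends that lies below it (`traceHomotopic_of_le`).
The diagonal traces the pointwise composition, and the path through the corner `(1, 0)` traces the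
concatenation. The two operations are therefore homotopic. A loop followed by its reverse is the
trace of a tent-shaped path, which slides down to a constant path.

The group axioms follow: pointwise composition is associative with unit the constant loop already up
to natural relation, concatenation is compatible with homotopy, and the reversed loop is an inverse.
A based loop starts at the identity on the nose, whereas the reversed loop does so only up to
2-morphism; a constant path put in front of it restores this.
-/

noncomputable section

namespace HamOrb

section

/-! ### Calculus of smooth maps between manifolds -/

namespace Man

variable {M N K : Man}

@[simp] lemma fn_id (x : M) : Man.fn (𝟙 M) x = x := rfl

@[simp] lemma fn_comp (f : M ⟶ N) (g : N ⟶ K) (x : M) :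
    Man.fn (f ≫ g) x = Man.fn g (Man.fn f x) := rfl

lemma contMDiff_fn (f : M ⟶ N) : ContMDiff M.I N.I ∞ (Man.fn f) := (Man.fn f).contMDiff

lemma continuous_fn (f : M ⟶ N) : Continuous (Man.fn f) := (contMDiff_fn f).continuous

lemma mdiff_fn (f : M ⟶ N) (x : M) : MDifferentiableAt M.I N.I (Man.fn f) x :=
  (contMDiff_fn f).mdifferentiableAt (by simp)

/-- A smooth function between manifolds, as a morphism. -/
def ofFun (f : M → N) (hf : ContMDiff M.I N.I ∞ f) : M ⟶ N :=
  (⟨f, hf⟩ : C^∞⟮M.I, M; N.I, N⟯)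

@[simp] lemma fn_ofFun (f : M → N) (hf : ContMDiff M.I N.I ∞ f) (x : M) : Man.fn (ofFun f hf) x = f x :=
  rfl

@[ext] lemma hom_ext {f g : M ⟶ N} (h : ∀ x, Man.fn f x = Man.fn g x) : f = g :=
  ContMDiffMap.ext (f := Man.fn f) (g := Man.fn g) h

/-- The differential of a smooth map at a point. The tangent spaces are identified with the model
vector spaces. -/
def d (f : M ⟶ N) (x : M) : M.E →L[ℝ] N.E :=
  mfderiv M.I N.I (Man.fn f) x

@[simp] lemma d_id (x : M) (u : M.E) : d (𝟙 M) x u = u := by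
  have : mfderiv M.I M.I (Man.fn (𝟙 M)) x = ContinuousLinearMap.id ℝ _ := mfderiv_id
  unfold d
  rw [this]
  rfl

lemma d_comp (f : M ⟶ N) (g : N ⟶ K) (x : M) (u : M.E) :
    d (f ≫ g) x u = d g (Man.fn f x) (d f x u) := by
  have : mfderiv M.I K.I (Man.fn (f ≫ g)) x =
      (mfderiv N.I K.I (Man.fn g) (Man.fn f x)).comp (mfderiv M.I N.I (Man.fn f) x) :=
    mfderiv_comp x (mdiff_fn g _) (mdiff_fn f _)
  unfold d
  rw [this]
  rfl

/-- The manifold underlying a finite-dimensional vector space. -/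
abbrev vec (V : Type) [NormedAddCommGroup V] [NormedSpace ℝ V] [FiniteDimensional ℝ V] : Man where
  carrier := V
  E := V
  H := V
  I := 𝓘(ℝ, V)
  secondCountable := by
    have := FiniteDimensional.proper ℝ V
    infer_instance

/-- The product of two manifolds. -/
abbrev prod (M N : Man) : Man where
  carrier := M × N
  E := M.E × N.E
  H := ModelProd M.H N.H
  I := M.I.prod N.I

/-- The first projection. -/
def fst (M N : Man) : M.prod N ⟶ M := ofFun (M := M.prod N) Prod.fst contMDiff_fst

/-- The second projection. -/
def snd (M N : Man) : M.prod N ⟶ N := ofFun (M := M.prod N) Prod.snd contMDiff_snd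

/-- The map to a product with given components. -/
def pair (f : K ⟶ M) (g : K ⟶ N) : K ⟶ M.prod N :=
  ofFun (N := M.prod N) (fun x => (Man.fn f x, Man.fn g x)) ((contMDiff_fn f).prodMk (contMDiff_fn g))

@[simp] lemma pair_fst (f : K ⟶ M) (g : K ⟶ N) : pair f g ≫ fst M N = f := rfl

@[simp] lemma pair_snd (f : K ⟶ M) (g : K ⟶ N) : pair f g ≫ snd M N = g := rfl

/-- The constant map. -/
def const (M : Man) (y : N) : M ⟶ N := ofFun (fun _ => y) contMDiff_const

@[simp] lemma fn_const (y : N) (x : M) : Man.fn (const M y) x = y := rfl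

@[simp] lemma const_comp (x : M) (f : M ⟶ N) : const K x ≫ f = const K (Man.fn f x) := rfl

@[simp] lemma comp_const (f : K ⟶ M) (y : N) : f ≫ const M y = const K y := rfl

@[simp] lemma d_const (y : N) (x : M) (u : M.E) : d (const M y) x u = 0 := by
  have : mfderiv M.I N.I (fun _ : M => y) x = 0 := mfderiv_const
  change mfderiv M.I N.I (fun _ : M => y) x u = 0
  rw [this]
  rfl

lemma d_fst (z : M.prod N) (w : M.E × N.E) :
    d (fst M N) z w = w.1 := by
  have : mfderiv (M.I.prod N.I) M.I (Prod.fst : M × N → M) z =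
      ContinuousLinearMap.fst ℝ (TangentSpace M.I z.1) (TangentSpace N.I z.2) := mfderiv_fst
  change mfderiv (M.I.prod N.I) M.I (Prod.fst : M × N → M) z w = _
  rw [this]
  rfl

lemma d_snd (z : M.prod N) (w : M.E × N.E) :
    d (snd M N) z w = w.2 := by
  have : mfderiv (M.I.prod N.I) N.I (Prod.snd : M × N → N) z =
      ContinuousLinearMap.snd ℝ (TangentSpace M.I z.1) (TangentSpace N.I z.2) := mfderiv_snd
  change mfderiv (M.I.prod N.I) N.I (Prod.snd : M × N → N) z w = _
  rw [this]
  rfl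

lemma d_pair (f : K ⟶ M) (g : K ⟶ N) (x : K) (u : K.E) :
    d (pair f g) x u = (d f x u, d g x u) := by
  have h₁ := d_comp (pair f g) (fst M N) x u
  have h₂ := d_comp (pair f g) (snd M N) x u
  rw [d_fst, pair_fst] at h₁
  rw [d_snd, pair_snd] at h₂
  exact Prod.ext h₁.symm h₂.symm

lemma fn_hom_inv (i : M ≅ N) (x : M) : Man.fn i.inv (Man.fn i.hom x) = x := by
  rw [← fn_comp, i.hom_inv_id, fn_id]

lemma fn_inv_hom (i : M ≅ N) (x : N) : Man.fn i.hom (Man.fn i.inv x) = x := by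
  rw [← fn_comp, i.inv_hom_id, fn_id]

lemma d_bijective_iso (i : M ≅ N) (x : M) : Function.Bijective (d i.hom x) := by
  refine Function.bijective_iff_has_inverse.2 ⟨d i.inv (Man.fn i.hom x), fun u => ?_, fun u => ?_⟩
  · rw [← d_comp, i.hom_inv_id, d_id]
  · have h := d_comp i.inv i.hom (Man.fn i.hom x) u
    rw [fn_hom_inv, i.inv_hom_id, d_id] at h
    exact h.symm

lemma d_bijective_of_isLocalDiffeomorph {f : M ⟶ N} (hf : IsLocalDiffeomorph M.I N.I ∞ (Man.fn f))
    (x : M) : Function.Bijective (d f x) := by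
  have := (hf.mfderivToContinuousLinearEquiv (by simp) x).bijective
  have h2 := hf.mfderivToContinuousLinearEquiv_coe (by simp) x
  have h3 : ⇑(d f x) = ⇑(hf.mfderivToContinuousLinearEquiv (by simp) x) :=
    congrArg DFunLike.coe h2.symm
  rwa [h3]

end Man

end

section

/-! ### Categories fibred in groupoids and their points -/

namespace Man

variable {M N K : Man}

lemma isLocalDiffeomorph_iso (i : M ≅ N) : IsLocalDiffeomorph M.I N.I ∞ (Man.fn i.hom) :=
  (({ toFun := Man.fn i.hom
      invFun := Man.fn i.inv
      left_inv := fn_hom_inv i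
      right_inv := fn_inv_hom i
      contMDiff_toFun := contMDiff_fn _
      contMDiff_invFun := contMDiff_fn _ } : Diffeomorph M.I N.I M N ∞)).isLocalDiffeomorph

lemma isLocalDiffeomorph_comp {f : M ⟶ N} {g : N ⟶ K}
    (hf : IsLocalDiffeomorph M.I N.I ∞ (Man.fn f)) (hg : IsLocalDiffeomorph N.I K.I ∞ (Man.fn g)) :
    IsLocalDiffeomorph M.I K.I ∞ (Man.fn (f ≫ g)) :=
  fun x => (hf x).comp K.I K (hg _)

end Man

section CFG

variable {𝒳 : BasedCategory.{v, u} Man} {𝒴 : BasedCategory.{v', u'} Man}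

lemma IsCFG.exists_arrow (h : IsCFG 𝒳) (ζ : 𝒳.obj) {M : Man} (f : M ⟶ 𝒳.p.obj ζ) :
    ∃ (κ : 𝒳.obj) (i : M ≅ 𝒳.p.obj κ) (a : κ ⟶ ζ), i.hom ≫ 𝒳.p.map a = f := by
  obtain ⟨κ, g, hg⟩ := h.exists_lift ζ M f
  refine ⟨κ, eqToIso (IsHomLift.domain_eq 𝒳.p f g).symm, g, ?_⟩
  have := IsHomLift.fac 𝒳.p f g
  simpa using this.symm

lemma IsCFG.exists_factor (h : IsCFG 𝒳) {ξ ξ' ξ'' : 𝒳.obj} (g₁ : ξ' ⟶ ξ) (g₂ : ξ'' ⟶ ξ)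
    (r : 𝒳.p.obj ξ'' ⟶ 𝒳.p.obj ξ') (hr : r ≫ 𝒳.p.map g₁ = 𝒳.p.map g₂) :
    ∃ g : ξ'' ⟶ ξ', 𝒳.p.map g = r ∧ g ≫ g₁ = g₂ :=
  (h.unique_lift ξ ξ' ξ'' g₁ g₂ r hr).exists

lemma IsCFG.hom_eq (h : IsCFG 𝒳) {ξ ξ' ξ'' : 𝒳.obj} {a b : ξ'' ⟶ ξ'} (g : ξ' ⟶ ξ)
    (h₁ : 𝒳.p.map a = 𝒳.p.map b) (h₂ : a ≫ g = b ≫ g) : a = b :=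
  (h.unique_lift ξ ξ' ξ'' g (b ≫ g) (𝒳.p.map b) (by simp)).unique ⟨h₁, h₂⟩ ⟨rfl, rfl⟩

lemma IsCFG.isIso (h : IsCFG 𝒳) {ξ ξ' : 𝒳.obj} (g : ξ' ⟶ ξ) (hg : IsIso (𝒳.p.map g)) :
    IsIso g := by
  obtain ⟨k, hk, hk'⟩ := h.exists_factor g (𝟙 ξ) (inv (𝒳.p.map g)) (by simp)
  refine ⟨k, h.hom_eq g ?_ ?_, hk'⟩
  · simp [hk]
  · simp [hk']

lemma isCFG_times {E : Type} [NormedAddCommGroup E] [NormedSpace ℝ E] (S : Set E)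
    (h : IsCFG 𝒳) : IsCFG (times S 𝒳) where
  exists_lift η M r := by
    have key : ∀ r : M ⟶ 𝒳.p.obj (TimesObj.pt η), ∃ (κ : 𝒳.obj) (g : κ ⟶ TimesObj.pt η)
        (e : 𝒳.p.obj κ = M), r = eqToHom e.symm ≫ 𝒳.p.map g ≫ eqToHom rfl := fun r => by
      obtain ⟨κ, g, hg⟩ := h.exists_lift (TimesObj.pt η) M r
      exact ⟨κ, g, IsHomLift.domain_eq 𝒳.p r g, IsHomLift.fac 𝒳.p r g⟩
    obtain ⟨κ, g, e, he⟩ := key r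
    refine ⟨(⟨κ, (TimesObj.par η).comp (baseMap g), fun x => TimesObj.mem η _⟩ : TimesObj S 𝒳),
      (⟨g, fun x => rfl⟩ : TimesHom _ _), ?_⟩
    exact IsHomLift.of_fac (times S 𝒳).p _ _ e rfl he
  unique_lift η η' η'' g₁ g₂ r hr := by
    obtain ⟨g, ⟨hg, hg'⟩, hu⟩ := h.unique_lift (TimesObj.pt η) (TimesObj.pt η') (TimesObj.pt η'')
      (TimesHom.hom g₁) (TimesHom.hom g₂) r hr
    refine ⟨(⟨g, fun x => ?_⟩ : TimesHom _ _), ⟨hg, TimesHom.ext hg'⟩, fun k hk => ?_⟩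
    · rw [← TimesHom.par g₁, ← TimesHom.par g₂, ← baseMap_comp, hg']
    · exact TimesHom.ext (hu (TimesHom.hom k) ⟨hk.1, congrArg TimesHom.hom hk.2⟩)

/-- The identification of the base of `η` with the base of its image. -/
def tr (T : BasedFunctor 𝒴 𝒳) (η : 𝒴.obj) : 𝒴.p.obj η ≅ 𝒳.p.obj (T.obj η) :=
  eqToIso (T.w_obj η).symm

lemma map_tr (T : BasedFunctor 𝒴 𝒳) {η η' : 𝒴.obj} (a : η ⟶ η') :
    (tr T η).hom ≫ 𝒳.p.map (T.map a) = 𝒴.p.map a ≫ (tr T η').hom := by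
  have h : 𝒳.p.map (T.map a) = eqToHom (T.w_obj η) ≫ 𝒴.p.map a ≫
      eqToHom (T.w_obj η').symm := Functor.congr_hom T.w a
  rw [h]
  simp [tr]

lemma map_tr' (T : BasedFunctor 𝒴 𝒳) {η η' : 𝒴.obj} (a : η ⟶ η') :
    𝒳.p.map (T.map a) = (tr T η).inv ≫ 𝒴.p.map a ≫ (tr T η').hom := by
  rw [← map_tr]
  simp

lemma fn_map_tr (T : BasedFunctor 𝒴 𝒳) {η η' : 𝒴.obj} (a : η ⟶ η') (n : base η) :
    baseMap (T.map a) (Man.fn (tr T η).hom n) = Man.fn (tr T η').hom (baseMap a n) :=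
  congrArg (fun k => Man.fn k n) (map_tr T a)

/-- Two points of a category fibred in groupoids, given as points of the bases of two objects, are
isomorphic. -/
def PtRel (ζ ζ' : 𝒳.obj) (x : base ζ) (x' : base ζ') : Prop :=
  ∃ (κ : 𝒳.obj) (a : κ ⟶ ζ) (b : κ ⟶ ζ') (z : base κ), baseMap a z = x ∧ baseMap b z = x'

lemma PtRel.refl (ζ : 𝒳.obj) (x : base ζ) : PtRel ζ ζ x x :=
  ⟨ζ, 𝟙 ζ, 𝟙 ζ, x, baseMap_id ζ x, baseMap_id ζ x⟩

lemma PtRel.symm {ζ ζ' : 𝒳.obj} {x : base ζ} {x' : base ζ'} (h : PtRel ζ ζ' x x') :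
    PtRel ζ' ζ x' x := by
  obtain ⟨κ, a, b, z, h₁, h₂⟩ := h
  exact ⟨κ, b, a, z, h₂, h₁⟩

lemma PtRel.of_arrow {ζ ζ' : 𝒳.obj} (g : ζ ⟶ ζ') (x : base ζ) : PtRel ζ ζ' x (baseMap g x) :=
  ⟨ζ, 𝟙 ζ, g, x, baseMap_id ζ x, rfl⟩

/-- A point of the base of an object, as an object over the line with constant base map. -/
lemma IsCFG.exists_pt (h : IsCFG 𝒳) (ζ : 𝒳.obj) (x : base ζ) :
    ∃ (κ : 𝒳.obj) (i : Man.vec ℝ ≅ 𝒳.p.obj κ) (a : κ ⟶ ζ),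
      i.hom ≫ 𝒳.p.map a = Man.const (Man.vec ℝ) x :=
  h.exists_arrow ζ _

/-- Isomorphic points have a common pullback over the line with constant base maps. -/
lemma IsCFG.exists_common_pt (h : IsCFG 𝒳) {ζ ζ' : 𝒳.obj} {x : base ζ} {x' : base ζ'}
    (hx : PtRel ζ ζ' x x') {κ₀ : 𝒳.obj} {i₀ : Man.vec ℝ ≅ 𝒳.p.obj κ₀} {a₀ : κ₀ ⟶ ζ}
    (h₀ : i₀.hom ≫ 𝒳.p.map a₀ = Man.const (Man.vec ℝ) x) :
    ∃ b : κ₀ ⟶ ζ', i₀.hom ≫ 𝒳.p.map b = Man.const (Man.vec ℝ) x' := by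
  obtain ⟨κ, a, b, z, rfl, rfl⟩ := hx
  obtain ⟨c, hc, -⟩ := h.exists_factor a a₀ (Man.const _ z) (by
    rw [← cancel_epi i₀.hom, h₀]
    rfl)
  refine ⟨c ≫ b, ?_⟩
  rw [Functor.map_comp, hc]
  rfl

lemma PtRel.trans (h : IsCFG 𝒳) {ζ ζ' ζ'' : 𝒳.obj} {x : base ζ} {x' : base ζ'} {x'' : base ζ''}
    (h₁ : PtRel ζ ζ' x x') (h₂ : PtRel ζ' ζ'' x' x'') : PtRel ζ ζ'' x x'' := by
  obtain ⟨κ, i, a, ha⟩ := h.exists_pt ζ' x'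
  obtain ⟨b, hb⟩ := h.exists_common_pt h₁.symm ha
  obtain ⟨c, hc⟩ := h.exists_common_pt h₂ ha
  exact ⟨κ, b, c, Man.fn i.hom (0 : ℝ), congrArg (fun k => Man.fn k (0 : ℝ)) hb,
    congrArg (fun k => Man.fn k (0 : ℝ)) hc⟩

lemma PtRel.map (T : BasedFunctor 𝒴 𝒳) {η η' : 𝒴.obj} {n : base η} {n' : base η'}
    (h : PtRel η η' n n') :
    PtRel (T.obj η) (T.obj η') (Man.fn (tr T η).hom n) (Man.fn (tr T η').hom n') := by
  obtain ⟨κ, a, b, z, rfl, rfl⟩ := h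
  exact ⟨T.obj κ, T.map a, T.map b, Man.fn (tr T κ).hom z, fn_map_tr T a z, fn_map_tr T b z⟩

/-- The fibre product of `η` and an étale chart `ζ` over `𝒳`, for a map `T : 𝒴 → 𝒳`: it is étale
over `η`. -/
structure IsPullback (T : BasedFunctor 𝒴 𝒳) {η θ : 𝒴.obj} {ζ : 𝒳.obj} (a : θ ⟶ η)
    (g : T.obj θ ⟶ ζ) : Prop where
  étale : IsLocalDiffeomorph (base θ).I (base η).I ∞ (baseMap a)
  lift : ∀ (η' : 𝒴.obj) (b : η' ⟶ η) (g' : T.obj η' ⟶ ζ), ∃ c : η' ⟶ θ, c ≫ a = b ∧ T.map c ≫ g = g'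

/-- The chart of `𝒳` pulled back to the base of `T η` is the base of an object of `𝒴`, because `𝒴` has
pullbacks along maps of manifolds. -/
lemma exists_isPullback (h𝒴 : IsCFG 𝒴) (h𝒳 : IsCFG 𝒳) (T : BasedFunctor 𝒴 𝒳) {ζ : 𝒳.obj}
    (hζ : IsEtale ζ) (η : 𝒴.obj) :
    ∃ (θ : 𝒴.obj) (a : θ ⟶ η) (g : T.obj θ ⟶ ζ), IsPullback T a g := by
  obtain ⟨ρ, α, β, hfib, hloc⟩ := hζ (T.obj η)
  obtain ⟨θ, i, a, ha⟩ := h𝒴.exists_arrow η (𝒳.p.map β ≫ (tr T η).inv)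
  obtain ⟨e, he, he'⟩ := h𝒳.exists_factor β (T.map a) ((tr T θ).inv ≫ i.inv) (by
    rw [map_tr', Category.assoc, Iso.cancel_iso_inv_left, Iso.inv_comp_eq, ← Category.assoc, ha]
    simp)
  refine ⟨θ, a, e ≫ α, ?_, fun η' b g' => ?_⟩
  · have : 𝒴.p.map a = (i.symm).hom ≫ 𝒳.p.map β ≫ ((tr T η).symm).hom := by
      rw [Iso.symm_hom, Iso.symm_hom, ← ha]
      simp
    change IsLocalDiffeomorph _ _ _ (Man.fn (𝒴.p.map a))
    rw [this]
    exact Man.isLocalDiffeomorph_comp (Man.isLocalDiffeomorph_iso _)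
      (Man.isLocalDiffeomorph_comp hloc (Man.isLocalDiffeomorph_iso _))
  · obtain ⟨k, ⟨hk, hk'⟩, -⟩ := hfib (T.obj η') g' (T.map b)
    obtain ⟨c, hc, hc'⟩ := h𝒴.exists_factor a b ((tr T η').hom ≫ 𝒳.p.map k ≫ i.hom) (by
      rw [Category.assoc, Category.assoc, ha, ← Category.assoc (𝒳.p.map k), ← Functor.map_comp, hk',
        map_tr']
      simp)
    refine ⟨c, hc', ?_⟩
    have : T.map c ≫ e = k := by
      refine h𝒳.hom_eq β ?_ ?_
      · rw [Functor.map_comp, he, map_tr', hc]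
        simp
      · rw [Category.assoc, he', hk', ← T.map_comp, hc']
    rw [← Category.assoc, this, hk]

lemma IsPullback.exists_pt (h𝒴 : IsCFG 𝒴) (h𝒳 : IsCFG 𝒳) {T : BasedFunctor 𝒴 𝒳} {η θ : 𝒴.obj}
    {ζ : 𝒳.obj} {a : θ ⟶ η} {g : T.obj θ ⟶ ζ} (h : IsPullback T a g) {n : base η} {x : base ζ}
    (hx : PtRel (T.obj η) ζ (Man.fn (tr T η).hom n) x) :
    ∃ w : base θ, baseMap a w = n ∧ baseMap g (Man.fn (tr T θ).hom w) = x := by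
  obtain ⟨κ, i, b, hb⟩ := h𝒴.exists_pt η n
  obtain ⟨g', hg'⟩ := h𝒳.exists_common_pt hx (i₀ := i ≪≫ tr T κ) (a₀ := T.map b) (by
    rw [Iso.trans_hom, Category.assoc, map_tr, ← Category.assoc, hb]
    rfl)
  obtain ⟨c, hc, hc'⟩ := h.lift κ b g'
  refine ⟨baseMap c (Man.fn i.hom (0 : ℝ)), ?_, ?_⟩
  · rw [← baseMap_comp, hc]
    exact congrArg (fun k => Man.fn k (0 : ℝ)) hb
  · rw [← fn_map_tr, ← baseMap_comp, hc']
    exact congrArg (fun k => Man.fn k (0 : ℝ)) hg'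

end CFG

end

section

/-! ### The inverse function theorem and étale charts -/

namespace Man

variable {M N K : Man}

/-- The inverse function theorem: a smooth map with bijective differential at a point has a local
inverse that is smooth at the image point. -/
lemma exists_local_inverse (f : M ⟶ N) (x : M) (hf : Function.Bijective (d f x)) :
    ∃ g : N → M, g (Man.fn f x) = x ∧ ContMDiffAt N.I M.I ∞ g (Man.fn f x) ∧
      ∀ᶠ y in nhds (Man.fn f x), Man.fn f (g y) = y := by
  set c := extChartAt M.I x with hc
  set c' := extChartAt N.I (Man.fn f x) with hc'
  have h0 : ContMDiffAt M.I N.I ∞ (Man.fn f) x := contMDiff_fn f x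
  have hF : ContDiffAt ℝ ∞ (c' ∘ Man.fn f ∘ c.symm) (c x) := by
    have := (contMDiffAt_iff.1 h0).2
    rwa [M.I.range_eq_univ, contDiffWithinAt_univ] at this
  have hD : fderiv ℝ (c' ∘ Man.fn f ∘ c.symm) (c x) = d f x := by
    have h1 := (mdiff_fn f x).mfderiv
    rw [M.I.range_eq_univ, fderivWithin_univ] at h1
    exact h1.symm
  let e : M.E ≃L[ℝ] N.E := ContinuousLinearEquiv.ofBijective (d f x)
    (LinearMap.ker_eq_bot.2 hf.1) (LinearMap.range_eq_top.2 hf.2)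
  have he : (e : M.E →L[ℝ] N.E) = d f x := ContinuousLinearEquiv.coe_ofBijective _ _ _
  have hF' : HasFDerivAt (c' ∘ Man.fn f ∘ c.symm) (e : M.E →L[ℝ] N.E) (c x) := by
    rw [he, ← hD]
    exact (hF.differentiableAt (by simp)).hasFDerivAt
  set G := hF.localInverse hF' (by simp) with hG
  have hval : (c' ∘ Man.fn f ∘ c.symm) (c x) = c' (Man.fn f x) := by
    simp [hc]
  have hGs : ContDiffAt ℝ ∞ G (c' (Man.fn f x)) := by
    have := hF.to_localInverse hF' (by simp)
    rwa [hval] at this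
  have hG0 : G (c' (Man.fn f x)) = c x := by
    rw [← hval]
    exact hF.localInverse_apply_image hF' (by simp)
  have hGr : ∀ᶠ y in nhds (c' (Man.fn f x)), (c' ∘ Man.fn f ∘ c.symm) (G y) = y := by
    have := (hF.hasStrictFDerivAt' hF' (by simp)).eventually_right_inverse
    rwa [hval] at this
  have hx : c.symm (c x) = x := extChartAt_to_inv x
  have hc's : ContMDiffAt N.I 𝓘(ℝ, N.E) ∞ c' (Man.fn f x) := contMDiffAt_extChartAt
  have hcs : ContMDiffAt 𝓘(ℝ, M.E) M.I ∞ c.symm (c x) :=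
    (contMDiffOn_extChartAt_symm x).contMDiffAt (extChartAt_target_mem_nhds x)
  have hsm : ContMDiffAt N.I M.I ∞ (c.symm ∘ G ∘ c') (Man.fn f x) := by
    refine ContMDiffAt.comp _ (g := c.symm) ?_ (ContMDiffAt.comp _ hGs.contMDiffAt hc's)
    simpa only [Function.comp_apply, hG0] using hcs
  have hpt : (c.symm ∘ G ∘ c') (Man.fn f x) = x := by
    simp only [Function.comp_apply, hG0, hx]
  refine ⟨c.symm ∘ G ∘ c', hpt, hsm, ?_⟩
  have e1 : ∀ᶠ y in nhds (Man.fn f x), (c' ∘ Man.fn f ∘ c.symm) (G (c' y)) = c' y :=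
    hc's.continuousAt.eventually hGr
  have e2 : ∀ᶠ y in nhds (Man.fn f x), y ∈ c'.source := extChartAt_source_mem_nhds _
  have e3 : ∀ᶠ y in nhds (Man.fn f x), Man.fn f ((c.symm ∘ G ∘ c') y) ∈ c'.source := by
    have hct : ContinuousAt (fun y => Man.fn f ((c.symm ∘ G ∘ c') y)) (Man.fn f x) :=
      (continuous_fn f).continuousAt.comp hsm.continuousAt
    refine hct.eventually_mem ?_
    rw [hpt]
    exact extChartAt_source_mem_nhds _
  filter_upwards [e1, e2, e3] with y h1 h2 h3
  exact c'.injOn h3 h2 h1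

lemma map_nhds_of_bijective (f : M ⟶ N) (x : M) (hf : Function.Bijective (d f x)) {U : Set M}
    (hU : U ∈ nhds x) : Man.fn f '' U ∈ nhds (Man.fn f x) := by
  obtain ⟨g, hg, hgs, hgr⟩ := exists_local_inverse f x hf
  have : ∀ᶠ y in nhds (Man.fn f x), g y ∈ U := hgs.continuousAt.eventually_mem (by rwa [hg])
  filter_upwards [hgr, this] with y h1 h2
  exact ⟨g y, h2, h1⟩

/-- A submersion all of whose fibres have only constant smooth curves is a local diffeomorphism. -/
lemma isLocalDiffeomorph_of_isSubmersion (f : M ⟶ N)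
    (hf : Manifold.IsSubmersion M.I N.I ∞ (Man.fn f))
    (hc : ∀ c : Man.vec ℝ ⟶ M, (∀ t, Man.fn f (Man.fn c t) = Man.fn f (Man.fn c (0 : ℝ))) →
      ∀ t, Man.fn c t = Man.fn c (0 : ℝ)) :
    IsLocalDiffeomorph M.I N.I ∞ (Man.fn f) := by
  intro z
  have h := hf.isSubmersionOfComplement_complement z
  set φ := h.domChart with hφ
  set ψ := h.codChart with hψ
  have hφa := h.domChart_mem_maximalAtlas
  have hψa := h.codChart_mem_maximalAtlas
  have hnf : EqOn (ψ.extend N.I ∘ Man.fn f ∘ (φ.extend M.I).symm) (Prod.fst ∘ h.equiv)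
    (φ.extend M.I).target := h.writtenInCharts
  have hsrc : ∀ x ∈ φ.source, Man.fn f x ∈ ψ.source := h.source_subset_preimage_source
  have hz : z ∈ φ.source := h.mem_domChart_source
  have hopen : IsOpen (φ.extend M.I).target := φ.isOpen_extend_target
  have hsymm : ContMDiffOn 𝓘(ℝ, M.E) M.I ∞ (φ.extend M.I).symm (φ.extend M.I).target := by
    have := contMDiffOn_extend_symm hφa
    rwa [← φ.extend_target'] at this
  have hext : ∀ y ∈ (φ.extend M.I).target, (φ.extend M.I).symm y ∈ φ.source := fun y hy => by
    have := (φ.extend M.I).map_target hy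
    rwa [φ.extend_source] at this
  have hz0 : φ.extend M.I z ∈ (φ.extend M.I).target :=
    (φ.extend M.I).map_source (by rwa [φ.extend_source])
  -- a nonzero vector in the kernel of the linear projection would give a nonconstant curve in a
  -- fibre; the sine keeps the curve inside the chart
  have hF : ∀ w : hf.complement, w = 0 := by
    intro w
    obtain ⟨ε, hε, hball⟩ := Metric.isOpen_iff.1 hopen _ hz0
    set v := h.equiv.symm (0, w) with hv
    set δ : ℝ := ε / (‖v‖ + 1) with hδ
    have hδ0 : 0 < δ := by positivity
    have hmem : ∀ t : ℝ, φ.extend M.I z + (δ * Real.sin t) • v ∈ (φ.extend M.I).target := by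
      intro t
      apply hball
      rw [mem_ball_iff_norm, add_sub_cancel_left, norm_smul, norm_mul, Real.norm_of_nonneg hδ0.le]
      have h1 : ‖Real.sin t‖ ≤ 1 := Real.abs_sin_le_one t
      calc δ * ‖Real.sin t‖ * ‖v‖ ≤ δ * 1 * ‖v‖ := by gcongr
        _ < δ * (‖v‖ + 1) := by nlinarith [norm_nonneg v]
        _ = ε := by rw [hδ]; field_simp
    have hline : ContMDiff 𝓘(ℝ, ℝ) 𝓘(ℝ, M.E) ∞
        (fun t : ℝ => φ.extend M.I z + (δ * Real.sin t) • v) := by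
      apply ContDiff.contMDiff
      fun_prop
    let c : Man.vec ℝ ⟶ M := ofFun (M := Man.vec ℝ)
      (fun t : ℝ => (φ.extend M.I).symm (φ.extend M.I z + (δ * Real.sin t) • v))
      (hsymm.comp_contMDiff hline hmem)
    have hcc : ∀ t : ℝ, Man.fn f (Man.fn c t) = Man.fn f z := by
      intro t
      refine (ψ.extend N.I).injOn ?_ ?_ ?_
      · rw [ψ.extend_source]
        exact hsrc _ (hext _ (hmem t))
      · rw [ψ.extend_source]
        exact hsrc _ hz
      · have e1 := hnf (hmem t)
        have e2 := hnf hz0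
        simp only [Function.comp_apply] at e1 e2
        rw [φ.extend_left_inv hz] at e2
        refine e1.trans (Eq.trans ?_ e2.symm)
        rw [map_add, map_smul, hv, ContinuousLinearEquiv.apply_symm_apply]
        simp
    have h1 := hc c (fun t => (hcc t).trans (hcc 0).symm) (Real.pi / 2 : ℝ)
    have h2 : (φ.extend M.I).symm (φ.extend M.I z + (δ * Real.sin (Real.pi / 2)) • v) =
      (φ.extend M.I).symm (φ.extend M.I z + (δ * Real.sin 0) • v) := h1
    have h3 := (φ.extend M.I).symm.injOn (hmem _) (hmem _) h2
    rw [Real.sin_pi_div_two, Real.sin_zero] at h3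
    have h4 : v = 0 := by simpa [hδ0.ne'] using h3
    have h5 := congrArg h.equiv h4
    rw [hv, ContinuousLinearEquiv.apply_symm_apply, map_zero] at h5
    exact congrArg Prod.snd h5
  -- in the charts the map is therefore a linear isomorphism
  have hLinv : ∀ y : N.E, (h.equiv (h.equiv.symm (y, 0))).1 = y := fun y => by simp
  have hLinv' : ∀ x : M.E, h.equiv.symm ((h.equiv x).1, 0) = x := fun x => by
    rw [ContinuousLinearEquiv.symm_apply_eq]
    exact Prod.ext rfl (hF _).symm
  let g : N → M := fun y => (φ.extend M.I).symm (h.equiv.symm (ψ.extend N.I y, 0))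
  let V : Set N := ψ.source ∩ (fun y => h.equiv.symm (ψ.extend N.I y, 0)) ⁻¹' (φ.extend M.I).target
  have hgsm : ContMDiffOn N.I 𝓘(ℝ, M.E) ∞ (fun y => h.equiv.symm (ψ.extend N.I y, 0)) ψ.source := by
    have h1 : ContMDiffOn N.I 𝓘(ℝ, N.E) ∞ (ψ.extend N.I) ψ.source := fun y hy =>
      (ψ.contMDiffAt_extend hψa hy).contMDiffWithinAt
    have h2 : ContDiff ℝ ∞ (fun y : N.E => h.equiv.symm (y, (0 : hf.complement))) := by fun_prop
    exact h2.contMDiff.comp_contMDiffOn h1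
  have hfg : ∀ x ∈ φ.source, h.equiv.symm (ψ.extend N.I (Man.fn f x), 0) = φ.extend M.I x := by
    intro x hx
    have hx' : φ.extend M.I x ∈ (φ.extend M.I).target :=
      (φ.extend M.I).map_source (by rwa [φ.extend_source])
    have e := hnf hx'
    simp only [Function.comp_apply] at e
    rw [φ.extend_left_inv hx] at e
    rw [e, hLinv']
  refine ⟨{ toFun := Man.fn f
            invFun := g
            source := φ.source
            target := V
            map_source' := fun x hx => ⟨hsrc x hx, ?_⟩
            map_target' := fun y hy => hext _ hy.2
            left_inv' := fun x hx => ?_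
            right_inv' := fun y hy => ?_
            open_source := φ.open_source
            open_target := ?_
            contMDiffOn_toFun := (contMDiff_fn f).contMDiffOn
            contMDiffOn_invFun := hsymm.comp (hgsm.mono inter_subset_left) fun y hy => hy.2 },
    hz, fun x _ => rfl⟩
  · rw [mem_preimage, hfg x hx]
    exact (φ.extend M.I).map_source (by rwa [φ.extend_source])
  · change (φ.extend M.I).symm (h.equiv.symm (ψ.extend N.I (Man.fn f x), 0)) = x
    rw [hfg x hx]
    exact φ.extend_left_inv hx
  · refine (ψ.extend N.I).injOn ?_ (by rw [ψ.extend_source]; exact hy.1) ?_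
    · rw [ψ.extend_source]
      exact hsrc _ (hext _ hy.2)
    · have e := hnf hy.2
      simp only [Function.comp_apply] at e
      exact e.trans (hLinv _)
  · exact hgsm.continuousOn.isOpen_inter_preimage ψ.open_source hopen

end Man

section Etale

variable {𝒳 : BasedCategory.{v, u} Man}

/-- An atlas with étale groupoid is étale. Its pullback `β` to another object is a submersion, and it
is étale because its fibres contain no nonconstant curves: a curve in a fibre of `β`, compared with
a constant curve, traces a curve in the atlas groupoid with constant target. -/
lemma isEtale_of_isAtlas (h : IsCFG 𝒳) {ξ : 𝒳.obj} (hξ : IsAtlas ξ) (hep : IsEtaleProper ξ) :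
    IsEtale ξ := by
  intro η
  obtain ⟨ζ, α, β, hfib, -, hsub⟩ := hξ η
  refine ⟨ζ, α, β, hfib, Man.isLocalDiffeomorph_of_isSubmersion (𝒳.p.map β) hsub fun c hc => ?_⟩
  set z := Man.fn c (0 : ℝ) with hz
  -- `p₁` lies over the curve `c` in a fibre of `β`, and `p₂` over a constant curve
  obtain ⟨κ, i, p₁, hp₁⟩ := h.exists_arrow ζ c
  obtain ⟨p₂, hp₂, hp₂'⟩ := h.exists_factor β (p₁ ≫ β) (Man.const (𝒳.p.obj κ) z) (by
    rw [← cancel_epi i.hom, Functor.map_comp, ← Category.assoc i.hom (𝒳.p.map p₁), hp₁]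
    ext t
    exact (hc t).symm)
  obtain ⟨R, s, t, hR, -, -⟩ := hξ ξ
  obtain ⟨-, ht, -⟩ := hep R s t hR
  obtain ⟨k, ⟨hk₁, hk₂⟩, -⟩ := hR κ (p₁ ≫ α) (p₂ ≫ α)
  obtain ⟨δ, ⟨hδ₁, hδ₂⟩, -⟩ := hR ξ (𝟙 ξ) (𝟙 ξ)
  -- the curve traced in the atlas groupoid is constant because `t` is étale
  have hconst : ∀ τ : ℝ, Man.fn (i.hom ≫ 𝒳.p.map k) τ = Man.fn (i.hom ≫ 𝒳.p.map k) (0 : ℝ) := by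
    have hcomp : (i.hom ≫ 𝒳.p.map k) ≫ 𝒳.p.map t = Man.const (Man.vec ℝ) (baseMap α z) := by
      rw [Category.assoc, ← Functor.map_comp, hk₂, Functor.map_comp, hp₂]
      rfl
    have := (T2Space.isSeparatedMap (baseMap t)).eq_of_comp_eq
      (ht.isLocalHomeomorph.isLocallyInjective) (A := ℝ)
      (Man.continuous_fn (i.hom ≫ 𝒳.p.map k))
      (g₂ := fun _ => Man.fn (i.hom ≫ 𝒳.p.map k) (0 : ℝ)) continuous_const ?_ 0 rfl
    · exact fun τ => congrFun this τ
    · funext τ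
      have e1 := congrArg (fun k => Man.fn k τ) hcomp
      have e2 := congrArg (fun k => Man.fn k (0 : ℝ)) hcomp
      exact e1.trans e2.symm
  -- over `0` the two arrows agree, so the constant is the unit of the groupoid at `α z`
  have h0 : Man.fn (i.hom ≫ 𝒳.p.map k) (0 : ℝ) = baseMap δ (baseMap α z) := by
    obtain ⟨κ₀, i₀, e, he⟩ := h.exists_pt κ (Man.fn i.hom (0 : ℝ))
    have hep : e ≫ p₁ = e ≫ p₂ := by
      refine h.hom_eq β ?_ (by simp only [Category.assoc, hp₂'])
      rw [← cancel_epi i₀.hom, Functor.map_comp, Functor.map_comp, ← Category.assoc, he,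
        ← Category.assoc, he, hp₂, ← (Iso.inv_comp_eq i).2 hp₁.symm]
      have := Man.fn_hom_inv i (0 : ℝ)
      simp only [Man.const_comp, Man.comp_const, Man.fn_comp]
      rw [this]
    have hek : e ≫ k = (e ≫ p₁ ≫ α) ≫ δ := by
      refine (hR κ₀ (e ≫ p₁ ≫ α) (e ≫ p₂ ≫ α)).unique ⟨by rw [Category.assoc, hk₁],
        by rw [Category.assoc, hk₂]⟩ ⟨by rw [Category.assoc, hδ₁, Category.comp_id], ?_⟩
      rw [Category.assoc, hδ₂, Category.comp_id, ← Category.assoc, hep, Category.assoc]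
    have h1 := congrArg (fun m => Man.fn (i₀.hom ≫ 𝒳.p.map m) (0 : ℝ)) hek
    simp only [Functor.map_comp, ← Category.assoc, he] at h1
    have h2 : Man.fn (𝒳.p.map p₁) (Man.fn i.hom (0 : ℝ)) = z :=
      congrArg (fun k => Man.fn k (0 : ℝ)) hp₁
    simp only [Man.const_comp, h2] at h1
    exact h1
  have hk : k = (k ≫ t) ≫ δ := by
    refine h.hom_eq t ?_ (by rw [Category.assoc, hδ₂, Category.comp_id])
    rw [← cancel_epi i.hom]
    ext τ
    rw [hconst τ, h0, hk₂, Functor.map_comp, Functor.map_comp, hp₂]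
    rfl
  have h12 : p₁ ≫ α = p₂ ≫ α := by
    rw [← hk₁, ← hk₂]
    conv_lhs => rw [hk]
    rw [Category.assoc, hδ₁, Category.comp_id]
  have hp : p₁ = p₂ := (hfib κ (p₂ ≫ α) (p₁ ≫ β)).unique ⟨h12, rfl⟩ ⟨rfl, hp₂'⟩
  intro τ
  rw [← hp₁, hp, hp₂]
  rfl

/-- Both projections from the fibre product of two étale charts are étale. -/
lemma IsEtale.exists_fiberProduct {ζ ζ' : 𝒳.obj} (hζ : IsEtale ζ) (hζ' : IsEtale ζ') :
    ∃ (κ : 𝒳.obj) (α : κ ⟶ ζ) (β : κ ⟶ ζ'), IsFiberProduct α β ∧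
      IsLocalDiffeomorph (base κ).I (base ζ).I ∞ (baseMap α) ∧
      IsLocalDiffeomorph (base κ).I (base ζ').I ∞ (baseMap β) := by
  obtain ⟨κ, α, β, h, hβ⟩ := hζ ζ'
  obtain ⟨κ', α', β', h', hβ'⟩ := hζ' ζ
  obtain ⟨i, ⟨hi₁, hi₂⟩, -⟩ := h' κ β α
  obtain ⟨j, ⟨hj₁, hj₂⟩, -⟩ := h κ' β' α'
  have hij : i ≫ j = 𝟙 κ := (h κ α β).unique ⟨by rw [Category.assoc, hj₁, hi₂],
    by rw [Category.assoc, hj₂, hi₁]⟩ ⟨Category.id_comp _, Category.id_comp _⟩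
  have hji : j ≫ i = 𝟙 κ' := (h' κ' α' β').unique ⟨by rw [Category.assoc, hi₁, hj₂],
    by rw [Category.assoc, hi₂, hj₁]⟩ ⟨Category.id_comp _, Category.id_comp _⟩
  let e : κ ≅ κ' := ⟨i, j, hij, hji⟩
  refine ⟨κ, α, β, h, ?_, hβ⟩
  have : 𝒳.p.map α = (𝒳.p.mapIso e).hom ≫ 𝒳.p.map β' := by
    rw [← hi₂, Functor.map_comp]
    rfl
  change IsLocalDiffeomorph _ _ _ (Man.fn (𝒳.p.map α))
  rw [this]
  exact Man.isLocalDiffeomorph_comp (Man.isLocalDiffeomorph_iso _) hβ'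

/-- Arrows between étale charts are étale. -/
lemma IsEtale.d_bijective {ζ ζ' : 𝒳.obj} (hζ : IsEtale ζ) (hζ' : IsEtale ζ') (g : ζ ⟶ ζ')
    (x : base ζ) : Function.Bijective (Man.d (𝒳.p.map g) x) := by
  obtain ⟨κ, α, β, hfib, hα, hβ⟩ := hζ.exists_fiberProduct hζ'
  obtain ⟨c, ⟨hc₁, hc₂⟩, -⟩ := hfib ζ (𝟙 ζ) g
  have hα' := Man.d_bijective_of_isLocalDiffeomorph (f := 𝒳.p.map α) hα (baseMap c x)
  have hβ' := Man.d_bijective_of_isLocalDiffeomorph (f := 𝒳.p.map β) hβ (baseMap c x)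
  have e₁ : Function.LeftInverse (Man.d (𝒳.p.map α) (baseMap c x)) (Man.d (𝒳.p.map c) x) := by
    intro u
    have := Man.d_comp (𝒳.p.map c) (𝒳.p.map α) x u
    rw [← Functor.map_comp, hc₁, CategoryTheory.Functor.map_id, Man.d_id] at this
    exact this.symm
  have hc : Function.Bijective (Man.d (𝒳.p.map c) x) := by
    refine ⟨e₁.injective, fun w => ⟨Man.d (𝒳.p.map α) (baseMap c x) w, hα'.1 ?_⟩⟩
    exact e₁ _
  have : ⇑(Man.d (𝒳.p.map g) x) = Man.d (𝒳.p.map β) (baseMap c x) ∘ Man.d (𝒳.p.map c) x := by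
    funext u
    rw [← hc₂, Functor.map_comp]
    exact Man.d_comp _ _ _ _
  rw [this]
  exact hβ'.comp hc

/-- Étale charts have the same dimension at isomorphic points. -/
lemma IsEtale.finrank_eq {ζ ζ' : 𝒳.obj} (hζ : IsEtale ζ) (hζ' : IsEtale ζ')
    {x : base ζ} {x' : base ζ'} (hx : PtRel ζ ζ' x x') :
    Module.finrank ℝ (base ζ).E = Module.finrank ℝ (base ζ').E := by
  obtain ⟨κ, α, β, hfib, hα, hβ⟩ := hζ.exists_fiberProduct hζ'
  obtain ⟨θ, a, b, z, -, -⟩ := hx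
  obtain ⟨c, -, -⟩ := hfib θ a b
  have hα' := Man.d_bijective_of_isLocalDiffeomorph (f := 𝒳.p.map α) hα (baseMap c z)
  have hβ' := Man.d_bijective_of_isLocalDiffeomorph (f := 𝒳.p.map β) hβ (baseMap c z)
  exact (LinearEquiv.ofBijective (Man.d (𝒳.p.map α) _).toLinearMap hα').finrank_eq.symm.trans
    (LinearEquiv.ofBijective (Man.d (𝒳.p.map β) _).toLinearMap hβ').finrank_eq

lemma IsOrbifold.exists_étale_atlas (h : IsOrbifold 𝒳) :
    ∃ ξ : 𝒳.obj, IsAtlas ξ ∧ IsEtaleProper ξ ∧ IsEtale ξ := by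
  obtain ⟨ξ, h₁, h₂⟩ := h.exists_atlas
  exact ⟨ξ, h₁, h₂, isEtale_of_isAtlas h.toIsCFG h₁ h₂⟩

lemma IsAtlas.exists_pt {ξ : 𝒳.obj} (hξ : IsAtlas ξ) (ζ : 𝒳.obj) (y : base ζ) :
    ∃ x : base ξ, PtRel ζ ξ y x := by
  obtain ⟨κ, α, β, -, hs, -⟩ := hξ ζ
  obtain ⟨z, hz⟩ := hs y
  exact ⟨baseMap α z, κ, β, α, z, hz, rfl⟩

end Etale

end

section

/-! ### Functions and forms along maps to a stack -/

section Forms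

variable {E : Type} [NormedAddCommGroup E] [NormedSpace ℝ E]

lemma update_pair_zero {E : Type} (u w x : E) : Function.update ![u, w] 0 x = ![x, w] := by
  funext i
  fin_cases i <;> rfl

lemma update_pair_one {E : Type} (u w x : E) : Function.update ![u, w] 1 x = ![u, x] := by
  funext i
  fin_cases i <;> rfl

/-- The bilinear form underlying an alternating form. -/
def bil (B : E [⋀^Fin 2]→L[ℝ] ℝ) : E →ₗ[ℝ] E →ₗ[ℝ] ℝ :=
  LinearMap.mk₂ ℝ (fun u w => B ![u, w])
    (fun u u' w => by
      have := B.map_update_add ![u, w] 0 u u'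
      rwa [update_pair_zero, update_pair_zero, update_pair_zero] at this)
    (fun c u w => by
      have := B.map_update_smul ![u, w] 0 c u
      rwa [update_pair_zero, update_pair_zero] at this)
    (fun u w w' => by
      have := B.map_update_add ![u, w] 1 w w'
      rwa [update_pair_one, update_pair_one, update_pair_one] at this)
    (fun c u w => by
      have := B.map_update_smul ![u, w] 1 c w
      rwa [update_pair_one, update_pair_one] at this)

lemma bil_self (B : E [⋀^Fin 2]→L[ℝ] ℝ) (u : E) : bil B u u = 0 :=
  B.map_eq_zero_of_eq ![u, u] (i := 0) (j := 1) rfl (by simp)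

lemma bil_swap (B : E [⋀^Fin 2]→L[ℝ] ℝ) (u w : E) : bil B u w = - bil B w u := by
  have h := bil_self B (u + w)
  simp only [map_add, LinearMap.add_apply, bil_self] at h
  linarith

end Forms

section Pull

variable {𝒳 : BasedCategory.{v, u} Man}

/-- A symplectic form on an étale chart or any other object, as a bilinear form on the model
vector space of the base. -/
def SymplecticForm.ev (Ω : SymplecticForm 𝒳) (ζ : 𝒳.obj) (x : base ζ) :
    (base ζ).E →ₗ[ℝ] (base ζ).E →ₗ[ℝ] ℝ :=
  bil (E := (base ζ).E) (Ω.form ζ x)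

lemma SymplecticForm.ev_self (Ω : SymplecticForm 𝒳) (ζ : 𝒳.obj) (x : base ζ) (w : (base ζ).E) :
    Ω.ev ζ x w w = 0 := bil_self _ _

lemma SymplecticForm.ev_swap (Ω : SymplecticForm 𝒳) (ζ : 𝒳.obj) (x : base ζ)
    (w w' : (base ζ).E) : Ω.ev ζ x w w' = - Ω.ev ζ x w' w := bil_swap _ _ _

lemma SymplecticForm.ev_map (Ω : SymplecticForm 𝒳) {ζ ζ' : 𝒳.obj} (g : ζ ⟶ ζ') (x : base ζ)
    (w w' : (base ζ).E) :
    Ω.ev ζ' (baseMap g x) (Man.d (𝒳.p.map g) x w) (Man.d (𝒳.p.map g) x w') = Ω.ev ζ x w w' := by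
  have h := Ω.compat ζ ζ' g x
  change Ω.form ζ' (baseMap g x) ![Man.d (𝒳.p.map g) x w, Man.d (𝒳.p.map g) x w'] =
    Ω.form ζ x ![w, w']
  rw [h]
  change _ = Ω.form ζ' (baseMap g x) _
  congr 1
  funext i
  fin_cases i <;> rfl

lemma SymplecticForm.ev_nondegenerate (Ω : SymplecticForm 𝒳) {ζ : 𝒳.obj} (hζ : IsEtale ζ)
    (x : base ζ) {w w' : (base ζ).E} (h : ∀ e, Ω.ev ζ x w e = Ω.ev ζ x w' e) : w = w' := by
  have := Ω.nondegenerate ζ hζ x (w - w') (fun e => by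
    have h' : Ω.ev ζ x (w - w') (show (base ζ).E from e) = 0 := by
      rw [map_sub, LinearMap.sub_apply, h, sub_self]
    exact h')
  exact sub_eq_zero.1 this

/-- On étale charts the symplectic form identifies tangent and cotangent vectors. -/
lemma SymplecticForm.exists_ev_eq (Ω : SymplecticForm 𝒳) {ζ : 𝒳.obj} (hζ : IsEtale ζ)
    (x : base ζ) (α : (base ζ).E →ₗ[ℝ] ℝ) : ∃ w, ∀ e, Ω.ev ζ x w e = α e := by
  have hinj : Function.Injective (Ω.ev ζ x) := fun w w' h =>
    Ω.ev_nondegenerate hζ x fun e => by rw [h]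
  have hsurj := (LinearMap.injective_iff_surjective_of_finrank_eq_finrank
    (Subspace.dual_finrank_eq (K := ℝ) (V := (base ζ).E)).symm).1 hinj
  obtain ⟨w, hw⟩ := hsurj α
  exact ⟨w, fun e => by rw [hw]⟩

variable {J : Set ℝ}

/-- The time coordinate of an object of `J × 𝒳`. -/
def time (η : TimesObj J 𝒳) : 𝒳.p.obj η.pt ⟶ Man.vec ℝ := η.par

lemma time_mem (η : TimesObj J 𝒳) (n : base η.pt) : Man.fn (time η) n ∈ J := η.mem n

lemma map_time {η η' : (times J 𝒳).obj} (a : η ⟶ η') :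
    𝒳.p.map (TimesHom.hom a) ≫ time η' = time η := by
  ext x
  exact TimesHom.par a x

/-- The object of `J × 𝒳` given by a map from a manifold to a chart of `𝒳` and a time
coordinate. -/
lemma IsCFG.exists_timesObj (h : IsCFG 𝒳) {M : Man} (ζ : 𝒳.obj) (p : M ⟶ 𝒳.p.obj ζ)
    (f : M ⟶ Man.vec ℝ) (hf : ∀ m, Man.fn f m ∈ J) :
    ∃ (η : TimesObj J 𝒳) (i : M ≅ 𝒳.p.obj η.pt) (a : η.pt ⟶ ζ),
      i.hom ≫ 𝒳.p.map a = p ∧ i.hom ≫ time η = f := by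
  obtain ⟨κ, i, a, ha⟩ := h.exists_arrow ζ p
  refine ⟨⟨κ, i.inv ≫ f, fun x => hf (Man.fn i.inv x)⟩, i, a, ha, ?_⟩
  change i.hom ≫ i.inv ≫ f = f
  simp

/-- The projection `S × 𝒳 → 𝒳`. -/
def forget {E : Type} [NormedAddCommGroup E] [NormedSpace ℝ E] (S : Set E)
    (𝒳 : BasedCategory.{v, u} Man) : BasedFunctor (times S 𝒳) 𝒳 where
  obj η := TimesObj.pt η
  map g := TimesHom.hom g
  map_id _ := rfl
  map_comp _ _ := rfl
  w := rfl

lemma IsCFG.exists_times_factor (h : IsCFG 𝒳) {η η' : TimesObj J 𝒳} {ζ : 𝒳.obj} (b : η'.pt ⟶ ζ)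
    (c : η.pt ⟶ ζ) (r : 𝒳.p.obj η.pt ⟶ 𝒳.p.obj η'.pt) (hr : r ≫ 𝒳.p.map b = 𝒳.p.map c)
    (hr' : r ≫ time η' = time η) :
    ∃ a : TimesHom η η', 𝒳.p.map a.hom = r ∧ a.hom ≫ b = c := by
  obtain ⟨a, ha, ha'⟩ := h.exists_factor b c r hr
  refine ⟨⟨a, fun x => ?_⟩, ha, ha'⟩
  have := congrArg (fun k => Man.fn k x) hr'
  rw [← ha] at this
  exact this

/-- The value of a function on `J × 𝒳` at a time and a point of the base of an object of `𝒳`. -/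
def StackFunction.eval (H : StackFunction (times J 𝒳)) (t : J) (ζ : 𝒳.obj) (x : base ζ) : ℝ :=
  H.val ((sliceAt 𝒳 (t : ℝ) t.2).obj ζ) x

lemma StackFunction.eval_map (H : StackFunction (times J 𝒳)) (t : J) {ζ ζ' : 𝒳.obj} (g : ζ ⟶ ζ')
    (x : base ζ) : H.eval t ζ' (baseMap g x) = H.eval t ζ x :=
  (H.compat _ _ ((sliceAt 𝒳 (t : ℝ) t.2).map g) x).symm

lemma StackFunction.eval_ptRel (H : StackFunction (times J 𝒳)) (t : J) {ζ ζ' : 𝒳.obj}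
    {x : base ζ} {x' : base ζ'} (h : PtRel ζ ζ' x x') : H.eval t ζ x = H.eval t ζ' x' := by
  obtain ⟨κ, a, b, z, rfl, rfl⟩ := h
  rw [H.eval_map, H.eval_map]

lemma StackFunction.val_eq_eval (h : IsCFG 𝒳) (H : StackFunction (times J 𝒳)) (η : TimesObj J 𝒳)
    (n : base η.pt) (t : J) (ht : η.par n = t) : H.val η n = H.eval t η.pt n := by
  obtain ⟨κ, i, a, ha⟩ := h.exists_pt η.pt n
  have ha' : 𝒳.p.map a = Man.const _ n := by
    rw [← cancel_epi i.hom, ha]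
    rfl
  have hb : ∀ z, baseMap a z = n := fun z => congrArg (fun k => Man.fn k z) ha'
  let κ' : TimesObj J 𝒳 := (sliceAt 𝒳 (t : ℝ) t.2).obj κ
  let b : TimesHom κ' η := ⟨a, fun x => (congrArg η.par (hb x)).trans ht⟩
  have h₁ := H.compat κ' η b (Man.fn i.hom (0 : ℝ))
  have h₂ := H.compat _ _ ((sliceAt 𝒳 (t : ℝ) t.2).map a) (Man.fn i.hom (0 : ℝ))
  have h₃ : baseMap a (Man.fn i.hom (0 : ℝ)) = n := hb _
  exact (congrArg (H.val η) h₃).symm.trans (h₁.symm.trans (h₂.trans (congrArg (H.val _) h₃)))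

/-- A function on `J × 𝒳` pulled back to a manifold along a smooth time coordinate and a smooth
map to a chart. -/
def StackFunction.pull (h : IsCFG 𝒳) (H : StackFunction (times J 𝒳)) {M : Man} {ζ : 𝒳.obj}
    (f : M ⟶ Man.vec ℝ) (hf : ∀ m, Man.fn f m ∈ J) (p : M ⟶ 𝒳.p.obj ζ) : M ⟶ Man.vec ℝ :=
  Man.ofFun (N := Man.vec ℝ) (fun m => H.eval ⟨Man.fn f m, hf m⟩ ζ (Man.fn p m)) (by
    obtain ⟨η, i, a, ha, hi⟩ := h.exists_timesObj ζ p f hf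
    have h₁ : ContMDiff M.I 𝓘(ℝ, ℝ) ∞ (fun m => H.val η (Man.fn i.hom m)) :=
      (H.val η).contMDiff.comp (Man.contMDiff_fn i.hom)
    convert h₁ using 2 with m
    rw [H.val_eq_eval h η (Man.fn i.hom m) ⟨Man.fn f m, hf m⟩
      (congrArg (fun k => Man.fn k m) hi), ← ha]
    exact H.eval_map _ a _)

/-- The function `H_t` on a chart. -/
def StackFunction.slice (h : IsCFG 𝒳) (H : StackFunction (times J 𝒳)) (t : J) (ζ : 𝒳.obj) :
    𝒳.p.obj ζ ⟶ Man.vec ℝ :=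
  H.pull h (Man.const _ (t : ℝ)) (fun _ => t.2) (𝟙 _)

lemma StackFunction.map_slice (h : IsCFG 𝒳) (H : StackFunction (times J 𝒳)) (t : J)
    {ζ ζ' : 𝒳.obj} (g : ζ ⟶ ζ') : 𝒳.p.map g ≫ H.slice h t ζ' = H.slice h t ζ := by
  ext x
  exact H.eval_map t g x

end Pull

section TwoIso

variable {𝒳 : BasedCategory.{v, u} Man} {𝒴 𝒵 : BasedCategory.{v', u'} Man}

lemma TwoIso.refl (F : BasedFunctor 𝒴 𝒳) : TwoIso F F := ⟨BasedNatTrans.id F⟩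

lemma TwoIso.of_eq {F G : BasedFunctor 𝒴 𝒳} (h : F = G) : TwoIso F G := h ▸ TwoIso.refl F

lemma TwoIso.trans {F G K : BasedFunctor 𝒴 𝒳} (h : TwoIso F G) (h' : TwoIso G K) : TwoIso F K :=
  ⟨h.some.comp h'.some⟩

lemma BasedNatTrans.tr_app {F G : BasedFunctor 𝒴 𝒳} (θ : BasedNatTrans F G) (η : 𝒴.obj) :
    (tr F η).hom ≫ 𝒳.p.map (θ.app η) = (tr G η).hom := by
  have := IsHomLift.fac' 𝒳.p (𝟙 (𝒴.p.obj η)) (θ.app η)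
  rw [this]
  simp [tr]

lemma BasedNatTrans.isIso_app (h : IsCFG 𝒳) {F G : BasedFunctor 𝒴 𝒳} (θ : BasedNatTrans F G)
    (η : 𝒴.obj) : IsIso (θ.app η) := by
  refine h.isIso _ ?_
  have : 𝒳.p.map (θ.app η) = (tr F η).inv ≫ (tr G η).hom := by
    rw [← BasedNatTrans.tr_app θ, Iso.inv_hom_id_assoc]
  rw [this]
  infer_instance

lemma TwoIso.symm (h : IsCFG 𝒳) {F G : BasedFunctor 𝒴 𝒳} (hFG : TwoIso F G) : TwoIso G F := by
  obtain ⟨θ⟩ := hFG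
  have : ∀ η, IsIso (θ.app η) := BasedNatTrans.isIso_app h θ
  exact ⟨(BasedNatIso.mkNatIso (NatIso.ofComponents (fun η => asIso (θ.app η))
    (fun f => θ.naturality f)) (fun a => θ.isHomLift' a)).inv⟩

lemma TwoIso.whiskerLeft (K : BasedFunctor 𝒵 𝒴) {F G : BasedFunctor 𝒴 𝒳} (h : TwoIso F G) :
    TwoIso (K.comp F) (K.comp G) :=
  ⟨BasedCategory.whiskerLeft K h.some⟩

lemma TwoIso.whiskerRight {F G : BasedFunctor 𝒵 𝒴} (h : TwoIso F G) (K : BasedFunctor 𝒴 𝒳) :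
    TwoIso (F.comp K) (G.comp K) :=
  ⟨BasedCategory.whiskerRight h.some K⟩

end TwoIso

end

section

/-! ### Hamiltonian vector fields -/

namespace Man

variable {M N : Man}

/-- The differential of the preferred chart at `c`. -/
def chartD (c x : M) : M.E →L[ℝ] M.E := mfderiv M.I 𝓘(ℝ, M.E) (extChartAt M.I c) x

/-- The differential of the inverse of the preferred chart at `c`. -/
def chartSymmD (c : M) (y : M.E) : M.E →L[ℝ] M.E :=
  mfderiv 𝓘(ℝ, M.E) M.I (extChartAt M.I c).symm y

lemma chartD_chartSymmD (c : M) {y : M.E} (hy : y ∈ (extChartAt M.I c).target) (w : M.E) :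
    chartD c ((extChartAt M.I c).symm y) (chartSymmD c y w) = w := by
  have h := mfderiv_extChartAt_comp_mfderivWithin_extChartAt_symm (I := M.I) hy
  rw [M.I.range_eq_univ, mfderivWithin_univ] at h
  exact DFunLike.congr_fun h w

lemma chartSymmD_chartD (c : M) {y : M.E} (hy : y ∈ (extChartAt M.I c).target) (w : M.E) :
    chartSymmD c y (chartD c ((extChartAt M.I c).symm y) w) = w := by
  have h := mfderivWithin_extChartAt_symm_comp_mfderiv_extChartAt (I := M.I) hy
  rw [M.I.range_eq_univ, mfderivWithin_univ] at h
  exact DFunLike.congr_fun h w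

lemma contMDiffAt_chart_symm (c : M) {y : M.E} (hy : y ∈ (extChartAt M.I c).target) :
    ContMDiffAt 𝓘(ℝ, M.E) M.I ∞ (extChartAt M.I c).symm y :=
  (contMDiffOn_extChartAt_symm c).contMDiffAt ((isOpen_extChartAt_target c).mem_nhds hy)

lemma fderiv_comp_chart_symm (f : M ⟶ Man.vec ℝ) (c : M) {y : M.E}
    (hy : y ∈ (extChartAt M.I c).target) (w : M.E) :
    fderiv ℝ (fun y => (Man.fn f ((extChartAt M.I c).symm y) : ℝ)) y w =
      d f ((extChartAt M.I c).symm y) (chartSymmD c y w) := by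
  rw [← mfderiv_eq_fderiv]
  have h : mfderiv 𝓘(ℝ, M.E) 𝓘(ℝ, ℝ) (Man.fn f ∘ (extChartAt M.I c).symm) y = _ :=
    mfderiv_comp y (mdiff_fn f _) ((contMDiffAt_chart_symm c hy).mdifferentiableAt (by simp))
  exact DFunLike.congr_fun h w

/-- Smoothness of a vector field along a map can be checked in the preferred chart. -/
lemma contMDiffAt_tangent (φ : N ⟶ M) (V : N → M.E) (n₀ : N)
    (h : ContMDiffAt N.I 𝓘(ℝ, M.E) ∞ (fun n => chartD (Man.fn φ n₀) (Man.fn φ n) (V n)) n₀) :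
    ContMDiffAt N.I M.I.tangent ∞
      (fun n => (⟨Man.fn φ n, V n⟩ : TangentBundle M.I M)) n₀ := by
  rw [Bundle.contMDiffAt_totalSpace]
  refine ⟨contMDiff_fn φ n₀, h.congr_of_eventuallyEq ?_⟩
  have : ∀ᶠ n in nhds n₀, Man.fn φ n ∈ (chartAt M.H (Man.fn φ n₀)).source :=
    (continuous_fn φ).continuousAt.eventually_mem (chart_source_mem_nhds _ _)
  filter_upwards [this] with n hn
  have h₁ := TangentBundle.continuousLinearMapAt_trivializationAt (I := M.I) hn
  have h₂ := DFunLike.congr_fun h₁ (V n)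
  refine Eq.trans ?_ h₂
  exact (congrFun (Bundle.Trivialization.coe_linearMapAt_of_mem (R := ℝ)
    (trivializationAt M.E (TangentSpace M.I) (fn φ n₀)) (b := fn φ n) hn) (V n)).symm

end Man

section

variable {𝒳 : BasedCategory.{v, u} Man}

/-- The coordinate expression of a symplectic form, as a map to the dual space. -/
def SymplecticForm.chartMap (Ω : SymplecticForm 𝒳) (ζ : 𝒳.obj) (c : base ζ) (y : (base ζ).E) :
    (base ζ).E →L[ℝ] (base ζ).E →L[ℝ] ℝ :=
  LinearMap.toContinuousLinearMap
    ((LinearMap.toContinuousLinearMap (𝕜 := ℝ) (E := (base ζ).E) (F' := ℝ)).toLinearMap ∘ₗ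
      bil (FormField.inChart (Ω.form ζ) c y))

lemma SymplecticForm.chartMap_apply (Ω : SymplecticForm 𝒳) (ζ : 𝒳.obj) (c : base ζ)
    (y w w' : (base ζ).E) :
    Ω.chartMap ζ c y w w' = Ω.ev ζ ((extChartAt (base ζ).I c).symm y) (Man.chartSymmD c y w)
      (Man.chartSymmD c y w') := by
  change FormField.inChart (Ω.form ζ) c y ![w, w'] = Ω.form ζ _ ![_, _]
  change Ω.form ζ _ _ = _
  congr 1
  funext i
  fin_cases i <;> rfl

lemma SymplecticForm.contDiffOn_chartMap (Ω : SymplecticForm 𝒳) (ζ : 𝒳.obj) (c : base ζ) :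
    ContDiffOn ℝ ∞ (Ω.chartMap ζ c) (extChartAt (base ζ).I c).target := by
  rw [contDiffOn_clm_apply]
  intro w
  rw [contDiffOn_clm_apply]
  intro w'
  exact (ContinuousAlternatingMap.apply ℝ (base ζ).E ℝ ![w, w']).contDiff.comp_contDiffOn
    (Ω.smooth ζ c)

lemma SymplecticForm.exists_chartMap_equiv (Ω : SymplecticForm 𝒳) {ζ : 𝒳.obj} (hζ : IsEtale ζ)
    (c : base ζ) {y : (base ζ).E} (hy : y ∈ (extChartAt (base ζ).I c).target) :
    ∃ e : (base ζ).E ≃L[ℝ] ((base ζ).E →L[ℝ] ℝ), (e : (base ζ).E →L[ℝ] _) = Ω.chartMap ζ c y := by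
  have hinj : Function.Injective (Ω.chartMap ζ c y) := by
    refine (injective_iff_map_eq_zero (Ω.chartMap ζ c y)).2 fun w hw => ?_
    have h₁ : Man.chartSymmD c y w = 0 := by
      refine Ω.ev_nondegenerate hζ ((extChartAt (base ζ).I c).symm y) fun e => ?_
      have := DFunLike.congr_fun hw (Man.chartD c ((extChartAt (base ζ).I c).symm y) e)
      rw [SymplecticForm.chartMap_apply, Man.chartSymmD_chartD c hy] at this
      rw [this, map_zero]
      rfl
    rw [← Man.chartD_chartSymmD c hy w, h₁, map_zero]
  have hfin : Module.finrank ℝ (base ζ).E = Module.finrank ℝ ((base ζ).E →L[ℝ] ℝ) := by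
    rw [← (LinearMap.toContinuousLinearMap (𝕜 := ℝ) (E := (base ζ).E) (F' := ℝ)).finrank_eq]
    exact (Subspace.dual_finrank_eq (K := ℝ) (V := (base ζ).E)).symm
  have hsurj : Function.Surjective (Ω.chartMap ζ c y) :=
    (LinearMap.injective_iff_surjective_of_finrank_eq_finrank
      (f := (Ω.chartMap ζ c y).toLinearMap) hfin).1 hinj
  exact ⟨ContinuousLinearEquiv.ofBijective (Ω.chartMap ζ c y) (LinearMap.ker_eq_bot.2 hinj)
    (LinearMap.range_eq_top.2 hsurj), ContinuousLinearEquiv.coe_ofBijective _ _ _⟩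

variable {J : Set ℝ}

/-- Every function on `J × 𝒳` has a Hamiltonian vector field. -/
lemma StackFunction.exists_hamiltonian_field (h : IsCFG 𝒳) (Ω : SymplecticForm 𝒳)
    (H : StackFunction (times J 𝒳)) :
    ∃ X : TimeVectorField 𝒳 J, ∀ (ζ : 𝒳.obj) (hζ : IsEtale ζ) (t : J)
      (x : base ζ) (e : (base ζ).E),
      Man.d (H.slice h t ζ) x e = Ω.ev ζ x (X.val ζ hζ t x) e := by
  choose V hV using fun (ζ : 𝒳.obj) (hζ : IsEtale ζ) (t : J) (x : base ζ) =>
    Ω.exists_ev_eq hζ x (Man.d (H.slice h t ζ) x).toLinearMap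
  refine ⟨⟨V, ?_, ?_⟩, fun ζ hζ t x e => (hV ζ hζ t x e).symm⟩
  · intro ζ hζ N f hf φ n₀
    refine Man.contMDiffAt_tangent φ (fun n => V ζ hζ ⟨f n, hf n⟩ (Man.fn φ n)) n₀ ?_
    set c := Man.fn φ n₀ with hc
    have hsrc : ∀ᶠ n in nhds n₀, Man.fn φ n ∈ (extChartAt (base ζ).I c).source :=
      (Man.continuous_fn φ).continuousAt.eventually_mem (extChartAt_source_mem_nhds _)
    have hy₀ : extChartAt (base ζ).I c (Man.fn φ n₀) ∈ (extChartAt (base ζ).I c).target :=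
      mem_extChartAt_target c
    have hcφ : ContMDiffAt N.I 𝓘(ℝ, (base ζ).E) ∞
        (fun n => extChartAt (base ζ).I c (Man.fn φ n)) n₀ :=
      ContMDiffAt.comp n₀ contMDiffAt_extChartAt (Man.contMDiff_fn φ n₀)
    -- the differential of the Hamiltonian in the chart
    let α : N → ((base ζ).E →L[ℝ] ℝ) := fun n => fderiv ℝ (fun y : (base ζ).E =>
      H.eval ⟨f n, hf n⟩ ζ ((extChartAt (base ζ).I c).symm y)) (extChartAt (base ζ).I c (Man.fn φ n))
    have hα : ContMDiffAt N.I 𝓘(ℝ, (base ζ).E →L[ℝ] ℝ) ∞ α n₀ := by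
      have hunc : ContMDiffAt (N.I.prod 𝓘(ℝ, (base ζ).E)) 𝓘(ℝ, ℝ) ∞
          (Function.uncurry fun (n : N) (y : (base ζ).E) =>
            H.eval ⟨f n, hf n⟩ ζ ((extChartAt (base ζ).I c).symm y))
          (n₀, extChartAt (base ζ).I c (Man.fn φ n₀)) := by
        have h₁ := Man.contMDiff_fn (H.pull h (Man.fst N (base ζ) ≫ (show N ⟶ Man.vec ℝ from f))
          (fun m => hf _) (Man.snd N (base ζ)))
        have h₂ : ContMDiffAt (N.I.prod 𝓘(ℝ, (base ζ).E)) (N.I.prod (base ζ).I) ∞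
            (fun q : N × (base ζ).E => (q.1, (extChartAt (base ζ).I c).symm q.2))
            (n₀, extChartAt (base ζ).I c (Man.fn φ n₀)) :=
          contMDiffAt_fst.prodMk (ContMDiffAt.comp (n₀, extChartAt (base ζ).I c (Man.fn φ n₀))
            (g := (extChartAt (base ζ).I c).symm) (f := Prod.snd)
            (Man.contMDiffAt_chart_symm c hy₀) contMDiffAt_snd)
        exact ContMDiffAt.comp _ (h₁ _) h₂
      have := hunc.mfderiv _ _ hcφ (m := ∞) (by simp)
      erw [inTangentCoordinates_model_space] at this
      simpa only [mfderiv_eq_fderiv] using this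
    have hev : ∀ᶠ n in nhds n₀, Man.chartD c (Man.fn φ n) (V ζ hζ ⟨f n, hf n⟩ (Man.fn φ n)) =
        ContinuousLinearMap.inverse (Ω.chartMap ζ c (extChartAt (base ζ).I c (Man.fn φ n)))
          (α n) := by
      filter_upwards [hsrc] with n hn
      have hy := (extChartAt (base ζ).I c).map_source hn
      have hx := (extChartAt (base ζ).I c).left_inv hn
      set y := extChartAt (base ζ).I c (Man.fn φ n) with hydef
      rw [← hx]
      obtain ⟨e, he⟩ := Ω.exists_chartMap_equiv hζ c hy
      rw [← he, ContinuousLinearMap.inverse_equiv]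
      change _ = e.symm (α n)
      rw [ContinuousLinearEquiv.eq_symm_apply]
      ext w
      have he' := DFunLike.congr_fun (DFunLike.congr_fun he (Man.chartD c
        ((extChartAt (base ζ).I c).symm y) (V ζ hζ ⟨f n, hf n⟩
          ((extChartAt (base ζ).I c).symm y)))) w
      refine Eq.trans he' ?_
      rw [SymplecticForm.chartMap_apply, Man.chartSymmD_chartD c hy, hV]
      exact (Man.fderiv_comp_chart_symm (H.slice h ⟨f n, hf n⟩ ζ) c hy w).symm
    refine ContMDiffAt.congr_of_eventuallyEq ?_ hev
    obtain ⟨e, he⟩ := Ω.exists_chartMap_equiv hζ c hy₀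
    have h₁ : ContMDiffAt N.I 𝓘(ℝ, (base ζ).E →L[ℝ] (base ζ).E →L[ℝ] ℝ) ∞
        (fun n => Ω.chartMap ζ c (extChartAt (base ζ).I c (Man.fn φ n))) n₀ :=
      ContMDiffAt.comp n₀ (g := Ω.chartMap ζ c) (((Ω.contDiffOn_chartMap ζ c).contDiffAt
        ((isOpen_extChartAt_target c).mem_nhds hy₀)).contMDiffAt) hcφ
    have h₂ : ContMDiffAt N.I 𝓘(ℝ, ((base ζ).E →L[ℝ] ℝ) →L[ℝ] (base ζ).E) ∞
        (fun n => ContinuousLinearMap.inverse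
          (Ω.chartMap ζ c (extChartAt (base ζ).I c (Man.fn φ n)))) n₀ := by
      have : FiniteDimensional ℝ (base ζ).E := (base ζ).finDim
      have : CompleteSpace (base ζ).E := FiniteDimensional.complete ℝ _
      refine ContMDiffAt.comp n₀ (g := ContinuousLinearMap.inverse) ?_ h₁
      rw [← he]
      exact (contDiffAt_map_inverse e).contMDiffAt
    exact h₂.clm_apply hα
  · intro ζ ζ' hζ hζ' g t x
    refine Ω.ev_nondegenerate hζ' (baseMap g x) fun e => ?_
    obtain ⟨e', rfl⟩ := (hζ.d_bijective hζ' g x).2 e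
    have h₁ := Ω.ev_map g x (V ζ hζ t x) e'
    refine Eq.trans h₁ ?_
    rw [hV, hV, ← H.map_slice h t g]
    exact Man.d_comp _ _ _ _

end

end

section

/-! ### Differentiating in the time direction -/

/-- A smooth function of `sin τ` that is smooth in `τ` is Lipschitz in `sin τ`. -/
lemma exists_lipschitz_sin (Q : ℝ → ℝ) (hQ : ContDiff ℝ ∞ Q) (h₁ : ∀ τ, Q (Real.pi - τ) = Q τ)
    (h₂ : ∀ τ, Q (-Real.pi - τ) = Q τ) :
    ∃ C : ℝ, ∀ τ ∈ Icc (-(Real.pi / 2)) (Real.pi / 2), ∀ τ' ∈ Icc (-(Real.pi / 2)) (Real.pi / 2),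
      |Q τ - Q τ'| ≤ C * |Real.sin τ - Real.sin τ'| := by
  have hpi := Real.pi_pos
  set I := Icc (-(Real.pi / 2)) (Real.pi / 2) with hI
  have hd : Differentiable ℝ Q := hQ.differentiable (by simp)
  have hQ' : ContDiff ℝ ∞ (deriv Q) := (contDiff_infty_iff_deriv.1 hQ).2
  have hd' : Differentiable ℝ (deriv Q) := hQ'.differentiable (by simp)
  have hQ'' : Continuous (deriv (deriv Q)) := (contDiff_infty_iff_deriv.1 hQ').2.continuous
  -- the symmetries force the derivative to vanish at the ends
  have hz : ∀ c : ℝ, (∀ τ, Q (c - τ) = Q τ) → deriv Q (c / 2) = 0 := by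
    intro c hc
    have e : deriv (fun τ => Q (c - τ)) (c / 2) = - deriv Q (c - c / 2) :=
      deriv_comp_const_sub _ _ _
    have e2 : (fun τ => Q (c - τ)) = Q := funext hc
    rw [e2, sub_half] at e
    linarith
  have hz₁ : deriv Q (Real.pi / 2) = 0 := hz _ h₁
  have hz₂ : deriv Q (-(Real.pi / 2)) = 0 := by
    have := hz _ h₂
    rwa [neg_div] at this
  obtain ⟨K, hK⟩ := isCompact_Icc.exists_bound_of_continuousOn (s := I) hQ''.continuousOn
  have hK0 : 0 ≤ K := (norm_nonneg _).trans (hK 0 ⟨by linarith, by linarith⟩)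
  have hLip : ∀ τ ∈ I, ∀ τ' ∈ I, |deriv Q τ - deriv Q τ'| ≤ K * |τ - τ'| := fun τ hτ τ' hτ' =>
    Convex.norm_image_sub_le_of_norm_deriv_le (fun x _ => hd' x) hK (convex_Icc _ _) hτ' hτ
  have hcos : ∀ τ ∈ I, |deriv Q τ| ≤ K * (Real.pi / 2) * Real.cos τ := by
    have hkey : ∀ x ∈ Icc 0 (Real.pi / 2), K * x ≤ K * (Real.pi / 2) * Real.sin x := by
      intro x hx
      have := Real.mul_le_sin hx.1 hx.2
      have h3 : x ≤ Real.pi / 2 * Real.sin x := by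
        calc x = Real.pi / 2 * (2 / Real.pi * x) := by field_simp
          _ ≤ _ := by gcongr
      calc K * x ≤ K * (Real.pi / 2 * Real.sin x) := by gcongr
        _ = _ := by ring
    intro τ hτ
    rcases le_total 0 τ with h0 | h0
    · have e := hLip τ hτ (Real.pi / 2) ⟨by linarith, le_rfl⟩
      rw [hz₁, sub_zero] at e
      refine e.trans ?_
      rw [abs_sub_comm, abs_of_nonneg (by linarith [hτ.2]), ← Real.sin_pi_div_two_sub]
      exact hkey _ ⟨by linarith [hτ.2], by linarith⟩
    · have e := hLip τ hτ (-(Real.pi / 2)) ⟨le_rfl, by linarith⟩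
      rw [hz₂, sub_zero] at e
      refine e.trans ?_
      rw [abs_of_nonneg (by linarith [hτ.1]), ← Real.sin_add_pi_div_two, sub_neg_eq_add]
      exact hkey _ ⟨by linarith [hτ.1], by linarith⟩
  set C := K * (Real.pi / 2) with hC
  have hmono : ∀ R : ℝ → ℝ, Differentiable ℝ R → (∀ τ ∈ I, |deriv R τ| ≤ C * Real.cos τ) →
      MonotoneOn (fun τ => C * Real.sin τ - R τ) I := by
    intro R hR hb
    refine monotoneOn_of_deriv_nonneg (convex_Icc _ _)
      ((continuous_const.mul Real.continuous_sin).sub hR.continuous).continuousOn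
      ((Real.differentiable_sin.const_mul C).sub hR).differentiableOn fun τ hτ => ?_
    rw [deriv_fun_sub (by fun_prop) (hR τ), deriv_const_mul _ (by fun_prop), Real.deriv_sin]
    have := (abs_le.1 (hb τ (interior_subset hτ))).2
    linarith
  have hm₁ := hmono Q hd hcos
  have hm₂ := hmono (fun τ => - Q τ) hd.neg (fun τ hτ => by
    rw [deriv.fun_neg, abs_neg]
    exact hcos τ hτ)
  have hsin : MonotoneOn Real.sin I := Real.strictMonoOn_sin.monotoneOn
  have hC0 : 0 ≤ C := by positivity
  have key : ∀ τ ∈ I, ∀ τ' ∈ I, τ ≤ τ' → |Q τ - Q τ'| ≤ C * |Real.sin τ - Real.sin τ'| := by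
    intro τ hτ τ' hτ' hle
    have a₁ := hm₁ hτ hτ' hle
    have a₂ := hm₂ hτ hτ' hle
    have a₃ := hsin hτ hτ' hle
    simp only at a₁ a₂
    rw [abs_sub_comm (Real.sin τ), abs_of_nonneg (sub_nonneg.2 a₃), abs_le]
    constructor <;> nlinarith
  refine ⟨C, fun τ hτ τ' hτ' => ?_⟩
  rcases le_total τ τ' with h | h
  · exact key τ hτ τ' hτ' h
  · rw [abs_sub_comm, abs_sub_comm (Real.sin τ)]
    exact key τ' hτ' τ hτ h

/-- A smooth surjection from the line onto the interval `[a, b]`. Composing with it replaces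
parameters in an interval with boundary by parameters in a manifold. -/
def osc (a b τ : ℝ) : ℝ := (a + b) / 2 + (b - a) / 2 * Real.sin τ

lemma osc_mem {a b : ℝ} (hab : a ≤ b) (τ : ℝ) : osc a b τ ∈ Icc a b := by
  have h₁ := Real.neg_one_le_sin τ
  have h₂ := Real.sin_le_one τ
  unfold osc
  constructor <;> nlinarith

lemma contDiff_osc (a b : ℝ) : ContDiff ℝ ∞ (osc a b) := by
  unfold osc
  fun_prop

lemma exists_osc_eq {a b : ℝ} (hab : a < b) {t : ℝ} (ht : t ∈ Icc a b) :
    ∃ τ ∈ Icc (-(Real.pi / 2)) (Real.pi / 2), osc a b τ = t := by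
  have h1 : 0 < (b - a) / 2 := by linarith
  have h2 : b - a ≠ 0 := by linarith
  refine ⟨Real.arcsin ((t - (a + b) / 2) / ((b - a) / 2)), Real.arcsin_mem_Icc _, ?_⟩
  rw [osc, Real.sin_arcsin]
  · field_simp
    ring
  · rw [le_div_iff₀ h1]
    linarith [ht.1]
  · rw [div_le_iff₀ h1]
    linarith [ht.2]

/-- The plot `osc` as a morphism of manifolds. -/
def oscHom (a b : ℝ) : Man.vec ℝ ⟶ Man.vec ℝ :=
  Man.ofFun (M := Man.vec ℝ) (N := Man.vec ℝ) (osc a b) (contDiff_osc a b).contMDiff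

namespace Man

variable {M N K : Man}

/-- The differential as a derivative along a line in the preferred chart. -/
lemma hasDerivAt_line (f : M ⟶ Man.vec ℝ) (n : M) (w : M.E) :
    HasDerivAt (fun s : ℝ => (Man.fn f ((extChartAt M.I n).symm (extChartAt M.I n n + s • w)) : ℝ))
      (d f n w) 0 := by
  have hy : extChartAt M.I n n ∈ (extChartAt M.I n).target := mem_extChartAt_target n
  have h₁ : HasFDerivAt (fun y => (Man.fn f ((extChartAt M.I n).symm y) : ℝ)) (d f n)
      (extChartAt M.I n n) := by
    have hd : DifferentiableAt ℝ (fun y => (Man.fn f ((extChartAt M.I n).symm y) : ℝ))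
        (extChartAt M.I n n) := by
      rw [← mdifferentiableAt_iff_differentiableAt]
      exact MDifferentiableAt.comp (g := Man.fn f) _ (mdiff_fn f _)
        ((contMDiffAt_chart_symm n hy).mdifferentiableAt (by simp))
    have h1 := (mdiff_fn f n).mfderiv
    rw [M.I.range_eq_univ, fderivWithin_univ] at h1
    have h2 : fderiv ℝ (fun y => (Man.fn f ((extChartAt M.I n).symm y) : ℝ))
        (extChartAt M.I n n) = d f n := h1.symm
    rw [← h2]
    exact hd.hasFDerivAt
  have h₂ : HasDerivAt (fun s : ℝ => extChartAt M.I n n + s • w) w 0 := by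
    simpa using ((hasDerivAt_id (0 : ℝ)).smul_const w).const_add (extChartAt M.I n n)
  have h₃ : HasFDerivAt (fun y => (Man.fn f ((extChartAt M.I n).symm y) : ℝ)) (d f n)
      (extChartAt M.I n n + (0 : ℝ) • w) := by simpa using h₁
  exact h₃.comp_hasDerivAt (0 : ℝ) h₂

lemma d_eq_zero_of_lipschitz (f g : M ⟶ Man.vec ℝ) (n : M) (w : M.E) (C : ℝ)
    (hC : ∀ m, |(Man.fn g m : ℝ) - Man.fn g n| ≤ C * |(Man.fn f m : ℝ) - Man.fn f n|)
    (hf : d f n w = 0) : d g n w = 0 := by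
  have hF := hasDerivAt_line f n w
  have hG := hasDerivAt_line g n w
  rw [hf] at hF
  have h0 : (extChartAt M.I n).symm (extChartAt M.I n n + (0 : ℝ) • w) = n := by simp
  refine hG.unique ?_
  rw [hasDerivAt_iff_isLittleO] at hF ⊢
  simp only [smul_zero, sub_zero, h0] at hF ⊢
  refine Asymptotics.IsBigO.trans_isLittleO (Asymptotics.IsBigO.of_bound C ?_) hF
  exact Filter.Eventually.of_forall fun s => hC _

end Man

section

variable {𝒳 : BasedCategory.{v, u} Man} {a b : ℝ}

/-- A function on `[a, b] × 𝒳` is Lipschitz in time. Smoothness is only known along plots, so near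
the ends of the interval it is tested on `osc`. -/
lemma StackFunction.exists_lipschitz (h : IsCFG 𝒳) (hab : a < b)
    (H : StackFunction (times (Icc a b) 𝒳)) (ζ : 𝒳.obj) (x : base ζ) :
    ∃ C : ℝ, ∀ t t' : Icc a b, |H.eval t ζ x - H.eval t' ζ x| ≤ C * |(t : ℝ) - t'| := by
  have hb2 : 0 < (b - a) / 2 := by linarith
  have hb3 : b - a ≠ 0 := by linarith
  let Q : ℝ → ℝ := fun τ => H.eval ⟨osc a b τ, osc_mem hab.le τ⟩ ζ x
  have hQ : ContDiff ℝ ∞ Q := by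
    rw [← contMDiff_iff_contDiff]
    exact Man.contMDiff_fn (H.pull h (oscHom a b) (fun τ => osc_mem hab.le τ)
      (Man.const (Man.vec ℝ) x))
  have hs : ∀ c τ, Real.sin (c - τ) = Real.sin τ → Q (c - τ) = Q τ := by
    intro c τ hc
    have : osc a b (c - τ) = osc a b τ := by rw [osc, osc, hc]
    simp only [Q, this]
  obtain ⟨C, hC⟩ := exists_lipschitz_sin Q hQ (fun τ => hs _ τ (Real.sin_pi_sub τ))
    (fun τ => hs _ τ (by
      rw [show -Real.pi - τ = -(τ + Real.pi) by ring, Real.sin_neg, Real.sin_add_pi, neg_neg]))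
  refine ⟨C / ((b - a) / 2), fun t t' => ?_⟩
  obtain ⟨τ, hτ, ht⟩ := exists_osc_eq hab t.2
  obtain ⟨τ', hτ', ht'⟩ := exists_osc_eq hab t'.2
  have e₁ : Q τ = H.eval t ζ x := by simp only [Q, ht]
  have e₂ : Q τ' = H.eval t' ζ x := by simp only [Q, ht']
  have e₃ : (t : ℝ) - t' = (b - a) / 2 * (Real.sin τ - Real.sin τ') := by
    rw [← ht, ← ht', osc, osc]
    ring
  rw [← e₁, ← e₂, e₃, abs_mul, abs_of_pos hb2]
  calc _ ≤ _ := hC τ hτ τ' hτ'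
    _ = _ := by field_simp

/-- The time part of the differential of a function on `J × 𝒳` vanishes where the differential of
the time coordinate does. At the ends of the interval this is not an instance of the chain rule. -/
lemma StackFunction.d_pull_const_eq_zero (h : IsCFG 𝒳) (hab : a < b)
    (H : StackFunction (times (Icc a b) 𝒳)) {M : Man} {ζ : 𝒳.obj} (f : M ⟶ Man.vec ℝ)
    (hf : ∀ m, Man.fn f m ∈ Icc a b) (x : base ζ) (n : M) (w : M.E) (hw : Man.d f n w = 0) :
    Man.d (H.pull h f hf (Man.const M x)) n w = 0 := by
  obtain ⟨C, hC⟩ := H.exists_lipschitz h hab ζ x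
  exact Man.d_eq_zero_of_lipschitz f _ n w C (fun m => hC _ _) hw

/-- The differential of a function on `J × 𝒳` along a plot is the sum of its space part and its time
part. -/
lemma StackFunction.d_pull (h : IsCFG 𝒳) {J : Set ℝ} (H : StackFunction (times J 𝒳)) {M : Man}
    {ζ : 𝒳.obj} (f : M ⟶ Man.vec ℝ) (hf : ∀ m, Man.fn f m ∈ J) (p : M ⟶ 𝒳.p.obj ζ) (n : M)
    (w : M.E) :
    Man.d (H.pull h f hf p) n w =
      Man.d (H.slice h ⟨Man.fn f n, hf n⟩ ζ) (Man.fn p n) (Man.d p n w) +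
        Man.d (H.pull h f hf (Man.const M (Man.fn p n))) n w := by
  let G := H.pull h (Man.fst M (base ζ) ≫ f) (fun _ => hf _) (Man.snd M (base ζ))
  have e₁ : H.pull h f hf p = Man.pair (𝟙 M) p ≫ G := rfl
  have e₂ : H.slice h ⟨Man.fn f n, hf n⟩ ζ = Man.pair (Man.const (base ζ) n) (𝟙 (base ζ)) ≫ G := rfl
  have e₃ : H.pull h f hf (Man.const M (Man.fn p n)) =
    Man.pair (𝟙 M) (Man.const M (Man.fn p n)) ≫ G := rfl
  rw [e₁, e₂, e₃, Man.d_comp, Man.d_comp, Man.d_comp, Man.d_pair, Man.d_pair, Man.d_pair]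
  simp only [Man.d_id, Man.d_const]
  have : ((w, Man.d p n w) : M.E × (base ζ).E) = (0, Man.d p n w) + (w, 0) := by simp
  rw [this]
  exact map_add (Man.d G (n, Man.fn p n)) _ _

lemma StackFunction.pull_map (h : IsCFG 𝒳) {J : Set ℝ} (H : StackFunction (times J 𝒳)) {M : Man}
    {ζ ζ' : 𝒳.obj} (f : M ⟶ Man.vec ℝ) (hf : ∀ m, Man.fn f m ∈ J) (p : M ⟶ 𝒳.p.obj ζ)
    (g : ζ ⟶ ζ') : H.pull h f hf (p ≫ 𝒳.p.map g) = H.pull h f hf p := by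
  ext m
  exact H.eval_map _ g _

lemma StackFunction.comp_pull (h : IsCFG 𝒳) {J : Set ℝ} (H : StackFunction (times J 𝒳)) {M N : Man}
    {ζ : 𝒳.obj} (k : N ⟶ M) (f : M ⟶ Man.vec ℝ) (hf : ∀ m, Man.fn f m ∈ J) (p : M ⟶ 𝒳.p.obj ζ) :
    k ≫ H.pull h f hf p = H.pull h (k ≫ f) (fun _ => hf _) (k ≫ p) := rfl

/-- The time part of the differential is proportional to the differential of the time
coordinate. -/
lemma StackFunction.d_pull_const_proportional (h : IsCFG 𝒳) (hab : a < b)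
    (H : StackFunction (times (Icc a b) 𝒳)) {M : Man} {ζ : 𝒳.obj} (f : M ⟶ Man.vec ℝ)
    (hf : ∀ m, Man.fn f m ∈ Icc a b) (x : base ζ) (n : M) (w w' : M.E) :
    (Man.d f n w : ℝ) * Man.d (H.pull h f hf (Man.const M x)) n w' =
      (Man.d f n w' : ℝ) * Man.d (H.pull h f hf (Man.const M x)) n w := by
  have := H.d_pull_const_eq_zero h hab f hf x n ((Man.d f n w : ℝ) • w' - (Man.d f n w' : ℝ) • w) (by
    rw [map_sub, map_smul, map_smul]
    change (Man.d f n w : ℝ) * (Man.d f n w' : ℝ) - (Man.d f n w' : ℝ) * (Man.d f n w : ℝ) = 0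
    ring)
  rw [map_sub, map_smul, map_smul] at this
  exact sub_eq_zero.1 this

end

end

section

/-! ### Pulling back symplectic forms along maps to a stack -/

/-- If `ι_e B = g dh` in the directions `v`, `w`, where `g` is constant in these directions, then
closedness of `B` forces `B(v, w)` to be constant along `e`. -/
lemma const_of_extDeriv_eq_zero {V : Type} [NormedAddCommGroup V] [NormedSpace ℝ V]
    (B : V → V [⋀^Fin 2]→L[ℝ] ℝ) (hB : ContDiff ℝ ∞ B) (hd : ∀ y, extDeriv B y = 0)
    (g h : V → ℝ) (hg : Differentiable ℝ g) (hh : ContDiff ℝ ∞ h) (e v w : V)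
    (hgv : ∀ y, fderiv ℝ g y v = 0) (hgw : ∀ y, fderiv ℝ g y w = 0)
    (hv : ∀ y, B y ![e, v] = g y * fderiv ℝ h y v) (hw : ∀ y, B y ![e, w] = g y * fderiv ℝ h y w)
    (t t' : ℝ) : B (t • e) ![v, w] = B (t' • e) ![v, w] := by
  have hdB : Differentiable ℝ B := hB.differentiable (by simp)
  have hh' : Differentiable ℝ (fderiv ℝ h) := (hh.fderiv_right (m := ∞) (by simp)).differentiable
    (by simp)
  have key : ∀ y, fderiv ℝ (fun y => B y ![v, w]) y e = 0 := by
    intro y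
    have h1 := extDeriv_apply (hdB y) ![e, v, w]
    rw [hd y] at h1
    have r0 : (0 : Fin 3).removeNth ![e, v, w] = ![v, w] := by
      funext i; fin_cases i <;> rfl
    have r1 : (1 : Fin 3).removeNth ![e, v, w] = ![e, w] := by
      funext i; fin_cases i <;> rfl
    have r2 : (2 : Fin 3).removeNth ![e, v, w] = ![e, v] := by
      funext i; fin_cases i <;> rfl
    rw [Fin.sum_univ_three, r0, r1, r2] at h1
    have hmix : ∀ p q : V, fderiv ℝ g y p = 0 →
        fderiv ℝ (fun y => g y * fderiv ℝ h y q) y p = g y * fderiv ℝ (fderiv ℝ h) y p q := by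
      intro p q hp
      rw [fderiv_fun_mul (hg y) ((hh' y).clm_apply (differentiableAt_const q))]
      simp only [add_apply, smul_apply, smul_eq_mul, hp,
        mul_zero, add_zero]
      rw [fderiv_clm_apply (hh' y) (differentiableAt_const q)]
      simp
    have hsym : fderiv ℝ (fderiv ℝ h) y v w = fderiv ℝ (fderiv ℝ h) y w v :=
      (hh.contDiffAt.isSymmSndFDerivAt (by
        rw [minSmoothness_of_isRCLikeNormedField]
        exact WithTop.coe_le_coe.2 le_top)) v w
    have e1 : (fun y => B y ![e, w]) = fun y => g y * fderiv ℝ h y w := funext hw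
    have e2 : (fun y => B y ![e, v]) = fun y => g y * fderiv ℝ h y v := funext hv
    rw [e1, e2] at h1
    simp only [Fin.val_zero, Fin.val_one, Fin.val_two,
      Matrix.cons_val_zero, Matrix.cons_val_one, Matrix.cons_val] at h1
    rw [hmix v w (hgv y), hmix w v (hgw y), hsym] at h1
    simp at h1
    exact h1.symm
  have hdiff : Differentiable ℝ (fun y => B y ![v, w]) := fun y =>
    (ContinuousAlternatingMap.apply ℝ V ℝ ![v, w]).differentiableAt.comp y (hdB y)
  have : ∀ t : ℝ, HasDerivAt (fun t : ℝ => B (t • e) ![v, w]) 0 t := fun t => by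
    have h1 : HasDerivAt (fun t : ℝ => t • e) e t := by
      simpa using (hasDerivAt_id t).smul_const e
    have := (hdiff (t • e)).hasFDerivAt.comp_hasDerivAt t h1
    rwa [key] at this
  exact is_const_of_deriv_eq_zero (fun t => (this t).differentiableAt) (fun t => (this t).deriv) t t'

namespace Man

/-- Any two tangent vectors at a point are tangent to a smooth map from the plane. -/
lemma exists_surface (M : Man) (x : M) (v w : M.E) :
    ∃ σ : vec (ℝ × ℝ) ⟶ M, Man.fn σ (0 : ℝ × ℝ) = x ∧ d σ (0 : ℝ × ℝ) ((1, 0) : ℝ × ℝ) = v ∧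
      d σ (0 : ℝ × ℝ) ((0, 1) : ℝ × ℝ) = w := by
  set c := extChartAt M.I x
  have hx := mem_extChartAt_target (I := M.I) x
  obtain ⟨ε, hε, hball⟩ := Metric.isOpen_iff.1 (isOpen_extChartAt_target (I := M.I) x) _ hx
  set v' := chartD x x v
  set w' := chartD x x w
  obtain ⟨K, hK0, hK⟩ : ∃ K : ℝ, 0 < K ∧ ∀ a b : ℝ,
      ‖(Real.sin (a * K) / K) • v' + (Real.sin (b * K) / K) • w'‖ < ε := by
    refine ⟨(‖v'‖ + ‖w'‖ + 1) / ε, by positivity, fun a b => ?_⟩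
    set K := (‖v'‖ + ‖w'‖ + 1) / ε with hK
    have hKp : 0 < K := by positivity
    have hs : ∀ a : ℝ, |Real.sin (a * K) / K| ≤ 1 / K := fun a => by
      rw [abs_div, abs_of_pos hKp]
      gcongr
      exact Real.abs_sin_le_one _
    calc _ ≤ ‖(Real.sin (a * K) / K) • v'‖ + ‖(Real.sin (b * K) / K) • w'‖ := norm_add_le _ _
      _ = |Real.sin (a * K) / K| * ‖v'‖ + |Real.sin (b * K) / K| * ‖w'‖ := by
        rw [norm_smul, norm_smul, Real.norm_eq_abs, Real.norm_eq_abs]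
      _ ≤ 1 / K * ‖v'‖ + 1 / K * ‖w'‖ := by
        gcongr <;> exact hs _
      _ < 1 / K * (‖v'‖ + ‖w'‖ + 1) := by
        rw [← mul_add]
        exact mul_lt_mul_of_pos_left (lt_add_one _) (by positivity)
      _ = ε := by
        rw [hK]
        field_simp
  let q : ℝ × ℝ → M.E := fun z =>
    c x + ((Real.sin (z.1 * K) / K) • v' + (Real.sin (z.2 * K) / K) • w')
  have hq : ContDiff ℝ ∞ q := by
    have h1 : ContDiff ℝ ∞ fun z : ℝ × ℝ => Real.sin (z.1 * K) / K := by fun_prop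
    have h2 : ContDiff ℝ ∞ fun z : ℝ × ℝ => Real.sin (z.2 * K) / K := by fun_prop
    exact contDiff_const.add ((h1.smul contDiff_const).add (h2.smul contDiff_const))
  have hmem : ∀ z, q z ∈ c.target := fun z => hball (by
    rw [Metric.mem_ball, dist_eq_norm, add_sub_cancel_left]
    exact hK _ _)
  have hs : ContMDiff 𝓘(ℝ, ℝ × ℝ) M.I ∞ (fun z => c.symm (q z)) := fun z =>
    (contMDiffAt_chart_symm x (hmem z)).comp z hq.contMDiff.contMDiffAt
  have hq0 : q 0 = c x := by simp [q]
  have hdq : ∀ a b : ℝ, fderiv ℝ q 0 (a, b) = a • v' + b • w' := by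
    intro a b
    have hsin : ∀ a : ℝ, HasDerivAt (fun t : ℝ => Real.sin ((t * a) * K) / K) a 0 := by
      intro a
      have h1 : HasDerivAt (fun t : ℝ => (t * a) * K) (a * K) 0 := by
        simpa using ((hasDerivAt_id (0 : ℝ)).mul_const a).mul_const K
      have := h1.sin.div_const K
      simpa [hK0.ne'] using this
    have h1 : HasDerivAt (fun t : ℝ => q (t • (a, b))) (a • v' + b • w') 0 :=
      (((hsin a).smul_const v').add ((hsin b).smul_const w')).const_add (c x)
    have h2 : HasDerivAt (fun t : ℝ => t • ((a, b) : ℝ × ℝ)) (a, b) 0 := by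
      simpa using (hasDerivAt_id (0 : ℝ)).smul_const ((a, b) : ℝ × ℝ)
    have h3 : HasFDerivAt q (fderiv ℝ q 0) ((0 : ℝ) • ((a, b) : ℝ × ℝ)) := by
      rw [zero_smul]
      exact (hq.differentiable (by simp) 0).hasFDerivAt
    have h4 : HasDerivAt (fun t : ℝ => q (t • (a, b))) (fderiv ℝ q 0 (a, b)) 0 :=
      HasFDerivAt.comp_hasDerivAt (l := q) (f := fun t : ℝ => t • ((a, b) : ℝ × ℝ))
        (l' := fderiv ℝ q 0) (0 : ℝ) h3 h2
    exact h4.unique h1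
  have hd : ∀ z, d (M := vec (ℝ × ℝ)) (ofFun (M := vec (ℝ × ℝ)) _ hs) (0 : ℝ × ℝ) z =
      chartSymmD x (c x) (fderiv ℝ q 0 z) := by
    intro z
    have h : mfderiv 𝓘(ℝ, ℝ × ℝ) M.I (c.symm ∘ q) 0 = _ := mfderiv_comp 0
      ((contMDiffAt_chart_symm x (hmem 0)).mdifferentiableAt (by simp))
      (hq.contMDiff.contMDiffAt.mdifferentiableAt (by simp))
    rw [mfderiv_eq_fderiv] at h
    have h2 := DFunLike.congr_fun h z
    refine h2.trans ?_
    rw [hq0]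
    rfl
  have hback : ∀ u, chartSymmD x (c x) (chartD x x u) = u := by
    intro u
    have := chartSymmD_chartD x hx u
    rwa [extChartAt_to_inv] at this
  refine ⟨ofFun (M := vec (ℝ × ℝ)) _ hs, ?_, ?_, ?_⟩
  · change c.symm (q 0) = x
    rw [hq0]
    exact extChartAt_to_inv x
  · rw [hd, hdq, one_smul, zero_smul, add_zero, hback]
  · rw [hd, hdq, one_smul, zero_smul, zero_add, hback]

end Man

section

variable {𝒳 : BasedCategory.{v, u} Man} {𝒴 : BasedCategory.{v', u'} Man}

/-- The pullback of a symplectic form along a smooth map to a chart, from a vector space. -/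
lemma SymplecticForm.exists_pullback (h : IsCFG 𝒳) (Ω : SymplecticForm 𝒳) {V : Type}
    [NormedAddCommGroup V] [NormedSpace ℝ V] [FiniteDimensional ℝ V] {ζ : 𝒳.obj}
    (f : Man.vec V ⟶ 𝒳.p.obj ζ) :
    ∃ B : V → V [⋀^Fin 2]→L[ℝ] ℝ, ContDiff ℝ ∞ B ∧ (∀ y, extDeriv B y = 0) ∧
      ∀ (y u w : V), B y ![u, w] = Ω.ev ζ (Man.fn f y) (Man.d f y u) (Man.d f y w) := by
  obtain ⟨κ, a, ha⟩ := h.exists_lift ζ (Man.vec V) f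
  have key : ∀ (M : Man) (f : M ⟶ 𝒳.p.obj ζ) (_ : 𝒳.p.IsHomLift f a),
      ∃ B : FormField M, FormField.IsSmooth B ∧ FormField.IsClosed B ∧
        ∀ (y : M) (u w : M.E), bil (E := M.E) (B y) u w =
          Ω.ev ζ (Man.fn f y) (Man.d f y u) (Man.d f y w) := by
    intro M f hf
    obtain rfl := IsHomLift.domain_eq 𝒳.p f a
    have := IsHomLift.fac 𝒳.p f a
    simp only [eqToHom_refl, Category.comp_id, Category.id_comp] at this
    rw [this]
    exact ⟨Ω.form κ, Ω.smooth κ, Ω.closed κ, fun y u w => (Ω.ev_map a y u w).symm⟩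
  obtain ⟨B, hs, hcl, hB⟩ := key _ f ha
  let B' : V → V [⋀^Fin 2]→L[ℝ] ℝ := B
  have hchart : FormField.inChart B (0 : V) = B' := by
    funext y
    have h1 : mfderiv 𝓘(ℝ, V) 𝓘(ℝ, V) (extChartAt 𝓘(ℝ, V) (0 : V)).symm y =
        ContinuousLinearMap.id ℝ V := by
      rw [extChartAt_model_space_eq_id]
      exact mfderiv_id
    change (B ((extChartAt 𝓘(ℝ, V) (0 : V)).symm y)).compContinuousLinearMap
      (mfderiv 𝓘(ℝ, V) 𝓘(ℝ, V) (extChartAt 𝓘(ℝ, V) (0 : V)).symm y) = _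
    rw [h1, extChartAt_model_space_eq_id]
    ext v
    rfl
  have ht : (extChartAt 𝓘(ℝ, V) (0 : V)).target = univ := by
    rw [extChartAt_model_space_eq_id]
    rfl
  refine ⟨B', ?_, fun y => ?_, hB⟩
  · rw [← contDiffOn_univ, ← ht, ← hchart]
    exact hs (0 : V)
  · rw [← hchart]
    exact hcl (0 : V) y (by rw [ht]; trivial)

/-- The pullback of a symplectic form along a map `T` of stacks, on the base of an object. -/
def SymplecticForm.pb (Ω : SymplecticForm 𝒳) (T : BasedFunctor 𝒴 𝒳) (η : 𝒴.obj)
    (n : 𝒴.p.obj η) : (𝒴.p.obj η).E →ₗ[ℝ] (𝒴.p.obj η).E →ₗ[ℝ] ℝ :=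
  (Ω.ev (T.obj η) (Man.fn (tr T η).hom n)).compl₁₂ (Man.d (tr T η).hom n).toLinearMap
    (Man.d (tr T η).hom n).toLinearMap

lemma SymplecticForm.pb_apply (Ω : SymplecticForm 𝒳) (T : BasedFunctor 𝒴 𝒳) (η : 𝒴.obj)
    (n : 𝒴.p.obj η) (w w' : (𝒴.p.obj η).E) :
    Ω.pb T η n w w' = Ω.ev (T.obj η) (Man.fn (tr T η).hom n) (Man.d (tr T η).hom n w)
      (Man.d (tr T η).hom n w') := rfl

lemma SymplecticForm.pb_swap (Ω : SymplecticForm 𝒳) (T : BasedFunctor 𝒴 𝒳) (η : 𝒴.obj)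
    (n : 𝒴.p.obj η) (w w' : (𝒴.p.obj η).E) : Ω.pb T η n w w' = - Ω.pb T η n w' w :=
  Ω.ev_swap _ _ _ _

lemma SymplecticForm.ev_comp (Ω : SymplecticForm 𝒳) {ζ ζ' : 𝒳.obj} {M : Man} (p : M ⟶ 𝒳.p.obj ζ)
    (g : ζ ⟶ ζ') (m : M) (w w' : M.E) :
    Ω.ev ζ' (Man.fn (p ≫ 𝒳.p.map g) m) (Man.d (p ≫ 𝒳.p.map g) m w) (Man.d (p ≫ 𝒳.p.map g) m w') =
      Ω.ev ζ (Man.fn p m) (Man.d p m w) (Man.d p m w') := by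
  rw [Man.d_comp, Man.d_comp]
  exact Ω.ev_map g _ _ _

lemma SymplecticForm.pb_map (Ω : SymplecticForm 𝒳) (T : BasedFunctor 𝒴 𝒳) {η η' : 𝒴.obj}
    (a : η ⟶ η') (n : 𝒴.p.obj η) (w w' : (𝒴.p.obj η).E) :
    Ω.pb T η' (Man.fn (𝒴.p.map a) n) (Man.d (𝒴.p.map a) n w) (Man.d (𝒴.p.map a) n w') =
      Ω.pb T η n w w' := by
  have h := Ω.ev_comp (tr T η).hom (T.map a) n w w'
  rw [map_tr] at h
  rw [SymplecticForm.pb_apply, SymplecticForm.pb_apply, ← h, Man.d_comp, Man.d_comp]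
  rfl

lemma StackFunction.pull_congr (h : IsCFG 𝒳) {J : Set ℝ} (H : StackFunction (times J 𝒳)) {M : Man}
    {ζ ζ' : 𝒳.obj} {f f' : M ⟶ Man.vec ℝ} (hf : ∀ m, Man.fn f m ∈ J) (hf' : ∀ m, Man.fn f' m ∈ J)
    (p : M ⟶ 𝒳.p.obj ζ) (p' : M ⟶ 𝒳.p.obj ζ') (e : f = f')
    (hp : ∀ m, PtRel ζ ζ' (Man.fn p m) (Man.fn p' m)) :
    H.pull h f hf p = H.pull h f' hf' p' := by
  subst e
  ext m
  exact H.eval_ptRel _ (hp m)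

end

end

section

/-! ### The symplectic form along a Hamiltonian isotopy -/

section

variable {𝒳 : BasedCategory.{v, u} Man} {J : Set ℝ}

/-- The wedge product of two linear forms. -/
def wedge {E : Type} [AddCommGroup E] [Module ℝ E] (α β : E →ₗ[ℝ] ℝ) : E →ₗ[ℝ] E →ₗ[ℝ] ℝ :=
  α.smulRight β - β.smulRight α

/-- The object `{t} × ζ` of `J × 𝒳`. -/
abbrev sliceObj (ζ : 𝒳.obj) (t : J) : TimesObj J 𝒳 :=
  ⟨ζ, ContMDiffMap.const (t : ℝ), fun _ => t.2⟩

/-- The base of an object of `J × 𝒳` is identified with the base of its image under `F`. -/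
def trT (F : BasedFunctor (times J 𝒳) 𝒳) (η : TimesObj J 𝒳) :
    𝒳.p.obj η.pt ≅ 𝒳.p.obj (F.obj η) := tr F η

lemma map_trT (F : BasedFunctor (times J 𝒳) 𝒳) {η η' : TimesObj J 𝒳} (a : TimesHom η η') :
    (trT F η).hom ≫ 𝒳.p.map (F.map (X := η) (Y := η') a) = 𝒳.p.map a.hom ≫ (trT F η').hom :=
  map_tr F a

/-- The pullback along `F : J × 𝒳 → 𝒳` of a symplectic form. -/
def SymplecticForm.pbT (Ω : SymplecticForm 𝒳) (F : BasedFunctor (times J 𝒳) 𝒳) (η : TimesObj J 𝒳)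
    (n : base η.pt) : (base η.pt).E →ₗ[ℝ] (base η.pt).E →ₗ[ℝ] ℝ :=
  Ω.pb F η n

/-- The function `(t, x) ↦ H (t, F (t, x))` on the base of an object of `J × 𝒳`. -/
def StackFunction.along (h : IsCFG 𝒳) (H : StackFunction (times J 𝒳))
    (F : BasedFunctor (times J 𝒳) 𝒳) (η : TimesObj J 𝒳) : 𝒳.p.obj η.pt ⟶ Man.vec ℝ :=
  H.pull h (time η) (time_mem η) (trT F η).hom

lemma StackFunction.map_along (h : IsCFG 𝒳) (H : StackFunction (times J 𝒳))
    (F : BasedFunctor (times J 𝒳) 𝒳) {η η' : TimesObj J 𝒳} (a : TimesHom η η') :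
    𝒳.p.map a.hom ≫ H.along h F η' = H.along h F η := by
  refine (H.comp_pull h (𝒳.p.map a.hom) (time η') (time_mem η') (trT F η').hom).trans ?_
  refine H.pull_congr h _ _ _ _ (map_time a) fun m => ?_
  rw [← map_trT F a]
  exact (PtRel.of_arrow _ _).symm

/-- The defect in the identity `F^* Ω = Ω + dt ∧ d(H ∘ (t, F))`. -/
def gap (h : IsCFG 𝒳) (Ω : SymplecticForm 𝒳) (F : BasedFunctor (times J 𝒳) 𝒳)
    (H : StackFunction (times J 𝒳)) (η : TimesObj J 𝒳) (n : base η.pt) :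
    (base η.pt).E →ₗ[ℝ] (base η.pt).E →ₗ[ℝ] ℝ :=
  Ω.pbT F η n - Ω.ev η.pt n - wedge (Man.d (time η) n).toLinearMap
    (Man.d (H.along h F η) n).toLinearMap

lemma gap_apply (h : IsCFG 𝒳) (Ω : SymplecticForm 𝒳) (F : BasedFunctor (times J 𝒳) 𝒳)
    (H : StackFunction (times J 𝒳)) (η : TimesObj J 𝒳) (n : base η.pt) (w w' : (base η.pt).E) :
    gap h Ω F H η n w w' = Ω.pbT F η n w w' - Ω.ev η.pt n w w' -
      ((Man.d (time η) n w : ℝ) * Man.d (H.along h F η) n w' -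
        Man.d (H.along h F η) n w * (Man.d (time η) n w' : ℝ)) := rfl

lemma gap_swap (h : IsCFG 𝒳) (Ω : SymplecticForm 𝒳) (F : BasedFunctor (times J 𝒳) 𝒳)
    (H : StackFunction (times J 𝒳)) (η : TimesObj J 𝒳) (n : base η.pt) (w w' : (base η.pt).E) :
    gap h Ω F H η n w w' = - gap h Ω F H η n w' w := by
  rw [gap_apply, gap_apply, Ω.ev_swap _ _ w, show Ω.pbT F η n w w' = - Ω.pbT F η n w' w from
    Ω.pb_swap _ _ _ _ _]
  ring

lemma SymplecticForm.pbT_map (Ω : SymplecticForm 𝒳) (F : BasedFunctor (times J 𝒳) 𝒳)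
    {η η' : TimesObj J 𝒳} (a : TimesHom η η') (n : base η.pt) (w w' : (base η.pt).E) :
    Ω.pbT F η' (baseMap a.hom n) (Man.d (𝒳.p.map a.hom) n w) (Man.d (𝒳.p.map a.hom) n w') =
      Ω.pbT F η n w w' :=
  Ω.pb_map F (η := η) (η' := η') a n w w'

lemma gap_map (h : IsCFG 𝒳) (Ω : SymplecticForm 𝒳) (F : BasedFunctor (times J 𝒳) 𝒳)
    (H : StackFunction (times J 𝒳)) {η η' : TimesObj J 𝒳} (a : TimesHom η η') (n : base η.pt)
    (w w' : (base η.pt).E) :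
    gap h Ω F H η' (baseMap a.hom n) (Man.d (𝒳.p.map a.hom) n w) (Man.d (𝒳.p.map a.hom) n w') =
      gap h Ω F H η n w w' := by
  rw [gap_apply, gap_apply, Ω.pbT_map, Ω.ev_map, ← map_time (η := η) (η' := η') a,
    ← H.map_along h F a, Man.d_comp, Man.d_comp, Man.d_comp, Man.d_comp]

/-- The object of `J × 𝒳` over a manifold mapping to the bases of two objects of `J × 𝒳`. -/
lemma IsCFG.exists_common_timesObj (h : IsCFG 𝒳) {η η' : TimesObj J 𝒳} {ζ : 𝒳.obj}
    (b : η.pt ⟶ ζ) (b' : η'.pt ⟶ ζ) {M : Man} (j : M ⟶ 𝒳.p.obj η.pt) (j' : M ⟶ 𝒳.p.obj η'.pt)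
    (hj : j ≫ 𝒳.p.map b = j' ≫ 𝒳.p.map b') (ht : j ≫ time η = j' ≫ time η') :
    ∃ (θ : TimesObj J 𝒳) (i : M ≅ 𝒳.p.obj θ.pt) (a : TimesHom θ η) (a' : TimesHom θ η'),
      i.hom ≫ 𝒳.p.map a.hom = j ∧ i.hom ≫ 𝒳.p.map a'.hom = j' := by
  obtain ⟨θ, i, c, hc, hi⟩ := h.exists_timesObj ζ (j ≫ 𝒳.p.map b) (j ≫ time η)
    (fun m => time_mem η _)
  obtain ⟨a, ha, -⟩ := h.exists_times_factor b c (i.inv ≫ j)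
    (by rw [Category.assoc, ← hc, Iso.inv_hom_id_assoc])
    (by rw [Category.assoc, ← hi, Iso.inv_hom_id_assoc])
  obtain ⟨a', ha', -⟩ := h.exists_times_factor b' c (i.inv ≫ j')
    (by rw [Category.assoc, ← hj, ← hc, Iso.inv_hom_id_assoc])
    (by rw [Category.assoc, ← ht, ← hi, Iso.inv_hom_id_assoc])
  exact ⟨θ, i, a, a', by rw [ha, Iso.hom_inv_id_assoc], by rw [ha', Iso.hom_inv_id_assoc]⟩

lemma gap_congr (h : IsCFG 𝒳) (Ω : SymplecticForm 𝒳) (F : BasedFunctor (times J 𝒳) 𝒳)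
    (H : StackFunction (times J 𝒳)) {η η' : TimesObj J 𝒳} {ζ : 𝒳.obj}
    (b : η.pt ⟶ ζ) (b' : η'.pt ⟶ ζ) {M : Man} (j : M ⟶ 𝒳.p.obj η.pt) (j' : M ⟶ 𝒳.p.obj η'.pt)
    (hj : j ≫ 𝒳.p.map b = j' ≫ 𝒳.p.map b') (ht : j ≫ time η = j' ≫ time η') (m : M) (w w' : M.E) :
    gap h Ω F H η (Man.fn j m) (Man.d j m w) (Man.d j m w') =
      gap h Ω F H η' (Man.fn j' m) (Man.d j' m w) (Man.d j' m w') := by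
  obtain ⟨θ, i, a, a', rfl, rfl⟩ := h.exists_common_timesObj b b' j j' hj ht
  simp only [Man.d_comp, Man.fn_comp]
  exact (gap_map h Ω F H a _ _ _).trans (gap_map h Ω F H a' _ _ _).symm

lemma SymplecticForm.pbT_congr (h : IsCFG 𝒳) (Ω : SymplecticForm 𝒳)
    (F : BasedFunctor (times J 𝒳) 𝒳) {η η' : TimesObj J 𝒳} {ζ : 𝒳.obj}
    (b : η.pt ⟶ ζ) (b' : η'.pt ⟶ ζ) {M : Man} (j : M ⟶ 𝒳.p.obj η.pt) (j' : M ⟶ 𝒳.p.obj η'.pt)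
    (hj : j ≫ 𝒳.p.map b = j' ≫ 𝒳.p.map b') (ht : j ≫ time η = j' ≫ time η') (m : M) (w w' : M.E) :
    Ω.pbT F η (Man.fn j m) (Man.d j m w) (Man.d j m w') =
      Ω.pbT F η' (Man.fn j' m) (Man.d j' m w) (Man.d j' m w') := by
  obtain ⟨θ, i, a, a', rfl, rfl⟩ := h.exists_common_timesObj b b' j j' hj ht
  simp only [Man.d_comp, Man.fn_comp]
  exact (Ω.pbT_map F a _ _ _).trans (Ω.pbT_map F a' _ _ _).symm

/-- The identity `F^* Ω = Ω + dt ∧ d(H ∘ (t, F))` on `J × 𝒳`, which characterizes the integrals of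
the Hamiltonian vector field of `H` among the isotopies of symplectic maps. -/
def Star (h : IsCFG 𝒳) (Ω : SymplecticForm 𝒳) (F : BasedFunctor (times J 𝒳) 𝒳)
    (H : StackFunction (times J 𝒳)) : Prop :=
  ∀ (η : TimesObj J 𝒳) (n : base η.pt) (w w' : (base η.pt).E), gap h Ω F H η n w w' = 0

/-- The values of a vector field as elements of the model vector space. -/
def TimeVectorField.vec (X : TimeVectorField 𝒳 J) (ζ : 𝒳.obj) (hζ : IsEtale ζ) (t : J)
    (x : base ζ) : (base ζ).E := X.val ζ hζ t x

/-- `X` is the Hamiltonian vector field of `H`. -/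
def IsHamiltonianField (h : IsCFG 𝒳) (Ω : SymplecticForm 𝒳) (H : StackFunction (times J 𝒳))
    (X : TimeVectorField 𝒳 J) : Prop :=
  ∀ (ζ : 𝒳.obj) (hζ : IsEtale ζ) (t : J) (x : base ζ) (e : (base ζ).E),
    Man.d (H.slice h t ζ) x e = Ω.ev ζ x (X.vec ζ hζ t x) e

lemma integrates_iff (F : BasedFunctor (times J 𝒳) 𝒳) (X : TimeVectorField 𝒳 J) :
    Integrates F X ↔ ∀ (η : TimesObj J 𝒳) (ξ : 𝒳.obj) (k : η.pt ⟶ ξ) (ζ : 𝒳.obj)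
      (hζ : IsEtale ζ) (g : F.obj η ⟶ ζ) (n : base η.pt) (e : (base η.pt).E),
      Man.d (𝒳.p.map k) n e = 0 → Man.d ((trT F η).hom ≫ 𝒳.p.map g) n e =
        (Man.d (time η) n e : ℝ) • X.vec ζ hζ ⟨Man.fn (time η) n, time_mem η n⟩
          (Man.fn ((trT F η).hom ≫ 𝒳.p.map g) n) :=
  Iff.rfl

end

section Interval

variable {𝒳 : BasedCategory.{v, u} Man} {a b : ℝ}

/-- Where the velocity in `𝒳` vanishes, `F` moves with velocity `(dt e) X`, so that both sides of
`F^* Ω = Ω + dt ∧ d(H ∘ (t, F))` agree on `e` by the definition of `X`; the time derivatives of `H`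
cancel. -/
lemma gap_contract_of_étale (h : IsCFG 𝒳) (hab : a < b) (Ω : SymplecticForm 𝒳)
    {F : BasedFunctor (times (Icc a b) 𝒳) 𝒳} {H : StackFunction (times (Icc a b) 𝒳)}
    {X : TimeVectorField 𝒳 (Icc a b)}
    (hX : IsHamiltonianField h Ω H X) (hF : Integrates F X)
    (η : TimesObj (Icc a b) 𝒳) {ξ : 𝒳.obj} (k : η.pt ⟶ ξ) {ζ : 𝒳.obj} (hζ : IsEtale ζ)
    (g : F.obj η ⟶ ζ) (n : base η.pt) (e w : (base η.pt).E) (he : Man.d (𝒳.p.map k) n e = 0) :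
    gap h Ω F H η n e w = 0 := by
  have hI := (integrates_iff F X).1 hF η ξ k ζ hζ g n e he
  set φ := (trT F η).hom ≫ 𝒳.p.map g with hφ
  have h₁ : Ω.pbT F η n e w = Ω.ev ζ (Man.fn φ n) (Man.d φ n e) (Man.d φ n w) :=
    (Ω.ev_comp (trT F η).hom g n e w).symm
  have h₂ : Ω.ev η.pt n e w = 0 := by
    have := Ω.ev_map k n e w
    rw [he, map_zero, LinearMap.zero_apply] at this
    exact this.symm
  have h₃ : H.along h F η = H.pull h (time η) (time_mem η) φ := (H.pull_map h _ _ _ g).symm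
  have hw := H.d_pull h (time η) (time_mem η) φ n w
  have he' := H.d_pull h (time η) (time_mem η) φ n e
  have hp := H.d_pull_const_proportional h hab (time η) (time_mem η) (Man.fn φ n) n e w
  rw [hX ζ hζ] at hw he'
  rw [gap_apply, h₁, h₂, h₃, hw, he', hI, map_smul, map_smul, LinearMap.smul_apply,
    Ω.ev_self]
  simp only [smul_eq_mul]
  linear_combination -hp

/-- The contraction of the defect with a vector pointing in the time direction vanishes. -/
lemma gap_contract (h : IsOrbifold 𝒳) (hab : a < b) (Ω : SymplecticForm 𝒳)
    {F : BasedFunctor (times (Icc a b) 𝒳) 𝒳} {H : StackFunction (times (Icc a b) 𝒳)}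
    {X : TimeVectorField 𝒳 (Icc a b)}
    (hX : IsHamiltonianField h.toIsCFG Ω H X) (hF : Integrates F X)
    (η : TimesObj (Icc a b) 𝒳) {ξ : 𝒳.obj} (k : η.pt ⟶ ξ) (n : base η.pt) (e w : (base η.pt).E)
    (he : Man.d (𝒳.p.map k) n e = 0) : gap h.toIsCFG Ω F H η n e w = 0 := by
  obtain ⟨ζ, hζ, -, hζ'⟩ := h.exists_étale_atlas
  have hT := isCFG_times (Icc a b) h.toIsCFG
  obtain ⟨θ, c, g, hpb⟩ := exists_isPullback hT h.toIsCFG F hζ' η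
  obtain ⟨x, hx⟩ := hζ.exists_pt (F.obj η) (Man.fn (trT F η).hom n)
  obtain ⟨m, rfl, -⟩ := hpb.exists_pt hT h.toIsCFG hx
  let c' : TimesHom θ η := c
  have hbij := Man.d_bijective_of_isLocalDiffeomorph (f := 𝒳.p.map c'.hom) hpb.étale m
  obtain ⟨e', rfl⟩ := hbij.2 e
  obtain ⟨w', rfl⟩ := hbij.2 w
  refine (gap_map h.toIsCFG Ω F H c' m e' w').trans ?_
  refine gap_contract_of_étale h.toIsCFG hab Ω hX hF θ (c'.hom ≫ k) hζ' g m e' w' ?_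
  refine Eq.trans ?_ he
  rw [Functor.map_comp]
  exact Man.d_comp (𝒳.p.map c'.hom) (𝒳.p.map k) m e'

/-- The maps `F_t` all pull the symplectic form back to the same form. It is enough to see this on a
surface `σ` in `𝒳`. The pullback `B` of `Ω` along `(τ, z) ↦ F (osc τ, σ z)` is closed and its
contraction with `∂_τ` is `osc' τ` times the differential of a function in the directions of `z`, so
that the restriction of `B` to the planes of constant `τ` does not depend on `τ`. -/
lemma pbT_sliceObj_eq (h : IsOrbifold 𝒳) (hab : a < b) (Ω : SymplecticForm 𝒳)
    {F : BasedFunctor (times (Icc a b) 𝒳) 𝒳} {H : StackFunction (times (Icc a b) 𝒳)}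
    {X : TimeVectorField 𝒳 (Icc a b)}
    (hX : IsHamiltonianField h.toIsCFG Ω H X) (hF : Integrates F X)
    (ζ : 𝒳.obj) (t t' : Icc a b) (y : base ζ) (w w' : (base ζ).E) :
    Ω.pbT F (sliceObj ζ t) y w w' = Ω.pbT F (sliceObj ζ t') y w w' := by
  obtain ⟨σ, rfl, rfl, rfl⟩ := Man.exists_surface (base ζ) y w w'
  let V := ℝ × ℝ × ℝ
  let M := Man.vec V
  let fst' : M ⟶ Man.vec ℝ := Man.ofFun (M := M) (N := Man.vec ℝ) (Prod.fst : V → ℝ)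
    contDiff_fst.contMDiff
  let snd' : M ⟶ Man.vec (ℝ × ℝ) := Man.ofFun (M := M) (N := Man.vec (ℝ × ℝ)) (Prod.snd : V → ℝ × ℝ)
    contDiff_snd.contMDiff
  obtain ⟨η, i, c, hc, hi⟩ := h.toIsCFG.exists_timesObj ζ (snd' ≫ σ) (fst' ≫ oscHom a b)
    (fun m => osc_mem hab.le _)
  let q : M ⟶ 𝒳.p.obj (F.obj η) := i.hom ≫ (trT F η).hom
  obtain ⟨B, hBs, hBd, hB⟩ := Ω.exists_pullback h.toIsCFG q
  have hBpb : ∀ y u w : V, B y ![u, w] =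
      Ω.pbT F η (Man.fn i.hom y) (Man.d i.hom y u) (Man.d i.hom y w) := by
    intro y u w
    rw [hB, Man.d_comp, Man.d_comp]
    rfl
  let hh : M ⟶ Man.vec ℝ := i.hom ≫ H.along h.toIsCFG F η
  have hfst : ∀ (y : V) (u : V), Man.d fst' y u = u.1 := by
    intro y u
    have : mfderiv 𝓘(ℝ, V) 𝓘(ℝ, ℝ) (Prod.fst : V → ℝ) y = ContinuousLinearMap.fst ℝ ℝ (ℝ × ℝ) := by
      rw [mfderiv_eq_fderiv]
      exact fderiv_fst
    exact DFunLike.congr_fun this u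
  have hsnd : ∀ (y : V) (u : V), Man.d snd' y u = u.2 := by
    intro y u
    have : mfderiv 𝓘(ℝ, V) 𝓘(ℝ, ℝ × ℝ) (Prod.snd : V → ℝ × ℝ) y =
        ContinuousLinearMap.snd ℝ ℝ (ℝ × ℝ) := by
      rw [mfderiv_eq_fderiv]
      exact fderiv_snd
    exact DFunLike.congr_fun this u
  let ft : V → ℝ := fun y => osc a b y.1
  have hft : ContDiff ℝ ∞ ft := (contDiff_osc a b).comp contDiff_fst
  have hdt : ∀ y u : V, (Man.d (time η) (Man.fn i.hom y) (Man.d i.hom y u) : ℝ) =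
      fderiv ℝ ft y u := by
    intro y u
    have e₁ : Man.d (i.hom ≫ time η) y u = mfderiv 𝓘(ℝ, V) 𝓘(ℝ, ℝ) ft y u := by
      rw [hi]
      rfl
    rw [Man.d_comp, mfderiv_eq_fderiv] at e₁
    exact e₁
  have hdft : ∀ y u : V, fderiv ℝ ft y u = u.1 * deriv (osc a b) y.1 := by
    intro y u
    have h1 : HasFDerivAt ft _ y := (((contDiff_osc a b).differentiable (by simp) y.1).hasFDerivAt).comp y
      (hasFDerivAt_fst (p := y))
    rw [h1.fderiv]
    exact fderiv_eq_smul_deriv u.1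
  have hdh : ∀ y u : V, (Man.d (H.along h.toIsCFG F η) (Man.fn i.hom y) (Man.d i.hom y u) : ℝ) =
      fderiv ℝ (fun y : V => (Man.fn hh y : ℝ)) y u := by
    intro y u
    have e₁ : Man.d hh y u = mfderiv 𝓘(ℝ, V) 𝓘(ℝ, ℝ) (fun y : V => (Man.fn hh y : ℝ)) y u := rfl
    rw [Man.d_comp, mfderiv_eq_fderiv] at e₁
    exact e₁
  have hcon : ∀ y : V, ∀ u : ℝ × ℝ, B y ![(1, 0), (0, u)] = deriv (osc a b) y.1 *
      fderiv ℝ (fun y : V => (Man.fn hh y : ℝ)) y (0, u) := by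
    intro y u
    have e₀ : Man.d (𝒳.p.map c) (Man.fn i.hom y) (Man.d i.hom y ((1, 0) : V)) = 0 := by
      rw [← Man.d_comp, hc, Man.d_comp, hsnd]
      exact map_zero (Man.d σ _)
    have e₁ := gap_contract h hab Ω hX hF η c (Man.fn i.hom y) (Man.d i.hom y ((1, 0) : V))
      (Man.d i.hom y ((0, u) : V)) e₀
    have e₂ : Ω.ev η.pt (Man.fn i.hom y) (Man.d i.hom y ((1, 0) : V)) (Man.d i.hom y ((0, u) : V)) =
        0 := by
      rw [← Ω.ev_map c, e₀, map_zero, LinearMap.zero_apply]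
    rw [gap_apply, e₂, hdt, hdt, hdh, hdh, hdft, hdft, ← hBpb] at e₁
    simp only [one_mul, zero_mul, mul_zero, sub_zero] at e₁
    exact sub_eq_zero.1 e₁
  have hg : Differentiable ℝ (fun y : V => deriv (osc a b) y.1) :=
    ((contDiff_infty_iff_deriv.1 (contDiff_osc a b)).2.differentiable (by simp)).comp
      differentiable_fst
  have hdg : ∀ (y : V) (u : ℝ × ℝ), fderiv ℝ (fun y : V => deriv (osc a b) y.1) y (0, u) = 0 := by
    intro y u
    have h1 := ((contDiff_infty_iff_deriv.1 (contDiff_osc a b)).2.differentiable (by simp)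
      y.1).hasFDerivAt.comp y (hasFDerivAt_fst (𝕜 := ℝ) (p := y))
    have h2 : fderiv ℝ (fun y : V => deriv (osc a b) y.1) y = _ := h1.fderiv
    rw [h2]
    exact map_zero (fderiv ℝ (deriv (osc a b)) y.1)
  have hconst := const_of_extDeriv_eq_zero B hBs hBd (fun y : V => deriv (osc a b) y.1)
    (fun y : V => (Man.fn hh y : ℝ)) hg (contMDiff_iff_contDiff.1 (Man.contMDiff_fn hh))
    (1, 0) (0, (1, 0)) (0, (0, 1)) (fun y => hdg y _) (fun y => hdg y _) (fun y => hcon y _)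
    (fun y => hcon y _)
  -- the plane at time `τ` computes the pullback under `F_t` for `t = osc τ`
  have hslice : ∀ (τ : ℝ) (t : Icc a b), osc a b τ = t → ∀ u u' : ℝ × ℝ,
      B (τ • (1, 0)) ![(0, u), (0, u')] = Ω.pbT F (sliceObj ζ t) (Man.fn σ (0 : ℝ × ℝ))
        (Man.d σ (0 : ℝ × ℝ) u) (Man.d σ (0 : ℝ × ℝ) u') := by
    intro τ t hτ u u'
    let j : Man.vec (ℝ × ℝ) ⟶ M := Man.ofFun (M := Man.vec (ℝ × ℝ)) (N := M)
      (fun z : ℝ × ℝ => ((τ, z) : V)) (contDiff_const.prodMk contDiff_id).contMDiff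
    have hdj : ∀ z u : ℝ × ℝ, Man.d j z u = ((0, u) : V) := by
      intro z u
      have h1 := Man.d_comp j fst' z u
      have h2 := Man.d_comp j snd' z u
      rw [hfst] at h1
      rw [hsnd] at h2
      have h3 : j ≫ fst' = Man.const _ τ := rfl
      have h4 : j ≫ snd' = 𝟙 _ := rfl
      rw [h3, Man.d_const] at h1
      rw [h4, Man.d_id] at h2
      exact Prod.ext h1.symm h2.symm
    have h1 := Ω.pbT_congr h.toIsCFG F (η := η) (η' := sliceObj ζ t) c (𝟙 ζ) (j ≫ i.hom) σ
      (by
        rw [Category.assoc, hc, 𝒳.p.map_id, Category.comp_id]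
        rfl)
      (by
        rw [Category.assoc, hi]
        ext z
        exact hτ) (0 : ℝ × ℝ) u u'
    rw [← h1, hBpb]
    have h2 : τ • ((1, 0) : V) = (τ, 0) := by ext <;> simp
    rw [h2, Man.d_comp, Man.d_comp, hdj, hdj]
    rfl
  obtain ⟨τ, -, hτ⟩ := exists_osc_eq hab t.2
  obtain ⟨τ', -, hτ'⟩ := exists_osc_eq hab t'.2
  rw [← hslice τ t hτ, ← hslice τ' t' hτ']
  exact hconst τ τ'

/-- If `F` integrates the Hamiltonian vector field of `H` and the map `F_{t₀}` is symplectic for one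
time `t₀`, then `F^* Ω = Ω + dt ∧ d(H ∘ (t, F))`. -/
lemma star_of_integrates (h : IsOrbifold 𝒳) (hab : a < b) (Ω : SymplecticForm 𝒳)
    {F : BasedFunctor (times (Icc a b) 𝒳) 𝒳} {H : StackFunction (times (Icc a b) 𝒳)}
    {X : TimeVectorField 𝒳 (Icc a b)}
    (hX : IsHamiltonianField h.toIsCFG Ω H X) (hF : Integrates F X)
    (t₀ : Icc a b) (h₀ : ∀ (ζ : 𝒳.obj) (y : base ζ) (w w' : (base ζ).E),
      Ω.pbT F (sliceObj ζ t₀) y w w' = Ω.ev ζ y w w') : Star h.toIsCFG Ω F H := by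
  have hsl : ∀ (t : Icc a b) (ζ : 𝒳.obj) (y : base ζ) (w w' : (base ζ).E),
      gap h.toIsCFG Ω F H (sliceObj ζ t) y w w' = 0 := by
    intro t ζ y w w'
    have h1 : ∀ w, (Man.d (time (sliceObj ζ t)) y w : ℝ) = 0 := fun w =>
      Man.d_const (M := base ζ) (N := Man.vec ℝ) (t : ℝ) y w
    have h2 : Ω.pbT F (sliceObj ζ t) y w w' = Ω.ev ζ y w w' :=
      (pbT_sliceObj_eq h hab Ω hX hF ζ t t₀ y w w').trans (h₀ ζ y w w')
    rw [gap_apply, h1 w, h1 w', h2, zero_mul, mul_zero, sub_zero, sub_zero]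
    exact sub_self _
  intro η n w w'
  let N := base η.pt
  obtain ⟨η', i, c, hc, hi⟩ := h.toIsCFG.exists_timesObj η.pt (Man.snd N N) (Man.fst N N ≫ time η)
    (fun m => time_mem η _)
  let Δ : N ⟶ N.prod N := Man.pair (𝟙 N) (𝟙 N)
  have e₁ := gap_congr h.toIsCFG Ω F H (η := η) (η' := η') (𝟙 η.pt) c (𝟙 N) (Δ ≫ i.hom)
    (by
      rw [Category.assoc, hc, 𝒳.p.map_id]
      rfl)
    (by
      rw [Category.assoc, hi]
      rfl) n w w'
  rw [Man.d_id, Man.d_id, Man.d_comp, Man.d_comp, Man.d_pair, Man.d_pair] at e₁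
  simp only [Man.d_id] at e₁
  refine e₁.trans ?_
  set G := gap h.toIsCFG Ω F H η' (Man.fn (Δ ≫ i.hom) n) with hG
  have hsplit : ∀ w : N.E, Man.d i.hom (Man.fn Δ n) ((w, w) : N.E × N.E) =
      Man.d i.hom (Man.fn Δ n) ((w, 0) : N.E × N.E) + Man.d i.hom (Man.fn Δ n) ((0, w) : N.E × N.E) := by
    intro w
    have : ((w, w) : N.E × N.E) = (w, 0) + (0, w) := by simp
    rw [this]
    exact map_add (Man.d i.hom (Man.fn Δ n)) _ _
  have hzero : ∀ (w : N.E) (z : (base η'.pt).E),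
      G (Man.d i.hom (Man.fn Δ n) ((w, 0) : N.E × N.E)) z = 0 := by
    intro w z
    refine gap_contract h hab Ω hX hF η' c _ _ _ ?_
    have := Man.d_comp i.hom (𝒳.p.map c) (Man.fn Δ n) ((w, 0) : N.E × N.E)
    rw [hc, Man.d_snd] at this
    exact this.symm
  have hzero' : ∀ (w : N.E) (z : (base η'.pt).E),
      G z (Man.d i.hom (Man.fn Δ n) ((w, 0) : N.E × N.E)) = 0 := by
    intro w z
    rw [hG, gap_swap, ← hG, hzero, neg_zero]
  have hlast : G (Man.d i.hom (Man.fn Δ n) ((0, w) : N.E × N.E))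
      (Man.d i.hom (Man.fn Δ n) ((0, w') : N.E × N.E)) = 0 := by
    let j : N ⟶ N.prod N := Man.pair (Man.const N n) (𝟙 N)
    have e₂ := gap_congr h.toIsCFG Ω F H (η := η')
      (η' := sliceObj η.pt ⟨Man.fn (time η) n, time_mem η n⟩) c (𝟙 η.pt) (j ≫ i.hom) (𝟙 N)
      (by
        rw [Category.assoc, hc, 𝒳.p.map_id]
        rfl)
      (by
        rw [Category.assoc, hi]
        rfl) n w w'
    rw [hsl, Man.d_comp, Man.d_comp, Man.d_pair, Man.d_pair] at e₂
    simp only [Man.d_id, Man.d_const] at e₂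
    exact e₂
  rw [hsplit w, hsplit w', (G _).map_add, hzero', G.map_add, LinearMap.add_apply, hzero, hlast]
  simp

end Interval

end

section

/-! ### Characterization of Hamiltonian isotopies by forms -/

section

variable {𝒳 : BasedCategory.{v, u} Man} {J : Set ℝ}

/-- All étale charts of an orbifold have the same dimension, wherever they are nonempty. -/
lemma IsOrbifold.finrank_eq (h : IsOrbifold 𝒳) {ζ ζ' : 𝒳.obj} (hζ : IsEtale ζ) (hζ' : IsEtale ζ')
    (x : base ζ) (x' : base ζ') : Module.finrank ℝ (base ζ).E = Module.finrank ℝ (base ζ').E := by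
  obtain ⟨ξ, hξ, -, hξ'⟩ := h.exists_étale_atlas
  obtain ⟨y, hy⟩ := hξ.exists_pt ζ x
  obtain ⟨y', hy'⟩ := hξ.exists_pt ζ' x'
  exact (hζ.finrank_eq hξ' hy).trans (hζ'.finrank_eq hξ' hy').symm

/-- A linear map between tangent spaces of étale charts that preserves the symplectic form is
bijective. -/
lemma SymplecticForm.bijective_of_preserves (h : IsOrbifold 𝒳) (Ω : SymplecticForm 𝒳) {ζ ζ' : 𝒳.obj}
    (hζ : IsEtale ζ) (hζ' : IsEtale ζ') (x : base ζ) (x' : base ζ')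
    (L : (base ζ).E →ₗ[ℝ] (base ζ').E)
    (hL : ∀ w w', Ω.ev ζ' x' (L w) (L w') = Ω.ev ζ x w w') : Function.Bijective L := by
  have hinj : Function.Injective L := fun w w' e =>
    Ω.ev_nondegenerate hζ x fun u => by rw [← hL, ← hL, e]
  exact ⟨hinj, (LinearMap.injective_iff_surjective_of_finrank_eq_finrank
    (h.finrank_eq hζ hζ' x x')).1 hinj⟩

/-- If `F^* Ω = Ω + dt ∧ dh`, then `F` is étale in the space directions. -/
lemma Star.bijective (h : IsOrbifold 𝒳) {Ω : SymplecticForm 𝒳}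
    {F : BasedFunctor (times J 𝒳) 𝒳} {H : StackFunction (times J 𝒳)} (hF : Star h.toIsCFG Ω F H)
    (ρ : TimesObj J 𝒳) {ζ₀ ζ : 𝒳.obj} (hζ₀ : IsEtale ζ₀) (hζ : IsEtale ζ) (k : ρ.pt ⟶ ζ₀)
    (g : F.obj ρ ⟶ ζ) (m : base ρ.pt) (L : (base ζ₀).E →ₗ[ℝ] (base ρ.pt).E)
    (ht : ∀ w, (Man.d (time ρ) m (L w) : ℝ) = 0) (hk : ∀ w, Man.d (𝒳.p.map k) m (L w) = w) :
    Function.Bijective fun w => Man.d ((trT F ρ).hom ≫ 𝒳.p.map g) m (L w) := by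
  refine Ω.bijective_of_preserves h hζ₀ hζ (baseMap k m)
    (Man.fn ((trT F ρ).hom ≫ 𝒳.p.map g) m)
    ((Man.d ((trT F ρ).hom ≫ 𝒳.p.map g) m).toLinearMap ∘ₗ L) fun w w' => ?_
  have h₁ := hF ρ m (L w) (L w')
  rw [gap_apply, ht, ht, zero_mul, mul_zero, sub_zero, sub_zero, sub_eq_zero] at h₁
  have h₂ := Ω.ev_map k m (L w) (L w')
  rw [hk, hk] at h₂
  rw [h₂]
  exact (Ω.ev_comp (trT F ρ).hom g m (L w) (L w')).trans h₁

/-- Étale locally, an object of `J × 𝒳` maps to a given étale chart around a given point. -/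
lemma IsCFG.exists_lift_forget (h : IsCFG 𝒳) {ζ : 𝒳.obj} (hζ : IsEtale ζ) (η : TimesObj J 𝒳)
    {n : base η.pt} {x : base ζ} (hx : PtRel η.pt ζ n x) :
    ∃ (θ : TimesObj J 𝒳) (c : TimesHom θ η) (g : θ.pt ⟶ ζ) (m : base θ.pt),
      baseMap c.hom m = n ∧ baseMap g m = x ∧
        IsLocalDiffeomorph (base θ.pt).I (base η.pt).I ∞ (baseMap c.hom) := by
  have hT := isCFG_times J h
  obtain ⟨θ, c, g, hpb⟩ := exists_isPullback hT h (forget J 𝒳) hζ η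
  obtain ⟨m, hm, hm'⟩ := hpb.exists_pt hT h (x := x) hx
  exact ⟨θ, c, g, m, hm, hm', hpb.étale⟩

/-- Stationarity of a map to `𝒳` in a given direction does not depend on the chart. -/
lemma IsEtale.d_eq_zero {ζ ξ θ : 𝒳.obj} (hζ : IsEtale ζ) (k : θ ⟶ ξ) (g : θ ⟶ ζ) (n : base θ)
    (e : (base θ).E) (he : Man.d (𝒳.p.map k) n e = 0) : Man.d (𝒳.p.map g) n e = 0 := by
  obtain ⟨κ, α, β, hfib, hβ⟩ := hζ ξ
  obtain ⟨c, ⟨hc, hc'⟩, -⟩ := hfib θ g k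
  have hbij := Man.d_bijective_of_isLocalDiffeomorph (f := 𝒳.p.map β) hβ (baseMap c n)
  have h₁ : Man.d (𝒳.p.map β) (baseMap c n) (Man.d (𝒳.p.map c) n e) = 0 := by
    have := Man.d_comp (𝒳.p.map c) (𝒳.p.map β) n e
    rw [← Functor.map_comp, hc', he] at this
    exact this.symm
  have h₂ : Man.d (𝒳.p.map c) n e = 0 := hbij.1 (h₁.trans (map_zero _).symm)
  have := Man.d_comp (𝒳.p.map c) (𝒳.p.map α) n e
  rw [← Functor.map_comp, hc, h₂, map_zero] at this
  exact this

end

section Interval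

variable {𝒳 : BasedCategory.{v, u} Man} {a b : ℝ}

/-- For `dk e = 0` the identity `F^* Ω = Ω + dt ∧ d(H ∘ (t, F))` says that `dφ e` pairs with `dφ v`
as `(dt e) X` does, for all `v` in the space directions, where `φ` is `F` read in charts. These `dφ v`
are all tangent vectors, and `Ω` is nondegenerate. -/
lemma Star.integrates_of_étale (h : IsOrbifold 𝒳) (hab : a < b) {Ω : SymplecticForm 𝒳}
    {F : BasedFunctor (times (Icc a b) 𝒳) 𝒳} {H : StackFunction (times (Icc a b) 𝒳)}
    (hF : Star h.toIsCFG Ω F H) {X : TimeVectorField 𝒳 (Icc a b)}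
    (hX : IsHamiltonianField h.toIsCFG Ω H X) (η : TimesObj (Icc a b) 𝒳) {ζ₀ ζ : 𝒳.obj}
    (hζ₀ : IsEtale ζ₀) (k : η.pt ⟶ ζ₀) (hζ : IsEtale ζ) (g : F.obj η ⟶ ζ) (n : base η.pt)
    (e : (base η.pt).E) (he : Man.d (𝒳.p.map k) n e = 0) :
    Man.d ((trT F η).hom ≫ 𝒳.p.map g) n e =
        (Man.d (time η) n e : ℝ) • X.vec ζ hζ ⟨Man.fn (time η) n, time_mem η n⟩
          (Man.fn ((trT F η).hom ≫ 𝒳.p.map g) n) := by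
  have hT := isCFG_times (Icc a b) h.toIsCFG
  -- replace the base of `η` by its product with the chart `ζ₀`
  obtain ⟨η₀, i, c, hc, hi⟩ := h.toIsCFG.exists_timesObj ζ₀ (Man.snd (base η.pt) (base ζ₀))
    (Man.fst (base η.pt) (base ζ₀) ≫ time η) (fun m => time_mem η _)
  let s : base η.pt ⟶ (base η.pt).prod (base ζ₀) := Man.pair (𝟙 _) (𝒳.p.map k)
  obtain ⟨j, hj, -⟩ := h.toIsCFG.exists_times_factor (η := η) (η' := η₀) c k (s ≫ i.hom)
    (by
      rw [Category.assoc, hc]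
      rfl)
    (by
      rw [Category.assoc, hi]
      rfl)
  obtain ⟨ρ, b', g', hpb⟩ := exists_isPullback hT h.toIsCFG F hζ η₀
  obtain ⟨r, hr, hr'⟩ := hpb.lift η j g
  let ρ' : TimesObj (Icc a b) 𝒳 := ρ
  let r' : TimesHom η ρ' := r
  let bb : TimesHom ρ' η₀ := b'
  let gg : F.obj ρ' ⟶ ζ := g'
  have hr₁ : r'.hom ≫ bb.hom = j.hom := congrArg TimesHom.hom hr
  have hr₂ : F.map (X := η) (Y := ρ') r' ≫ gg = g := hr'
  set φ := (trT F ρ').hom ≫ 𝒳.p.map gg with hφ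
  have hφη : (trT F η).hom ≫ 𝒳.p.map g = 𝒳.p.map r'.hom ≫ φ := by
    rw [hφ, ← Category.assoc, ← map_trT F r', Category.assoc, ← Functor.map_comp, hr₂]
  set m := baseMap r'.hom n with hm
  set w := Man.d (𝒳.p.map r'.hom) n e with hw
  let q : base ρ'.pt ⟶ (base η.pt).prod (base ζ₀) := 𝒳.p.map bb.hom ≫ i.inv
  have hbij : Function.Bijective (Man.d q m) := by
    have h₁ := Man.d_bijective_of_isLocalDiffeomorph (f := 𝒳.p.map bb.hom) hpb.étale m
    have h₂ := Man.d_bijective_iso i.symm (Man.fn (𝒳.p.map bb.hom) m)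
    have h₃ : ⇑(Man.d q m) = Man.d i.inv (Man.fn (𝒳.p.map bb.hom) m) ∘ Man.d (𝒳.p.map bb.hom) m :=
      funext fun u => Man.d_comp _ _ _ _
    rw [h₃]
    exact h₂.comp h₁
  have hq₁ : q ≫ Man.fst _ _ ≫ time η = time ρ' := by
    rw [← hi, ← map_time (η := ρ') (η' := η₀) bb]
    simp [q]
  have hq₂ : q ≫ Man.snd _ _ = 𝒳.p.map (bb.hom ≫ c) := by
    rw [← hc, Functor.map_comp]
    simp [q]
  let Q := LinearEquiv.ofBijective (Man.d q m).toLinearMap hbij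
  -- the inclusion of the space directions
  let L : (base ζ₀).E →ₗ[ℝ] (base ρ'.pt).E :=
    Q.symm.toLinearMap ∘ₗ LinearMap.inr ℝ (base η.pt).E (base ζ₀).E
  have hQL : ∀ v, Man.d q m (L v) = ((0, v) : (base η.pt).E × (base ζ₀).E) := fun v =>
    Q.apply_symm_apply _
  have hLt : ∀ v, (Man.d (time ρ') m (L v) : ℝ) = 0 := by
    intro v
    rw [← hq₁, Man.d_comp, Man.d_comp, hQL, Man.d_fst]
    exact map_zero (Man.d (time η) _)
  have hLk : ∀ v, Man.d (𝒳.p.map (bb.hom ≫ c)) m (L v) = v := by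
    intro v
    rw [← hq₂, Man.d_comp, hQL, Man.d_snd]
  have hwk : Man.d (𝒳.p.map (bb.hom ≫ c)) m w = 0 := by
    have h₁ : r'.hom ≫ bb.hom ≫ c = j.hom ≫ c := by rw [← Category.assoc, hr₁]
    have h₂ := Man.d_comp (𝒳.p.map r'.hom) (𝒳.p.map (bb.hom ≫ c)) n e
    rw [← Functor.map_comp, h₁, Functor.map_comp, hj, Category.assoc, hc] at h₂
    exact h₂.symm.trans he
  have hwt : (Man.d (time ρ') m w : ℝ) = Man.d (time η) n e := by
    rw [← map_time (η := η) (η' := ρ') r', Man.d_comp]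
  have hsurj := (hF.bijective h ρ' hζ₀ hζ (bb.hom ≫ c) gg m L hLt hLk).2
  have htime : (⟨Man.fn (time η) n, time_mem η n⟩ : Icc a b) = ⟨Man.fn (time ρ') m, time_mem ρ' m⟩ :=
    Subtype.ext (congrArg (fun k => (Man.fn k n : ℝ)) (map_time (η := η) (η' := ρ') r').symm)
  rw [hφη, Man.d_comp, Man.fn_comp, htime, ← hwt]
  refine Ω.ev_nondegenerate hζ (Man.fn φ m) fun v => ?_
  obtain ⟨v₀, rfl⟩ := hsurj v
  rw [map_smul, LinearMap.smul_apply, ← hX]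
  have h₁ := hF ρ' m w (L v₀)
  have h₂ : Ω.ev ρ'.pt m w (L v₀) = 0 := by
    rw [← Ω.ev_map (bb.hom ≫ c), hwk, map_zero, LinearMap.zero_apply]
  have h₃ : Ω.pbT F ρ' m w (L v₀) = Ω.ev ζ (Man.fn φ m) (Man.d φ m w) (Man.d φ m (L v₀)) :=
    (Ω.ev_comp (trT F ρ').hom gg m w (L v₀)).symm
  have h₄ : H.along h.toIsCFG F ρ' = H.pull h.toIsCFG (time ρ') (time_mem ρ') φ :=
    (H.pull_map h.toIsCFG _ _ _ gg).symm
  have h₅ := H.d_pull h.toIsCFG (time ρ') (time_mem ρ') φ m (L v₀)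
  rw [H.d_pull_const_eq_zero h.toIsCFG hab (time ρ') (time_mem ρ') (Man.fn φ m) m (L v₀) (hLt v₀)]
    at h₅
  rw [gap_apply, h₂, h₃, hLt, mul_zero, sub_zero, sub_zero, h₄, h₅, sub_eq_zero] at h₁
  rw [h₁, smul_eq_mul]
  exact congrArg _ (add_zero _)

/-- If `F^* Ω = Ω + dt ∧ d(H ∘ (t, F))`, then `F` integrates the Hamiltonian vector field of `H`. -/
lemma Star.integrates (h : IsOrbifold 𝒳) (hab : a < b) {Ω : SymplecticForm 𝒳}
    {F : BasedFunctor (times (Icc a b) 𝒳) 𝒳} {H : StackFunction (times (Icc a b) 𝒳)}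
    (hF : Star h.toIsCFG Ω F H) {X : TimeVectorField 𝒳 (Icc a b)}
    (hX : IsHamiltonianField h.toIsCFG Ω H X) : Integrates F X := by
  rw [integrates_iff]
  intro η ξ k ζ hζ g n e he
  obtain ⟨ζ₀, hat, -, hζ₀⟩ := h.exists_étale_atlas
  obtain ⟨x, hx⟩ := hat.exists_pt η.pt n
  obtain ⟨θ', cc, gg, m, rfl, -, hloc⟩ := h.toIsCFG.exists_lift_forget hζ₀ η hx
  have hbij := Man.d_bijective_of_isLocalDiffeomorph (f := 𝒳.p.map cc.hom) hloc m
  obtain ⟨e, rfl⟩ := hbij.2 e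
  have he' : Man.d (𝒳.p.map (cc.hom ≫ k)) m e = 0 := by
    refine Eq.trans ?_ he
    rw [Functor.map_comp]
    exact Man.d_comp (𝒳.p.map cc.hom) (𝒳.p.map k) m e
  have key := hF.integrates_of_étale h hab hX θ' hζ₀ gg hζ (F.map (X := θ') (Y := η) cc ≫ g) m e
    (hζ₀.d_eq_zero (cc.hom ≫ k) gg m e he')
  have h₁ : (trT F θ').hom ≫ 𝒳.p.map (F.map (X := θ') (Y := η) cc ≫ g) =
      𝒳.p.map cc.hom ≫ (trT F η).hom ≫ 𝒳.p.map g := by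
    rw [Functor.map_comp, ← Category.assoc, map_trT, Category.assoc]
  have htime : (⟨Man.fn (time θ') m, time_mem θ' m⟩ : Icc a b) =
      ⟨Man.fn (time η) (baseMap cc.hom m), time_mem η _⟩ :=
    Subtype.ext (congrArg (fun k => (Man.fn k m : ℝ)) (map_time (η := θ') (η' := η) cc).symm)
  rw [h₁, Man.d_comp (𝒳.p.map cc.hom) ((trT F η).hom ≫ 𝒳.p.map g), htime,
    ← map_time (η := θ') (η' := η) cc, Man.d_comp (𝒳.p.map cc.hom) (time η)] at key
  exact key

end Interval

end

section

/-! ### Reparametrizations and 2-morphisms -/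

section

variable {𝒳 : BasedCategory.{v, u} Man} {J J' : Set ℝ}

/-- The pullback of a function on `J × 𝒳` along a map `J' → J`. -/
def StackFunction.reparam (H : StackFunction (times J 𝒳)) (φ : ℝ → ℝ) (hφ : ContDiff ℝ ∞ φ)
    (hJ : MapsTo φ J' J) : StackFunction (times J' 𝒳) where
  val η := H.val ((HamOrb.reparam 𝒳 φ hφ hJ).obj η)
  compat _ _ g := H.compat _ _ ((HamOrb.reparam 𝒳 φ hφ hJ).map g)

/-- The product of a function on `J × 𝒳` and a function of time. -/
def StackFunction.timeMul (H : StackFunction (times J 𝒳)) (c : ℝ → ℝ) (hc : ContDiff ℝ ∞ c) :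
    StackFunction (times J 𝒳) where
  val η := ⟨fun x => c ((TimesObj.par η) x) * H.val η x,
    (hc.contMDiff.comp (TimesObj.par η).contMDiff).mul (H.val η).contMDiff⟩
  compat η η' g x := by
    have h₁ := H.compat η η' g x
    have h₂ := TimesHom.par g x
    change c ((TimesObj.par η) x) * H.val η x = c ((TimesObj.par η') _) * H.val η' _
    rw [h₁]
    congr 2
    exact h₂.symm

/-- The sum of two functions. -/
def StackFunction.add (H K : StackFunction (times J 𝒳)) : StackFunction (times J 𝒳) where
  val η := ⟨fun x => H.val η x + K.val η x, (H.val η).contMDiff.add (K.val η).contMDiff⟩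
  compat η η' g x := by
    have h₁ := H.compat η η' g x
    have h₂ := K.compat η η' g x
    exact congrArg₂ (· + ·) h₁ h₂

lemma StackFunction.d_mul_const {M : Man} (f g : M ⟶ Man.vec ℝ) (c : ℝ)
    (hg : ∀ m, (Man.fn g m : ℝ) = c * Man.fn f m) (n : M) (w : M.E) :
    (Man.d g n w : ℝ) = c * Man.d f n w := by
  let μ : Man.vec ℝ ⟶ Man.vec ℝ := Man.ofFun (M := Man.vec ℝ) (N := Man.vec ℝ) (fun x : ℝ => c * x)
    (contDiff_const.mul contDiff_id).contMDiff
  have h₁ : g = f ≫ μ := by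
    ext m
    exact hg m
  rw [h₁, Man.d_comp]
  have h₂ : mfderiv 𝓘(ℝ, ℝ) 𝓘(ℝ, ℝ) (fun x : ℝ => c * x) (Man.fn f n) (Man.d f n w) =
      c * (Man.d f n w : ℝ) := by
    rw [mfderiv_eq_fderiv]
    have h₃ : HasFDerivAt (fun x : ℝ => c * x) (c • ContinuousLinearMap.id ℝ ℝ)
        (Man.fn f n : ℝ) := by
      simpa using (hasFDerivAt_id (𝕜 := ℝ) (Man.fn f n : ℝ)).const_mul c
    exact DFunLike.congr_fun h₃.fderiv _
  exact h₂

/-- A smooth function of the line as a morphism. -/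
def lineHom (φ : ℝ → ℝ) (hφ : ContDiff ℝ ∞ φ) : Man.vec ℝ ⟶ Man.vec ℝ :=
  Man.ofFun (M := Man.vec ℝ) (N := Man.vec ℝ) φ hφ.contMDiff

lemma d_lineHom (φ : ℝ → ℝ) (hφ : ContDiff ℝ ∞ φ) (t w : ℝ) :
    (Man.d (lineHom φ hφ) t w : ℝ) = deriv φ t * w := by
  have h₁ : fderiv ℝ φ t w = deriv φ t * w := by
    rw [mul_comm]
    exact fderiv_eq_smul_deriv w
  have h₂ : mfderiv 𝓘(ℝ, ℝ) 𝓘(ℝ, ℝ) φ t = fderiv ℝ φ t := mfderiv_eq_fderiv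
  exact (DFunLike.congr_fun h₂ w).trans h₁

lemma contDiff_deriv {φ : ℝ → ℝ} (hφ : ContDiff ℝ ∞ φ) : ContDiff ℝ ∞ (deriv φ) :=
  (contDiff_infty_iff_deriv.1 hφ).2

/-- The Hamiltonian function of the integral of a reparametrized vector field. -/
def StackFunction.reparamHam (H : StackFunction (times J 𝒳)) (φ : ℝ → ℝ) (hφ : ContDiff ℝ ∞ φ)
    (hJ : MapsTo φ J' J) : StackFunction (times J' 𝒳) :=
  (H.reparam φ hφ hJ).timeMul (deriv φ) (contDiff_deriv hφ)

lemma StackFunction.eval_reparamHam (H : StackFunction (times J 𝒳)) (φ : ℝ → ℝ)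
    (hφ : ContDiff ℝ ∞ φ) (hJ : MapsTo φ J' J) (t : J') (ζ : 𝒳.obj) (x : base ζ) :
    (H.reparamHam φ hφ hJ).eval t ζ x = deriv φ t * H.eval ⟨φ t, hJ t.2⟩ ζ x := rfl

lemma Integrates.reparam (h : IsCFG 𝒳) {Ω : SymplecticForm 𝒳} {F : BasedFunctor (times J 𝒳) 𝒳}
    {H : StackFunction (times J 𝒳)} {X : TimeVectorField 𝒳 J} (hX : IsHamiltonianField h Ω H X)
    (hF : Integrates F X) (φ : ℝ → ℝ) (hφ : ContDiff ℝ ∞ φ) (hJ : MapsTo φ J' J)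
    {X' : TimeVectorField 𝒳 J'} (hX' : IsHamiltonianField h Ω (H.reparamHam φ hφ hJ) X') :
    Integrates ((HamOrb.reparam 𝒳 φ hφ hJ).comp F) X' := by
  have hvec : ∀ (ζ : 𝒳.obj) (hζ : IsEtale ζ) (t : J') (x : base ζ),
      X'.vec ζ hζ t x = deriv φ t • X.vec ζ hζ ⟨φ t, hJ t.2⟩ x := by
    intro ζ hζ t x
    refine Ω.ev_nondegenerate hζ x fun e => ?_
    rw [← hX', map_smul, LinearMap.smul_apply, ← hX, smul_eq_mul]
    exact StackFunction.d_mul_const _ _ _ (fun m => H.eval_reparamHam φ hφ hJ t ζ m) x e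
  rw [integrates_iff] at hF ⊢
  intro η ξ k ζ hζ g n e he
  have h₁ := hF ((HamOrb.reparam 𝒳 φ hφ hJ).obj η) ξ k ζ hζ g n e he
  have h₂ : (Man.d (time ((HamOrb.reparam 𝒳 φ hφ hJ).obj η)) n e : ℝ) =
      deriv φ (Man.fn (time η) n) * Man.d (time η) n e := by
    have h₃ := Man.d_comp (time η) (lineHom φ hφ) n e
    rw [d_lineHom] at h₃
    exact h₃
  rw [h₂] at h₁
  rw [hvec, smul_smul, mul_comm]
  exact h₁

lemma IntegratesHamiltonian.iff_exists (h : IsCFG 𝒳) {Ω : SymplecticForm 𝒳}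
    {F : BasedFunctor (times J 𝒳) 𝒳} : IntegratesHamiltonian Ω F ↔
      ∃ (H : StackFunction (times J 𝒳)) (X : TimeVectorField 𝒳 J),
        IsHamiltonianField h Ω H X ∧ Integrates F X :=
  ⟨fun ⟨X, ⟨H, hH⟩, hF⟩ => ⟨H, X, hH, hF⟩, fun ⟨H, X, hH, hF⟩ => ⟨X, ⟨H, hH⟩, hF⟩⟩

/-- Reparametrizations of Hamiltonian isotopies are Hamiltonian. -/
lemma IntegratesHamiltonian.reparam (h : IsCFG 𝒳) {Ω : SymplecticForm 𝒳}
    {F : BasedFunctor (times J 𝒳) 𝒳} (hF : IntegratesHamiltonian Ω F) (φ : ℝ → ℝ)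
    (hφ : ContDiff ℝ ∞ φ) (hJ : MapsTo φ J' J) :
    IntegratesHamiltonian Ω ((HamOrb.reparam 𝒳 φ hφ hJ).comp F) := by
  obtain ⟨H, X, hX, hFX⟩ := (IntegratesHamiltonian.iff_exists h).1 hF
  obtain ⟨X', hX'⟩ := (H.reparamHam φ hφ hJ).exists_hamiltonian_field h Ω
  exact (IntegratesHamiltonian.iff_exists h).2 ⟨_, X', hX', hFX.reparam h hX φ hφ hJ hX'⟩

lemma IntegratesHamiltonian.of_twoIso {Ω : SymplecticForm 𝒳}
    {F F' : BasedFunctor (times J 𝒳) 𝒳} (hF : IntegratesHamiltonian Ω F) (e : TwoIso F F') :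
    IntegratesHamiltonian Ω F' := by
  obtain ⟨X, hX, hFX⟩ := hF
  refine ⟨X, hX, ?_⟩
  obtain ⟨θ⟩ := e
  rw [integrates_iff] at hFX ⊢
  intro η ξ k ζ hζ g n e he
  have h₁ := hFX η ξ k ζ hζ (θ.app η ≫ g) n e he
  have h₂ : (trT F η).hom ≫ 𝒳.p.map (θ.app η ≫ g) = (trT F' η).hom ≫ 𝒳.p.map g := by
    rw [Functor.map_comp, ← Category.assoc]
    congr 1
    exact BasedNatTrans.tr_app θ η
  rw [h₂] at h₁
  exact h₁

end

/-! ### Symplectic maps that are bijective on points -/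

section

variable {𝒳 : BasedCategory.{v, u} Man}

/-- Maps `𝒳 → 𝒳` that preserve the symplectic form and induce a bijection on isomorphism classes of
points. -/
structure IsGood (Ω : SymplecticForm 𝒳) (T : BasedFunctor 𝒳 𝒳) : Prop where
  symp : ∀ (ζ : 𝒳.obj) (x : base ζ) (w w' : (base ζ).E), Ω.pb T ζ x w w' = Ω.ev ζ x w w'
  inj : ∀ (ζ ζ' : 𝒳.obj) (x : base ζ) (x' : base ζ'),
    PtRel (T.obj ζ) (T.obj ζ') (Man.fn (tr T ζ).hom x) (Man.fn (tr T ζ').hom x') → PtRel ζ ζ' x x'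
  surj : ∀ (ζ : 𝒳.obj) (y : base ζ), ∃ (ζ' : 𝒳.obj) (x : base ζ'),
    PtRel (T.obj ζ') ζ (Man.fn (tr T ζ').hom x) y

lemma IsGood.id (Ω : SymplecticForm 𝒳) : IsGood Ω (BasedFunctor.id 𝒳) where
  symp ζ x w w' := by
    change Ω.ev ζ x (Man.d (𝟙 (𝒳.p.obj ζ)) x w) (Man.d (𝟙 (𝒳.p.obj ζ)) x w') = _
    rw [Man.d_id, Man.d_id]
  inj ζ ζ' x x' h := h
  surj ζ y := ⟨ζ, y, PtRel.refl ζ y⟩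

lemma ptRel_of_twoIso {𝒴 : BasedCategory.{v', u'} Man} {T T' : BasedFunctor 𝒴 𝒳} (e : TwoIso T T')
    (η : 𝒴.obj) (n : 𝒴.p.obj η) :
    PtRel (T.obj η) (T'.obj η) (Man.fn (tr T η).hom n) (Man.fn (tr T' η).hom n) := by
  obtain ⟨θ⟩ := e
  rw [← BasedNatTrans.tr_app θ]
  exact PtRel.of_arrow _ _

lemma IsGood.of_twoIso (h : IsCFG 𝒳) {Ω : SymplecticForm 𝒳} {T T' : BasedFunctor 𝒳 𝒳}
    (hT : IsGood Ω T) (e : TwoIso T T') : IsGood Ω T' where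
  symp ζ x w w' := by
    rw [← hT.symp, SymplecticForm.pb_apply, SymplecticForm.pb_apply,
      ← BasedNatTrans.tr_app e.some]
    exact Ω.ev_comp (tr T ζ).hom (e.some.app ζ) x w w'
  inj ζ ζ' x x' hx := hT.inj ζ ζ' x x'
    (((ptRel_of_twoIso e ζ x).trans h hx).trans h (ptRel_of_twoIso e ζ' x').symm)
  surj ζ y := by
    obtain ⟨ζ', x, hx⟩ := hT.surj ζ y
    exact ⟨ζ', x, (ptRel_of_twoIso e ζ' x).symm.trans h hx⟩

lemma tr_comp_hom {𝒴 𝒵 : BasedCategory.{v', u'} Man} (S : BasedFunctor 𝒵 𝒴)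
    (T : BasedFunctor 𝒴 𝒳) (ζ : 𝒵.obj) :
    (tr (S.comp T) ζ).hom = (tr S ζ).hom ≫ (tr T (S.obj ζ)).hom := by
  simp only [tr, eqToIso.hom, eqToHom_trans]
  rfl

lemma SymplecticForm.pb_comp {𝒴 𝒵 : BasedCategory.{v', u'} Man} (Ω : SymplecticForm 𝒳)
    (S : BasedFunctor 𝒵 𝒴) (T : BasedFunctor 𝒴 𝒳) (ζ : 𝒵.obj) (x : 𝒵.p.obj ζ)
    (w w' : (𝒵.p.obj ζ).E) :
    Ω.pb (S.comp T) ζ x w w' = Ω.pb T (S.obj ζ) (Man.fn (tr S ζ).hom x) (Man.d (tr S ζ).hom x w)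
      (Man.d (tr S ζ).hom x w') := by
  have key : ∀ f : 𝒵.p.obj ζ ⟶ 𝒳.p.obj (T.obj (S.obj ζ)), f = (tr S ζ).hom ≫ (tr T (S.obj ζ)).hom →
      Ω.ev (T.obj (S.obj ζ)) (Man.fn f x) (Man.d f x w) (Man.d f x w') = Ω.pb T (S.obj ζ)
        (Man.fn (tr S ζ).hom x) (Man.d (tr S ζ).hom x w) (Man.d (tr S ζ).hom x w') := by
    rintro _ rfl
    rw [Man.d_comp, Man.d_comp]
    rfl
  exact key _ (tr_comp_hom S T ζ)

lemma IsGood.comp (h : IsCFG 𝒳) {Ω : SymplecticForm 𝒳} {S T : BasedFunctor 𝒳 𝒳}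
    (hS : IsGood Ω S) (hT : IsGood Ω T) : IsGood Ω (S.comp T) where
  symp ζ x w w' := by
    rw [Ω.pb_comp, hT.symp]
    exact hS.symp ζ x w w'
  inj ζ ζ' x x' hx := by
    rw [tr_comp_hom, tr_comp_hom] at hx
    exact hS.inj ζ ζ' x x' (hT.inj _ _ _ _ hx)
  surj ζ y := by
    obtain ⟨ζ', x, hx⟩ := hT.surj ζ y
    obtain ⟨ζ'', z, hz⟩ := hS.surj ζ' x
    refine ⟨ζ'', z, ?_⟩
    rw [tr_comp_hom]
    exact (hz.map T).trans h hx

end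

/-! ### The coarse moduli space -/

section

variable {𝒳 : BasedCategory.{v, u} Man} {ξ : 𝒳.obj}

/-- The point of the coarse moduli space below a point of the base of an object. -/
def coarse (hξ : IsAtlas ξ) (ζ : 𝒳.obj) (y : base ζ) : Quot (CoarseRel ξ) :=
  Quot.mk _ (hξ.exists_pt ζ y).choose

lemma coarse_eq_mk (hξ : IsAtlas ξ) (ζ : 𝒳.obj) (y : base ζ) :
    ∃ x : base ξ, PtRel ζ ξ y x ∧ coarse hξ ζ y = Quot.mk _ x :=
  ⟨_, (hξ.exists_pt ζ y).choose_spec, rfl⟩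

lemma mk_eq_mk_iff (h : IsCFG 𝒳) (x x' : base ξ) :
    (Quot.mk (CoarseRel ξ) x = Quot.mk _ x') ↔ PtRel ξ ξ x x' := by
  refine ⟨fun e => ?_, fun e => Quot.sound e⟩
  have heq : _root_.Equivalence (CoarseRel ξ) :=
    ⟨fun x => PtRel.refl ξ x, fun e => PtRel.symm e, fun e e' => PtRel.trans h e e'⟩
  exact (heq.quot_mk_eq_iff x x').1 e

lemma coarse_eq_iff (h : IsCFG 𝒳) (hξ : IsAtlas ξ) {ζ ζ' : 𝒳.obj} (y : base ζ) (y' : base ζ') :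
    coarse hξ ζ y = coarse hξ ζ' y' ↔ PtRel ζ ζ' y y' := by
  obtain ⟨x, hx, e⟩ := coarse_eq_mk hξ ζ y
  obtain ⟨x', hx', e'⟩ := coarse_eq_mk hξ ζ' y'
  rw [e, e', mk_eq_mk_iff h]
  exact ⟨fun r => (hx.trans h r).trans h hx'.symm, fun r => (hx.symm.trans h r).trans h hx'⟩

lemma coarse_atlas (h : IsCFG 𝒳) (hξ : IsAtlas ξ) (x : base ξ) : coarse hξ ξ x = Quot.mk _ x := by
  obtain ⟨x', hx', e⟩ := coarse_eq_mk hξ ξ x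
  rw [e]
  exact ((mk_eq_mk_iff h x x').2 hx').symm

/-- The saturation of an open set of the atlas is open because the target map is étale. -/
lemma isOpenMap_quot_mk (h : IsCFG 𝒳) (hξ : IsEtale ξ) (hep : IsEtaleProper ξ) :
    IsOpenMap (Quot.mk (CoarseRel ξ)) := by
  intro U hU
  obtain ⟨ζ, s, t, hfib, -⟩ := hξ ξ
  obtain ⟨-, ht, -⟩ := hep ζ s t hfib
  have : (Quot.mk (CoarseRel ξ)) ⁻¹' (Quot.mk (CoarseRel ξ) '' U) =
      baseMap t '' (baseMap s ⁻¹' U) := by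
    ext y
    constructor
    · rintro ⟨x, hx, e⟩
      obtain ⟨κ, a, b, z, rfl, rfl⟩ := (mk_eq_mk_iff h x y).1 e
      obtain ⟨c, ⟨rfl, rfl⟩, -⟩ := hfib κ a b
      rw [baseMap_comp] at hx ⊢
      exact ⟨baseMap c z, hx, rfl⟩
    · rintro ⟨z, hz, rfl⟩
      exact ⟨baseMap s z, hz, Quot.sound ⟨ζ, s, t, z, rfl, rfl⟩⟩
  refine isQuotientMap_quot_mk.isOpen_preimage.1 ?_
  rw [this]
  exact ht.isOpenMap _ (hU.preimage (Man.continuous_fn (𝒳.p.map s)))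

lemma isOpenQuotientMap_quot_mk (h : IsCFG 𝒳) (hξ : IsEtale ξ) (hep : IsEtaleProper ξ) :
    IsOpenQuotientMap (Quot.mk (CoarseRel ξ)) :=
  ⟨Quot.mk_surjective, continuous_quot_mk, isOpenMap_quot_mk h hξ hep⟩

/-- The coarse moduli space is Hausdorff because the atlas groupoid is proper. -/
lemma t2Space_quot (h : IsCFG 𝒳) (hξ : IsEtale ξ) (hep : IsEtaleProper ξ) :
    T2Space (Quot (CoarseRel ξ)) := by
  rw [t2Space_iff_of_isOpenQuotientMap (isOpenQuotientMap_quot_mk h hξ hep)]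
  obtain ⟨ζ, s, t, hfib, -⟩ := hξ ξ
  obtain ⟨-, -, hp⟩ := hep ζ s t hfib
  have : {q : base ξ × base ξ | Quot.mk (CoarseRel ξ) q.1 = Quot.mk (CoarseRel ξ) q.2} =
      range (fun z : base ζ => (baseMap s z, baseMap t z)) := by
    ext ⟨x, y⟩
    constructor
    · intro e
      obtain ⟨κ, a, b, z, rfl, rfl⟩ := (mk_eq_mk_iff h x y).1 e
      obtain ⟨c, ⟨rfl, rfl⟩, -⟩ := hfib κ a b
      exact ⟨baseMap c z, by rw [baseMap_comp, baseMap_comp]⟩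
    · rintro ⟨z, hz⟩
      rw [Prod.mk.injEq] at hz
      obtain ⟨rfl, rfl⟩ := hz
      exact Quot.sound ⟨ζ, s, t, z, rfl, rfl⟩
  rw [this]
  exact hp.isClosedMap.isClosed_range

lemma continuous_coarse (h : IsCFG 𝒳) (hξ : IsAtlas ξ) (hξ' : IsEtale ξ) (ζ : 𝒳.obj) :
    Continuous (coarse hξ ζ) := by
  rw [continuous_iff_continuousAt]
  intro y
  obtain ⟨κ, α, β, hfib, hβ⟩ := hξ' ζ
  obtain ⟨x, θ, a, b, z, rfl, rfl⟩ := hξ.exists_pt ζ y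
  obtain ⟨c, ⟨rfl, rfl⟩, -⟩ := hfib θ b a
  rw [baseMap_comp, ContinuousAt, ← hβ.isLocalHomeomorph.map_nhds_eq, Filter.tendsto_map'_iff]
  have e : coarse hξ ζ ∘ baseMap β = fun w => Quot.mk (CoarseRel ξ) (baseMap α w) := by
    funext w
    rw [← coarse_atlas h hξ]
    exact (coarse_eq_iff h hξ _ _).2 ⟨κ, β, α, w, rfl, rfl⟩
  have h₂ : Continuous fun w => Quot.mk (CoarseRel ξ) (baseMap α w) :=
    continuous_quot_mk.comp (Man.continuous_fn (𝒳.p.map α))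
  have h₃ := h₂.continuousAt (x := baseMap c z)
  rw [← e] at h₃
  exact h₃

end

end

section

/-! ### Uniqueness of integral curves -/

section

variable {𝒳 : BasedCategory.{v, u} Man} {J : Set ℝ}

/-- The map `F_t`. -/
abbrev atTime (F : BasedFunctor (times J 𝒳) 𝒳) (t : J) : BasedFunctor 𝒳 𝒳 :=
  (sliceAt 𝒳 (t : ℝ) t.2).comp F

/-- A point of `J × 𝒳` is isomorphic to the corresponding point of a slice. -/
lemma ptRel_atTime (h : IsCFG 𝒳) (F : BasedFunctor (times J 𝒳) 𝒳) (η : TimesObj J 𝒳) {ζ : 𝒳.obj}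
    (k : η.pt ⟶ ζ) (n : base η.pt) (t : J) (ht : (Man.fn (time η) n : ℝ) = t) :
    PtRel (F.obj η) ((atTime F t).obj ζ) (Man.fn (trT F η).hom n)
      (Man.fn (tr (atTime F t) ζ).hom (baseMap k n)) := by
  obtain ⟨θ, i, a, a', ha, ha'⟩ := h.exists_common_timesObj (η := η) (η' := sliceObj ζ t) k (𝟙 ζ)
    (Man.const (Man.vec ℝ) n) (Man.const (Man.vec ℝ) (baseMap k n))
    (by
      rw [𝒳.p.map_id]
      rfl)
    (by
      ext z
      exact ht)
  have h₁ : PtRel (𝒳 := times J 𝒳) η (sliceObj ζ t) n (baseMap k n) :=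
    ⟨θ, a, a', Man.fn i.hom (0 : ℝ), congrArg (fun k => Man.fn k (0 : ℝ)) ha,
      congrArg (fun k => Man.fn k (0 : ℝ)) ha'⟩
  exact h₁.map F

/-- Integral curves of a time dependent vector field through the same point agree locally. -/
lemma TimeVectorField.curve_unique (X : TimeVectorField 𝒳 univ) {ζ : 𝒳.obj} (hζ : IsEtale ζ)
    (γ γ' : ℝ → base ζ) (τ₀ : ℝ)
    (hγ : ∀ᶠ τ in nhds τ₀, HasMFDerivAt 𝓘(ℝ, ℝ) (base ζ).I γ τ
      ((1 : ℝ →L[ℝ] ℝ).smulRight (X.val ζ hζ ⟨τ, trivial⟩ (γ τ))))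
    (hγ' : ∀ᶠ τ in nhds τ₀, HasMFDerivAt 𝓘(ℝ, ℝ) (base ζ).I γ' τ
      ((1 : ℝ →L[ℝ] ℝ).smulRight (X.val ζ hζ ⟨τ, trivial⟩ (γ' τ))))
    (h₀ : γ τ₀ = γ' τ₀) : γ =ᶠ[nhds τ₀] γ' := by
  let P := (Man.vec ℝ).prod (base ζ)
  let V : ∀ p : P, TangentSpace P.I p := fun p =>
    ((1 : ℝ), X.val ζ hζ ⟨p.1, trivial⟩ p.2)
  have hV : ContMDiff P.I P.I.tangent ∞ (fun p => (⟨p, V p⟩ : TangentBundle P.I P)) := by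
    have h₁ : ContMDiff P.I (Man.vec ℝ).I.tangent ∞
        (fun p : P => (⟨p.1, (1 : ℝ)⟩ : TangentBundle (Man.vec ℝ).I (Man.vec ℝ))) := by
      intro p
      refine Man.contMDiffAt_tangent (Man.fst (Man.vec ℝ) (base ζ)) (fun _ => (1 : ℝ)) p ?_
      have : ∀ q : P, Man.chartD (M := Man.vec ℝ) p.1 q.1 (1 : ℝ) = (1 : ℝ) := by
        intro q
        have : mfderiv 𝓘(ℝ, ℝ) 𝓘(ℝ, ℝ) (extChartAt 𝓘(ℝ, ℝ) p.1) q.1 =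
            ContinuousLinearMap.id ℝ ℝ := by
          rw [extChartAt_model_space_eq_id]
          exact mfderiv_id
        exact DFunLike.congr_fun this (1 : ℝ)
      refine contMDiffAt_const (c := (1 : ℝ)).congr_of_eventuallyEq (Filter.Eventually.of_forall ?_)
      exact this
    have h₂ := X.smooth ζ hζ P (Man.fn (Man.fst (Man.vec ℝ) (base ζ))) (fun _ => trivial)
      (Man.snd (Man.vec ℝ) (base ζ))
    exact (contMDiff_equivTangentBundleProd_symm (I := 𝓘(ℝ, ℝ)) (M := ℝ) (I' := (base ζ).I)
      (M' := base ζ)).comp (h₁.prodMk h₂)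
  have hcur : ∀ γ : ℝ → base ζ, (∀ᶠ τ in nhds τ₀, HasMFDerivAt 𝓘(ℝ, ℝ) (base ζ).I γ τ
      ((1 : ℝ →L[ℝ] ℝ).smulRight (X.val ζ hζ ⟨τ, trivial⟩ (γ τ)))) →
      IsMIntegralCurveAt (I := P.I) (M := P) (fun τ : ℝ => (τ, γ τ)) V τ₀ := by
    intro γ hγ
    filter_upwards [hγ] with τ hτ
    have h₁ := (hasMFDerivAt_id (I := 𝓘(ℝ, ℝ)) τ).prodMk hτ
    refine h₁.congr_mfderiv (ContinuousLinearMap.ext fun (r : ℝ) => ?_)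
    exact Prod.ext (show r = r * (1 : ℝ) from (mul_one r).symm) rfl
  have hcompl : CompleteSpace P.E := FiniteDimensional.complete ℝ P.E
  have h₁ := isMIntegralCurveAt_eventuallyEq_of_contMDiffAt_boundaryless (I := P.I) (M := P)
    (t₀ := τ₀) (((hV _).of_le (by simp))) (hcur γ hγ) (hcur γ' hγ') (by
      change (τ₀, γ τ₀) = (τ₀, γ' τ₀)
      rw [h₀])
  filter_upwards [h₁] with τ hτ
  exact congrArg Prod.snd hτ

/-- The curve `t ↦ F_t(x)` lifts locally to an integral curve in any étale chart. -/
lemma Integrates.exists_curve (h : IsCFG 𝒳) {F : BasedFunctor (times univ 𝒳) 𝒳}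
    {X : TimeVectorField 𝒳 univ} (hF : Integrates F X) {ζ : 𝒳.obj} (hζ : IsEtale ζ)
    (ζ' : 𝒳.obj) (x : base ζ') (τ₀ : ℝ) (y : base ζ)
    (hy : PtRel ((atTime F ⟨τ₀, trivial⟩).obj ζ') ζ
      (Man.fn (tr (atTime F ⟨τ₀, trivial⟩) ζ').hom x) y) :
    ∃ γ : ℝ → base ζ, γ τ₀ = y ∧ (∀ᶠ τ in nhds τ₀, PtRel ((atTime F ⟨τ, trivial⟩).obj ζ') ζ
      (Man.fn (tr (atTime F ⟨τ, trivial⟩) ζ').hom x) (γ τ)) ∧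
      ∀ᶠ τ in nhds τ₀, HasMFDerivAt 𝓘(ℝ, ℝ) (base ζ).I γ τ
        ((1 : ℝ →L[ℝ] ℝ).smulRight (X.val ζ hζ ⟨τ, trivial⟩ (γ τ))) := by
  obtain ⟨η, i, c, hci, hi⟩ := h.exists_timesObj (J := univ) ζ' (Man.const (Man.vec ℝ) x)
    (𝟙 (Man.vec ℝ)) (fun _ => trivial)
  have hck : ∀ τ : ℝ, baseMap c (Man.fn i.hom τ) = x := fun τ =>
    congrArg (fun k => Man.fn k τ) hci
  have htm : ∀ τ : ℝ, (Man.fn (time η) (Man.fn i.hom τ) : ℝ) = τ := fun τ =>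
    congrArg (fun k => Man.fn k τ) hi
  have hpt : ∀ τ : ℝ, PtRel (F.obj η) ((atTime F ⟨τ, trivial⟩).obj ζ')
      (Man.fn (trT F η).hom (Man.fn i.hom τ)) (Man.fn (tr (atTime F ⟨τ, trivial⟩) ζ').hom x) := by
    intro τ
    have := ptRel_atTime h F η c (Man.fn i.hom τ) ⟨τ, trivial⟩ (htm τ)
    rwa [hck τ] at this
  have hT := isCFG_times (univ : Set ℝ) h
  obtain ⟨θ, b, g, hpb⟩ := exists_isPullback hT h F hζ η
  obtain ⟨m, hm, hm'⟩ := hpb.exists_pt hT h (n := Man.fn i.hom τ₀) (x := y) ((hpt τ₀).trans h hy)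
  let θ' : TimesObj univ 𝒳 := θ
  let b' : TimesHom θ' η := b
  let g' : F.obj θ' ⟶ ζ := g
  let q : base θ'.pt ⟶ Man.vec ℝ := 𝒳.p.map b'.hom ≫ i.inv
  let φ : base θ'.pt ⟶ base ζ := (trT F θ').hom ≫ 𝒳.p.map g'
  have hqt : q = time θ' := by
    have h₁ : time η = i.inv := by
      rw [← cancel_epi i.hom, hi, Iso.hom_inv_id]
    rw [← map_time (η := θ') (η' := η) b', h₁]
  have hqm : Man.fn q m = τ₀ := by
    have h₁ : Man.fn q m = Man.fn i.inv (baseMap b'.hom m) := rfl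
    rw [h₁, show baseMap b'.hom m = Man.fn i.hom τ₀ from hm, Man.fn_hom_inv]
  have hbij : Function.Bijective (Man.d q m) := by
    have h₁ := Man.d_bijective_of_isLocalDiffeomorph (f := 𝒳.p.map b'.hom) hpb.étale m
    have h₂ := Man.d_bijective_iso i.symm (Man.fn (𝒳.p.map b'.hom) m)
    have h₃ : ⇑(Man.d q m) = Man.d i.inv (Man.fn (𝒳.p.map b'.hom) m) ∘ Man.d (𝒳.p.map b'.hom) m :=
      funext fun u => Man.d_comp _ _ _ _
    rw [h₃]
    exact h₂.comp h₁
  obtain ⟨G, hG₀, hGs, hGr⟩ := Man.exists_local_inverse q m hbij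
  rw [hqm] at hG₀ hGs hGr
  have hGs' : ∀ᶠ τ in nhds τ₀, ContMDiffAt 𝓘(ℝ, ℝ) (base θ'.pt).I 1 G τ :=
    by
    have h₁ : ContMDiffAt 𝓘(ℝ, ℝ) (base θ'.pt).I 1 G τ₀ := ContMDiffAt.of_le hGs (by simp)
    exact (contMDiffAt_iff_contMDiffAt_nhds (by simp)).1 h₁
  refine ⟨fun τ => Man.fn φ (G τ), ?_, ?_, ?_⟩
  · change Man.fn φ (G τ₀) = y
    rw [hG₀]
    exact hm'
  · filter_upwards [hGr] with τ hτ
    refine (hpt τ).symm.trans h ?_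
    have h₁ : baseMap b'.hom (G τ) = Man.fn i.hom τ := by
      have h₂ : Man.fn i.inv (baseMap b'.hom (G τ)) = τ := hτ
      have h₃ := congrArg (Man.fn i.hom) h₂
      rwa [Man.fn_inv_hom] at h₃
    rw [← h₁]
    have h₄ : baseMap (F.map (X := θ') (Y := η) b') (Man.fn (trT F θ').hom (G τ)) =
        Man.fn (trT F η).hom (baseMap b'.hom (G τ)) :=
      congrArg (fun k => Man.fn k (G τ)) (map_trT F b')
    rw [← h₄]
    exact (PtRel.of_arrow _ _).symm.trans h (PtRel.of_arrow g' _)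
  · filter_upwards [hGs', hGr.eventually_nhds] with τ hτ hτ'
    have hd : HasMFDerivAt 𝓘(ℝ, ℝ) (base θ'.pt).I G τ (mfderiv 𝓘(ℝ, ℝ) (base θ'.pt).I G τ) :=
      (hτ.mdifferentiableAt (by simp)).hasMFDerivAt
    let e : (base θ'.pt).E := mfderiv 𝓘(ℝ, ℝ) (base θ'.pt).I G τ (1 : ℝ)
    have hφ : HasMFDerivAt (base θ'.pt).I (base ζ).I (Man.fn φ) (G τ) (Man.d φ (G τ)) :=
      (Man.mdiff_fn φ (G τ)).hasMFDerivAt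
    have hq : HasMFDerivAt (base θ'.pt).I 𝓘(ℝ, ℝ) (Man.fn q) (G τ) (Man.d q (G τ)) :=
      (Man.mdiff_fn q (G τ)).hasMFDerivAt
    have he : (Man.d q (G τ) e : ℝ) = 1 := by
      have h₁ := hq.comp τ hd
      have h₂ : (fun τ => (Man.fn q (G τ) : ℝ)) =ᶠ[nhds τ] id := hτ'
      have h₃ : HasMFDerivAt 𝓘(ℝ, ℝ) 𝓘(ℝ, ℝ) (fun τ : ℝ => τ) τ _ :=
        h₁.congr_of_eventuallyEq h₂.symm
      exact DFunLike.congr_fun (hasMFDerivAt_unique h₃ (hasMFDerivAt_id τ)) (1 : ℝ)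
    have hk : Man.d (𝒳.p.map (b'.hom ≫ c)) (G τ) e = 0 := by
      have h₁ : 𝒳.p.map (b'.hom ≫ c) = Man.const _ x := by
        rw [Functor.map_comp, (Iso.eq_inv_comp i).2 hci]
        rfl
      rw [h₁, Man.d_const]
    have hI := (integrates_iff F X).1 hF θ' ζ' (b'.hom ≫ c) ζ hζ g' (G τ) e hk
    have htime : (Man.fn (time θ') (G τ) : ℝ) = τ := by
      rw [← hqt]
      exact hτ'.self_of_nhds
    have ht₂ : (⟨Man.fn (time θ') (G τ), time_mem θ' _⟩ : (univ : Set ℝ)) = ⟨τ, trivial⟩ :=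
      Subtype.ext htime
    rw [ht₂, ← hqt, he, one_smul] at hI
    have h₁ := hφ.comp τ hd
    refine h₁.congr_mfderiv (ContinuousLinearMap.ext fun (r : ℝ) => ?_)
    have hlin : ∀ D : ℝ →L[ℝ] (base θ'.pt).E, D r = r • D 1 := fun D => by
      rw [← map_smul, smul_eq_mul, mul_one]
    have h₂ : (mfderiv 𝓘(ℝ, ℝ) (base θ'.pt).I G τ : ℝ →L[ℝ] (base θ'.pt).E) r = r • e := hlin _
    have h₃ : Man.d φ (G τ) (r • e) = r • X.vec ζ hζ ⟨τ, trivial⟩ (Man.fn φ (G τ)) := by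
      rw [map_smul]
      exact congrArg (fun z => r • z) hI
    exact (congrArg (Man.d φ (G τ)) h₂).trans h₃

end

end

section

/-! ### Bijectivity on points propagates in time -/

section

variable {𝒳 : BasedCategory.{v, u} Man} {ξ : 𝒳.obj}

/-- The path of a point under an isotopy, in the coarse moduli space. -/
lemma continuous_coarse_curve (h : IsCFG 𝒳) (hξ : IsAtlas ξ) (hξ' : IsEtale ξ)
    (F : BasedFunctor (times univ 𝒳) 𝒳) (ζ : 𝒳.obj) (x : base ζ) :
    Continuous fun τ : ℝ => coarse hξ ((atTime F ⟨τ, trivial⟩).obj ζ)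
      (Man.fn (tr (atTime F ⟨τ, trivial⟩) ζ).hom x) := by
  obtain ⟨η, i, c, hci, hi⟩ := h.exists_timesObj (J := univ) ζ (Man.const (Man.vec ℝ) x)
    (𝟙 (Man.vec ℝ)) (fun _ => trivial)
  have e : (fun τ : ℝ => coarse hξ ((atTime F ⟨τ, trivial⟩).obj ζ)
      (Man.fn (tr (atTime F ⟨τ, trivial⟩) ζ).hom x)) =
      fun τ : ℝ => coarse hξ (F.obj η) (Man.fn (i.hom ≫ (trT F η).hom) τ) := by
    funext τ
    refine ((coarse_eq_iff h hξ _ _).2 ?_).symm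
    have := ptRel_atTime h F η c (Man.fn i.hom τ) ⟨τ, trivial⟩ (congrArg (fun k => Man.fn k τ) hi)
    rwa [show baseMap c (Man.fn i.hom τ) = x from congrArg (fun k => Man.fn k τ) hci] at this
  rw [e]
  exact (continuous_coarse h hξ hξ' _).comp (Man.continuous_fn _)

/-- Points with isomorphic images at one time have isomorphic images at all times. The set of these
times is closed because the coarse moduli space is Hausdorff, and open because integral curves in an
étale chart are unique. -/
lemma Integrates.inj (h : IsOrbifold 𝒳) {F : BasedFunctor (times univ 𝒳) 𝒳}
    {X : TimeVectorField 𝒳 univ} (hF : Integrates F X) (ζ ζ' : 𝒳.obj) (x : base ζ) (x' : base ζ')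
    (τ₀ τ₁ : ℝ) (hx : PtRel ((atTime F ⟨τ₁, trivial⟩).obj ζ) ((atTime F ⟨τ₁, trivial⟩).obj ζ')
      (Man.fn (tr (atTime F ⟨τ₁, trivial⟩) ζ).hom x)
      (Man.fn (tr (atTime F ⟨τ₁, trivial⟩) ζ').hom x')) :
    PtRel ((atTime F ⟨τ₀, trivial⟩).obj ζ) ((atTime F ⟨τ₀, trivial⟩).obj ζ')
      (Man.fn (tr (atTime F ⟨τ₀, trivial⟩) ζ).hom x)
      (Man.fn (tr (atTime F ⟨τ₀, trivial⟩) ζ').hom x') := by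
  obtain ⟨ξ, hξ, hep, hξ'⟩ := h.exists_étale_atlas
  have hcfg := h.toIsCFG
  have := t2Space_quot hcfg hξ' hep
  have hc := continuous_coarse_curve hcfg hξ hξ' F ζ x
  have hc' := continuous_coarse_curve hcfg hξ hξ' F ζ' x'
  let S : Set ℝ := {τ | PtRel ((atTime F ⟨τ, trivial⟩).obj ζ) ((atTime F ⟨τ, trivial⟩).obj ζ')
      (Man.fn (tr (atTime F ⟨τ, trivial⟩) ζ).hom x)
      (Man.fn (tr (atTime F ⟨τ, trivial⟩) ζ').hom x')}
  have hclosed : IsClosed S := by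
    have : S = {τ : ℝ | coarse hξ ((atTime F ⟨τ, trivial⟩).obj ζ)
        (Man.fn (tr (atTime F ⟨τ, trivial⟩) ζ).hom x) = coarse hξ ((atTime F ⟨τ, trivial⟩).obj ζ')
        (Man.fn (tr (atTime F ⟨τ, trivial⟩) ζ').hom x')} := by
      ext τ
      exact (coarse_eq_iff hcfg hξ _ _).symm
    rw [this]
    exact isClosed_eq hc hc'
  have hopen : IsOpen S := by
    rw [isOpen_iff_mem_nhds]
    intro τ hτ
    obtain ⟨y, hy⟩ := hξ.exists_pt ((atTime F ⟨τ, trivial⟩).obj ζ)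
      (Man.fn (tr (atTime F ⟨τ, trivial⟩) ζ).hom x)
    obtain ⟨γ, hγ₀, hγ, hγ'⟩ := hF.exists_curve hcfg hξ' ζ x τ y hy
    obtain ⟨δ, hδ₀, hδ, hδ'⟩ := hF.exists_curve hcfg hξ' ζ' x' τ y ((PtRel.symm hτ).trans hcfg hy)
    filter_upwards [hγ, hδ, X.curve_unique hξ' γ δ τ hγ' hδ' (hγ₀.trans hδ₀.symm)] with σ h₁ h₂ h₃
    rw [h₃] at h₁
    exact h₁.trans hcfg h₂.symm
  have := IsClopen.eq_univ ⟨hclosed, hopen⟩ ⟨τ₁, hx⟩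
  have h₀ : τ₀ ∈ S := by rw [this]; trivial
  exact h₀

/-- A symplectic map is étale. -/
lemma bijective_d_of_symp (h : IsOrbifold 𝒳) {Ω : SymplecticForm 𝒳} {T : BasedFunctor 𝒳 𝒳}
    (hT : ∀ (ζ : 𝒳.obj) (x : base ζ) (w w' : (base ζ).E), Ω.pb T ζ x w w' = Ω.ev ζ x w w')
    {ζ ζ' ρ : 𝒳.obj} (hζ : IsEtale ζ) (hζ' : IsEtale ζ') (b : ρ ⟶ ζ)
    (hb : IsLocalDiffeomorph (base ρ).I (base ζ).I ∞ (baseMap b)) (g : T.obj ρ ⟶ ζ')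
    (m : base ρ) : Function.Bijective (Man.d ((tr T ρ).hom ≫ 𝒳.p.map g) m) := by
  have hbij := Man.d_bijective_of_isLocalDiffeomorph (f := 𝒳.p.map b) hb m
  let Q := LinearEquiv.ofBijective (Man.d (𝒳.p.map b) m).toLinearMap hbij
  have hQ : ∀ w, Man.d (𝒳.p.map b) m (Q.symm w) = w := fun w => Q.apply_symm_apply w
  have key := Ω.bijective_of_preserves h hζ hζ' (baseMap b m)
    (Man.fn ((tr T ρ).hom ≫ 𝒳.p.map g) m)
    ((Man.d ((tr T ρ).hom ≫ 𝒳.p.map g) m).toLinearMap ∘ₗ Q.symm.toLinearMap) (fun w w' => by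
      have h₁ := Ω.ev_comp (tr T ρ).hom g m (Q.symm w) (Q.symm w')
      have h₂ := Ω.ev_map b m (Q.symm w) (Q.symm w')
      rw [hQ, hQ] at h₂
      rw [h₂]
      exact h₁.trans (hT ρ m _ _))
  have e : ⇑(Man.d ((tr T ρ).hom ≫ 𝒳.p.map g) m) =
      ⇑((Man.d ((tr T ρ).hom ≫ 𝒳.p.map g) m).toLinearMap ∘ₗ Q.symm.toLinearMap) ∘ Q := by
    funext w
    exact (congrArg (Man.d ((tr T ρ).hom ≫ 𝒳.p.map g) m) (Q.symm_apply_apply w)).symm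
  rw [e]
  exact key.comp Q.bijective

/-- The image of a symplectic map in the coarse moduli space is open and closed. -/
lemma isClopen_image (h : IsOrbifold 𝒳) (hc : IsCompactOrbifold 𝒳) {Ω : SymplecticForm 𝒳}
    {T : BasedFunctor 𝒳 𝒳}
    (hT : ∀ (ζ : 𝒳.obj) (x : base ζ) (w w' : (base ζ).E), Ω.pb T ζ x w w' = Ω.ev ζ x w w')
    (hξ : IsAtlas ξ) (hep : IsEtaleProper ξ) (hξ' : IsEtale ξ) :
    IsClopen (range fun x : base ξ => coarse hξ (T.obj ξ) (Man.fn (tr T ξ).hom x)) := by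
  have hcfg := h.toIsCFG
  have := t2Space_quot hcfg hξ' hep
  have := hc ξ hξ
  constructor
  · let f : Quot (CoarseRel ξ) → Quot (CoarseRel ξ) :=
      Quot.lift (fun x : base ξ => coarse hξ (T.obj ξ) (Man.fn (tr T ξ).hom x))
        (fun x y hxy => (coarse_eq_iff hcfg hξ _ _).2 (PtRel.map T (η := ξ) (η' := ξ) hxy))
    have hf : Continuous f := continuous_quot_lift _
      ((continuous_coarse hcfg hξ hξ' _).comp (Man.continuous_fn (tr T ξ).hom))
    have e : range (fun x : base ξ => coarse hξ (T.obj ξ) (Man.fn (tr T ξ).hom x)) = range f := by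
      ext q
      constructor
      · rintro ⟨x, rfl⟩
        exact ⟨Quot.mk _ x, rfl⟩
      · rintro ⟨q, rfl⟩
        obtain ⟨x, rfl⟩ := Quot.exists_rep q
        exact ⟨x, rfl⟩
    rw [e]
    exact (isCompact_range hf).isClosed
  · refine isQuotientMap_quot_mk.isOpen_preimage.1 (isOpen_iff_mem_nhds.2 ?_)
    rintro y ⟨x, hx⟩
    have hx' : coarse hξ (T.obj ξ) (Man.fn (tr T ξ).hom x) = Quot.mk _ y := hx
    rw [← coarse_atlas hcfg hξ, coarse_eq_iff hcfg hξ] at hx'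
    obtain ⟨ρ, b, g, hpb⟩ := exists_isPullback hcfg hcfg T hξ' ξ
    obtain ⟨m, rfl, rfl⟩ := hpb.exists_pt hcfg hcfg hx'
    have hbij := bijective_d_of_symp h hT hξ' hξ' b hpb.étale g m
    have hn := Man.map_nhds_of_bijective _ m hbij Filter.univ_mem
    refine Filter.mem_of_superset hn ?_
    rintro _ ⟨m', -, rfl⟩
    refine ⟨baseMap b m', ?_⟩
    change coarse hξ (T.obj ξ) (Man.fn (tr T ξ).hom (baseMap b m')) = Quot.mk _ _
    rw [← coarse_atlas hcfg hξ, coarse_eq_iff hcfg hξ, ← fn_map_tr]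
    exact (PtRel.of_arrow (T.map b) _).symm.trans hcfg (PtRel.of_arrow g _)

/-- If the maps `F_t` are symplectic and one of them is bijective on points, all of them are. -/
lemma Integrates.isGood (h : IsOrbifold 𝒳) (hc : IsCompactOrbifold 𝒳) {Ω : SymplecticForm 𝒳}
    {F : BasedFunctor (times univ 𝒳) 𝒳} {X : TimeVectorField 𝒳 univ} (hF : Integrates F X)
    (hsymp : ∀ (τ : ℝ) (ζ : 𝒳.obj) (x : base ζ) (w w' : (base ζ).E),
      Ω.pb (atTime F ⟨τ, trivial⟩) ζ x w w' = Ω.ev ζ x w w') (τ₀ : ℝ)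
    (h₀ : IsGood Ω (atTime F ⟨τ₀, trivial⟩)) (τ : ℝ) : IsGood Ω (atTime F ⟨τ, trivial⟩) where
  symp := hsymp τ
  inj ζ ζ' x x' hx := h₀.inj ζ ζ' x x' (hF.inj h ζ ζ' x x' τ₀ τ hx)
  surj ζ y := by
    obtain ⟨ξ, hξ, hep, hξ'⟩ := h.exists_étale_atlas
    have hcfg := h.toIsCFG
    have hclopen := isClopen_image h hc (hsymp τ) hξ hep hξ'
    obtain ⟨ζ', x, hx⟩ := h₀.surj ζ y
    have hcur := continuous_coarse_curve hcfg hξ hξ' F ζ' x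
    have huniv := (hclopen.preimage hcur).eq_univ (by
      refine ⟨τ, ?_⟩
      obtain ⟨x', hx'⟩ := hξ.exists_pt ζ' x
      exact ⟨x', (coarse_eq_iff hcfg hξ _ _).2 (hx'.map (atTime F ⟨τ, trivial⟩)).symm⟩)
    have hmem : τ₀ ∈ _ := huniv.symm ▸ mem_univ τ₀
    obtain ⟨x', hx'⟩ := hmem
    exact ⟨ξ, x', ((coarse_eq_iff hcfg hξ _ _).1 hx').trans hcfg hx⟩

end

section Interval

variable {𝒳 : BasedCategory.{v, u} Man} {a b : ℝ}

/-- Hamiltonian isotopies through symplectic maps that are bijective on points. -/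
def HamIsotopy (h : IsCFG 𝒳) (Ω : SymplecticForm 𝒳) {J : Set ℝ} (F : BasedFunctor (times J 𝒳) 𝒳) :
    Prop :=
  (∃ H : StackFunction (times J 𝒳), Star h Ω F H) ∧ ∀ t : J, IsGood Ω (atTime F t)

lemma Star.symp {h : IsCFG 𝒳} {Ω : SymplecticForm 𝒳} {J : Set ℝ} {F : BasedFunctor (times J 𝒳) 𝒳}
    {H : StackFunction (times J 𝒳)} (hF : Star h Ω F H) (t : J) (ζ : 𝒳.obj) (x : base ζ)
    (w w' : (base ζ).E) : Ω.pb (atTime F t) ζ x w w' = Ω.ev ζ x w w' := by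
  have h₁ := hF (sliceObj ζ t) x w w'
  have h₂ : ∀ w, (Man.d (time (sliceObj ζ t)) x w : ℝ) = 0 := fun w =>
    Man.d_const (M := base ζ) (N := Man.vec ℝ) (t : ℝ) x w
  rw [gap_apply, h₂, h₂, zero_mul, mul_zero, sub_zero, sub_zero, sub_eq_zero] at h₁
  exact h₁

/-- An isotopy that integrates a Hamiltonian vector field and starts at a symplectic map that is
bijective on points is a Hamiltonian isotopy. -/
lemma IntegratesHamiltonian.hamIsotopy (h : IsOrbifold 𝒳) (hc : IsCompactOrbifold 𝒳) (hab : a < b)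
    {Ω : SymplecticForm 𝒳} {F : BasedFunctor (times (Icc a b) 𝒳) 𝒳}
    (hF : IntegratesHamiltonian Ω F) (t₀ : Icc a b) (h₀ : IsGood Ω (atTime F t₀)) :
    HamIsotopy h.toIsCFG Ω F := by
  obtain ⟨H, X, hX, hFX⟩ := (IntegratesHamiltonian.iff_exists h.toIsCFG).1 hF
  have hstar := star_of_integrates h hab Ω hX hFX t₀ h₀.symp
  refine ⟨⟨H, hstar⟩, fun t => ?_⟩
  have hmaps : MapsTo (osc a b) univ (Icc a b) := fun τ _ => osc_mem hab.le τ
  obtain ⟨X', -, hGX⟩ := hF.reparam h.toIsCFG (osc a b) (contDiff_osc a b) hmaps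
  have hat : ∀ τ : ℝ, atTime ((HamOrb.reparam 𝒳 (osc a b) (contDiff_osc a b) hmaps).comp F) ⟨τ, trivial⟩ =
      atTime F ⟨osc a b τ, osc_mem hab.le τ⟩ := fun τ => rfl
  obtain ⟨τ, -, hτ⟩ := exists_osc_eq hab t.2
  obtain ⟨τ₀, -, hτ₀⟩ := exists_osc_eq hab t₀.2
  have e : (⟨osc a b τ, osc_mem hab.le τ⟩ : Icc a b) = t := Subtype.ext hτ
  have e₀ : (⟨osc a b τ₀, osc_mem hab.le τ₀⟩ : Icc a b) = t₀ := Subtype.ext hτ₀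
  have key := hGX.isGood h hc (Ω := Ω) (fun τ => by
    rw [hat]
    exact hstar.symp _) τ₀ (by
      rw [hat, e₀]
      exact h₀) τ
  rwa [hat, e] at key

lemma HamIsotopy.integratesHamiltonian (h : IsOrbifold 𝒳) (hab : a < b)
    {Ω : SymplecticForm 𝒳} {F : BasedFunctor (times (Icc a b) 𝒳) 𝒳}
    (hF : HamIsotopy h.toIsCFG Ω F) : IntegratesHamiltonian Ω F := by
  obtain ⟨⟨H, hH⟩, -⟩ := hF
  obtain ⟨X, hX⟩ := H.exists_hamiltonian_field h.toIsCFG Ω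
  exact (IntegratesHamiltonian.iff_exists h.toIsCFG).2 ⟨H, X, hX, hH.integrates h hab hX⟩

end Interval

end

section

/-! ### Pushing functions forward along a Hamiltonian isotopy -/

section

variable {𝒳 : BasedCategory.{v, u} Man} {J : Set ℝ}

/-- The value at `y` of the function whose pullback along `F_t` is `H_t`. -/
def pushVal {Ω : SymplecticForm 𝒳} {F : BasedFunctor (times J 𝒳) 𝒳}
    (hF : ∀ t : J, IsGood Ω (atTime F t)) (H : StackFunction (times J 𝒳)) (t : J) (ζ : 𝒳.obj)
    (y : base ζ) : ℝ :=
  H.eval t ((hF t).surj ζ y).choose ((hF t).surj ζ y).choose_spec.choose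

lemma pushVal_eq (h : IsCFG 𝒳) {Ω : SymplecticForm 𝒳} {F : BasedFunctor (times J 𝒳) 𝒳}
    (hF : ∀ t : J, IsGood Ω (atTime F t)) (H : StackFunction (times J 𝒳)) (t : J) {ζ ζ' : 𝒳.obj}
    {y : base ζ} {x : base ζ'}
    (hx : PtRel ((atTime F t).obj ζ') ζ (Man.fn (tr (atTime F t) ζ').hom x) y) :
    pushVal hF H t ζ y = H.eval t ζ' x :=
  H.eval_ptRel t ((hF t).inj _ _ _ _
    (((hF t).surj ζ y).choose_spec.choose_spec.trans h hx.symm))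

lemma pushVal_ptRel (h : IsCFG 𝒳) {Ω : SymplecticForm 𝒳} {F : BasedFunctor (times J 𝒳) 𝒳}
    (hF : ∀ t : J, IsGood Ω (atTime F t)) (H : StackFunction (times J 𝒳)) (t : J) {ζ ζ' : 𝒳.obj}
    {y : base ζ} {y' : base ζ'} (hy : PtRel ζ ζ' y y') :
    pushVal hF H t ζ y = pushVal hF H t ζ' y' :=
  (pushVal_eq h hF H t
    (((hF t).surj ζ y).choose_spec.choose_spec.trans h hy)).symm

/-- Solving `F (t, x) = y` for `x` étale locally, by the inverse function theorem. -/
lemma contMDiffAt_pushVal (h : IsOrbifold 𝒳) {Ω : SymplecticForm 𝒳}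
    {F : BasedFunctor (times J 𝒳) 𝒳} {H₀ : StackFunction (times J 𝒳)}
    (hstar : Star h.toIsCFG Ω F H₀) (hF : ∀ t : J, IsGood Ω (atTime F t))
    (H : StackFunction (times J 𝒳)) (η : TimesObj J 𝒳) {ξ : 𝒳.obj} (hξ : IsAtlas ξ)
    (hξ' : IsEtale ξ) (α : η.pt ⟶ ξ) (n₀ : base η.pt) :
    ContMDiffAt (base η.pt).I 𝓘(ℝ, ℝ) ∞
      (fun n => pushVal hF H ⟨Man.fn (time η) n, time_mem η n⟩ η.pt n) n₀ := by
  have hcfg := h.toIsCFG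
  have hT := isCFG_times J hcfg
  let N := base η.pt
  -- a solution over `n₀` exists because `F_t` is bijective on points
  obtain ⟨x₀, hx₀⟩ : ∃ x₀ : base ξ,
      PtRel ((atTime F ⟨Man.fn (time η) n₀, time_mem η n₀⟩).obj ξ) ξ
        (Man.fn (tr (atTime F ⟨Man.fn (time η) n₀, time_mem η n₀⟩) ξ).hom x₀) (baseMap α n₀) := by
    obtain ⟨ζ', x, hx⟩ := (hF ⟨Man.fn (time η) n₀, time_mem η n₀⟩).surj ξ (baseMap α n₀)
    obtain ⟨x₀, hx₀⟩ := hξ.exists_pt ζ' x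
    exact ⟨x₀, ((hx₀.map (atTime F _)).symm).trans hcfg hx⟩
  obtain ⟨η', i, c, hc, hi⟩ := hcfg.exists_timesObj (J := J) ξ (Man.snd N (base ξ))
    (Man.fst N (base ξ) ≫ time η) (fun m => time_mem η _)
  -- a chart `ρ` of `J × 𝒳`, étale over `N × base ξ` by `q`, on which `F` is a map `φ` to `base ξ`
  obtain ⟨ρ, b, g, hpb⟩ := exists_isPullback hT hcfg F hξ' η'
  have hc' : ∀ z, baseMap c (Man.fn i.hom z) = z.2 := fun z => congrArg (fun k => Man.fn k z) hc
  have hi' : ∀ z, Man.fn (time η') (Man.fn i.hom z) = Man.fn (time η) z.1 := fun z =>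
    congrArg (fun k => Man.fn k z) hi
  have hrel : ∀ z : N × base ξ, PtRel (F.obj η')
      ((atTime F ⟨Man.fn (time η) z.1, time_mem η z.1⟩).obj ξ)
      (Man.fn (trT F η').hom (Man.fn i.hom z)) (Man.fn (tr (atTime F _) ξ).hom z.2) := by
    intro z
    have := ptRel_atTime hcfg F η' c (Man.fn i.hom z) ⟨Man.fn (time η) z.1, time_mem η z.1⟩ (hi' z)
    rwa [hc'] at this
  let ρ' : TimesObj J 𝒳 := ρ
  let b' : TimesHom ρ' η' := b
  let g' : F.obj ρ' ⟶ ξ := g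
  let q : base ρ'.pt ⟶ N.prod (base ξ) := 𝒳.p.map b'.hom ≫ i.inv
  let φ : base ρ'.pt ⟶ base ξ := (trT F ρ').hom ≫ 𝒳.p.map g'
  obtain ⟨w₀, hw₀, hw₀'⟩ : ∃ w : base ρ'.pt,
      baseMap b'.hom w = Man.fn i.hom ((n₀, x₀) : N × base ξ) ∧ Man.fn φ w = baseMap α n₀ :=
    hpb.exists_pt hT hcfg (n := Man.fn i.hom ((n₀, x₀) : N × base ξ))
      (x := baseMap α n₀) ((hrel (n₀, x₀)).trans hcfg hx₀)
  have hqb : ∀ w, Man.fn i.hom (Man.fn q w) = baseMap b'.hom w := fun w => Man.fn_inv_hom i _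
  have hbij : Function.Bijective (Man.d q w₀) := by
    have h₁ := Man.d_bijective_of_isLocalDiffeomorph (f := 𝒳.p.map b'.hom) hpb.étale w₀
    have h₂ := Man.d_bijective_iso i.symm (Man.fn (𝒳.p.map b'.hom) w₀)
    have h₃ : ⇑(Man.d q w₀) =
        Man.d i.inv (Man.fn (𝒳.p.map b'.hom) w₀) ∘ Man.d (𝒳.p.map b'.hom) w₀ :=
      funext fun u => Man.d_comp _ _ _ _
    rw [h₃]
    exact h₂.comp h₁
  have hq₁ : q ≫ Man.fst _ _ ≫ time η = time ρ' := by
    rw [← hi, ← map_time (η := ρ') (η' := η') b']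
    simp [q]
  have hq₂ : q ≫ Man.snd _ _ = 𝒳.p.map (b'.hom ≫ c) := by
    rw [← hc, Functor.map_comp]
    simp [q]
  let Q := LinearEquiv.ofBijective (Man.d q w₀).toLinearMap hbij
  let L : (base ξ).E →ₗ[ℝ] (base ρ'.pt).E :=
    Q.symm.toLinearMap ∘ₗ LinearMap.inr ℝ N.E (base ξ).E
  have hQ : ∀ z, Man.d q w₀ (Q.symm z) = z := fun z => Q.apply_symm_apply z
  have hQL : ∀ v, Man.d q w₀ (L v) = ((0, v) : N.E × (base ξ).E) := fun v =>
    Q.apply_symm_apply _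
  have hbijL := hstar.bijective h ρ' hξ' hξ' (b'.hom ≫ c) g' w₀ L
    (fun v => by
      rw [← hq₁, Man.d_comp, Man.d_comp, hQL, Man.d_fst]
      exact map_zero (Man.d (time η) _))
    (fun v => by rw [← hq₂, Man.d_comp, hQL, Man.d_snd])
  -- `Ψ = (n, F)` is a local diffeomorphism, as `F` is étale in the space directions
  let Ψ : base ρ'.pt ⟶ N.prod (base ξ) := Man.pair (q ≫ Man.fst _ _) φ
  have hdΨ : ∀ w, Man.d Ψ w₀ w = ((Man.d q w₀ w).1, Man.d φ w₀ w) := by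
    intro w
    rw [Man.d_pair, Man.d_comp, Man.d_fst]
  have hΨ : Function.Bijective (Man.d Ψ w₀) := by
    constructor
    · refine (injective_iff_map_eq_zero (Man.d Ψ w₀)).2 fun w hw => ?_
      rw [hdΨ] at hw
      have h₁ : (Man.d q w₀ w).1 = 0 := congrArg Prod.fst hw
      have h₂ : Man.d φ w₀ w = 0 := congrArg Prod.snd hw
      have h₃ : w = L (Man.d q w₀ w).2 := by
        refine hbij.1 ?_
        rw [hQL]
        exact Prod.ext h₁ rfl
      rw [h₃] at h₂
      have h₄ := hbijL.1 (h₂.trans (by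
        change (0 : (base ξ).E) = Man.d φ w₀ (L 0)
        rw [map_zero, map_zero]))
      rw [h₃, h₄, map_zero]
    · rintro ⟨u, v⟩
      obtain ⟨v', hv'⟩ := hbijL.2 (v - Man.d φ w₀ (Q.symm (u, 0)))
      refine ⟨Q.symm (u, 0) + L v', ?_⟩
      rw [hdΨ, map_add, map_add, hQ, hQL]
      refine Prod.ext (add_zero u) ?_
      change Man.d φ w₀ (Q.symm (u, 0)) + Man.d φ w₀ (L v') = v
      have hv'' : Man.d φ w₀ (L v') = v - Man.d φ w₀ (Q.symm (u, 0)) := hv'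
      rw [hv'', add_sub_cancel]
  have hq₀ : Man.fn q w₀ = ((n₀, x₀) : N × base ξ) := by
    have h₁ : Man.fn i.hom (Man.fn q w₀) = Man.fn i.hom ((n₀, x₀) : N × base ξ) :=
      (hqb w₀).trans hw₀
    have h₂ := congrArg (Man.fn i.inv) h₁
    rwa [Man.fn_hom_inv, Man.fn_hom_inv] at h₂
  have hΨ₀ : Man.fn Ψ w₀ = ((n₀, baseMap α n₀) : N × base ξ) := by
    have h₁ : (Man.fn q w₀).1 = n₀ := congrArg Prod.fst hq₀
    exact Prod.ext h₁ hw₀'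
  obtain ⟨G, -, hGs, hGr⟩ := Man.exists_local_inverse Ψ w₀ hΨ
  rw [hΨ₀] at hGs hGr
  -- the inverse of `Ψ` along the graph `s` of `α` solves `F (t, x) = α n`
  let s : N ⟶ N.prod (base ξ) := Man.pair (𝟙 N) (𝒳.p.map α)
  let P : base ρ'.pt ⟶ Man.vec ℝ := H.pull hcfg (q ≫ Man.fst _ _ ≫ time η) (fun m => time_mem η _)
    (q ≫ Man.snd _ _)
  have hsm : ContMDiffAt N.I 𝓘(ℝ, ℝ) ∞ (fun n => (Man.fn P (G (Man.fn s n)) : ℝ)) n₀ :=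
    ContMDiffAt.comp n₀ (Man.contMDiff_fn P _)
      (ContMDiffAt.comp n₀ (g := G) hGs (Man.contMDiff_fn s n₀))
  refine hsm.congr_of_eventuallyEq ?_
  have hs : Filter.Tendsto (Man.fn s) (nhds n₀) (nhds (Man.fn s n₀)) :=
    (Man.continuous_fn s).continuousAt
  filter_upwards [hs.eventually hGr] with n hn
  set w := G (Man.fn s n) with hw
  have h₁ : (Man.fn q w).1 = n := congrArg Prod.fst hn
  have h₂ : Man.fn φ w = baseMap α n := congrArg Prod.snd hn
  change _ = H.eval ⟨Man.fn (time η) (Man.fn q w).1, time_mem η _⟩ ξ (Man.fn q w).2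
  have h₃ := hrel (Man.fn q w)
  rw [← h₁]
  refine pushVal_eq hcfg hF H _ ?_
  rw [hqb] at h₃
  have h₄ : baseMap (F.map (X := ρ') (Y := η') b') (Man.fn (trT F ρ').hom w) =
      Man.fn (trT F η').hom (baseMap b'.hom w) :=
    congrArg (fun k => Man.fn k w) (map_trT F b')
  rw [← h₄] at h₃
  refine h₃.symm.trans hcfg ((PtRel.of_arrow _ _).symm.trans hcfg
    ((PtRel.of_arrow g' _).trans hcfg ?_))
  change PtRel ξ η.pt (Man.fn φ w) (Man.fn q w).1
  rw [h₂, h₁]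
  exact (PtRel.of_arrow α n).symm

/-- Functions on `J × 𝒳` are pushed forward along a Hamiltonian isotopy. -/
lemma exists_pushforward (h : IsOrbifold 𝒳) {Ω : SymplecticForm 𝒳}
    {F : BasedFunctor (times J 𝒳) 𝒳} (hF : HamIsotopy h.toIsCFG Ω F)
    (H : StackFunction (times J 𝒳)) :
    ∃ K : StackFunction (times J 𝒳), ∀ (t : J) (ζ : 𝒳.obj) (x : base ζ),
      K.eval t ((atTime F t).obj ζ) (Man.fn (tr (atTime F t) ζ).hom x) = H.eval t ζ x := by
  obtain ⟨⟨H₀, hstar⟩, hg⟩ := hF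
  have hcfg := h.toIsCFG
  have hnat : ∀ (η η' : TimesObj J 𝒳) (g : TimesHom η η') (n : base η.pt),
      pushVal hg H ⟨Man.fn (time η) n, time_mem η n⟩ η.pt n =
        pushVal hg H ⟨Man.fn (time η') (baseMap g.hom n), time_mem η' _⟩ η'.pt
          (baseMap g.hom n) := by
    intro η η' g n
    have e : (⟨Man.fn (time η') (baseMap g.hom n), time_mem η' _⟩ : J) =
        ⟨Man.fn (time η) n, time_mem η n⟩ := Subtype.ext (TimesHom.par g n)
    rw [e]
    exact pushVal_ptRel hcfg hg H _ (PtRel.of_arrow g.hom n)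
  have hsm : ∀ η : TimesObj J 𝒳, ContMDiff (base η.pt).I 𝓘(ℝ, ℝ) ∞
      (fun n => pushVal hg H ⟨Man.fn (time η) n, time_mem η n⟩ η.pt n) := by
    intro η n
    obtain ⟨ξ, hξ, hep, hξ'⟩ := h.exists_étale_atlas
    obtain ⟨x, hx⟩ := hξ.exists_pt η.pt n
    obtain ⟨θ, c, α, m, rfl, -, hloc⟩ := hcfg.exists_lift_forget hξ' η hx
    obtain ⟨G, hG₀, hGs, hGr⟩ := Man.exists_local_inverse (𝒳.p.map c.hom) m
      (Man.d_bijective_of_isLocalDiffeomorph (f := 𝒳.p.map c.hom) hloc m)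
    have h₁ := contMDiffAt_pushVal h hstar hg H θ hξ hξ' α m
    rw [← hG₀] at h₁
    have h₂ := ContMDiffAt.comp (Man.fn (𝒳.p.map c.hom) m) (f := G) h₁ hGs
    refine h₂.congr_of_eventuallyEq ?_
    filter_upwards [hGr] with n' hn'
    refine Eq.trans ?_ (hnat θ η c (G n')).symm
    have hn'' : baseMap c.hom (G n') = n' := hn'
    rw [hn'']
  exact ⟨⟨fun η => ⟨fun n => pushVal hg H ⟨Man.fn (time η) n, time_mem η n⟩ (TimesObj.pt η) n,
    hsm η⟩, fun η η' g n => hnat η η' g n⟩, fun t ζ x => pushVal_eq hcfg hg H t (PtRel.refl _ _)⟩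

end

/-! ### Operations on Hamiltonian isotopies -/

section

variable {𝒳 : BasedCategory.{v, u} Man} {J J' : Set ℝ}

/-- The product rule for `c(f) g`; only the coefficient of `dg` is needed, as `df ∧ df = 0`. -/
lemma d_timeMul (c : ℝ → ℝ) (hc : ContDiff ℝ ∞ c) {M : Man} (f g k : M ⟶ Man.vec ℝ)
    (hk : ∀ m, (Man.fn k m : ℝ) = c (Man.fn f m) * Man.fn g m) (n : M) :
    ∃ r : ℝ, ∀ w, (Man.d k n w : ℝ) = r * Man.d f n w + c (Man.fn f n) * Man.d g n w := by
  let μ : (Man.vec ℝ).prod (Man.vec ℝ) ⟶ Man.vec ℝ := Man.ofFun (M := (Man.vec ℝ).prod (Man.vec ℝ))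
    (N := Man.vec ℝ) (fun z : ℝ × ℝ => c z.1 * z.2)
    ((hc.contMDiff.comp contMDiff_fst).mul contMDiff_snd)
  have h₁ : k = Man.pair f g ≫ μ := by
    ext m
    exact hk m
  let p : ℝ × ℝ := (Man.fn f n, Man.fn g n)
  let D : ℝ × ℝ →L[ℝ] ℝ := Man.d μ p
  refine ⟨D (1, 0), fun w => ?_⟩
  rw [h₁, Man.d_comp, Man.d_pair]
  have h₂ : ∀ v : ℝ, D (0, v) = c (Man.fn f n) * v := by
    intro v
    have h₃ := Man.d_comp (Man.pair (Man.const (Man.vec ℝ) (Man.fn f n)) (𝟙 (Man.vec ℝ))) μ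
      (Man.fn g n) v
    rw [Man.d_pair, Man.d_const, Man.d_id] at h₃
    refine h₃.symm.trans ?_
    have := StackFunction.d_mul_const (M := Man.vec ℝ) (𝟙 (Man.vec ℝ))
      (Man.pair (Man.const (Man.vec ℝ) (Man.fn f n)) (𝟙 (Man.vec ℝ)) ≫ μ) (c (Man.fn f n))
      (fun m => rfl) (Man.fn g n) v
    rw [Man.d_id] at this
    exact this
  have h₄ : ∀ u v : ℝ, D (u, v) = D (1, 0) * u + c (Man.fn f n) * v := by
    intro u v
    have : ((u, v) : ℝ × ℝ) = u • ((1, 0) : ℝ × ℝ) + (0, v) := by simp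
    rw [this, map_add, map_smul, h₂, smul_eq_mul, mul_comm]
  exact h₄ _ _

/-- The isotopy `t ↦ F_{φ t}` is generated by `φ' · (H ∘ φ)`. -/
lemma HamIsotopy.reparam (h : IsCFG 𝒳) {Ω : SymplecticForm 𝒳} {F : BasedFunctor (times J 𝒳) 𝒳}
    (hF : HamIsotopy h Ω F) (φ : ℝ → ℝ) (hφ : ContDiff ℝ ∞ φ) (hJ : MapsTo φ J' J) :
    HamIsotopy h Ω ((HamOrb.reparam 𝒳 φ hφ hJ).comp F) := by
  obtain ⟨⟨H, hH⟩, hg⟩ := hF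
  refine ⟨⟨H.reparamHam φ hφ hJ, fun η n w w' => ?_⟩, fun t => hg ⟨φ t, hJ t.2⟩⟩
  let η' : TimesObj J 𝒳 := (HamOrb.reparam 𝒳 φ hφ hJ).obj η
  let n' : base η'.pt := n
  let v : (base η'.pt).E := w
  let v' : (base η'.pt).E := w'
  have h₁ := (gap_apply h Ω F H η' n' v v').symm.trans (hH η' n' v v')
  have ht : ∀ w, (Man.d (time η') n' w : ℝ) = deriv φ (Man.fn (time η) n) * Man.d (time η) n w := by
    intro w
    have h₃ := Man.d_comp (time η) (lineHom φ hφ) n w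
    rw [d_lineHom] at h₃
    exact h₃
  obtain ⟨r, hr⟩ := d_timeMul (deriv φ) (contDiff_deriv hφ) (time η) (H.along h F η')
    ((H.reparamHam φ hφ hJ).along h ((HamOrb.reparam 𝒳 φ hφ hJ).comp F) η) (fun m => rfl) n
  rw [ht, ht] at h₁
  refine (gap_apply h Ω ((HamOrb.reparam 𝒳 φ hφ hJ).comp F) (H.reparamHam φ hφ hJ) η n w w').trans ?_
  rw [hr, hr]
  have h₂ : Ω.pbT ((HamOrb.reparam 𝒳 φ hφ hJ).comp F) η n w w' = Ω.pbT F η' n w w' := rfl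
  rw [h₂]
  have h₃ : Ω.ev η'.pt n w w' = Ω.ev η.pt n w w' := rfl
  rw [h₃] at h₁
  have alg : ∀ p e a a' k k' c : ℝ, p - e - (c * a * k' - k * (c * a')) = 0 →
      p - e - (a * (r * a' + c * k') - (r * a + c * k) * a') = 0 := by
    intro p e a a' k k' c hp
    linear_combination hp
  exact alg _ _ _ _ _ _ _ h₁

lemma d_add {M : Man} (f g k : M ⟶ Man.vec ℝ) (hk : ∀ m, (Man.fn k m : ℝ) = Man.fn f m + Man.fn g m)
    (n : M) (w : M.E) : (Man.d k n w : ℝ) = Man.d f n w + Man.d g n w := by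
  have h₁ := mfderiv_add (Man.mdiff_fn f n) (Man.mdiff_fn g n)
  have h₂ : (Man.fn k : M → ℝ) = (Man.fn f : M → ℝ) + (Man.fn g : M → ℝ) := funext hk
  rw [← h₂] at h₁
  exact DFunLike.congr_fun h₁ w

/-- The pointwise composition of Hamiltonian isotopies is generated by the sum of the generating
function of the outer one and the pushforward of that of the inner one. -/
lemma HamIsotopy.comp (h : IsOrbifold 𝒳) {Ω : SymplecticForm 𝒳} {F G : BasedFunctor (times J 𝒳) 𝒳}
    (hF : HamIsotopy h.toIsCFG Ω F) (hG : HamIsotopy h.toIsCFG Ω G) :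
    HamIsotopy h.toIsCFG Ω ((prodLift G).comp F) := by
  have hcfg := h.toIsCFG
  obtain ⟨⟨HG, hHG⟩, hgG⟩ := hG
  obtain ⟨K, hK⟩ := exists_pushforward h hF HG
  obtain ⟨⟨HF, hHF⟩, hgF⟩ := hF
  refine ⟨⟨HF.add K, fun η n w w' => ?_⟩, fun t => ?_⟩
  · let C := (prodLift G).comp F
    let η' : TimesObj J 𝒳 := (prodLift G).obj η
    let n' : base η'.pt := Man.fn (trT G η).hom n
    have htime : (trT G η).hom ≫ time η' = time η := by
      ext m
      exact congrArg (Man.fn (time η)) (Man.fn_hom_inv (trT G η) m)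
    have e₁ : Ω.pbT C η n w w' = Ω.pbT F η' n' (Man.d (trT G η).hom n w)
        (Man.d (trT G η).hom n w') := Ω.pb_comp (prodLift G) F η n w w'
    have e₂ := hHF η' n' (Man.d (trT G η).hom n w) (Man.d (trT G η).hom n w')
    have e₃ := hHG η n w w'
    have e₄ : ∀ w, (Man.d (time η') n' (Man.d (trT G η).hom n w) : ℝ) = Man.d (time η) n w := by
      intro w
      have := Man.d_comp (trT G η).hom (time η') n w
      rw [htime] at this
      exact this.symm
    have hsum := d_add (HF.along hcfg C η) (K.along hcfg C η) ((HF.add K).along hcfg C η)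
      (fun m => rfl) n
    have hrel : ∀ m, PtRel (C.obj η) (F.obj η') (Man.fn (trT C η).hom m)
        (Man.fn (trT F η').hom (Man.fn (trT G η).hom m)) := by
      intro m
      have : Man.fn (trT C η).hom m = Man.fn (trT F η').hom (Man.fn (trT G η).hom m) :=
        congrArg (fun k => Man.fn k m) (tr_comp_hom (prodLift G) F η)
      rw [this]
      exact PtRel.refl _ _
    have hHF' : HF.along hcfg C η = (trT G η).hom ≫ HF.along hcfg F η' := by
      refine Eq.trans ?_ (HF.comp_pull hcfg (trT G η).hom (time η') (time_mem η')
        (trT F η').hom).symm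
      exact HF.pull_congr hcfg _ _ _ _ htime.symm hrel
    have hK' : K.along hcfg C η = HG.along hcfg G η := by
      ext m
      have h₁ := ptRel_atTime hcfg F η' (𝟙 _) (Man.fn (trT G η).hom m)
        ⟨Man.fn (time η) m, time_mem η m⟩ (congrArg (fun k => Man.fn k m) htime)
      have hid : baseMap (𝟙 η'.pt) (Man.fn (trT G η).hom m) = Man.fn (trT G η).hom m :=
        baseMap_id _ _
      rw [hid] at h₁
      exact (K.eval_ptRel _ ((hrel m).trans hcfg h₁)).trans (hK _ (G.obj η) _)
    rw [hHF', hK'] at hsum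
    have e₆ : ∀ w, Man.d ((trT G η).hom ≫ HF.along hcfg F η') n w =
        Man.d (HF.along hcfg F η') n' (Man.d (trT G η).hom n w) := fun w => Man.d_comp _ _ _ _
    have e₂' := (gap_apply hcfg Ω F HF η' n' _ _).symm.trans e₂
    rw [e₄, e₄] at e₂'
    rw [gap_apply] at e₃
    refine (gap_apply hcfg Ω C (HF.add K) η n w w').trans ?_
    rw [hsum, hsum, e₁, e₆, e₆]
    have e₅ : Ω.ev η'.pt n' (Man.d (trT G η).hom n w) (Man.d (trT G η).hom n w') =
        Ω.pbT G η n w w' := rfl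
    rw [e₅] at e₂'
    linear_combination e₂' + e₃
  · exact (hgG t).comp hcfg (hgF t)

end

end

section

/-! ### 2-morphisms between reparametrizations and products -/

section

variable {𝒳 : BasedCategory.{v, u} Man}
variable {E E' E'' : Type} [NormedAddCommGroup E] [NormedSpace ℝ E] [NormedAddCommGroup E']
  [NormedSpace ℝ E'] [NormedAddCommGroup E''] [NormedSpace ℝ E'']
variable {S : Set E} {S' : Set E'} {S'' : Set E''}

lemma isHomLift_of_tr {𝒴 : BasedCategory.{v', u'} Man} {F G : BasedFunctor 𝒴 𝒳} (η : 𝒴.obj)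
    (g : F.obj η ⟶ G.obj η) (hg : (tr F η).hom ≫ 𝒳.p.map g = (tr G η).hom) :
    𝒳.p.IsHomLift (𝟙 (𝒴.p.obj η)) g := by
  refine IsHomLift.of_fac' 𝒳.p _ g (F.w_obj η) (G.w_obj η) ?_
  rw [Category.id_comp]
  refine ((Iso.eq_inv_comp (tr F η)).2 hg).trans ?_
  simp [tr]

/-- A criterion for 2-morphisms between maps to `S × 𝒳`. -/
lemma twoIso_of_timesHom {𝒴 : BasedCategory.{v', u'} Man} {F G : BasedFunctor 𝒴 (times S 𝒳)}
    (θ : ∀ η, TimesHom (F.obj η) (G.obj η))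
    (hθ : ∀ {η η' : 𝒴.obj} (g : η ⟶ η'),
      TimesHom.hom (F.map g) ≫ (θ η').hom = (θ η).hom ≫ TimesHom.hom (G.map g))
    (hθ' : ∀ η, (tr F η).hom ≫ 𝒳.p.map (θ η).hom = (tr G η).hom) : TwoIso F G :=
  ⟨{ app := θ
     naturality := fun _ _ g => TimesHom.ext (hθ g)
     isHomLift' := fun η => isHomLift_of_tr (𝒳 := times S 𝒳) η (θ η) (hθ' η) }⟩

/-- Reparametrizations depend, up to 2-morphism, only on the values on the parameter set. -/
lemma twoIso_reparam_congr {φ ψ : E → E'} (hφ : ContDiff ℝ ∞ φ) (hψ : ContDiff ℝ ∞ ψ)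
    (hS : MapsTo φ S S') (hS' : MapsTo ψ S S') (h : EqOn φ ψ S) :
    TwoIso (reparam 𝒳 φ hφ hS) (reparam 𝒳 ψ hψ hS') := by
  refine twoIso_of_timesHom (fun η => ⟨𝟙 (TimesObj.pt η), fun x => ?_⟩) (fun {η η'} g => ?_)
    (fun η => ?_)
  · exact (congrArg (fun y => ψ (TimesObj.par η y)) (baseMap_id (TimesObj.pt η) x)).trans
      (h (TimesObj.mem η x)).symm
  · exact (Category.comp_id (TimesHom.hom g)).trans (Category.id_comp (TimesHom.hom g)).symm
  · exact (Category.id_comp _).trans (𝒳.p.map_id (TimesObj.pt η))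

lemma TwoIso.prodLift {G G' : BasedFunctor (times S 𝒳) 𝒳} (e : TwoIso G G') :
    TwoIso (HamOrb.prodLift G) (HamOrb.prodLift G') := by
  obtain ⟨θ⟩ := e
  have hθ : ∀ η : TimesObj S 𝒳, 𝒳.p.map (θ.app η) ≫ (tr G' η).inv = (tr G η).inv := fun η => by
    rw [Iso.comp_inv_eq, ← BasedNatTrans.tr_app θ η, Iso.inv_hom_id_assoc]
  refine twoIso_of_timesHom (fun η => ⟨θ.app η, fun x => ?_⟩) (fun g => θ.naturality g)
    (fun η => BasedNatTrans.tr_app θ η)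
  exact congrArg (fun k => TimesObj.par η (Man.fn k x)) (hθ η)

lemma twoIso_prodLift_comp (F G : BasedFunctor (times S 𝒳) 𝒳) :
    TwoIso (prodLift ((prodLift F).comp G)) ((prodLift F).comp (prodLift G)) := by
  refine twoIso_of_timesHom (fun η => ⟨𝟙 _, fun x => ?_⟩) (fun g => ?_) (fun η => ?_)
  · have h : (tr G ((prodLift F).obj η)).inv ≫ (tr F η).inv = (tr ((prodLift F).comp G) η).inv :=
      eqToHom_trans (G.w_obj ((prodLift F).obj η)) (F.w_obj η)
    exact (congrArg (fun y => TimesObj.par (S := S) (𝒳 := 𝒳)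
      (((prodLift F).comp (prodLift G)).obj η) y) (baseMap_id _ x)).trans
      (congrArg (fun k => TimesObj.par η (Man.fn k x)) h)
  · exact (Category.comp_id _).trans (Category.id_comp _).symm
  · have h := 𝒳.p.map_id (TimesObj.pt ((prodLift ((prodLift F).comp G)).obj η))
    exact (congrArg (CategoryStruct.comp (tr (prodLift ((prodLift F).comp G)) η).hom) h).trans
      (Category.comp_id _)

/-- The projection is a Hamiltonian isotopy, generated by the function `0`. -/
lemma hamIsotopy_forget (h : IsCFG 𝒳) (Ω : SymplecticForm 𝒳) (J : Set ℝ) :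
    HamIsotopy h Ω (forget J 𝒳) := by
  let H : StackFunction (times J 𝒳) := ⟨fun _ => ContMDiffMap.const 0, fun _ _ _ _ => rfl⟩
  refine ⟨⟨H, fun η n w w' => ?_⟩, fun t => IsGood.id Ω⟩
  have h₁ : ∀ w, (Man.d (H.along h (forget J 𝒳) η) n w : ℝ) = 0 := fun w =>
    Man.d_const (M := base η.pt) (N := Man.vec ℝ) (0 : ℝ) n w
  have h₂ : Ω.pbT (forget J 𝒳) η n w w' = Ω.ev η.pt n w w' := by
    change Ω.ev η.pt n (Man.d (𝟙 (𝒳.p.obj η.pt)) n w) (Man.d (𝟙 (𝒳.p.obj η.pt)) n w') = _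
    rw [Man.d_id, Man.d_id]
  refine (gap_apply h Ω (forget J 𝒳) H η n w w').trans ?_
  rw [h₁, h₁, h₂, mul_zero, zero_mul, sub_zero, sub_zero, sub_self]

end

end

section

/-! ### Partitions -/

namespace Partition

variable {P Q : Partition} {a b p q p' q' x : ℝ}

lemma Consec.mem_left (h : P.Consec a b) : a ∈ Icc (0 : ℝ) 1 := P.mem_Icc a h.left

lemma Consec.mem_right (h : P.Consec a b) : b ∈ Icc (0 : ℝ) 1 := P.mem_Icc b h.right

lemma Consec.right_unique (h : P.Consec a b) (h' : P.Consec a q) : b = q := by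
  rcases h.between q h'.right with h₁ | h₁
  · exact absurd h'.lt h₁.not_gt
  · rcases h'.between b h.right with h₂ | h₂
    · exact absurd h.lt h₂.not_gt
    · exact le_antisymm h₁ h₂

/-- Intervals of a partition that contain a common interval coincide. -/
lemma Consec.unique (h : P.Consec p q) (h' : P.Consec p' q') (hab : a < b) (hp : p ≤ a) (hq : b ≤ q)
    (hp' : p' ≤ a) (hq' : b ≤ q') : p = p' ∧ q = q' := by
  have h₁ : p = p' := by
    rcases h.between p' h'.left with h₁ | h₁
    · rcases h'.between p h.left with h₂ | h₂ <;> linarith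
    · linarith
  subst h₁
  exact ⟨rfl, h.right_unique h'⟩

lemma exists_right (hx : x ∈ P.pts) (hx1 : x < 1) : ∃ b, P.Consec x b := by
  have hne : (P.pts.filter (fun y => x < y)).Nonempty :=
    ⟨1, Finset.mem_filter.2 ⟨P.one_mem, hx1⟩⟩
  have h₁ := Finset.mem_filter.1 (Finset.min'_mem _ hne)
  refine ⟨_, hx, h₁.1, h₁.2, fun c hc => ?_⟩
  by_cases hxc : x < c
  · exact Or.inr (Finset.min'_le _ c (Finset.mem_filter.2 ⟨hc, hxc⟩))
  · exact Or.inl (not_lt.1 hxc)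

lemma exists_left (hx : x ∈ P.pts) (hx0 : 0 < x) : ∃ a, P.Consec a x := by
  have hne : (P.pts.filter (fun y => y < x)).Nonempty :=
    ⟨0, Finset.mem_filter.2 ⟨P.zero_mem, hx0⟩⟩
  have h₁ := Finset.mem_filter.1 (Finset.max'_mem _ hne)
  refine ⟨_, h₁.1, hx, h₁.2, fun c hc => ?_⟩
  by_cases hxc : c < x
  · exact Or.inl (Finset.le_max' _ c (Finset.mem_filter.2 ⟨hc, hxc⟩))
  · exact Or.inr (not_lt.1 hxc)

lemma exists_first (P : Partition) : ∃ b, P.Consec 0 b := exists_right P.zero_mem one_pos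

lemma exists_last (P : Partition) : ∃ a, P.Consec a 1 := exists_left P.one_mem one_pos

/-- Induction along the points of a partition. -/
lemma induction_on {R : ℝ → Prop} (P : Partition) (h0 : R 0)
    (hR : ∀ a b, P.Consec a b → R a → R b) : ∀ x ∈ P.pts, R x := by
  classical
  by_contra! hcon
  obtain ⟨x, hx, hRx⟩ := hcon
  have hne : (P.pts.filter (fun y => ¬ R y)).Nonempty := ⟨x, Finset.mem_filter.2 ⟨hx, hRx⟩⟩
  have hm := Finset.mem_filter.1 (Finset.min'_mem _ hne)
  set m := Finset.min' _ hne with hmdef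
  have hm0 : 0 < m := lt_of_le_of_ne (P.mem_Icc m hm.1).1 (fun h => hm.2 (h ▸ h0))
  obtain ⟨a, ha⟩ := exists_left hm.1 hm0
  by_cases hRa : R a
  · exact hm.2 (hR a m ha hRa)
  · exact absurd (Finset.min'_le _ a (Finset.mem_filter.2 ⟨ha.left, hRa⟩)) ha.lt.not_ge

/-- The partition of the unit interval into one interval. -/
def whole : Partition where
  pts := {0, 1}
  zero_mem := by simp
  one_mem := by simp
  mem_Icc x hx := by
    rcases Finset.mem_insert.1 hx with rfl | hx
    · simp
    · rw [Finset.mem_singleton.1 hx]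
      simp

lemma whole_consec : whole.Consec 0 1 :=
  ⟨whole.zero_mem, whole.one_mem, one_pos, fun c hc => by
    rcases Finset.mem_insert.1 hc with rfl | hx
    · exact Or.inl le_rfl
    · rw [Finset.mem_singleton.1 hx]
      exact Or.inr le_rfl⟩

lemma Consec.of_whole (h : whole.Consec a b) : a = 0 ∧ b = 1 := by
  obtain ⟨h₁, h₂⟩ := whole_consec.unique h h.lt h.mem_left.1 h.mem_right.2 le_rfl le_rfl
  exact ⟨h₁.symm, h₂.symm⟩

lemma whole_subset (P : Partition) : whole.pts ⊆ P.pts := by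
  intro x hx
  rcases Finset.mem_insert.1 hx with rfl | hx
  · exact P.zero_mem
  · rw [Finset.mem_singleton.1 hx]
    exact P.one_mem

/-- The image of a partition under `t ↦ 1 - t`. -/
def rev (P : Partition) : Partition where
  pts := P.pts.image (fun x => 1 - x)
  zero_mem := Finset.mem_image.2 ⟨1, P.one_mem, by norm_num⟩
  one_mem := Finset.mem_image.2 ⟨0, P.zero_mem, by norm_num⟩
  mem_Icc x hx := by
    obtain ⟨y, hy, rfl⟩ := Finset.mem_image.1 hx
    obtain ⟨h0, h1⟩ := P.mem_Icc y hy
    constructor <;> linarith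

lemma Consec.of_rev (h : P.rev.Consec a b) : P.Consec (1 - b) (1 - a) := by
  have key : ∀ x ∈ P.rev.pts, 1 - x ∈ P.pts := by
    intro x hx
    obtain ⟨y, hy, rfl⟩ := Finset.mem_image.1 hx
    rwa [sub_sub_cancel]
  have hlt := h.lt
  refine ⟨key b h.right, key a h.left, by linarith, fun c hc => ?_⟩
  rcases h.between (1 - c) (Finset.mem_image.2 ⟨c, hc, rfl⟩) with h' | h'
  · right; linarith
  · left; linarith

/-- Consecutive intervals of a refinement lie in the same interval of the coarser partition, or
in consecutive ones. -/
lemma Consec.parents (h : Q.Consec a b) {c : ℝ} (h' : Q.Consec b c) (hp : P.Consec p q)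
    (hp' : P.Consec p' q') (h₁ : p ≤ a) (h₂ : b ≤ q) (h₃ : p' ≤ b) (h₄ : c ≤ q') :
    (p = p' ∧ q = q') ∨ (q = b ∧ p' = b) := by
  have hab := h.lt
  have hbc := h'.lt
  rcases h₂.eq_or_lt with rfl | hlt
  · right
    refine ⟨rfl, ?_⟩
    rcases hp'.between b hp.right with h₅ | h₅ <;> linarith
  · left
    have h₅ : p' ≤ p := by
      rcases hp.between p' hp'.left with h₅ | h₅
      · exact h₅
      · linarith
    exact hp.unique hp' h.lt h₁ h₂ (h₅.trans h₁) (by linarith)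

lemma concat_between_half (h : (P.concat Q).Consec a b) : b ≤ 1 / 2 ∨ 1 / 2 ≤ a := by
  rcases h.between _ (P.half_mem Q) with h' | h'
  · exact Or.inr h'
  · exact Or.inl h'

lemma concat_subset {P' R : Partition} (h : P.pts ⊆ Q.pts) (h' : P'.pts ⊆ R.pts) :
    (P.concat P').pts ⊆ (Q.concat R).pts :=
  Finset.union_subset_union (Finset.image_subset_image h) (Finset.image_subset_image h')

end Partition

/-! ### Naturally related paths -/

namespace PiecewisePath

variable {𝒳 : BasedCategory.{v, u} Man} {Ω : SymplecticForm 𝒳} {γ γ' γ'' : PiecewisePath 𝒳}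
  {a b p q : ℝ}

/-- The restriction of the piece over `[p, q]` to a smaller interval. -/
abbrev res (γ : PiecewisePath 𝒳) (h : γ.P.Consec p q) (hp : Icc a b ⊆ Icc p q) :
    BasedFunctor (times (Icc a b) 𝒳) 𝒳 :=
  (reparam 𝒳 (fun t : ℝ => t) contDiff_id hp).comp (γ.map p q h)

lemma subdivide_map (γ : PiecewisePath 𝒳) (Q : Partition) (hQ : γ.P.pts ⊆ Q.pts)
    (h : Q.Consec a b) (h' : γ.P.Consec p q) (hp : p ≤ a) (hq : b ≤ q) :
    (γ.subdivide Q hQ).map a b h = γ.res h' (Icc_subset_Icc hp hq) := by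
  have key : ∀ (w : ℝ × ℝ) (hw : γ.P.Consec w.1 w.2) (h₁ : w.1 ≤ a) (h₂ : b ≤ w.2),
      γ.res hw (Icc_subset_Icc h₁ h₂) = γ.res h' (Icc_subset_Icc hp hq) := by
    rintro ⟨w₁, w₂⟩ hw h₁ h₂
    obtain ⟨rfl, rfl⟩ := hw.unique h' h.lt h₁ h₂ hp hq
    rfl
  exact key _ _ (Partition.exists_parent hQ h).choose_spec.2.1
    (Partition.exists_parent hQ h).choose_spec.2.2

lemma exists_subdivide_map (γ : PiecewisePath 𝒳) (Q : Partition) (hQ : γ.P.pts ⊆ Q.pts)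
    (h : Q.Consec a b) : ∃ (p q : ℝ) (h' : γ.P.Consec p q) (hp : p ≤ a) (hq : b ≤ q),
      (γ.subdivide Q hQ).map a b h = γ.res h' (Icc_subset_Icc hp hq) := by
  obtain ⟨⟨p, q⟩, h', hp, hq⟩ := Partition.exists_parent hQ h
  exact ⟨p, q, h', hp, hq, γ.subdivide_map Q hQ h h' hp hq⟩

lemma IsHamiltonian.subdivide (h𝒳 : IsCFG 𝒳) (hγ : γ.IsHamiltonian Ω) (Q : Partition)
    (hQ : γ.P.pts ⊆ Q.pts) : (γ.subdivide Q hQ).IsHamiltonian Ω where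
  integrates a b h := (hγ.integrates _ _ _).reparam h𝒳 _ _ _
  joins a b c h h' := by
    obtain ⟨p, q, hpq, hp, hq, e⟩ := γ.exists_subdivide_map Q hQ h
    obtain ⟨p', q', hpq', hp', hq', e'⟩ := γ.exists_subdivide_map Q hQ h'
    unfold right left
    rw [e, e']
    rcases h.parents h' hpq hpq' hp hq hp' hq' with ⟨rfl, rfl⟩ | ⟨rfl, rfl⟩
    · exact TwoIso.refl _
    · exact hγ.joins _ _ _ hpq hpq'

/-- The pieces of the two paths agree up to 2-morphism over the intervals of `Q`. -/
def Agree (Q : Partition) (γ γ' : PiecewisePath 𝒳) : Prop :=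
  ∀ a b, Q.Consec a b → ∀ p q (h : γ.P.Consec p q) p' q' (h' : γ'.P.Consec p' q')
    (hp : Icc a b ⊆ Icc p q) (hp' : Icc a b ⊆ Icc p' q'), TwoIso (γ.res h hp) (γ'.res h' hp')

lemma NaturallyRelated.symm (h : IsCFG 𝒳) (hγ : NaturallyRelated Ω γ γ') :
    NaturallyRelated Ω γ' γ := by
  have hsymm : Std.Symm (fun δ δ' : PiecewisePath 𝒳 => δ.IsHamiltonian Ω ∧ δ'.IsHamiltonian Ω ∧
      (δ.IsSplitting δ' ∨ δ'.IsSplitting δ ∨ δ.TwoRelated δ')) := ⟨fun δ δ' hδ => ?_⟩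
  · exact Relation.ReflTransGen.stdSymm.symm _ _ hγ
  refine ⟨hδ.2.1, hδ.1, ?_⟩
  rcases hδ.2.2 with h₁ | h₁ | h₁
  · exact Or.inr (Or.inl h₁)
  · exact Or.inl h₁
  · exact Or.inr (Or.inr ⟨h₁.1.symm, fun a b h₂ h₃ => (h₁.2 a b h₃ h₂).symm h⟩)

lemma NaturallyRelated.of_twoRelated (hγ : γ.IsHamiltonian Ω) (hγ' : γ'.IsHamiltonian Ω)
    (h : TwoRelated γ γ') : NaturallyRelated Ω γ γ' :=
  Relation.ReflTransGen.single ⟨hγ, hγ', Or.inr (Or.inr h)⟩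

/-- A Hamiltonian path is naturally related to its subdivisions: the points of the refinement are
added one at a time. -/
lemma naturallyRelated_subdivide (h : IsCFG 𝒳) (hγ : γ.IsHamiltonian Ω) (Q : Partition)
    (hQ : γ.P.pts ⊆ Q.pts) : NaturallyRelated Ω γ (γ.subdivide Q hQ) := by
  induction hn : (Q.pts \ γ.P.pts).card generalizing γ with
  | zero =>
    have hsub : Q.pts ⊆ γ.P.pts := Finset.sdiff_eq_empty_iff_subset.1 (Finset.card_eq_zero.1 hn)
    have hP : γ.P = Q := Partition.ext (Finset.Subset.antisymm hQ hsub)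
    refine .of_twoRelated hγ (hγ.subdivide h Q hQ) ⟨hP, fun a b h₁ h₂ => ?_⟩
    rw [γ.subdivide_map Q hQ h₂ h₁ le_rfl le_rfl]
    exact TwoIso.refl _
  | succ n ih =>
    obtain ⟨c, hc⟩ : (Q.pts \ γ.P.pts).Nonempty := Finset.card_pos.1 (by omega)
    obtain ⟨hcQ, hcP⟩ := Finset.mem_sdiff.1 hc
    let δ := γ.subdivide (γ.P.addPoint c (Q.mem_Icc c hcQ)) (Finset.subset_insert _ _)
    have hδ : δ.IsHamiltonian Ω := hγ.subdivide h _ _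
    have hδQ : δ.P.pts ⊆ Q.pts := Finset.insert_subset hcQ hQ
    have hcard : (Q.pts \ δ.P.pts).card = n := by
      have : Q.pts \ δ.P.pts = (Q.pts \ γ.P.pts).erase c := by
        ext x
        simp only [δ, subdivide, Partition.addPoint, Finset.mem_sdiff, Finset.mem_insert,
          Finset.mem_erase]
        tauto
      rw [this, Finset.card_erase_of_mem hc, hn]
      rfl
    have h₁ : NaturallyRelated Ω γ δ :=
      Relation.ReflTransGen.single ⟨hγ, hδ, Or.inl ⟨c, Q.mem_Icc c hcQ, hcP, rfl⟩⟩
    refine (h₁.trans (ih hδ hδQ hcard)).trans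
      (NaturallyRelated.of_twoRelated (hδ.subdivide h Q hδQ) (hγ.subdivide h Q hQ) ⟨rfl, fun a b h₂ h₃ => ?_⟩)
    obtain ⟨p, q, hpq, hp, hq, e⟩ := δ.exists_subdivide_map Q hδQ h₂
    obtain ⟨p', q', hpq', hp', hq', e'⟩ := γ.exists_subdivide_map _ (Finset.subset_insert _ _) hpq
    rw [e, γ.subdivide_map Q hQ h₃ hpq' (hp'.trans hp) (hq.trans hq')]
    exact TwoIso.of_eq (congrArg (fun F => (reparam 𝒳 (fun t : ℝ => t) contDiff_id
      (Icc_subset_Icc hp hq)).comp F) e')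

/-- Hamiltonian paths are naturally related as soon as their pieces agree up to 2-morphism over
some common refinement. -/
lemma Agree.naturallyRelated (h : IsCFG 𝒳) (hγ : γ.IsHamiltonian Ω) (hγ' : γ'.IsHamiltonian Ω)
    {Q : Partition} (hQ : γ.P.pts ⊆ Q.pts) (hQ' : γ'.P.pts ⊆ Q.pts) (hag : Agree Q γ γ') :
    NaturallyRelated Ω γ γ' := by
  refine ((naturallyRelated_subdivide h hγ Q hQ).trans
    (NaturallyRelated.of_twoRelated (hγ.subdivide h Q hQ) (hγ'.subdivide h Q hQ') ⟨rfl, fun a b h₁ h₂ => ?_⟩)).trans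
    ((naturallyRelated_subdivide h hγ' Q hQ').symm h)
  obtain ⟨p, q, hpq, hp, hq, e⟩ := γ.exists_subdivide_map Q hQ h₁
  obtain ⟨p', q', hpq', hp', hq', e'⟩ := γ'.exists_subdivide_map Q hQ' h₁
  change TwoIso ((γ.subdivide Q hQ).map a b h₁) ((γ'.subdivide Q hQ').map a b h₁)
  rw [e, e']
  exact hag a b h₁ p q hpq p' q' hpq' _ _

lemma TwoRelated.agree (h : TwoRelated γ γ') : Agree γ.P γ γ' := by
  intro a b hab p q hpq p' q' hpq' hp hp'
  have h₁ := (Icc_subset_Icc_iff hab.lt.le).1 hp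
  have h₂ := (Icc_subset_Icc_iff hab.lt.le).1 hp'
  have hpq'' := hpq'
  rw [← h.1] at hpq''
  obtain ⟨rfl, rfl⟩ := hpq.unique hpq'' hab.lt h₁.1 h₁.2 h₂.1 h₂.2
  exact (h.2 p q hpq hpq').whiskerLeft _

lemma IsSplitting.agree (h : IsSplitting γ γ') :
    γ.P.pts ⊆ γ'.P.pts ∧ Agree γ'.P γ γ' := by
  obtain ⟨c, hc, hc', rfl⟩ := h
  refine ⟨Finset.subset_insert _ _, fun a b hab p q hpq p' q' hpq' hp hp' => ?_⟩
  have h₁ := (Icc_subset_Icc_iff hab.lt.le).1 hp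
  have h₂ := (Icc_subset_Icc_iff hab.lt.le).1 hp'
  obtain ⟨rfl, rfl⟩ := hab.unique hpq' hab.lt le_rfl le_rfl h₂.1 h₂.2
  have e := γ.subdivide_map (γ.P.addPoint c hc) (Finset.subset_insert _ _) hab hpq h₁.1 h₁.2
  exact TwoIso.of_eq e.symm

lemma Agree.symm (h : IsCFG 𝒳) {Q : Partition} (hag : Agree Q γ γ') : Agree Q γ' γ :=
  fun a b hab p q hpq p' q' hpq' hp hp' => (hag a b hab p' q' hpq' p q hpq hp' hp).symm h

end PiecewisePath

end

section

namespace PiecewisePath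

variable {𝒳 : BasedCategory.{v, u} Man} {Ω : SymplecticForm 𝒳} {γ γ' γ'' δ δ' : PiecewisePath 𝒳}
  {a b p q : ℝ} {Q R : Partition}

lemma agree_refl (γ : PiecewisePath 𝒳) : Agree γ.P γ γ :=
  TwoRelated.agree ⟨rfl, fun _ _ _ _ => TwoIso.refl _⟩

lemma Agree.mono (hag : Agree Q γ γ') (hQ : γ.P.pts ⊆ Q.pts) (hQ' : γ'.P.pts ⊆ Q.pts)
    (hQR : Q.pts ⊆ R.pts) : Agree R γ γ' := by
  intro a b hab p q hpq p' q' hpq' hp hp'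
  have h₁ := (Icc_subset_Icc_iff hab.lt.le).1 hp
  have h₂ := (Icc_subset_Icc_iff hab.lt.le).1 hp'
  obtain ⟨⟨c, d⟩, hcd, hc, hd⟩ := Partition.exists_parent hQR hab
  obtain ⟨⟨e, f⟩, hef, he, hf⟩ := Partition.exists_parent hQ hcd
  obtain ⟨⟨e', f'⟩, hef', he', hf'⟩ := Partition.exists_parent hQ' hcd
  dsimp only at *
  obtain ⟨rfl, rfl⟩ := hpq.unique hef hab.lt h₁.1 h₁.2 (he.trans hc) (hd.trans hf)
  obtain ⟨rfl, rfl⟩ := hpq'.unique hef' hab.lt h₂.1 h₂.2 (he'.trans hc) (hd.trans hf')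
  exact (hag c d hcd p q hpq p' q' hpq' (Icc_subset_Icc he hf) (Icc_subset_Icc he' hf')).whiskerLeft
    (reparam 𝒳 (fun t : ℝ => t) contDiff_id (Icc_subset_Icc hc hd))

lemma Agree.trans (h : Agree Q γ γ') (h' : Agree R γ' γ'') (h₁ : γ.P.pts ⊆ Q.pts)
    (h₂ : γ'.P.pts ⊆ Q.pts) (h₃ : γ'.P.pts ⊆ R.pts) (h₄ : γ''.P.pts ⊆ R.pts) :
    Agree (Q.union R) γ γ'' := by
  have hQ : Q.pts ⊆ (Q.union R).pts := Finset.subset_union_left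
  have hR : R.pts ⊆ (Q.union R).pts := Finset.subset_union_right
  intro a b hab p q hpq p' q' hpq' hp hp'
  obtain ⟨⟨c, d⟩, hcd, hc, hd⟩ := Partition.exists_parent (h₂.trans hQ) hab
  exact (h.mono h₁ h₂ hQ a b hab p q hpq c d hcd hp (Icc_subset_Icc hc hd)).trans
    (h'.mono h₃ h₄ hR a b hab c d hcd p' q' hpq' (Icc_subset_Icc hc hd) hp')

/-- Naturally related paths agree over some common refinement. -/
lemma NaturallyRelated.exists_agree (h : IsCFG 𝒳) (hγ : NaturallyRelated Ω γ γ') :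
    ∃ Q : Partition, γ.P.pts ⊆ Q.pts ∧ γ'.P.pts ⊆ Q.pts ∧ Agree Q γ γ' := by
  induction hγ with
  | refl => exact ⟨γ.P, subset_rfl, subset_rfl, γ.agree_refl⟩
  | @tail δ δ' _ hstep ih =>
    obtain ⟨Q, h₁, h₂, hQ⟩ := ih
    obtain ⟨R, h₃, h₄, hR⟩ : ∃ R : Partition, δ.P.pts ⊆ R.pts ∧ δ'.P.pts ⊆ R.pts ∧
        Agree R δ δ' := by
      rcases hstep.2.2 with hs | hs | hs
      · exact ⟨δ'.P, hs.agree.1, subset_rfl, hs.agree.2⟩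
      · exact ⟨δ.P, subset_rfl, hs.agree.1, hs.agree.2.symm h⟩
      · exact ⟨δ.P, subset_rfl, (congrArg Partition.pts hs.1).symm.subset, hs.agree⟩
    exact ⟨Q.union R, h₁.trans Finset.subset_union_left, h₄.trans Finset.subset_union_right,
      hQ.trans hR h₁ h₂ h₃ h₄⟩

/-! ### Hamiltonian loops up to 2-morphism and their concatenation -/

/-- Hamiltonian paths whose ends are identified with the identity by 2-morphisms. -/
structure IsLoop (Ω : SymplecticForm 𝒳) (γ : PiecewisePath 𝒳) : Prop extends
    IsHamiltonian Ω γ where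
  start : ∀ b (h : γ.P.Consec 0 b), TwoIso (γ.left h) (BasedFunctor.id 𝒳)
  finish : ∀ a (h : γ.P.Consec a 1), TwoIso (γ.right h) (BasedFunctor.id 𝒳)

lemma IsBasedLoop.isLoop (hγ : γ.IsBasedLoop Ω) : γ.IsLoop Ω where
  toIsHamiltonian := hγ.toIsHamiltonian
  start b h := TwoIso.of_eq (hγ.based b h)
  finish a h := by
    obtain ⟨b, hb⟩ := γ.P.exists_first
    exact (hγ.closes a b h hb).trans (TwoIso.of_eq (hγ.based b hb))

lemma IsLoop.isBasedLoop (h𝒳 : IsCFG 𝒳) (hγ : γ.IsLoop Ω)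
    (hb : ∀ b (h : γ.P.Consec 0 b), γ.left h = BasedFunctor.id 𝒳) : γ.IsBasedLoop Ω where
  toIsHamiltonian := hγ.toIsHamiltonian
  closes a b h h' := (hγ.finish a h).trans ((hγ.start b h').symm h𝒳)
  based := hb

lemma IsLoop.sameStart (h𝒳 : IsCFG 𝒳) (hγ : γ.IsLoop Ω) (hδ : δ.IsLoop Ω) : SameStart γ δ :=
  fun _ _ h h' => (hγ.start _ h).trans ((hδ.start _ h').symm h𝒳)

lemma IsLoop.sameEnd (h𝒳 : IsCFG 𝒳) (hγ : γ.IsLoop Ω) (hδ : δ.IsLoop Ω) : SameEnd γ δ :=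
  fun _ _ h h' => (hγ.finish _ h).trans ((hδ.finish _ h').symm h𝒳)

lemma IsHamiltonian.isLoop (hγ : γ.IsHamiltonian Ω) (hδ : δ.IsLoop Ω) (h₁ : SameStart γ δ)
    (h₂ : SameEnd γ δ) : γ.IsLoop Ω where
  toIsHamiltonian := hγ
  start b h := by
    obtain ⟨b', h'⟩ := δ.P.exists_first
    exact (h₁ b b' h h').trans (hδ.start b' h')
  finish a h := by
    obtain ⟨a', h'⟩ := δ.P.exists_last
    exact (h₂ a a' h h').trans (hδ.finish a' h')

lemma IsLoop.start' (hγ : γ.IsLoop Ω) (h : γ.P.Consec a b) (ha : a = 0) :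
    TwoIso (γ.left h) (BasedFunctor.id 𝒳) := by
  subst ha
  exact hγ.start b h

lemma IsLoop.finish' (hγ : γ.IsLoop Ω) (h : γ.P.Consec a b) (hb : b = 1) :
    TwoIso (γ.right h) (BasedFunctor.id 𝒳) := by
  subst hb
  exact hγ.finish a h

lemma concat_map_left (γ δ : PiecewisePath 𝒳) (h : (γ.concat δ).P.Consec a b) (hb : b ≤ 1 / 2) :
    (γ.concat δ).map a b h =
      (reparam 𝒳 (S := Icc a b) (S' := Icc (2 * a) (2 * b)) (fun t : ℝ => 2 * t) (by fun_prop)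
        (fun t ht => ⟨by linarith [ht.1], by linarith [ht.2]⟩)).comp
        (γ.map _ _ (Partition.concat_left h hb)) :=
  dif_pos hb

lemma concat_map_right (γ δ : PiecewisePath 𝒳) (h : (γ.concat δ).P.Consec a b)
    (hb : ¬ b ≤ 1 / 2) : (γ.concat δ).map a b h =
      (reparam 𝒳 (S := Icc a b) (S' := Icc (2 * a - 1) (2 * b - 1)) (fun t : ℝ => 2 * t - 1)
        (by fun_prop) (fun t ht => ⟨by linarith [ht.1], by linarith [ht.2]⟩)).comp
        (δ.map _ _ (Partition.concat_right h hb)) :=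
  dif_neg hb

lemma concat_left_of_le (γ δ : PiecewisePath 𝒳) (h : (γ.concat δ).P.Consec a b)
    (hb : b ≤ 1 / 2) : (γ.concat δ).left h = γ.left (Partition.concat_left h hb) := by
  unfold left
  rw [concat_map_left γ δ h hb]
  rfl

lemma concat_right_of_le (γ δ : PiecewisePath 𝒳) (h : (γ.concat δ).P.Consec a b)
    (hb : b ≤ 1 / 2) : (γ.concat δ).right h = γ.right (Partition.concat_left h hb) := by
  unfold right
  rw [concat_map_left γ δ h hb]
  rfl

lemma concat_left_of_not_le (γ δ : PiecewisePath 𝒳) (h : (γ.concat δ).P.Consec a b)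
    (hb : ¬ b ≤ 1 / 2) : (γ.concat δ).left h = δ.left (Partition.concat_right h hb) := by
  unfold left
  rw [concat_map_right γ δ h hb]
  rfl

lemma concat_right_of_not_le (γ δ : PiecewisePath 𝒳) (h : (γ.concat δ).P.Consec a b)
    (hb : ¬ b ≤ 1 / 2) : (γ.concat δ).right h = δ.right (Partition.concat_right h hb) := by
  unfold right
  rw [concat_map_right γ δ h hb]
  rfl

lemma IsLoop.concat (h𝒳 : IsCFG 𝒳) (hγ : γ.IsLoop Ω) (hδ : δ.IsLoop Ω) :
    (γ.concat δ).IsLoop Ω where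
  integrates a b h := by
    by_cases hb : b ≤ 1 / 2
    · rw [concat_map_left γ δ h hb]
      exact (hγ.integrates _ _ _).reparam h𝒳 _ _ _
    · rw [concat_map_right γ δ h hb]
      exact (hδ.integrates _ _ _).reparam h𝒳 _ _ _
  joins a b c h h' := by
    have hbc := h'.lt
    by_cases hb : b ≤ 1 / 2
    · rw [concat_right_of_le γ δ h hb]
      by_cases hc : c ≤ 1 / 2
      · rw [concat_left_of_le γ δ h' hc]
        exact hγ.joins _ _ _ _ _
      · have hb' : 1 / 2 ≤ b := (Partition.concat_between_half h').resolve_left hc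
        rw [concat_left_of_not_le γ δ h' hc]
        exact (hγ.finish' _ (by linarith)).trans ((hδ.start' _ (by linarith)).symm h𝒳)
    · have hc : ¬ c ≤ 1 / 2 := fun hc => hb (by linarith)
      rw [concat_right_of_not_le γ δ h hb, concat_left_of_not_le γ δ h' hc]
      exact hδ.joins _ _ _ _ _
  start b h := by
    have hb : b ≤ 1 / 2 := (Partition.concat_between_half h).resolve_right (by norm_num)
    rw [concat_left_of_le γ δ h hb]
    exact hγ.start' _ (by norm_num)
  finish a h := by
    have hb : ¬ (1 : ℝ) ≤ 1 / 2 := by norm_num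
    rw [concat_right_of_not_le γ δ h hb]
    exact hδ.finish' _ (by norm_num)

lemma left_eq_id_of_eq (hγ : γ.IsBasedLoop Ω) (h : γ.P.Consec a b) (ha : a = 0) :
    γ.left h = BasedFunctor.id 𝒳 := by
  subst ha
  exact hγ.based b h

lemma IsBasedLoop.concat_isLoop (h𝒳 : IsCFG 𝒳) (hγ : γ.IsBasedLoop Ω) (hδ : δ.IsLoop Ω) :
    (γ.concat δ).IsBasedLoop Ω := by
  refine (hγ.isLoop.concat h𝒳 hδ).isBasedLoop h𝒳 fun b h => ?_
  have hb : b ≤ 1 / 2 := (Partition.concat_between_half h).resolve_right (by norm_num)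
  rw [concat_left_of_le γ δ h hb]
  exact left_eq_id_of_eq hγ _ (by norm_num)

lemma Agree.concat (hγ : Agree Q γ γ') (hδ : Agree R δ δ') :
    Agree (Q.concat R) (γ.concat δ) (γ'.concat δ') := by
  intro a b hab p q hpq p' q' hpq' hp hp'
  have h₁ := (Icc_subset_Icc_iff hab.lt.le).1 hp
  have h₂ := (Icc_subset_Icc_iff hab.lt.le).1 hp'
  have hlt := hab.lt
  by_cases hb : b ≤ 1 / 2
  · have hq : q ≤ 1 / 2 := (Partition.concat_between_half hpq).resolve_right fun h => by linarith
    have hq' : q' ≤ 1 / 2 :=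
      (Partition.concat_between_half hpq').resolve_right fun h => by linarith
    unfold res
    rw [concat_map_left γ δ hpq hq, concat_map_left γ' δ' hpq' hq']
    exact (hγ _ _ (Partition.concat_left hab hb) _ _ (Partition.concat_left hpq hq) _ _
      (Partition.concat_left hpq' hq') (Icc_subset_Icc (by linarith) (by linarith))
      (Icc_subset_Icc (by linarith) (by linarith))).whiskerLeft
      (reparam 𝒳 (S := Icc a b) (S' := Icc (2 * a) (2 * b)) (fun t : ℝ => 2 * t) (by fun_prop)
        (fun t ht => ⟨by linarith [ht.1], by linarith [ht.2]⟩))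
  · have hq : ¬ q ≤ 1 / 2 := fun h => by linarith
    have hq' : ¬ q' ≤ 1 / 2 := fun h => by linarith
    unfold res
    rw [concat_map_right γ δ hpq hq, concat_map_right γ' δ' hpq' hq']
    exact (hδ _ _ (Partition.concat_right hab hb) _ _ (Partition.concat_right hpq hq) _ _
      (Partition.concat_right hpq' hq') (Icc_subset_Icc (by linarith) (by linarith))
      (Icc_subset_Icc (by linarith) (by linarith))).whiskerLeft
      (reparam 𝒳 (S := Icc a b) (S' := Icc (2 * a - 1) (2 * b - 1)) (fun t : ℝ => 2 * t - 1)
        (by fun_prop) (fun t ht => ⟨by linarith [ht.1], by linarith [ht.2]⟩))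

lemma NaturallyRelated.concat (h𝒳 : IsCFG 𝒳) (h : NaturallyRelated Ω γ γ')
    (h' : NaturallyRelated Ω δ δ') (h₁ : γ.IsLoop Ω) (h₂ : δ.IsLoop Ω) (h₃ : γ'.IsLoop Ω)
    (h₄ : δ'.IsLoop Ω) : NaturallyRelated Ω (γ.concat δ) (γ'.concat δ') := by
  obtain ⟨Q, hQ, hQ', hag⟩ := h.exists_agree h𝒳
  obtain ⟨R, hR, hR', hag'⟩ := h'.exists_agree h𝒳
  exact (hag.concat hag').naturallyRelated h𝒳 (h₁.concat h𝒳 h₂).toIsHamiltonian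
    (h₃.concat h𝒳 h₄).toIsHamiltonian (Partition.concat_subset hQ hR)
    (Partition.concat_subset hQ' hR')

end PiecewisePath

/-! ### Homotopies of Hamiltonian loops -/

open PiecewisePath

variable {𝒳 : BasedCategory.{v, u} Man} {Ω : SymplecticForm 𝒳} {γ γ' γ'' δ δ' : PiecewisePath 𝒳}
  {s s' r r' : ℝ}

/-- A layer of bricks of a piecewise homotopy. -/
structure Layer (𝒳 : BasedCategory.{v, u} Man) (s s' : ℝ) where
  T : Partition
  map : ∀ a b, T.Consec a b → BasedFunctor (times (Icc s s' ×ˢ Icc a b) 𝒳) 𝒳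

namespace Layer

/-- The restriction of a layer to `{σ} × [0, 1] × 𝒳`. -/
def slice (L : Layer 𝒳 s s') (σ : ℝ) (hσ : σ ∈ Icc s s') : PiecewisePath 𝒳 where
  P := L.T
  map a b h :=
    (reparam 𝒳 (S := Icc a b) (S' := Icc s s' ×ˢ Icc a b) (fun t : ℝ => (σ, t)) (by fun_prop)
      (fun _ ht => ⟨hσ, ht⟩)).comp (L.map a b h)

/-- The layer obtained by substituting the homotopy parameter. -/
def pull (f : ℝ → ℝ) (hf : ContDiff ℝ ∞ f) (hm : MapsTo f (Icc s s') (Icc r r'))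
    (L : Layer 𝒳 r r') : Layer 𝒳 s s' where
  T := L.T
  map a b h :=
    (reparam 𝒳 (S := Icc s s' ×ˢ Icc a b) (S' := Icc r r' ×ˢ Icc a b)
      (fun z : ℝ × ℝ => (f z.1, z.2)) ((hf.comp contDiff_fst).prodMk contDiff_snd)
      (fun _ hz => ⟨hm hz.1, hz.2⟩)).comp (L.map a b h)

/-- The constant layer. -/
def const (γ : PiecewisePath 𝒳) (s s' : ℝ) : Layer 𝒳 s s' where
  T := γ.P
  map a b h := (reparam 𝒳 (S := Icc s s' ×ˢ Icc a b) (S' := Icc a b) (fun z : ℝ × ℝ => z.2)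
    contDiff_snd (fun _ hz => hz.2)).comp (γ.map a b h)

/-- The concatenation of two layers in the direction of time. -/
def concat (L L' : Layer 𝒳 s s') : Layer 𝒳 s s' where
  T := L.T.concat L'.T
  map a b h :=
    if hb : b ≤ 1 / 2 then
      (reparam 𝒳 (S := Icc s s' ×ˢ Icc a b) (S' := Icc s s' ×ˢ Icc (2 * a) (2 * b))
        (fun z : ℝ × ℝ => (z.1, 2 * z.2)) (by fun_prop)
        (fun z hz => ⟨hz.1, by linarith [hz.2.1], by linarith [hz.2.2]⟩)).comp
        (L.map _ _ (Partition.concat_left h hb))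
    else
      (reparam 𝒳 (S := Icc s s' ×ˢ Icc a b) (S' := Icc s s' ×ˢ Icc (2 * a - 1) (2 * b - 1))
        (fun z : ℝ × ℝ => (z.1, 2 * z.2 - 1)) (by fun_prop)
        (fun z hz => ⟨hz.1, by linarith [hz.2.1], by linarith [hz.2.2]⟩)).comp
        (L'.map _ _ (Partition.concat_right h hb))

lemma slice_concat (L L' : Layer 𝒳 s s') (σ : ℝ) (hσ : σ ∈ Icc s s') :
    (L.concat L').slice σ hσ = (L.slice σ hσ).concat (L'.slice σ hσ) := by
  have key : ((L.concat L').slice σ hσ).map =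
      ((L.slice σ hσ).concat (L'.slice σ hσ)).map := by
    funext a b h
    by_cases hb : b ≤ 1 / 2
    · refine Eq.trans ?_ (concat_map_left (L.slice σ hσ) (L'.slice σ hσ) h hb).symm
      change BasedFunctor.comp _ (dite _ _ _) = _
      rw [dif_pos hb]
      rfl
    · refine Eq.trans ?_ (concat_map_right (L.slice σ hσ) (L'.slice σ hσ) h hb).symm
      change BasedFunctor.comp _ (dite _ _ _) = _
      rw [dif_neg hb]
      rfl
  exact congrArg (fun m => (⟨L.T.concat L'.T, m⟩ : PiecewisePath 𝒳)) key

end Layer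

/-- A piecewise homotopy as a sequence of layers. -/
def PiecewiseHomotopy.ofLayers (S : Partition) (L : ∀ s s', S.Consec s s' → Layer 𝒳 s s') :
    PiecewiseHomotopy 𝒳 where
  S := S
  T s s' h := (L s s' h).T
  map s s' h := (L s s' h).map

/-- The layers of a piecewise homotopy. -/
def PiecewiseHomotopy.layer (Γ : PiecewiseHomotopy 𝒳) (s s' : ℝ) (h : Γ.S.Consec s s') :
    Layer 𝒳 s s' where
  T := Γ.T s s' h
  map := Γ.map s s' h

/-- The layers `L` form a homotopy through Hamiltonian loops from `γ` to `γ'`. -/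
structure IsHomotopy (Ω : SymplecticForm 𝒳) (S : Partition)
    (L : ∀ s s', S.Consec s s' → Layer 𝒳 s s') (γ γ' : PiecewisePath 𝒳) : Prop where
  loop : ∀ s s' (h : S.Consec s s') σ (hσ : σ ∈ Icc s s'), ((L s s' h).slice σ hσ).IsLoop Ω
  layers : ∀ s s' s'' (h : S.Consec s s') (h' : S.Consec s' s''),
    NaturallyRelated Ω ((L s s' h).slice s' (right_mem_Icc.2 h.lt.le))
      ((L s' s'' h').slice s' (left_mem_Icc.2 h'.lt.le))
  bottom : ∀ s s' (h : S.Consec s s'), s = 0 →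
    NaturallyRelated Ω ((L s s' h).slice s (left_mem_Icc.2 h.lt.le)) γ
  top : ∀ s s' (h : S.Consec s s'), s' = 1 →
    NaturallyRelated Ω ((L s s' h).slice s' (right_mem_Icc.2 h.lt.le)) γ'

/-- Homotopy of Hamiltonian loops that are based at the identity up to 2-morphism. -/
def LoopHomotopic (Ω : SymplecticForm 𝒳) (γ γ' : PiecewisePath 𝒳) : Prop :=
  ∃ (S : Partition) (L : ∀ s s', S.Consec s s' → Layer 𝒳 s s'), IsHomotopy Ω S L γ γ'

lemma relHomotopic_iff (h𝒳 : IsCFG 𝒳) (γ γ' : BasedLoop Ω) :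
    RelHomotopic Ω γ γ' ↔ LoopHomotopic Ω γ.1 γ'.1 := by
  have hl := γ.2.isLoop
  have hl' := γ'.2.isLoop
  constructor
  · rintro ⟨Γ, hΓ⟩
    refine ⟨Γ.S, Γ.layer, fun s s' h σ hσ => ?_, hΓ.layers, ?_, ?_⟩
    · exact (hΓ.hamiltonian s s' h σ hσ).isLoop hl (hΓ.starts s s' h σ hσ).1
        (hΓ.ends s s' h σ hσ).1
    · rintro s s' h rfl
      exact hΓ.bottom s' h
    · rintro s s' h rfl
      exact hΓ.top s h
  · rintro ⟨S, L, hL⟩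
    refine ⟨.ofLayers S L, fun s s' h σ hσ => (hL.loop s s' h σ hσ).toIsHamiltonian, hL.layers,
      fun s h => hL.bottom 0 s h rfl, fun s h => hL.top s 1 h rfl, fun s s' h σ hσ => ?_,
      fun s s' h σ hσ => ?_⟩
    · exact ⟨(hL.loop s s' h σ hσ).sameStart h𝒳 hl, (hL.loop s s' h σ hσ).sameStart h𝒳 hl'⟩
    · exact ⟨(hL.loop s s' h σ hσ).sameEnd h𝒳 hl, (hL.loop s s' h σ hσ).sameEnd h𝒳 hl'⟩

namespace LoopHomotopic

/-- A single layer of Hamiltonian loops is a homotopy. -/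
lemma of_layer (L : Layer 𝒳 0 1) (hL : ∀ σ (hσ : σ ∈ Icc (0 : ℝ) 1), (L.slice σ hσ).IsLoop Ω) :
    LoopHomotopic Ω (L.slice 0 (left_mem_Icc.2 zero_le_one))
      (L.slice 1 (right_mem_Icc.2 zero_le_one)) := by
  refine ⟨Partition.whole, fun s s' h => L.pull (fun x => x) contDiff_id
    (fun x hx => ⟨h.mem_left.1.trans hx.1, hx.2.trans h.mem_right.2⟩),
    fun s s' h σ hσ => hL σ ⟨h.mem_left.1.trans hσ.1, hσ.2.trans h.mem_right.2⟩,
    fun s s' s'' h h' => ?_, ?_, ?_⟩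
  · exact absurd (h.of_whole.2.symm.trans h'.of_whole.1) one_ne_zero
  · rintro s s' h rfl
    exact Relation.ReflTransGen.refl
  · rintro s s' h rfl
    exact Relation.ReflTransGen.refl

protected lemma refl (hγ : γ.IsLoop Ω) : LoopHomotopic Ω γ γ :=
  of_layer (Layer.const γ 0 1) fun _ _ => hγ

lemma trans_naturallyRelated (h : LoopHomotopic Ω γ γ') (h' : NaturallyRelated Ω γ' γ'') :
    LoopHomotopic Ω γ γ'' := by
  obtain ⟨S, L, hL⟩ := h
  exact ⟨S, L, hL.loop, hL.layers, hL.bottom, fun s s' hs h₁ => (hL.top s s' hs h₁).trans h'⟩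

lemma of_naturallyRelated (hγ : γ.IsLoop Ω) (h : NaturallyRelated Ω γ γ') :
    LoopHomotopic Ω γ γ' := (LoopHomotopic.refl hγ).trans_naturallyRelated h

protected lemma symm (h𝒳 : IsCFG 𝒳) (h : LoopHomotopic Ω γ γ') : LoopHomotopic Ω γ' γ := by
  obtain ⟨S, L, hL⟩ := h
  refine ⟨S.rev, fun s s' h => (L _ _ h.of_rev).pull (fun x => 1 - x) (by fun_prop)
    (fun x hx => ⟨by linarith [hx.2], by linarith [hx.1]⟩), fun s s' h σ hσ => ?_,
    fun s s' s'' h h' => ?_, fun s s' h hs => ?_, fun s s' h hs => ?_⟩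
  · exact hL.loop _ _ h.of_rev (1 - σ) ⟨by linarith [hσ.2], by linarith [hσ.1]⟩
  · exact (hL.layers _ _ _ h'.of_rev h.of_rev).symm h𝒳
  · exact hL.top _ _ h.of_rev (by linarith)
  · exact hL.bottom _ _ h.of_rev (by linarith)

protected lemma trans (h𝒳 : IsCFG 𝒳) (h : LoopHomotopic Ω γ γ') (h' : LoopHomotopic Ω γ' γ'') :
    LoopHomotopic Ω γ γ'' := by
  obtain ⟨S, L, hL⟩ := h
  obtain ⟨S', L', hL'⟩ := h'
  let M (s s' : ℝ) (h : (S.concat S').Consec s s') : Layer 𝒳 s s' :=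
    if hb : s' ≤ 1 / 2 then
      (L _ _ (Partition.concat_left h hb)).pull (fun x => 2 * x) (by fun_prop)
        (fun x hx => ⟨by linarith [hx.1], by linarith [hx.2]⟩)
    else
      (L' _ _ (Partition.concat_right h hb)).pull (fun x => 2 * x - 1) (by fun_prop)
        (fun x hx => ⟨by linarith [hx.1], by linarith [hx.2]⟩)
  have hM₁ : ∀ s s' (h : (S.concat S').Consec s s') (hb : s' ≤ 1 / 2),
      M s s' h = (L _ _ (Partition.concat_left h hb)).pull (fun x => 2 * x) (by fun_prop)
        (fun x hx => ⟨by linarith [hx.1], by linarith [hx.2]⟩) := fun s s' h hb => dif_pos hb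
  have hM₂ : ∀ s s' (h : (S.concat S').Consec s s') (hb : ¬ s' ≤ 1 / 2),
      M s s' h = (L' _ _ (Partition.concat_right h hb)).pull (fun x => 2 * x - 1) (by fun_prop)
        (fun x hx => ⟨by linarith [hx.1], by linarith [hx.2]⟩) := fun s s' h hb => dif_neg hb
  refine ⟨S.concat S', M, fun s s' h σ hσ => ?_, fun s s' s'' h h' => ?_, fun s s' h hs => ?_,
    fun s s' h hs => ?_⟩
  · by_cases hb : s' ≤ 1 / 2
    · rw [hM₁ s s' h hb]
      exact hL.loop _ _ (Partition.concat_left h hb) (2 * σ)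
        ⟨by linarith [hσ.1], by linarith [hσ.2]⟩
    · rw [hM₂ s s' h hb]
      exact hL'.loop _ _ (Partition.concat_right h hb) (2 * σ - 1)
        ⟨by linarith [hσ.1], by linarith [hσ.2]⟩
  · have hlt := h'.lt
    by_cases hb : s' ≤ 1 / 2
    · rw [hM₁ s s' h hb]
      by_cases hb' : s'' ≤ 1 / 2
      · rw [hM₁ s' s'' h' hb']
        exact hL.layers _ _ _ (Partition.concat_left h hb) (Partition.concat_left h' hb')
      · have hs' : 1 / 2 ≤ s' := (Partition.concat_between_half h').resolve_left hb'
        rw [hM₂ s' s'' h' hb']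
        exact (hL.top _ _ (Partition.concat_left h hb) (by linarith)).trans
          ((hL'.bottom _ _ (Partition.concat_right h' hb') (by linarith)).symm h𝒳)
    · have hb' : ¬ s'' ≤ 1 / 2 := fun h₁ => hb (by linarith)
      rw [hM₂ s s' h hb, hM₂ s' s'' h' hb']
      exact hL'.layers _ _ _ (Partition.concat_right h hb) (Partition.concat_right h' hb')
  · have hb : s' ≤ 1 / 2 :=
      (Partition.concat_between_half h).resolve_right (by rw [hs]; norm_num)
    rw [hM₁ s s' h hb]
    exact hL.bottom _ _ (Partition.concat_left h hb) (by linarith)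
  · have hb : ¬ s' ≤ 1 / 2 := by rw [hs]; norm_num
    rw [hM₂ s s' h hb]
    exact hL'.top _ _ (Partition.concat_right h hb) (by linarith)

end LoopHomotopic

/-- The concatenation of homotopies with the same partition of the homotopy parameter. -/
lemma IsHomotopy.concat (h𝒳 : IsCFG 𝒳) {S : Partition} {L L' : ∀ s s', S.Consec s s' → Layer 𝒳 s s'}
    (hL : IsHomotopy Ω S L γ γ') (hL' : IsHomotopy Ω S L' δ δ') (h₁ : γ.IsLoop Ω)
    (h₂ : γ'.IsLoop Ω) (h₃ : δ.IsLoop Ω) (h₄ : δ'.IsLoop Ω) :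
    IsHomotopy Ω S (fun s s' h => (L s s' h).concat (L' s s' h)) (γ.concat δ) (γ'.concat δ') where
  loop s s' h σ hσ := by
    rw [Layer.slice_concat]
    exact (hL.loop _ _ _ _ _).concat h𝒳 (hL'.loop _ _ _ _ _)
  layers s s' s'' h h' := by
    rw [Layer.slice_concat, Layer.slice_concat]
    exact (hL.layers _ _ _ h h').concat h𝒳 (hL'.layers _ _ _ h h') (hL.loop _ _ _ _ _)
      (hL'.loop _ _ _ _ _) (hL.loop _ _ _ _ _) (hL'.loop _ _ _ _ _)
  bottom s s' h hs := by
    rw [Layer.slice_concat]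
    exact (hL.bottom _ _ h hs).concat h𝒳 (hL'.bottom _ _ h hs) (hL.loop _ _ _ _ _)
      (hL'.loop _ _ _ _ _) h₁ h₃
  top s s' h hs := by
    rw [Layer.slice_concat]
    exact (hL.top _ _ h hs).concat h𝒳 (hL'.top _ _ h hs) (hL.loop _ _ _ _ _)
      (hL'.loop _ _ _ _ _) h₂ h₄

lemma IsHomotopy.const (hγ : γ.IsLoop Ω) (S : Partition) :
    IsHomotopy Ω S (fun s s' _ => Layer.const γ s s') γ γ where
  loop _ _ _ _ _ := hγ
  layers _ _ _ _ _ := Relation.ReflTransGen.refl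
  bottom _ _ _ _ := Relation.ReflTransGen.refl
  top _ _ _ _ := Relation.ReflTransGen.refl

lemma LoopHomotopic.concat (h𝒳 : IsCFG 𝒳) (h : LoopHomotopic Ω γ γ') (h' : LoopHomotopic Ω δ δ')
    (h₁ : γ.IsLoop Ω) (h₂ : γ'.IsLoop Ω) (h₃ : δ.IsLoop Ω) (h₄ : δ'.IsLoop Ω) :
    LoopHomotopic Ω (γ.concat δ) (γ'.concat δ') := by
  obtain ⟨S, L, hL⟩ := h
  obtain ⟨S', L', hL'⟩ := h'
  exact LoopHomotopic.trans h𝒳 ⟨S, _, hL.concat h𝒳 (.const h₃ S) h₁ h₂ h₃ h₃⟩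
    ⟨S', _, (IsHomotopy.const h₂ S').concat h𝒳 hL' h₂ h₂ h₃ h₄⟩

end

section

/-! ### The two-parameter family of compositions of two loops -/

section

variable {𝒳 : BasedCategory.{v, u} Man}
variable {E E' : Type} [NormedAddCommGroup E] [NormedSpace ℝ E] [NormedAddCommGroup E']
  [NormedSpace ℝ E'] {S : Set E} {S' : Set E'} {A B : Set ℝ}

/-- The family of compositions `F (φ s) ∘ G (ψ s)`, for `s` in `S`. -/
def grid (F : BasedFunctor (times A 𝒳) 𝒳) (G : BasedFunctor (times B 𝒳) 𝒳) (φ ψ : E → ℝ)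
    (hφ : ContDiff ℝ ∞ φ) (hψ : ContDiff ℝ ∞ ψ) (mφ : MapsTo φ S A) (mψ : MapsTo ψ S B) :
    BasedFunctor (times S 𝒳) 𝒳 :=
  (prodLift ((reparam 𝒳 ψ hψ mψ).comp G)).comp ((reparam 𝒳 φ hφ mφ).comp F)

lemma sliceAt_grid (F : BasedFunctor (times A 𝒳) 𝒳) (G : BasedFunctor (times B 𝒳) 𝒳) (φ ψ : E → ℝ)
    (hφ : ContDiff ℝ ∞ φ) (hψ : ContDiff ℝ ∞ ψ) (mφ : MapsTo φ S A) (mψ : MapsTo ψ S B)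
    (e : E) (he : e ∈ S) : (sliceAt 𝒳 e he).comp (grid F G φ ψ hφ hψ mφ mψ) =
      ((sliceAt 𝒳 (ψ e) (mψ he)).comp G).comp ((sliceAt 𝒳 (φ e) (mφ he)).comp F) := rfl

lemma TwoIso.comp {F F' G G' : BasedFunctor 𝒳 𝒳} (hF : TwoIso F F') (hG : TwoIso G G') :
    TwoIso (F.comp G) (F'.comp G') :=
  (hF.whiskerRight G).trans (hG.whiskerLeft F')

lemma twoIso_grid {A' B' : Set ℝ} {F : BasedFunctor (times A 𝒳) 𝒳} {G : BasedFunctor (times B 𝒳) 𝒳}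
    {F' : BasedFunctor (times A' 𝒳) 𝒳} {G' : BasedFunctor (times B' 𝒳) 𝒳} {φ ψ φ' ψ' : E → ℝ}
    {hφ : ContDiff ℝ ∞ φ} {hψ : ContDiff ℝ ∞ ψ} {mφ : MapsTo φ S A} {mψ : MapsTo ψ S B}
    {hφ' : ContDiff ℝ ∞ φ'} {hψ' : ContDiff ℝ ∞ ψ'} {mφ' : MapsTo φ' S A'} {mψ' : MapsTo ψ' S B'}
    (h₁ : TwoIso ((reparam 𝒳 φ hφ mφ).comp F) ((reparam 𝒳 φ' hφ' mφ').comp F'))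
    (h₂ : TwoIso ((reparam 𝒳 ψ hψ mψ).comp G) ((reparam 𝒳 ψ' hψ' mψ').comp G')) :
    TwoIso (grid F G φ ψ hφ hψ mφ mψ) (grid F' G' φ' ψ' hφ' hψ' mφ' mψ') :=
  (h₂.prodLift.whiskerRight _).trans (h₁.whiskerLeft _)

lemma twoIso_grid_const_right {F : BasedFunctor (times A 𝒳) 𝒳} {G : BasedFunctor (times B 𝒳) 𝒳}
    {φ : E → ℝ} {hφ : ContDiff ℝ ∞ φ} {mφ : MapsTo φ S A} {c : ℝ} (hc : c ∈ B)
    (e : TwoIso ((sliceAt 𝒳 c hc).comp G) (BasedFunctor.id 𝒳)) :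
    TwoIso (grid F G φ (fun _ => c) hφ contDiff_const mφ (fun _ _ => hc))
      ((reparam 𝒳 φ hφ mφ).comp F) :=
  TwoIso.whiskerRight (G := BasedFunctor.id (times S 𝒳))
    (e.whiskerLeft (forget S 𝒳)).prodLift _

lemma twoIso_grid_const_left {F : BasedFunctor (times A 𝒳) 𝒳} {G : BasedFunctor (times B 𝒳) 𝒳}
    {ψ : E → ℝ} {hψ : ContDiff ℝ ∞ ψ} {mψ : MapsTo ψ S B} {c : ℝ} (hc : c ∈ A)
    (e : TwoIso ((sliceAt 𝒳 c hc).comp F) (BasedFunctor.id 𝒳)) :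
    TwoIso (grid F G (fun _ => c) ψ contDiff_const hψ (fun _ _ => hc) mψ)
      ((reparam 𝒳 ψ hψ mψ).comp G) :=
  (e.whiskerLeft (forget S 𝒳)).whiskerLeft (prodLift ((reparam 𝒳 ψ hψ mψ).comp G))

end

namespace PiecewisePath

variable {𝒳 : BasedCategory.{v, u} Man} {Ω : SymplecticForm 𝒳} {γ γ' δ δ' : PiecewisePath 𝒳}
  {a b p q p' q' : ℝ}

/-- The pieces of a Hamiltonian loop are Hamiltonian isotopies. -/
lemma IsLoop.hamIsotopy (h : IsOrbifold 𝒳) (hc : IsCompactOrbifold 𝒳) (hγ : γ.IsLoop Ω)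
    (hab : γ.P.Consec a b) : HamIsotopy h.toIsCFG Ω (γ.map a b hab) := by
  have key : ∀ x ∈ γ.P.pts, ∀ y (hxy : γ.P.Consec x y), IsGood Ω (γ.left hxy) := by
    refine Partition.induction_on γ.P (fun y hy => ?_) (fun x y hxy ih z hyz => ?_)
    · exact (IsGood.id Ω).of_twoIso h.toIsCFG ((hγ.start y hy).symm h.toIsCFG)
    · have h₁ := (hγ.integrates x y hxy).hamIsotopy h hc hxy.lt
        ⟨x, left_mem_Icc.2 hxy.lt.le⟩ (ih y hxy)
      exact (h₁.2 ⟨y, right_mem_Icc.2 hxy.lt.le⟩).of_twoIso h.toIsCFG (hγ.joins x y z hxy hyz)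
  exact (hγ.integrates a b hab).hamIsotopy h hc hab.lt ⟨a, left_mem_Icc.2 hab.lt.le⟩
    (key a hab.left b hab)

lemma IsHamiltonian.twoIso_sliceAt (h : IsCFG 𝒳) (hγ : γ.IsHamiltonian Ω) (hp : γ.P.Consec p q)
    (hp' : γ.P.Consec p' q') {x : ℝ} (hx : x ∈ Icc p q) (hx' : x ∈ Icc p' q') :
    TwoIso ((sliceAt 𝒳 x hx).comp (γ.map p q hp)) ((sliceAt 𝒳 x hx').comp (γ.map p' q' hp')) := by
  have key : ∀ {p q p' q' : ℝ} (hp : γ.P.Consec p q) (hp' : γ.P.Consec p' q') (hx : x ∈ Icc p q)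
      (hx' : x ∈ Icc p' q'), p < p' →
      TwoIso ((sliceAt 𝒳 x hx).comp (γ.map p q hp)) ((sliceAt 𝒳 x hx').comp (γ.map p' q' hp')) := by
    intro p q p' q' hp hp' hx hx' hlt
    have hqp : q ≤ p' := (hp.between p' hp'.left).resolve_left hlt.not_ge
    have h₁ : x = q := le_antisymm hx.2 (hqp.trans hx'.1)
    have h₂ : x = p' := le_antisymm (hx.2.trans hqp) hx'.1
    subst h₁
    subst h₂
    exact hγ.joins _ _ _ hp hp'
  rcases lt_trichotomy p p' with hlt | rfl | hlt
  · exact key hp hp' hx hx' hlt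
  · obtain rfl := hp.right_unique hp'
    exact TwoIso.refl _
  · exact (key hp' hp hx' hx hlt).symm h

/-- Reparametrizations of the pieces of a Hamiltonian path agree where they parametrize the same
times. -/
lemma IsHamiltonian.twoIso_reparam (h : IsCFG 𝒳) (hγ : γ.IsHamiltonian Ω) (hp : γ.P.Consec p q)
    (hp' : γ.P.Consec p' q') {E : Type} [NormedAddCommGroup E] [NormedSpace ℝ E] {S : Set E}
    (hS : S.Nonempty) {φ ψ : E → ℝ} (hφ : ContDiff ℝ ∞ φ) (hψ : ContDiff ℝ ∞ ψ)
    (mφ : MapsTo φ S (Icc p q)) (mψ : MapsTo ψ S (Icc p' q')) (he : EqOn φ ψ S) :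
    TwoIso ((reparam 𝒳 φ hφ mφ).comp (γ.map p q hp))
      ((reparam 𝒳 ψ hψ mψ).comp (γ.map p' q' hp')) := by
  by_cases hpp : p = p'
  · subst hpp
    obtain rfl := hp.right_unique hp'
    exact (twoIso_reparam_congr hφ hψ mφ mψ he).whiskerRight _
  -- times common to two different intervals form at most one point, where the path joins up
  · obtain ⟨x, hx⟩ : ∃ x, ∀ e ∈ S, φ e = x := by
      rcases lt_or_gt_of_ne hpp with hlt | hlt
      · have hqp : q ≤ p' := (hp.between p' hp'.left).resolve_left hlt.not_ge
        exact ⟨q, fun e hes => le_antisymm (mφ hes).2 (hqp.trans ((mψ hes).1.trans (he hes).ge))⟩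
      · have hqp : q' ≤ p := (hp'.between p hp.left).resolve_left hlt.not_ge
        exact ⟨p, fun e hes => le_antisymm ((he hes).le.trans ((mψ hes).2.trans hqp)) (mφ hes).1⟩
    obtain ⟨e₀, he₀⟩ := hS
    have h₁ : x ∈ Icc p q := hx e₀ he₀ ▸ mφ he₀
    have h₂ : x ∈ Icc p' q' := hx e₀ he₀ ▸ he he₀ ▸ mψ he₀
    refine ((twoIso_reparam_congr hφ contDiff_const mφ (fun _ _ => h₁) hx).whiskerRight _).trans
      (TwoIso.trans ?_ ((twoIso_reparam_congr contDiff_const hψ (fun _ _ => h₂) mψ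
        (fun e hes => (hx e hes).symm.trans (he hes))).whiskerRight _))
    exact (hγ.twoIso_sliceAt h hp hp' h₁ h₂).whiskerLeft (forget S 𝒳)

/-! ### Paths traced in the two-parameter family -/

/-- `δ` is, up to 2-morphisms, the path `t ↦ γ (u t) ∘ γ' (u' t)`. On each interval of its
partition, `u` and `u'` take values in one interval of the partition of `γ` and of `γ'`, and are
restrictions of smooth functions. -/
def IsTrace (γ γ' δ : PiecewisePath 𝒳) (u u' : ℝ → ℝ) : Prop :=
  ∀ a b (h : δ.P.Consec a b), ∃ (p q : ℝ) (hp : γ.P.Consec p q) (p' q' : ℝ)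
    (hp' : γ'.P.Consec p' q') (φ φ' : ℝ → ℝ) (hφ : ContDiff ℝ ∞ φ) (hφ' : ContDiff ℝ ∞ φ')
    (m : MapsTo φ (Icc a b) (Icc p q)) (m' : MapsTo φ' (Icc a b) (Icc p' q')),
    EqOn u φ (Icc a b) ∧ EqOn u' φ' (Icc a b) ∧
    TwoIso (δ.map a b h) (grid (γ.map p q hp) (γ'.map p' q' hp') φ φ' hφ hφ' m m')

lemma IsTrace.congr {u u' v v' : ℝ → ℝ} (h : IsTrace γ γ' δ u u') (hu : EqOn v u (Icc 0 1))
    (hu' : EqOn v' u' (Icc 0 1)) : IsTrace γ γ' δ v v' := by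
  intro a b hab
  obtain ⟨p, q, hp, p', q', hp', φ, φ', hφ, hφ', m, m', h₁, h₂, h₃⟩ := h a b hab
  have hsub : Icc a b ⊆ Icc 0 1 := Icc_subset_Icc hab.mem_left.1 hab.mem_right.2
  exact ⟨p, q, hp, p', q', hp', φ, φ', hφ, hφ', m, m', (hu.mono hsub).trans h₁,
    (hu'.mono hsub).trans h₂, h₃⟩

/-- Two paths with the same trace agree over any partition. -/
lemma IsTrace.agree (h : IsCFG 𝒳) (hγ : γ.IsHamiltonian Ω) (hγ' : γ'.IsHamiltonian Ω)
    {u u' : ℝ → ℝ} (hδ : IsTrace γ γ' δ u u') (hδ' : IsTrace γ γ' δ' u u') (Q : Partition) :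
    Agree Q δ δ' := by
  intro a b hab c d hcd c' d' hcd' hc hc'
  obtain ⟨p, q, hp, p', q', hp', φ, φ', hφ, hφ', m, m', h₁, h₂, h₃⟩ := hδ c d hcd
  obtain ⟨r, s, hr, r', s', hr', ψ, ψ', hψ, hψ', n, n', h₄, h₅, h₆⟩ := hδ' c' d' hcd'
  refine (h₃.whiskerLeft (reparam 𝒳 (fun t : ℝ => t) contDiff_id hc)).trans
    (TwoIso.trans ?_ ((h₆.symm h).whiskerLeft (reparam 𝒳 (fun t : ℝ => t) contDiff_id hc')))
  have hne : (Icc a b).Nonempty := nonempty_Icc.2 hab.lt.le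
  exact twoIso_grid
    (hγ.twoIso_reparam h hp hr hne hφ hψ (fun t ht => m (hc ht)) (fun t ht => n (hc' ht))
      (fun t ht => (h₁ (hc ht)).symm.trans (h₄ (hc' ht))))
    (hγ'.twoIso_reparam h hp' hr' hne hφ' hψ' (fun t ht => m' (hc ht)) (fun t ht => n' (hc' ht))
      (fun t ht => (h₂ (hc ht)).symm.trans (h₅ (hc' ht))))

lemma IsLoop.twoIso_sliceAt_id (h : IsCFG 𝒳) (hγ : γ.IsLoop Ω) (hp : γ.P.Consec p q) {x : ℝ}
    (hx : x ∈ Icc p q) (hx' : x = 0 ∨ x = 1) :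
    TwoIso ((sliceAt 𝒳 x hx).comp (γ.map p q hp)) (BasedFunctor.id 𝒳) := by
  rcases hx' with rfl | rfl
  · obtain ⟨b, hb⟩ := γ.P.exists_first
    exact (hγ.twoIso_sliceAt h hp hb hx (left_mem_Icc.2 hb.lt.le)).trans (hγ.start b hb)
  · obtain ⟨a, ha⟩ := γ.P.exists_last
    exact (hγ.twoIso_sliceAt h hp ha hx (right_mem_Icc.2 ha.lt.le)).trans (hγ.finish a ha)

/-- Paths traced in the two-parameter family of compositions of two Hamiltonian loops that start
and end at corners of the parameter square are Hamiltonian loops. -/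
lemma IsTrace.isLoop (h : IsOrbifold 𝒳) (hc : IsCompactOrbifold 𝒳) (hγ : γ.IsLoop Ω)
    (hγ' : γ'.IsLoop Ω) {u u' : ℝ → ℝ} (hδ : IsTrace γ γ' δ u u') (h₀ : u 0 = 0 ∨ u 0 = 1)
    (h₀' : u' 0 = 0 ∨ u' 0 = 1) (h₁ : u 1 = 0 ∨ u 1 = 1) (h₁' : u' 1 = 0 ∨ u' 1 = 1) :
    δ.IsLoop Ω where
  integrates a b hab := by
    obtain ⟨p, q, hp, p', q', hp', φ, φ', hφ, hφ', m, m', -, -, e⟩ := hδ a b hab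
    refine IntegratesHamiltonian.of_twoIso ?_ (e.symm h.toIsCFG)
    exact (((hγ.hamIsotopy h hc hp).reparam h.toIsCFG φ hφ m).comp h
      ((hγ'.hamIsotopy h hc hp').reparam h.toIsCFG φ' hφ' m')).integratesHamiltonian h hab.lt
  joins a b c hab hbc := by
    obtain ⟨p, q, hp, p', q', hp', φ, φ', hφ, hφ', m, m', e₁, e₂, e⟩ := hδ a b hab
    obtain ⟨r, s, hr, r', s', hr', ψ, ψ', hψ, hψ', n, n', e₃, e₄, e'⟩ := hδ b c hbc
    have hb := right_mem_Icc.2 hab.lt.le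
    have hb' := left_mem_Icc.2 hbc.lt.le
    refine (e.whiskerLeft (sliceAt 𝒳 b hb)).trans
      (TwoIso.trans ?_ ((e'.symm h.toIsCFG).whiskerLeft (sliceAt 𝒳 b hb')))
    rw [sliceAt_grid, sliceAt_grid]
    have key : ∀ {x y x' y' : ℝ} (hx : x ∈ Icc p q) (hy : y ∈ Icc r s) (hx' : x' ∈ Icc p' q')
        (hy' : y' ∈ Icc r' s'), x = y → x' = y' →
        TwoIso (((sliceAt 𝒳 x' hx').comp (γ'.map p' q' hp')).comp
            ((sliceAt 𝒳 x hx).comp (γ.map p q hp)))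
          (((sliceAt 𝒳 y' hy').comp (γ'.map r' s' hr')).comp
            ((sliceAt 𝒳 y hy).comp (γ.map r s hr))) := by
      rintro x _ x' _ hx hy hx' hy' rfl rfl
      exact (hγ'.twoIso_sliceAt h.toIsCFG hp' hr' hx' hy').comp
        (hγ.twoIso_sliceAt h.toIsCFG hp hr hx hy)
    exact key _ _ _ _ ((e₁ hb).symm.trans (e₃ hb')) ((e₂ hb).symm.trans (e₄ hb'))
  start b hab := by
    obtain ⟨p, q, hp, p', q', hp', φ, φ', hφ, hφ', m, m', e₁, e₂, e⟩ := hδ 0 b hab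
    have hb := left_mem_Icc.2 hab.lt.le
    refine (e.whiskerLeft (sliceAt 𝒳 0 hb)).trans ?_
    rw [sliceAt_grid]
    exact (hγ'.twoIso_sliceAt_id h.toIsCFG hp' (m' hb) (e₂ hb ▸ h₀')).comp
      (hγ.twoIso_sliceAt_id h.toIsCFG hp (m hb) (e₁ hb ▸ h₀))
  finish a hab := by
    obtain ⟨p, q, hp, p', q', hp', φ, φ', hφ, hφ', m, m', e₁, e₂, e⟩ := hδ a 1 hab
    have hb := right_mem_Icc.2 hab.lt.le
    refine (e.whiskerLeft (sliceAt 𝒳 1 hb)).trans ?_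
    rw [sliceAt_grid]
    exact (hγ'.twoIso_sliceAt_id h.toIsCFG hp' (m' hb) (e₂ hb ▸ h₁')).comp
      (hγ.twoIso_sliceAt_id h.toIsCFG hp (m hb) (e₁ hb ▸ h₁))

end PiecewisePath

/-- Over `[a, b]`, the functions `u` and `w` take values in one interval of the partition `P`, and
are restrictions of smooth functions. -/
def Ctrl (P : Partition) (u w : ℝ → ℝ) (a b : ℝ) : Prop :=
  ∃ p q, P.Consec p q ∧ ∃ φ ψ : ℝ → ℝ, ContDiff ℝ ∞ φ ∧ ContDiff ℝ ∞ ψ ∧ EqOn u φ (Icc a b) ∧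
    EqOn w ψ (Icc a b) ∧ MapsTo φ (Icc a b) (Icc p q) ∧ MapsTo ψ (Icc a b) (Icc p q)

namespace PiecewisePath

variable {𝒳 : BasedCategory.{v, u} Man} {Ω : SymplecticForm 𝒳} {γ γ' δ δ' : PiecewisePath 𝒳}

/-- Linear interpolation within the cells of the parameter square gives homotopies of traces. -/
lemma exists_linear_homotopy (h : IsOrbifold 𝒳) (hc : IsCompactOrbifold 𝒳) (hγ : γ.IsLoop Ω)
    (hγ' : γ'.IsLoop Ω) (Q : Partition) {u u' w w' : ℝ → ℝ}
    (hu : ∀ a b, Q.Consec a b → Ctrl γ.P u w a b) (hu' : ∀ a b, Q.Consec a b → Ctrl γ'.P u' w' a b)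
    (h₀ : u 0 = 0 ∨ u 0 = 1) (h₀' : u' 0 = 0 ∨ u' 0 = 1) (h₁ : u 1 = 0 ∨ u 1 = 1)
    (h₁' : u' 1 = 0 ∨ u' 1 = 1) (e₀ : u 0 = w 0) (e₀' : u' 0 = w' 0) (e₁ : u 1 = w 1)
    (e₁' : u' 1 = w' 1) :
    ∃ δ δ' : PiecewisePath 𝒳, IsTrace γ γ' δ u u' ∧ IsTrace γ γ' δ' w w' ∧
      LoopHomotopic Ω δ δ' := by
  choose p q hp φ ψ hφ hψ eφ eψ mφ mψ using hu
  choose p' q' hp' φ' ψ' hφ' hψ' eφ' eψ' mφ' mψ' using hu'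
  have conv : ∀ {c d x y s : ℝ}, x ∈ Icc c d → y ∈ Icc c d → s ∈ Icc (0 : ℝ) 1 →
      (1 - s) * x + s * y ∈ Icc c d := by
    intro c d x y s hx hy hs
    exact convex_Icc c d hx hy (by linarith [hs.2]) hs.1 (by ring)
  let L : Layer 𝒳 0 1 :=
    { T := Q
      map := fun a b hab => grid (γ.map _ _ (hp a b hab)) (γ'.map _ _ (hp' a b hab))
        (fun z : ℝ × ℝ => (1 - z.1) * φ a b hab z.2 + z.1 * ψ a b hab z.2)
        (fun z : ℝ × ℝ => (1 - z.1) * φ' a b hab z.2 + z.1 * ψ' a b hab z.2)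
        (((contDiff_const.sub contDiff_fst).mul ((hφ a b hab).comp contDiff_snd)).add
          (contDiff_fst.mul ((hψ a b hab).comp contDiff_snd)))
        (((contDiff_const.sub contDiff_fst).mul ((hφ' a b hab).comp contDiff_snd)).add
          (contDiff_fst.mul ((hψ' a b hab).comp contDiff_snd)))
        (fun z hz => conv (mφ a b hab hz.2) (mψ a b hab hz.2) hz.1)
        (fun z hz => conv (mφ' a b hab hz.2) (mψ' a b hab hz.2) hz.1) }
  have htr : ∀ σ (hσ : σ ∈ Icc (0 : ℝ) 1), IsTrace γ γ' (L.slice σ hσ)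
      (fun t => (1 - σ) * u t + σ * w t) (fun t => (1 - σ) * u' t + σ * w' t) := by
    intro σ hσ a b hab
    refine ⟨_, _, hp a b hab, _, _, hp' a b hab, fun t => (1 - σ) * φ a b hab t + σ * ψ a b hab t,
      fun t => (1 - σ) * φ' a b hab t + σ * ψ' a b hab t,
      (contDiff_const.mul (hφ a b hab)).add (contDiff_const.mul (hψ a b hab)),
      (contDiff_const.mul (hφ' a b hab)).add (contDiff_const.mul (hψ' a b hab)),
      fun t ht => conv (mφ a b hab ht) (mψ a b hab ht) hσ,
      fun t ht => conv (mφ' a b hab ht) (mψ' a b hab ht) hσ, fun t ht => ?_, fun t ht => ?_,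
      TwoIso.refl _⟩
    · change (1 - σ) * u t + σ * w t = _
      rw [eφ a b hab ht, eψ a b hab ht]
    · change (1 - σ) * u' t + σ * w' t = _
      rw [eφ' a b hab ht, eψ' a b hab ht]
  have hends : ∀ {x y : ℝ} (σ : ℝ), x = y → (1 - σ) * x + σ * y = x := by
    rintro x _ σ rfl
    ring
  have hl := LoopHomotopic.of_layer L fun σ hσ => (htr σ hσ).isLoop h hc hγ hγ'
    (by rw [hends σ e₀]; exact h₀) (by rw [hends σ e₀']; exact h₀')
    (by rw [hends σ e₁]; exact h₁) (by rw [hends σ e₁']; exact h₁')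
  exact ⟨_, _, (htr 0 _).congr (fun t _ => by simp) (fun t _ => by simp),
    (htr 1 _).congr (fun t _ => by simp) (fun t _ => by simp), hl⟩

end PiecewisePath

end

section

lemma Ctrl.self {P : Partition} {u φ : ℝ → ℝ} {a b p q : ℝ} (hp : P.Consec p q)
    (hφ : ContDiff ℝ ∞ φ) (h : EqOn u φ (Icc a b)) (m : MapsTo φ (Icc a b) (Icc p q)) :
    Ctrl P u u a b := ⟨p, q, hp, φ, φ, hφ, hφ, h, h, m, m⟩

/-- To deform `u` into a larger function `w`, move the points where `u ≤ x ≤ w` from one point `x`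
of the partition to the next one: this moves points only within one interval of the partition. -/
lemma Ctrl.slide {P : Partition} {u w : ℝ → ℝ} {a b x y : ℝ} (hu : Ctrl P u u a b)
    (hw : Ctrl P w w a b) (hle : ∀ t ∈ Icc a b, u t ≤ w t) (hx : x ∈ P.pts)
    (hxy : x = y ∨ P.Consec x y) :
    Ctrl P (fun t => min (w t) (max (u t) x)) (fun t => min (w t) (max (u t) y)) a b := by
  obtain ⟨p, q, hp, φ, -, hφ, -, eφ, -, mφ, -⟩ := hu
  obtain ⟨p', q', hp', ψ, -, hψ, -, eψ, -, mψ, -⟩ := hw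
  have hu : ∀ t ∈ Icc a b, u t ∈ Icc p q := fun t ht => eφ ht ▸ mφ ht
  have hw : ∀ t ∈ Icc a b, w t ∈ Icc p' q' := fun t ht => eψ ht ▸ mψ ht
  have k₁ : ∀ z, z ≤ p → EqOn (fun t => min (w t) (max (u t) z)) φ (Icc a b) := by
    intro z hz t ht
    change min (w t) (max (u t) z) = φ t
    rw [max_eq_left (hz.trans (hu t ht).1), min_eq_right (hle t ht), eφ ht]
  have k₂ : ∀ z, q' ≤ z → EqOn (fun t => min (w t) (max (u t) z)) ψ (Icc a b) := by
    intro z hz t ht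
    change min (w t) (max (u t) z) = ψ t
    rw [min_eq_left ((hw t ht).2.trans (hz.trans (le_max_right _ _))), eψ ht]
  have k₃ : ∀ z, q ≤ z → z ≤ p' →
      EqOn (fun t => min (w t) (max (u t) z)) (fun _ => z) (Icc a b) := by
    intro z hz hz' t ht
    change min (w t) (max (u t) z) = z
    rw [max_eq_right ((hu t ht).2.trans hz), min_eq_right (hz'.trans (hw t ht).1)]
  rcases hxy with rfl | hxy
  · rcases hp.between x hx with h₁ | h₁
    · exact .self hp hφ (k₁ x h₁) mφ
    · rcases hp'.between x hx with h₂ | h₂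
      · obtain ⟨z, hz⟩ := Partition.exists_left hx (by linarith [hp.mem_left.1, hp.lt])
        exact .self hz contDiff_const (k₃ x h₁ h₂) (fun _ _ => right_mem_Icc.2 hz.lt.le)
      · exact .self hp' hψ (k₂ x h₂) mψ
  · have hlt := hxy.lt
    by_cases hyp : y ≤ p
    · exact ⟨p, q, hp, φ, φ, hφ, hφ, k₁ x (hlt.le.trans hyp), k₁ y hyp, mφ, mφ⟩
    by_cases hqx : q' ≤ x
    · exact ⟨p', q', hp', ψ, ψ, hψ, hψ, k₂ x hqx, k₂ y (hqx.trans hlt.le), mψ, mψ⟩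
    have hpx : p ≤ x := (hxy.between p hp.left).resolve_right hyp
    have hyq : y ≤ q' := (hxy.between q' hp'.right).resolve_left hqx
    have hqy : q ≤ y := (hp.between y hxy.right).resolve_left hyp
    have hxp : x ≤ p' := (hp'.between x hx).resolve_right hqx
    obtain ⟨f, hf, ef, mf⟩ : ∃ f : ℝ → ℝ, ContDiff ℝ ∞ f ∧
        EqOn (fun t => min (w t) (max (u t) x)) f (Icc a b) ∧ MapsTo f (Icc a b) (Icc x y) := by
      rcases hp.between x hx with h₁ | h₁
      · exact ⟨φ, hφ, k₁ x h₁, fun t ht => Icc_subset_Icc h₁ hqy (mφ ht)⟩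
      · exact ⟨_, contDiff_const, k₃ x h₁ hxp, fun _ _ => left_mem_Icc.2 hlt.le⟩
    obtain ⟨g, hg, eg, mg⟩ : ∃ g : ℝ → ℝ, ContDiff ℝ ∞ g ∧
        EqOn (fun t => min (w t) (max (u t) y)) g (Icc a b) ∧ MapsTo g (Icc a b) (Icc x y) := by
      rcases hp'.between y hxy.right with h₁ | h₁
      · exact ⟨_, contDiff_const, k₃ y hqy h₁, fun _ _ => right_mem_Icc.2 hlt.le⟩
      · exact ⟨ψ, hψ, k₂ y h₁, fun t ht => Icc_subset_Icc hxp h₁ (mψ ht)⟩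
    exact ⟨x, y, hxy, f, g, hf, hg, ef, eg, mf, mg⟩

namespace PiecewisePath

variable {𝒳 : BasedCategory.{v, u} Man} {Ω : SymplecticForm 𝒳} {γ γ' δ δ' : PiecewisePath 𝒳}

/-- The function `u` starts and ends at `0` or `1`. -/
def EndsAtCorner (u : ℝ → ℝ) : Prop := (u 0 = 0 ∨ u 0 = 1) ∧ (u 1 = 0 ∨ u 1 = 1)

/-- Some path with trace `(u, u')` is homotopic to some path with trace `(w, w')`. -/
def TraceHomotopic (Ω : SymplecticForm 𝒳) (γ γ' : PiecewisePath 𝒳) (u u' w w' : ℝ → ℝ) : Prop :=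
  ∃ δ δ' : PiecewisePath 𝒳, IsTrace γ γ' δ u u' ∧ IsTrace γ γ' δ' w w' ∧ LoopHomotopic Ω δ δ'

section

variable (h : IsOrbifold 𝒳) (hc : IsCompactOrbifold 𝒳) (hγ : γ.IsLoop Ω) (hγ' : γ'.IsLoop Ω)
include h hc hγ hγ'

lemma IsTrace.naturallyRelated {u u' : ℝ → ℝ} (hu : EndsAtCorner u) (hu' : EndsAtCorner u')
    (hδ : IsTrace γ γ' δ u u') (hδ' : IsTrace γ γ' δ' u u') : NaturallyRelated Ω δ δ' :=
  (hδ.agree h.toIsCFG hγ.toIsHamiltonian hγ'.toIsHamiltonian hδ' (δ.P.union δ'.P)).naturallyRelated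
    h.toIsCFG (hδ.isLoop h hc hγ hγ' hu.1 hu'.1 hu.2 hu'.2).toIsHamiltonian
    (hδ'.isLoop h hc hγ hγ' hu.1 hu'.1 hu.2 hu'.2).toIsHamiltonian Finset.subset_union_left
    Finset.subset_union_right

lemma TraceHomotopic.loopHomotopic {u u' w w' : ℝ → ℝ} (hu : EndsAtCorner u)
    (hu' : EndsAtCorner u') (hw : EndsAtCorner w) (hw' : EndsAtCorner w')
    (hH : TraceHomotopic Ω γ γ' u u' w w') (hδ : IsTrace γ γ' δ u u')
    (hδ' : IsTrace γ γ' δ' w w') : LoopHomotopic Ω δ δ' := by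
  obtain ⟨ε, ε', hε, hε', hH⟩ := hH
  exact LoopHomotopic.trans h.toIsCFG (.of_naturallyRelated
    (hδ.isLoop h hc hγ hγ' hu.1 hu'.1 hu.2 hu'.2)
    (hδ.naturallyRelated h hc hγ hγ' hu hu' hε))
    (hH.trans_naturallyRelated (hε'.naturallyRelated h hc hγ hγ' hw hw' hδ'))

lemma TraceHomotopic.trans {u u' w w' z z' : ℝ → ℝ} (hw : EndsAtCorner w) (hw' : EndsAtCorner w')
    (h₁ : TraceHomotopic Ω γ γ' u u' w w') (h₂ : TraceHomotopic Ω γ γ' w w' z z') :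
    TraceHomotopic Ω γ γ' u u' z z' := by
  obtain ⟨δ, δ', hδ, hδ', H⟩ := h₁
  obtain ⟨ε, ε', hε, hε', H'⟩ := h₂
  exact ⟨δ, ε', hδ, hε', LoopHomotopic.trans h.toIsCFG
    (H.trans_naturallyRelated (hδ'.naturallyRelated h hc hγ hγ' hw hw' hε)) H'⟩

/-- Traces with the same ends at corners are homotopic as soon as one lies below the other. -/
lemma traceHomotopic_of_le (Q : Partition) {u u' w w' : ℝ → ℝ}
    (hu : ∀ a b, Q.Consec a b → Ctrl γ.P u u a b) (hw : ∀ a b, Q.Consec a b → Ctrl γ.P w w a b)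
    (hu' : ∀ a b, Q.Consec a b → Ctrl γ'.P u' u' a b)
    (hw' : ∀ a b, Q.Consec a b → Ctrl γ'.P w' w' a b)
    (h₀ : ∀ t ∈ Icc (0 : ℝ) 1, 0 ≤ u t) (h₀' : ∀ t ∈ Icc (0 : ℝ) 1, 0 ≤ u' t)
    (hle : ∀ t ∈ Icc (0 : ℝ) 1, u t ≤ w t) (hle' : ∀ t ∈ Icc (0 : ℝ) 1, u' t ≤ w' t)
    (h₁ : ∀ t ∈ Icc (0 : ℝ) 1, w t ≤ 1) (h₁' : ∀ t ∈ Icc (0 : ℝ) 1, w' t ≤ 1)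
    (c : EndsAtCorner u) (c' : EndsAtCorner u') (e₀ : u 0 = w 0) (e₀' : u' 0 = w' 0)
    (e₁ : u 1 = w 1) (e₁' : u' 1 = w' 1) : TraceHomotopic Ω γ γ' u u' w w' := by
  let m (x t : ℝ) : ℝ := min (w t) (max (u t) x)
  let m' (x t : ℝ) : ℝ := min (w' t) (max (u' t) x)
  have hends : ∀ {x y z : ℝ}, x ∈ Icc (0 : ℝ) 1 → y = z → y = 0 ∨ y = 1 →
      min z (max y x) = y := by
    rintro x y _ hx rfl -
    exact min_eq_left (le_max_left _ _)
  have hm : ∀ {x : ℝ}, x ∈ Icc (0 : ℝ) 1 → m x 0 = u 0 ∧ m x 1 = u 1 := fun hx =>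
    ⟨hends hx e₀ c.1, hends hx e₁ c.2⟩
  have hm' : ∀ {x : ℝ}, x ∈ Icc (0 : ℝ) 1 → m' x 0 = u' 0 ∧ m' x 1 = u' 1 := fun hx =>
    ⟨hends hx e₀' c'.1, hends hx e₁' c'.2⟩
  have cm : ∀ {x : ℝ}, x ∈ Icc (0 : ℝ) 1 → EndsAtCorner (m x) := fun hx => by
    obtain ⟨k₁, k₂⟩ := hm hx
    exact ⟨by rw [k₁]; exact c.1, by rw [k₂]; exact c.2⟩
  have cm' : ∀ {x : ℝ}, x ∈ Icc (0 : ℝ) 1 → EndsAtCorner (m' x) := fun hx => by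
    obtain ⟨k₁, k₂⟩ := hm' hx
    exact ⟨by rw [k₁]; exact c'.1, by rw [k₂]; exact c'.2⟩
  have sub : ∀ {a b : ℝ}, Q.Consec a b → Icc a b ⊆ Icc 0 1 := fun hab =>
    Icc_subset_Icc hab.mem_left.1 hab.mem_right.2
  have step : ∀ {x y x' y' : ℝ}, x ∈ γ.P.pts → x' ∈ γ'.P.pts → (x = y ∨ γ.P.Consec x y) →
      (x' = y' ∨ γ'.P.Consec x' y') → TraceHomotopic Ω γ γ' (m x) (m' x') (m y) (m' y') := by
    intro x y x' y' hx hx' hxy hxy'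
    have hxI := γ.P.mem_Icc x hx
    have hxI' := γ'.P.mem_Icc x' hx'
    have hyI : y ∈ Icc (0 : ℝ) 1 := by
      rcases hxy with rfl | hxy
      exacts [hxI, hxy.mem_right]
    have hyI' : y' ∈ Icc (0 : ℝ) 1 := by
      rcases hxy' with rfl | hxy'
      exacts [hxI', hxy'.mem_right]
    exact exists_linear_homotopy h hc hγ hγ' Q
      (fun a b hab => (hu a b hab).slide (hw a b hab) (fun t ht => hle t (sub hab ht)) hx hxy)
      (fun a b hab => (hu' a b hab).slide (hw' a b hab) (fun t ht => hle' t (sub hab ht)) hx' hxy')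
      (cm hxI).1 (cm' hxI').1 (cm hxI).2 (cm' hxI').2 ((hm hxI).1.trans (hm hyI).1.symm)
      ((hm' hxI').1.trans (hm' hyI').1.symm) ((hm hxI).2.trans (hm hyI).2.symm)
      ((hm' hxI').2.trans (hm' hyI').2.symm)
  have s₁ : ∀ x ∈ γ.P.pts, TraceHomotopic Ω γ γ' (m 0) (m' 0) (m x) (m' 0) :=
    Partition.induction_on γ.P (step γ.P.zero_mem γ'.P.zero_mem (Or.inl rfl) (Or.inl rfl))
      fun a b hab ih => ih.trans h hc hγ hγ' (cm hab.mem_left) (cm' (by simp))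
        (step hab.left γ'.P.zero_mem (Or.inr hab) (Or.inl rfl))
  have s₂ : ∀ x ∈ γ'.P.pts, TraceHomotopic Ω γ γ' (m 0) (m' 0) (m 1) (m' x) :=
    Partition.induction_on γ'.P (s₁ 1 γ.P.one_mem)
      fun a b hab ih => ih.trans h hc hγ hγ' (cm (by simp)) (cm' hab.mem_left)
        (step γ.P.one_mem hab.left (Or.inl rfl) (Or.inr hab))
  obtain ⟨δ, δ', hδ, hδ', H⟩ := s₂ 1 γ'.P.one_mem
  refine ⟨δ, δ', hδ.congr (fun t ht => ?_) (fun t ht => ?_), hδ'.congr (fun t ht => ?_)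
    (fun t ht => ?_), H⟩
  · change u t = min (w t) (max (u t) 0)
    rw [max_eq_left (h₀ t ht), min_eq_right (hle t ht)]
  · change u' t = min (w' t) (max (u' t) 0)
    rw [max_eq_left (h₀' t ht), min_eq_right (hle' t ht)]
  · change w t = min (w t) (max (u t) 1)
    rw [min_eq_left ((h₁ t ht).trans (le_max_right _ _))]
  · change w' t = min (w' t) (max (u' t) 1)
    rw [min_eq_left ((h₁' t ht).trans (le_max_right _ _))]

end

end PiecewisePath

end

section

namespace PiecewisePath

variable {𝒳 : BasedCategory.{v, u} Man} {Ω : SymplecticForm 𝒳} {γ γ' γ'' δ δ' : PiecewisePath 𝒳}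
  {a b : ℝ}

/-! ### Pointwise composition and concatenation -/

lemma exists_compose_map (γ γ' : PiecewisePath 𝒳) (h : (γ.compose γ').P.Consec a b) :
    ∃ (p q : ℝ) (hp : γ.P.Consec p q) (p' q' : ℝ) (hp' : γ'.P.Consec p' q')
      (m : Icc a b ⊆ Icc p q) (m' : Icc a b ⊆ Icc p' q'),
      (γ.compose γ').map a b h = (prodLift (γ'.res hp' m')).comp (γ.res hp m) := by
  obtain ⟨p, q, hp, h₁, h₂, e⟩ :=
    γ.exists_subdivide_map (γ.P.union γ'.P) Finset.subset_union_left h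
  obtain ⟨p', q', hp', h₁', h₂', e'⟩ :=
    γ'.exists_subdivide_map (γ.P.union γ'.P) Finset.subset_union_right h
  refine ⟨p, q, hp, p', q', hp', Icc_subset_Icc h₁ h₂, Icc_subset_Icc h₁' h₂', ?_⟩
  rw [← e, ← e']
  rfl

lemma isTrace_compose (γ γ' : PiecewisePath 𝒳) :
    IsTrace γ γ' (γ.compose γ') (fun t => t) (fun t => t) := by
  intro a b hab
  obtain ⟨p, q, hp, p', q', hp', m, m', e⟩ := exists_compose_map γ γ' hab
  exact ⟨p, q, hp, p', q', hp', fun t => t, fun t => t, contDiff_id, contDiff_id, m, m',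
    fun _ _ => rfl, fun _ _ => rfl, TwoIso.of_eq e⟩

lemma isTrace_concat (h : IsCFG 𝒳) (hγ : γ.IsLoop Ω) (hγ' : γ'.IsLoop Ω) :
    IsTrace γ γ' (γ.concat γ') (fun t => min (2 * t) 1) (fun t => max (2 * t - 1) 0) := by
  intro a b hab
  by_cases hb : b ≤ 1 / 2
  · obtain ⟨d, hd⟩ := γ'.P.exists_first
    refine ⟨_, _, Partition.concat_left hab hb, 0, d, hd, fun t => 2 * t, fun _ => 0, by fun_prop,
      contDiff_const, fun t ht => ⟨by linarith [ht.1], by linarith [ht.2]⟩,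
      fun _ _ => left_mem_Icc.2 hd.lt.le, fun t ht => min_eq_left (by linarith [ht.2]),
      fun t ht => max_eq_right (by linarith [ht.2]), ?_⟩
    rw [concat_map_left γ γ' hab hb]
    exact (twoIso_grid_const_right _ (hγ'.start d hd)).symm h
  · have ha : 1 / 2 ≤ a := (Partition.concat_between_half hab).resolve_left hb
    obtain ⟨c, hc⟩ := γ.P.exists_last
    refine ⟨c, 1, hc, _, _, Partition.concat_right hab hb, fun _ => 1, fun t => 2 * t - 1,
      contDiff_const, by fun_prop, fun _ _ => right_mem_Icc.2 hc.lt.le,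
      fun t ht => ⟨by linarith [ht.1], by linarith [ht.2]⟩,
      fun t ht => min_eq_right (by linarith [ht.1]),
      fun t ht => max_eq_left (by linarith [ht.1]), ?_⟩
    rw [concat_map_right γ γ' hab hb]
    exact (twoIso_grid_const_left _ (hγ.finish c hc)).symm h

lemma endsAtCorner_id : EndsAtCorner (fun t => t) := ⟨Or.inl rfl, Or.inr rfl⟩

lemma endsAtCorner_min : EndsAtCorner (fun t => min (2 * t) 1) := by
  constructor <;> norm_num

lemma endsAtCorner_max : EndsAtCorner (fun t => max (2 * t - 1) 0) := by
  constructor <;> norm_num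

lemma IsLoop.compose (h : IsOrbifold 𝒳) (hc : IsCompactOrbifold 𝒳) (hγ : γ.IsLoop Ω)
    (hγ' : γ'.IsLoop Ω) : (γ.compose γ').IsLoop Ω :=
  (isTrace_compose γ γ').isLoop h hc hγ hγ' (Or.inl rfl) (Or.inl rfl) (Or.inr rfl) (Or.inr rfl)

lemma IsBasedLoop.compose (h : IsOrbifold 𝒳) (hc : IsCompactOrbifold 𝒳) (hγ : γ.IsBasedLoop Ω)
    (hγ' : γ'.IsBasedLoop Ω) : (γ.compose γ').IsBasedLoop Ω := by
  refine (hγ.isLoop.compose h hc hγ'.isLoop).isBasedLoop h.toIsCFG fun b hb => ?_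
  obtain ⟨p, q, hp, p', q', hp', m, m', e⟩ := exists_compose_map γ γ' hb
  have h₁ := m (left_mem_Icc.2 hb.lt.le)
  have h₂ := m' (left_mem_Icc.2 hb.lt.le)
  obtain rfl : p = 0 := le_antisymm h₁.1 hp.mem_left.1
  obtain rfl : p' = 0 := le_antisymm h₂.1 hp'.mem_left.1
  unfold left
  rw [e]
  change (γ'.left hp').comp (γ.left hp) = _
  rw [hγ.based, hγ'.based]
  rfl

lemma IsBasedLoop.concat (h : IsCFG 𝒳) (hγ : γ.IsBasedLoop Ω) (hγ' : γ'.IsBasedLoop Ω) :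
    (γ.concat γ').IsBasedLoop Ω := hγ.concat_isLoop h hγ'.isLoop

/-- The pointwise composition `t ↦ γ t ∘ γ' t` is homotopic to the concatenation
`t ↦ γ (min (2 t) 1) ∘ γ' (max (2 t - 1) 0)`, by way of `t ↦ γ (min (2 t) 1) ∘ γ' t`. -/
lemma loopHomotopic_compose_concat (h : IsOrbifold 𝒳) (hc : IsCompactOrbifold 𝒳)
    (hγ : γ.IsLoop Ω) (hγ' : γ'.IsLoop Ω) :
    LoopHomotopic Ω (γ.compose γ') (γ.concat γ') := by
  let Q := (γ.P.union γ'.P).union (γ.P.concat γ'.P)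
  have hQ : (γ.P.union γ'.P).pts ⊆ Q.pts := Finset.subset_union_left
  have hQ' : (γ.P.concat γ'.P).pts ⊆ Q.pts := Finset.subset_union_right
  have c₁ : ∀ a b, Q.Consec a b → Ctrl γ.P (fun t => t) (fun t => t) a b := by
    intro a b hab
    obtain ⟨⟨p, q⟩, hp, h₁, h₂⟩ :=
      Partition.exists_parent (P := γ.P) (Finset.subset_union_left.trans hQ) hab
    exact .self hp contDiff_id (fun _ _ => rfl) (Icc_subset_Icc h₁ h₂)
  have c₂ : ∀ a b, Q.Consec a b → Ctrl γ'.P (fun t => t) (fun t => t) a b := by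
    intro a b hab
    obtain ⟨⟨p, q⟩, hp, h₁, h₂⟩ :=
      Partition.exists_parent (P := γ'.P) (Finset.subset_union_right.trans hQ) hab
    exact .self hp contDiff_id (fun _ _ => rfl) (Icc_subset_Icc h₁ h₂)
  have ctrl : ∀ {a b}, Q.Consec a b →
      Ctrl γ.P (fun t => min (2 * t) 1) (fun t => min (2 * t) 1) a b ∧
      Ctrl γ'.P (fun t => max (2 * t - 1) 0) (fun t => max (2 * t - 1) 0) a b := by
    intro a b hab
    obtain ⟨⟨p, q⟩, hp, h₁, h₂⟩ := Partition.exists_parent hQ' hab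
    dsimp only at hp h₁ h₂
    obtain ⟨r, s, hr, r', s', hr', φ, φ', hφ, hφ', m, m', e, e', -⟩ :=
      isTrace_concat h.toIsCFG hγ hγ' p q hp
    have hsub := Icc_subset_Icc h₁ h₂
    exact ⟨.self hr hφ (e.mono hsub) (m.mono_left hsub),
      .self hr' hφ' (e'.mono hsub) (m'.mono_left hsub)⟩
  have i₁ : ∀ t ∈ Icc (0 : ℝ) 1, t ≤ min (2 * t) 1 := fun t ht =>
    le_min (by linarith [ht.1]) ht.2
  have i₂ : ∀ t ∈ Icc (0 : ℝ) 1, max (2 * t - 1) 0 ≤ t := fun t ht =>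
    max_le (by linarith [ht.2]) ht.1
  have i₃ : ∀ t ∈ Icc (0 : ℝ) 1, min (2 * t) 1 ≤ 1 := fun t _ => min_le_right _ _
  have i₄ : ∀ t ∈ Icc (0 : ℝ) 1, 0 ≤ max (2 * t - 1) 0 := fun t _ => le_max_right _ _
  have i₅ : ∀ t ∈ Icc (0 : ℝ) 1, 0 ≤ min (2 * t) 1 := fun t ht => ht.1.trans (i₁ t ht)
  have H₁ : TraceHomotopic Ω γ γ' (fun t => t) (fun t => t) (fun t => min (2 * t) 1)
      (fun t => t) :=
    traceHomotopic_of_le h hc hγ hγ' Q c₁ (fun a b hab => (ctrl hab).1) c₂ c₂ (fun t ht => ht.1)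
      (fun t ht => ht.1) i₁ (fun t _ => le_rfl) i₃ (fun t ht => ht.2) endsAtCorner_id
      endsAtCorner_id (by norm_num) rfl (by norm_num) rfl
  have H₂ : TraceHomotopic Ω γ γ' (fun t => min (2 * t) 1) (fun t => max (2 * t - 1) 0)
      (fun t => min (2 * t) 1) (fun t => t) :=
    traceHomotopic_of_le h hc hγ hγ' Q (fun a b hab => (ctrl hab).1) (fun a b hab => (ctrl hab).1)
      (fun a b hab => (ctrl hab).2) c₂ i₅ i₄ (fun t _ => le_rfl) i₂ i₃ (fun t ht => ht.2)
      endsAtCorner_min endsAtCorner_max rfl (by norm_num) rfl (by norm_num)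
  have H₃ : TraceHomotopic Ω γ γ' (fun t => min (2 * t) 1) (fun t => t)
      (fun t => min (2 * t) 1) (fun t => max (2 * t - 1) 0) := by
    obtain ⟨ε, ε', hε, hε', H⟩ := H₂
    exact ⟨ε', ε, hε', hε, H.symm h.toIsCFG⟩
  exact (H₁.trans h hc hγ hγ' endsAtCorner_min endsAtCorner_id H₃).loopHomotopic h hc hγ hγ'
    endsAtCorner_id endsAtCorner_id endsAtCorner_min endsAtCorner_max (isTrace_compose γ γ')
    (isTrace_concat h.toIsCFG hγ hγ')

/-! ### Units and inverses -/

/-- The constant loop. -/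
def constLoop (𝒳 : BasedCategory.{v, u} Man) : PiecewisePath 𝒳 where
  P := Partition.whole
  map a b _ := forget (Icc a b) 𝒳

lemma isBasedLoop_constLoop (h : IsOrbifold 𝒳) (Ω : SymplecticForm 𝒳) :
    (constLoop 𝒳).IsBasedLoop Ω where
  integrates a b hab := (hamIsotopy_forget h.toIsCFG Ω (Icc a b)).integratesHamiltonian h hab.lt
  joins _ _ _ _ _ := TwoIso.refl _
  closes _ _ _ _ := TwoIso.refl _
  based _ _ := rfl

lemma twoRelated_compose_constLoop (γ : PiecewisePath 𝒳) :
    TwoRelated (γ.compose (constLoop 𝒳)) γ := by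
  refine ⟨Partition.ext (Finset.union_eq_left.2 γ.P.whole_subset), fun a b hab hab' => ?_⟩
  obtain ⟨p, q, hp, p', q', hp', m, m', e⟩ := exists_compose_map γ (constLoop 𝒳) hab
  have h₁ := (Icc_subset_Icc_iff hab.lt.le).1 m
  obtain ⟨rfl, rfl⟩ := hp.unique hab' hab.lt h₁.1 h₁.2 le_rfl le_rfl
  rw [e]
  exact TwoIso.refl _

lemma twoRelated_constLoop_compose (γ : PiecewisePath 𝒳) :
    TwoRelated ((constLoop 𝒳).compose γ) γ := by
  refine ⟨Partition.ext (Finset.union_eq_right.2 γ.P.whole_subset), fun a b hab hab' => ?_⟩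
  obtain ⟨p, q, hp, p', q', hp', m, m', e⟩ := exists_compose_map (constLoop 𝒳) γ hab
  have h₁ := (Icc_subset_Icc_iff hab.lt.le).1 m'
  obtain ⟨rfl, rfl⟩ := hp'.unique hab' hab.lt h₁.1 h₁.2 le_rfl le_rfl
  rw [e]
  exact TwoIso.refl _

/-- Pointwise composition is associative up to 2-morphism. -/
lemma twoRelated_compose_assoc (h : IsCFG 𝒳) (γ γ' γ'' : PiecewisePath 𝒳) :
    TwoRelated ((γ.compose γ').compose γ'') (γ.compose (γ'.compose γ'')) := by
  refine ⟨Partition.ext (Finset.union_assoc _ _ _), fun a b hab hab' => ?_⟩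
  obtain ⟨p, q, hp, p'', q'', hp'', m, m'', e⟩ := exists_compose_map (γ.compose γ') γ'' hab
  obtain ⟨r, s, hr, r', s', hr', n, n', f⟩ := exists_compose_map γ γ' hp
  obtain ⟨x, y, hx, x', y', hx', k, k', g⟩ := exists_compose_map γ (γ'.compose γ'') hab'
  obtain ⟨z, w, hz, z'', w'', hz'', l, l'', j⟩ := exists_compose_map γ' γ'' hx'
  have mem : ∀ {c d : ℝ}, Icc a b ⊆ Icc c d → c ≤ a ∧ b ≤ d := fun hcd =>
    (Icc_subset_Icc_iff hab.lt.le).1 hcd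
  obtain ⟨rfl, rfl⟩ := hr.unique hx hab.lt (mem (m.trans n)).1 (mem (m.trans n)).2 (mem k).1
    (mem k).2
  obtain ⟨rfl, rfl⟩ := hr'.unique hz hab.lt (mem (m.trans n')).1 (mem (m.trans n')).2
    (mem (k'.trans l)).1 (mem (k'.trans l)).2
  obtain ⟨rfl, rfl⟩ := hp''.unique hz'' hab.lt (mem m'').1 (mem m'').2 (mem (k'.trans l'')).1
    (mem (k'.trans l'')).2
  rw [e, g]
  unfold res
  rw [f, j]
  exact ((twoIso_prodLift_comp (γ''.res hp'' m'') (γ'.res hr' (m.trans n'))).whiskerRight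
    (γ.res hr k)).symm h

/-- The reversed path `t ↦ γ (1 - t)`. -/
def rev (γ : PiecewisePath 𝒳) : PiecewisePath 𝒳 where
  P := γ.P.rev
  map a b h := (reparam 𝒳 (S := Icc a b) (S' := Icc (1 - b) (1 - a)) (fun t : ℝ => 1 - t)
    (by fun_prop) (fun t ht => ⟨by linarith [ht.2], by linarith [ht.1]⟩)).comp
      (γ.map _ _ h.of_rev)

lemma IsLoop.rev (h𝒳 : IsCFG 𝒳) (hγ : γ.IsLoop Ω) : γ.rev.IsLoop Ω where
  integrates a b h := (hγ.integrates _ _ _).reparam h𝒳 _ _ _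
  joins a b c h h' := (hγ.joins _ _ _ h'.of_rev h.of_rev).symm h𝒳
  start b h := hγ.finish' h.of_rev (by norm_num)
  finish a h := hγ.start' h.of_rev (by norm_num)

lemma isTrace_constLoop (h : IsCFG 𝒳) (hγ : γ.IsLoop Ω) (hγ' : γ'.IsLoop Ω) :
    IsTrace γ γ' (constLoop 𝒳) (fun _ => 0) (fun _ => 0) := by
  intro a b hab
  obtain ⟨c, hc⟩ := γ.P.exists_first
  obtain ⟨d, hd⟩ := γ'.P.exists_first
  refine ⟨0, c, hc, 0, d, hd, fun _ => 0, fun _ => 0, contDiff_const, contDiff_const,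
    fun _ _ => left_mem_Icc.2 hc.lt.le, fun _ _ => left_mem_Icc.2 hd.lt.le, fun _ _ => rfl,
    fun _ _ => rfl, ?_⟩
  refine TwoIso.symm h ((twoIso_grid_const_right _ (hγ'.start d hd)).trans ?_)
  exact (hγ.start c hc).whiskerLeft (forget (Icc a b) 𝒳)

lemma isTrace_concat_rev (h : IsCFG 𝒳) (γ : PiecewisePath 𝒳) (hγ' : γ'.IsLoop Ω) :
    IsTrace γ γ' (γ.concat γ.rev) (fun t => min (2 * t) (2 - 2 * t)) (fun _ => 0) := by
  intro a b hab
  obtain ⟨d, hd⟩ := γ'.P.exists_first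
  by_cases hb : b ≤ 1 / 2
  · refine ⟨_, _, Partition.concat_left hab hb, 0, d, hd, fun t => 2 * t, fun _ => 0, by fun_prop,
      contDiff_const, fun t ht => ⟨by linarith [ht.1], by linarith [ht.2]⟩,
      fun _ _ => left_mem_Icc.2 hd.lt.le, fun t ht => min_eq_left (by linarith [ht.2]),
      fun _ _ => rfl, ?_⟩
    rw [concat_map_left γ γ.rev hab hb]
    exact (twoIso_grid_const_right _ (hγ'.start d hd)).symm h
  · have ha : 1 / 2 ≤ a := (Partition.concat_between_half hab).resolve_left hb
    refine ⟨_, _, (Partition.concat_right hab hb).of_rev, 0, d, hd, fun t => 1 - (2 * t - 1),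
      fun _ => 0, by fun_prop, contDiff_const,
      fun t ht => ⟨by linarith [ht.2], by linarith [ht.1]⟩, fun _ _ => left_mem_Icc.2 hd.lt.le,
      fun t ht => (min_eq_right (by linarith [ht.1])).trans (by ring), fun _ _ => rfl, ?_⟩
    rw [concat_map_right γ γ.rev hab hb]
    exact (twoIso_grid_const_right _ (hγ'.start d hd)).symm h

/-- A loop followed by its reverse is contracted along the loop. -/
lemma loopHomotopic_constLoop_concat_rev (h : IsOrbifold 𝒳) (hc : IsCompactOrbifold 𝒳)
    (hγ : γ.IsLoop Ω) : LoopHomotopic Ω (constLoop 𝒳) (γ.concat γ.rev) := by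
  have hz : ∀ (P : Partition) (a b : ℝ), Ctrl P (fun _ => 0) (fun _ => 0) a b := by
    intro P a b
    obtain ⟨c, hc⟩ := P.exists_first
    exact .self hc contDiff_const (fun _ _ => rfl) (fun _ _ => left_mem_Icc.2 hc.lt.le)
  have c₀ : EndsAtCorner (fun _ => 0) := ⟨Or.inl rfl, Or.inl rfl⟩
  have c₁ : EndsAtCorner (fun t => min (2 * t) (2 - 2 * t)) := by
    constructor <;> norm_num
  refine TraceHomotopic.loopHomotopic h hc hγ hγ c₀ c₀ c₁ c₀ ?_
    (isTrace_constLoop h.toIsCFG hγ hγ) (isTrace_concat_rev h.toIsCFG γ hγ)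
  refine traceHomotopic_of_le h hc hγ hγ (γ.concat γ.rev).P (fun a b _ => hz _ a b)
    (fun a b hab => ?_) (fun a b _ => hz _ a b) (fun a b _ => hz _ a b) (fun t _ => le_rfl)
    (fun t _ => le_rfl) (fun t ht => le_min (by linarith [ht.1]) (by linarith [ht.2]))
    (fun t _ => le_rfl) (fun t ht => ?_) (fun t _ => zero_le_one) c₀ c₀ (by norm_num) rfl
    (by norm_num) rfl
  · obtain ⟨r, s, hr, r', s', hr', φ, φ', hφ, hφ', m, m', e, e', -⟩ :=
      isTrace_concat_rev h.toIsCFG γ hγ a b hab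
    exact .self hr hφ e m
  · rcases le_total t (1 / 2) with ht' | ht'
    · exact (min_le_left _ _).trans (by linarith)
    · exact (min_le_right _ _).trans (by linarith)

lemma loopHomotopic_constLoop_concat (h : IsOrbifold 𝒳) (hc : IsCompactOrbifold 𝒳)
    (hγ : γ.IsLoop Ω) : LoopHomotopic Ω ((constLoop 𝒳).concat γ) γ := by
  have h₁ := (isBasedLoop_constLoop h Ω).isLoop
  exact (LoopHomotopic.trans h.toIsCFG
    ((loopHomotopic_compose_concat h hc h₁ hγ).symm h.toIsCFG)
    (LoopHomotopic.refl (h₁.compose h hc hγ))).trans_naturallyRelated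
    (.of_twoRelated (h₁.compose h hc hγ).toIsHamiltonian hγ.toIsHamiltonian
      (twoRelated_constLoop_compose γ))

end PiecewisePath

/-! ### The group structure -/

open PiecewisePath

variable {𝒳 : BasedCategory.{v, u} Man} {Ω : SymplecticForm 𝒳}

lemma equivalence_relHomotopic (h : IsCFG 𝒳) (Ω : SymplecticForm 𝒳) :
    Equivalence (RelHomotopic Ω) where
  refl γ := (relHomotopic_iff h γ γ).2 (LoopHomotopic.refl γ.2.isLoop)
  symm {γ γ'} hγ := (relHomotopic_iff h γ' γ).2 (((relHomotopic_iff h γ γ').1 hγ).symm h)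
  trans {γ γ' γ''} hγ hγ' := (relHomotopic_iff h γ γ'').2
    (LoopHomotopic.trans h ((relHomotopic_iff h γ γ').1 hγ) ((relHomotopic_iff h γ' γ'').1 hγ'))

/-- The concatenation of based loops. -/
def BasedLoop.concat (h : IsCFG 𝒳) (γ γ' : BasedLoop Ω) : BasedLoop Ω :=
  ⟨γ.1.concat γ'.1, γ.2.concat h γ'.2⟩

/-- The pointwise composition of based loops. -/
def BasedLoop.compose (h : IsOrbifold 𝒳) (hc : IsCompactOrbifold 𝒳) (γ γ' : BasedLoop Ω) :
    BasedLoop Ω :=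
  ⟨γ.1.compose γ'.1, γ.2.compose h hc γ'.2⟩

/-- The reversed loop, preceded by a constant path so that it starts at the identity, and not only
at a map with a 2-morphism to the identity. -/
def BasedLoop.rev (h : IsOrbifold 𝒳) (γ : BasedLoop Ω) : BasedLoop Ω :=
  ⟨(constLoop 𝒳).concat γ.1.rev,
    (isBasedLoop_constLoop h Ω).concat_isLoop h.toIsCFG (γ.2.isLoop.rev h.toIsCFG)⟩

/-- The product of homotopy classes induced by concatenation. -/
def Pi1Ham.mul (h : IsCFG 𝒳) : Pi1Ham Ω → Pi1Ham Ω → Pi1Ham Ω :=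
  Quot.map₂ (BasedLoop.concat h)
    (fun γ δ δ' hδ => (relHomotopic_iff h _ _).2 ((LoopHomotopic.refl γ.2.isLoop).concat h
      ((relHomotopic_iff h _ _).1 hδ) γ.2.isLoop γ.2.isLoop δ.2.isLoop δ'.2.isLoop))
    (fun γ γ' δ hγ => (relHomotopic_iff h _ _).2 (((relHomotopic_iff h _ _).1 hγ).concat h
      (LoopHomotopic.refl δ.2.isLoop) γ.2.isLoop γ'.2.isLoop δ.2.isLoop δ.2.isLoop))

lemma homotopyClass_eq (h : IsCFG 𝒳) {γ γ' : BasedLoop Ω} (hγ : LoopHomotopic Ω γ.1 γ'.1) :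
    homotopyClass γ = homotopyClass γ' :=
  Quot.sound ((relHomotopic_iff h γ γ').2 hγ)

lemma homotopyClass_eq_of_twoRelated (h : IsCFG 𝒳) {γ γ' : BasedLoop Ω}
    (hγ : TwoRelated γ.1 γ'.1) : homotopyClass γ = homotopyClass γ' :=
  homotopyClass_eq h (.of_naturallyRelated γ.2.isLoop
    (.of_twoRelated γ.2.toIsHamiltonian γ'.2.toIsHamiltonian hγ))

lemma mul_homotopyClass_concat (h : IsCFG 𝒳) (γ γ' : BasedLoop Ω) :
    Pi1Ham.mul h (homotopyClass γ) (homotopyClass γ') = homotopyClass (γ.concat h γ') := rfl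

lemma mul_homotopyClass_compose (h : IsOrbifold 𝒳) (hc : IsCompactOrbifold 𝒳)
    (γ γ' : BasedLoop Ω) : Pi1Ham.mul h.toIsCFG (homotopyClass γ) (homotopyClass γ') =
      homotopyClass (γ.compose h hc γ') :=
  homotopyClass_eq h.toIsCFG
    ((loopHomotopic_compose_concat h hc γ.2.isLoop γ'.2.isLoop).symm h.toIsCFG)

/-- Associativity and units are read off from pointwise composition, inverses from
concatenation. -/
lemma exists_group (h : IsOrbifold 𝒳) (hc : IsCompactOrbifold 𝒳) (Ω : SymplecticForm 𝒳) :
    ∃ G : Group (Pi1Ham Ω), ∀ x y, G.mul x y = Pi1Ham.mul h.toIsCFG x y := by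
  let e : BasedLoop Ω := ⟨constLoop 𝒳, isBasedLoop_constLoop h Ω⟩
  have assoc : ∀ x y z : Pi1Ham Ω, Pi1Ham.mul h.toIsCFG (Pi1Ham.mul h.toIsCFG x y) z =
      Pi1Ham.mul h.toIsCFG x (Pi1Ham.mul h.toIsCFG y z) := by
    rintro ⟨x⟩ ⟨y⟩ ⟨z⟩
    change Pi1Ham.mul _ (Pi1Ham.mul _ (homotopyClass x) (homotopyClass y)) (homotopyClass z) =
      Pi1Ham.mul _ (homotopyClass x) (Pi1Ham.mul _ (homotopyClass y) (homotopyClass z))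
    rw [mul_homotopyClass_compose h hc, mul_homotopyClass_compose h hc,
      mul_homotopyClass_compose h hc, mul_homotopyClass_compose h hc]
    exact homotopyClass_eq_of_twoRelated h.toIsCFG
      (twoRelated_compose_assoc h.toIsCFG x.1 y.1 z.1)
  have one : ∀ x : Pi1Ham Ω, Pi1Ham.mul h.toIsCFG x (homotopyClass e) = x := by
    rintro ⟨x⟩
    exact (mul_homotopyClass_compose h hc x e).trans
      (homotopyClass_eq_of_twoRelated h.toIsCFG (twoRelated_compose_constLoop x.1))
  have inv : ∀ x : Pi1Ham Ω, ∃ y, Pi1Ham.mul h.toIsCFG x y = homotopyClass e := by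
    rintro ⟨x⟩
    have hr := x.2.isLoop.rev h.toIsCFG
    refine ⟨homotopyClass (x.rev h), homotopyClass_eq h.toIsCFG (LoopHomotopic.trans h.toIsCFG
      ((LoopHomotopic.refl x.2.isLoop).concat h.toIsCFG (loopHomotopic_constLoop_concat h hc hr)
        x.2.isLoop x.2.isLoop (x.rev h).2.isLoop hr) ?_)⟩
    exact (loopHomotopic_constLoop_concat_rev h hc x.2.isLoop).symm h.toIsCFG
  choose i hi using inv
  let _ : Mul (Pi1Ham Ω) := ⟨Pi1Ham.mul h.toIsCFG⟩
  let _ : One (Pi1Ham Ω) := ⟨homotopyClass e⟩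
  let _ : Inv (Pi1Ham Ω) := ⟨i⟩
  exact ⟨Group.ofRightAxioms assoc one hi, fun _ _ => rfl⟩

end

end HamOrb

end

theorem mainTheorem6 {𝒳 : CategoryTheory.BasedCategory.{v, u} HamOrb.Man}
    (h𝒳 : HamOrb.IsOrbifold 𝒳) (hc : HamOrb.IsCompactOrbifold 𝒳) (Ω : HamOrb.SymplecticForm 𝒳) :
    Equivalence (HamOrb.RelHomotopic Ω) ∧
    ∃ (hcn : ∀ γ γ' : HamOrb.BasedLoop Ω, (γ.1.concat γ'.1).IsBasedLoop Ω)
      (hcp : ∀ γ γ' : HamOrb.BasedLoop Ω, (γ.1.compose γ'.1).IsBasedLoop Ω)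
      (G : Group (HamOrb.Pi1Ham Ω)),
      ∀ γ γ' : HamOrb.BasedLoop Ω,
        G.mul (HamOrb.homotopyClass γ) (HamOrb.homotopyClass γ') =
          HamOrb.homotopyClass ⟨γ.1.concat γ'.1, hcn γ γ'⟩ ∧
        G.mul (HamOrb.homotopyClass γ) (HamOrb.homotopyClass γ') =
          HamOrb.homotopyClass ⟨γ.1.compose γ'.1, hcp γ γ'⟩ := by
  obtain ⟨G, hG⟩ := HamOrb.exists_group h𝒳 hc Ω
  refine ⟨HamOrb.equivalence_relHomotopic h𝒳.toIsCFG Ω, fun γ γ' => γ.2.concat h𝒳.toIsCFG γ'.2,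
    fun γ γ' => γ.2.compose h𝒳 hc γ'.2, G, fun γ γ' => ⟨?_, ?_⟩⟩
  · exact (hG _ _).trans (HamOrb.mul_homotopyClass_concat h𝒳.toIsCFG γ γ')
  · exact (hG _ _).trans (HamOrb.mul_homotopyClass_compose h𝒳 hc γ γ')
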